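/- Let $b>0$, $A=(-bx_2/2,\,bx_1/2,\,0)$, $\nabla^A=\nabla-iA$, let $K\subset\mathbb R^3$ be compact with smooth boundary $\Sigma$, $\Omega=\mathbb R^3\setminus K$, and let $\gamma$ be a smooth real function on $\Sigma$. Let $H_0$ and $H_\Omega^\infty$ be the self-adjoint operators associated with the closures of the form $\int|\nabla^A u|^2$ on $C_c^\infty(\mathbb R^3)$ and on $C_c^\infty(\Omega)$, and let $H_\Omega^{\gamma}$, $H_K^{-\gamma}$ be those associated with the forms $\int_\Omega|\nabla^A u|^2+\int_\Sigma\gamma|u|^2d\sigma$ on $H^1_A(\Omega)$ and $\int_K|\nabla^A u|^2-\int_\Sigma\gamma|u|^2d\sigma$ on $H^1_A(K)$, where $H^1_A(U)=\{u\in L^2(U):\nabla^Au\in L^2(U)\}$. Fix $l\in\{\infty,\gamma\}$ and a constant $c\ge 0$ such that, if $l=\gamma$, the operators $H_\Omega^\gamma+c$ and $H_K^{-\gamma}+c$ are positive and invertible ($c=0$ is allowed when they already are). On $L^2(\mathbb R^3)=L^2(\Omega)\oplus L^2(K)$ put, wherever the inverses exist (in particular for $z=0$ and for $\operatorname{Im}z>0$),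 $$R_0(z)=(H_0+c-z)^{-1},\quad \tilde R^\infty(z)=(H^\infty_\Omega+c-z)^{-1}\oplus 0,\quad \tilde R^\gamma(z)=(H^\gamma_\Omega+c-z)^{-1}\oplus(H^{-\gamma}_K+c-z)^{-1},$$ $\varepsilon(\infty)=1$, $\varepsilon(\gamma)=-1$, and $V^l=R_0(0)-\tilde R^l(0)$. Let $M_l$ be a bounded operator on $L^2(\mathbb R^3)$ with $V^l=\varepsilon(l)M^lM_l$, $M^l:=(M_l)^*$; it extends to a bounded operator from $e^{\epsilon\langle x_3\rangle}L^2(\mathbb R^3)$ to $L^2(\mathbb R^3)$ for $0<\epsilon<\sqrt b$, where $\langle x_3\rangle=(1+x_3^2)^{1/2}$, and the extension is also denoted $M_l$. Fix $q\in\mathbb N=\{0,1,2,\dots\}$ and let $\Lambda=(2q+1)b+c$ (so $\Lambda=\Lambda_q$ is the Landau level if $c=0$). Let $p_q$ be the orthogonal projection of $L^2(\mathbb R^2)$ onto the eigenspace of the Landau Hamiltonian for the eigenvalue $(2q+1)b$; its integral kernel is $$\mathcal P_q(x,y)=\tfrac{b}{2\pi}L_q\big(\tfrac b2|x-y|^2\big)\exp\big(-\tfrac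 b4(|x-y|^2+2i(x_1y_2-y_1x_2))\big),$$ with $L_q$ the Laguerre polynomial. Let $r(\zeta)$ be the operator with integral kernel $\frac12e^{\zeta|x_3-x_3'|}$ and $P_q^0=p_q\otimes r(0)$. Then there is an operator-valued function $A_q^l$, holomorphic near $0$ in the Banach space of bounded operators on $L^2(\mathbb R^3)$, such that for small $k$ with $\operatorname{Re}k>0$, $\operatorname{Im}k>0$, and with $z=\Lambda+k^2$, $$A_q^l(ik)=z^2M_l(p_q\otimes r(ik))M^l-ik\,M_l\big(z+z^2R_0(z)(I-p_q\otimes I_3)\big)M^l ,$$ and its germ at $0$ is unique. Let $\Pi_q$ be the orthogonal projection onto $\operatorname{Ker}A_q^l(0)$. For every $\delta>0$ the following are equivalent: (i) $I-\varepsilon(l)(A_q^l)'(0)\Pi_q$ is invertible; (ii) the limit $$\lim_{S_\delta\ni z\to\Lambda}M_l(I+ikP_q^0)\tilde R^l(z)M^l,\qquad k=\sqrt{z-\Lambda},\ \operatorname{Re}k>0,\ \operatorname{Im}k>0,$$ exists in operator norm, where $S_\delta=\{z\in\mathbb C:\operatorname{Im}z>\delta|\operatorname{Re}z-\Lambda|\}$.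 When (ii) holds one says that $K$ produces no isolated resonance at $\Lambda_q$. -/

import Mathlib

open MeasureTheory Filter Topology
open scoped ContDiff InnerProductSpace

noncomputable section

namespace MagneticObstacle

/-! ### Spaces -/

/-- Three-dimensional Euclidean space; the coordinates `x₁, x₂, x₃` are `x 0, x 1, x 2`. -/
abbrev E3 : Type := EuclideanSpace ℝ (Fin 3)

/-- The Euclidean plane of the variables `x_⊥ = (x₁, x₂)`. -/
abbrev E2 : Type := EuclideanSpace ℝ (Fin 2)

/-- The Hilbert space `L²(ℝ³)`. -/
abbrev L2 : Type := Lp ℂ 2 (volume : Measure E3)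

/-- The Hilbert space `L²(U)`, for `U ⊆ ℝ³`. -/
abbrev L2on (U : Set E3) : Type := Lp ℂ 2 ((volume : Measure E3).restrict U)

/-- The Hilbert space `L²(S, dσ)` on a surface `S ⊆ ℝ³`; the surface measure is the
two-dimensional Hausdorff measure, normalized to agree with area. -/
abbrev L2surface (S : Set E3) : Type := Lp ℂ 2 ((μHE[2] : Measure E3).restrict S)

/-- The restriction operator `L²(ℝ³) → L²(U)`. -/
def restrictTo (U : Set E3) : L2 →L[ℂ] L2on U :=
  LpToLpRestrictCLM E3 ℂ ℂ volume 2 U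

/-- The operator `R ⊕ 0` on `L²(ℝ³) = L²(U) ⊕ L²(ℝ³ \ U)`, for an operator `R` on `L²(U)`
(the adjoint of the restriction operator is extension by zero). -/
def extendOp (U : Set E3) (R : L2on U →L[ℂ] L2on U) : L2 →L[ℂ] L2 :=
  (restrictTo U).adjoint ∘L R ∘L restrictTo U

/-- A compact set of `ℝ³` with smooth boundary: near each of its boundary points it is a
sublevel set `{ρ ≤ 0}` of a smooth function without critical point there. -/
def IsSmoothCompactDomain (K : Set E3) : Prop :=
  IsCompact K ∧ ∀ x ∈ frontier K, ∃ U ∈ 𝓝 x, ∃ ρ : E3 → ℝ,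
    ContDiff ℝ ∞ ρ ∧ fderiv ℝ ρ x ≠ 0 ∧ ∀ y ∈ U, (y ∈ K ↔ ρ y ≤ 0)

/-! ### The magnetic quadratic forms and their self-adjoint operators -/

/-- The magnetic potential `A = (-b x₂ / 2, b x₁ / 2, 0)`. -/
def magPotential (b : ℝ) (j : Fin 3) (x : E3) : ℝ :=
  ![-b * x 1 / 2, b * x 0 / 2, 0] j

/-- The `j`-th component `∂_j φ - i A_j φ` of the magnetic gradient of a smooth function. -/
def magGrad (b : ℝ) (φ : E3 → ℂ) (j : Fin 3) (x : E3) : ℂ :=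
  fderiv ℝ φ x (EuclideanSpace.single j 1) - Complex.I * magPotential b j x * φ x

/-- The pairs `(u, ∇^A u)`, where `u` runs through the domain of the closure of the form
`∫_U |∇^A u|²` initially defined on `C_c^∞(U)`. -/
def dirichletFormDomain (b : ℝ) (U : Set E3) : Set (L2on U × (Fin 3 → L2on U)) :=
  closure {p | ∃ φ : E3 → ℂ, ContDiff ℝ ∞ φ ∧ HasCompactSupport φ ∧ tsupport φ ⊆ U ∧
    p.1 =ᵐ[volume.restrict U] φ ∧ ∀ j, p.2 j =ᵐ[volume.restrict U] magGrad b φ j}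

/-- The triples `(u, ∇^A u, trace of u)`, where `u` runs through the magnetic Sobolev space
`H¹_A(U)` of an open or closed set `U` with compact smooth boundary `∂U`. Restrictions to `U`
of test functions on `ℝ³` are dense in `H¹_A(U)`, and the trace is the continuous extension of
the restriction to `∂U`. -/
def robinFormDomain (b : ℝ) (U : Set E3) :
    Set (L2on U × (Fin 3 → L2on U) × L2surface (frontier U)) :=
  closure {p | ∃ φ : E3 → ℂ, ContDiff ℝ ∞ φ ∧ HasCompactSupport φ ∧
    p.1 =ᵐ[volume.restrict U] φ ∧ (∀ j, p.2.1 j =ᵐ[volume.restrict U] magGrad b φ j) ∧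
    p.2.2 =ᵐ[(μHE[2] : Measure E3).restrict (frontier U)] φ}

/-- The graph of the self-adjoint operator associated with the closure of the form
`∫_U |∇^A u|²` on `C_c^∞(U)`: the Dirichlet realization of `-(∇^A)²` in `U`.
A pair `(u, w)` belongs to it iff `u` is in the form domain and
`Q(v, u) = ⟨v, w⟩` for all `v` in the form domain. -/
def dirichletOp (b : ℝ) (U : Set E3) : Set (L2on U × L2on U) :=
  {p | ∃ g, (p.1, g) ∈ dirichletFormDomain b U ∧
    ∀ v h, (v, h) ∈ dirichletFormDomain b U → ∑ j, ⟪h j, g j⟫_ℂ = ⟪v, p.2⟫_ℂ}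

/-- The graph of the self-adjoint operator associated with the form
`∫_U |∇^A u|² + ∫_{∂U} γ |u|² dσ` on `H¹_A(U)`: the Robin realization of `-(∇^A)²` in `U`
(the Neumann realization for `γ = 0`). -/
def robinOp (b : ℝ) (γ : E3 → ℝ) (U : Set E3) : Set (L2on U × L2on U) :=
  {p | ∃ g s, (p.1, g, s) ∈ robinFormDomain b U ∧
    ∀ v h t, (v, h, t) ∈ robinFormDomain b U →
      ∑ j, ⟪h j, g j⟫_ℂ
        + ∫ x in frontier U, (γ x : ℂ) * (starRingEnd ℂ (t x) * s x) ∂(μHE[2] : Measure E3)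
      = ⟪v, p.2⟫_ℂ}

/-! ### Resolvents -/

section Resolvent

variable {H : Type} [NormedAddCommGroup H] [InnerProductSpace ℂ H]

/-- `R = (T - z)⁻¹`, where the (unbounded) operator `T` is given by its graph. -/
def IsResolventAt (T : Set (H × H)) (z : ℂ) (R : H →L[ℂ] H) : Prop :=
  (∀ f, (R f, f + z • R f) ∈ T) ∧ ∀ p ∈ T, R (p.2 - z • p.1) = p.1

/-- There is at most one bounded operator `(T - z)⁻¹`. -/
theorem IsResolventAt.unique {T : Set (H × H)} {z : ℂ} {R R' : H →L[ℂ] H}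
    (h : IsResolventAt T z R) (h' : IsResolventAt T z R') : R = R' := by
  ext f
  have := h'.2 _ (h.1 f)
  simpa using this.symm

open Classical in
/-- The bounded operator `(T - z)⁻¹` (zero if `z` is in the spectrum of `T`). -/
def resolventAt (T : Set (H × H)) (z : ℂ) : H →L[ℂ] H :=
  if h : ∃ R, IsResolventAt T z R then h.choose else 0

theorem IsResolventAt.eq_resolventAt {T : Set (H × H)} {z : ℂ} {R : H →L[ℂ] H}
    (h : IsResolventAt T z R) : resolventAt T z = R := by
  have hex : ∃ R, IsResolventAt T z R := ⟨R, h⟩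
  rw [resolventAt, dif_pos hex]
  exact hex.choose_spec.unique h

/-- `T + c` is positive and invertible. -/
def IsPositiveInvertible (T : Set (H × H)) (c : ℝ) : Prop :=
  (∀ p ∈ T, 0 ≤ (⟪p.1, p.2 + (c : ℂ) • p.1⟫_ℂ).re) ∧ ∃ R, IsResolventAt T (-(c : ℂ)) R

end Resolvent

/-! ### The exterior problems -/

/-- The boundary condition `l`: Dirichlet (`l = ∞`), or Robin with a smooth real function `γ`
(`l = γ`, only the values of `γ` on the boundary matter). -/
inductive BoundaryCondition : Type
  | dirichlet : BoundaryCondition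
  | robin (γ : E3 → ℝ) (smooth : ContDiff ℝ ∞ γ) : BoundaryCondition

/-- The sign `ε(∞) = 1`, `ε(γ) = -1`. -/
def BoundaryCondition.sign : BoundaryCondition → ℂ
  | .dirichlet => 1
  | .robin _ _ => -1

/-- The shift by `c` makes the Robin realizations `H_Ω^γ + c` in `Ω = ℝ³ \ K` and
`H_K^{-γ} + c` in `K` positive and invertible. (The Dirichlet realization is always at least
`b`, so that nothing is required for `l = ∞`.) -/
def IsAdmissibleShift (b c : ℝ) (K : Set E3) : BoundaryCondition → Prop
  | .dirichlet => True
  | .robin γ _ => IsPositiveInvertible (robinOp b γ Kᶜ) c ∧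
      IsPositiveInvertible (robinOp b (fun x => -γ x) K) c

/-- The free resolvent `R₀(z) = (H₀ + c - z)⁻¹` on `L²(ℝ³)`. -/
def freeResolvent (b c : ℝ) (z : ℂ) : L2 →L[ℂ] L2 :=
  extendOp Set.univ (resolventAt (dirichletOp b Set.univ) (z - c))

/-- The operator `R̃^l(z)` on `L²(ℝ³) = L²(Ω) ⊕ L²(K)`, `Ω = ℝ³ \ K`, for the realizations
shifted by `c`:
`R̃^∞(z) = (H_Ω^∞ + c - z)⁻¹ ⊕ 0`, `R̃^γ(z) = (H_Ω^γ + c - z)⁻¹ ⊕ (H_K^{-γ} + c - z)⁻¹`. -/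
def obstacleResolvent (b c : ℝ) (K : Set E3) : BoundaryCondition → ℂ → (L2 →L[ℂ] L2)
  | .dirichlet, z => extendOp Kᶜ (resolventAt (dirichletOp b Kᶜ) (z - c))
  | .robin γ _, z => extendOp Kᶜ (resolventAt (robinOp b γ Kᶜ) (z - c))
      + extendOp K (resolventAt (robinOp b (fun x => -γ x) K) (z - c))

/-- The perturbation `V^l = R₀(0) - R̃^l(0)`. -/
def perturbation (b c : ℝ) (K : Set E3) (l : BoundaryCondition) : L2 →L[ℂ] L2 :=
  freeResolvent b c 0 - obstacleResolvent b c K l 0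

/-- `V^l = ε(l) M^l M_l` with `M = M_l` and `M^l = (M_l)^*`. -/
def IsFactorization (b c : ℝ) (K : Set E3) (l : BoundaryCondition) (M : L2 →L[ℂ] L2) : Prop :=
  perturbation b c K l = l.sign • (M.adjoint ∘L M)

/-! ### Operators on `L²(ℝ³)` given by a formula -/

open Classical in
/-- The bounded operator `T` on `L²(ℝ³)` with `(T f)(x) = F f x` for almost all `x`, for all `f`
(zero if there is none). -/
def opOf (F : L2 → E3 → ℂ) : L2 →L[ℂ] L2 :=
  if h : ∃ T : L2 →L[ℂ] L2, ∀ f, T f =ᵐ[volume] F f then h.choose else 0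

theorem opOf_eq {F : L2 → E3 → ℂ} {T : L2 →L[ℂ] L2} (hT : ∀ f, T f =ᵐ[volume] F f) :
    opOf F = T := by
  have hex : ∃ T : L2 →L[ℂ] L2, ∀ f, T f =ᵐ[volume] F f := ⟨T, hT⟩
  rw [opOf, dif_pos hex]
  ext1 f
  exact Lp.ext ((hex.choose_spec f).trans (hT f).symm)

/-- The weight `e^{-ε⟨x₃⟩}`, `⟨t⟩ = (1 + t²)^{1/2}`. -/
def weight (ε : ℝ) (x : E3) : ℝ := Real.exp (-ε * Real.sqrt (1 + x 2 ^ 2))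

/-- Multiplication by `e^{-ε⟨x₃⟩}`. -/
def mulWeight (ε : ℝ) : L2 →L[ℂ] L2 := opOf fun f x => (weight ε x : ℂ) * f x

open Classical in
/-- The bounded operator `g ↦ M (e^{ε⟨x₃⟩} g)` on `L²(ℝ³)`, for an operator `M` that is bounded
from `e^{ε⟨x₃⟩} L²(ℝ³)` to `L²(ℝ³)`: the operator `N` with `M = N e^{-ε⟨x₃⟩}`, unique because
`e^{-ε⟨x₃⟩}` has dense range. -/
def weightedExtension (ε : ℝ) (M : L2 →L[ℂ] L2) : L2 →L[ℂ] L2 :=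
  if h : ∃ N : L2 →L[ℂ] L2, N ∘L mulWeight ε = M then h.choose else 0

/-! ### Landau levels -/

/-- The threshold `Λ_q + c`, with the Landau level `Λ_q = (2 q + 1) b`. -/
def landauLevel (b c : ℝ) (q : ℕ) : ℝ := (2 * q + 1) * b + c

/-- The Laguerre polynomial `L_q`. -/
def laguerre (q : ℕ) (t : ℝ) : ℝ :=
  ∑ i ∈ Finset.range (q + 1), (-1) ^ i * (q.choose i : ℝ) * t ^ i / (i.factorial : ℝ)

/-- The integral kernel of the orthogonal projection `p_q` of `L²(ℝ²)` onto
`Ker (H_Landau - Λ_q)`: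
`(b / 2π) L_q(b |x - y|² / 2) exp (-(b / 4) (|x - y|² + 2 i (x₁ y₂ - y₁ x₂)))`. -/
def landauKernel (b : ℝ) (q : ℕ) (x y : E2) : ℂ :=
  ((b / (2 * Real.pi) * laguerre q (b * ‖x - y‖ ^ 2 / 2) : ℝ) : ℂ) *
    Complex.exp (-((b / 4 : ℝ) : ℂ) *
      (((‖x - y‖ ^ 2 : ℝ) : ℂ) + 2 * Complex.I * ((x 0 * y 1 - y 0 * x 1 : ℝ) : ℂ)))

/-- The component `x_⊥ = (x₁, x₂)`. -/
def perp (x : E3) : E2 := !₂[x 0, x 1]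

/-- The operator `p_q ⊗ I₃`. -/
def landauProj (b : ℝ) (q : ℕ) : L2 →L[ℂ] L2 :=
  opOf fun f x => ∫ y : E2, landauKernel b q (perp x) y * f !₂[y 0, y 1, x 2]

/-- The operator `p_q ⊗ r(ζ)`, where `r(ζ)` has the integral kernel `exp (ζ |x₃ - x₃'|) / 2`;
it is bounded on `L²(ℝ³)` for `Re ζ < 0`. -/
def landauTensor (b : ℝ) (q : ℕ) (ζ : ℂ) : L2 →L[ℂ] L2 :=
  opOf fun f x => ∫ y : E3, landauKernel b q (perp x) (perp y) *
    (1 / 2 * Complex.exp (ζ * ((|x 2 - y 2| : ℝ) : ℂ))) * f y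

/-- The function `P_q⁰ u`, with `P_q⁰ = p_q ⊗ r(0)` the operator with integral kernel
`(1 / 2) P_q(x_⊥, x_⊥')`, for `u ∈ e^{-η⟨x₃⟩} L²(ℝ³)`, `η > 0`. -/
def thresholdOp (b : ℝ) (q : ℕ) (u : L2) (x : E3) : ℂ :=
  ∫ y : E3, 1 / 2 * landauKernel b q (perp x) (perp y) * u y

/-! ### The operator functions -/

/-- For `Re k > 0`, `Im k > 0`, and with `z = Λ_q + c + k²`, the operator
`A_q^l(ik) = z² M_l (p_q ⊗ r(ik)) M^l - ik M_l (z + z² R₀(z) (I - p_q ⊗ I₃)) M^l`. -/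
def charOp (b c : ℝ) (q : ℕ) (M : L2 →L[ℂ] L2) (k : ℂ) : L2 →L[ℂ] L2 :=
  let z : ℂ := landauLevel b c q + k ^ 2
  z ^ 2 • (M ∘L landauTensor b q (Complex.I * k) ∘L M.adjoint)
    - (Complex.I * k) • (M ∘L
        (z • ContinuousLinearMap.id ℂ L2
          + z ^ 2 • (freeResolvent b c z ∘L (ContinuousLinearMap.id ℂ L2 - landauProj b q)))
        ∘L M.adjoint)

/-- `A` is (near `0`) the holomorphic operator-valued function `A_q^l`: it is holomorphic near
`0`, and given by the formula above at the points `ik` with `Re k > 0`, `Im k > 0`. By the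
identity theorem its germ at `0` is unique. -/
def IsCharFunction (b c : ℝ) (q : ℕ) (M : L2 →L[ℂ] L2) (A : ℂ → (L2 →L[ℂ] L2)) : Prop :=
  AnalyticAt ℂ A 0 ∧
    ∀ᶠ k : ℂ in 𝓝 0, 0 < k.re → 0 < k.im → A (Complex.I * k) = charOp b c q M k

/-- The sector `S_δ = {z : Im z > δ |Re z - Λ|}`. -/
def sector (Λ δ : ℝ) : Set ℂ := {z | δ * |z.re - Λ| < z.im}

/-- The bounded operator `M_l (I + ik P_q⁰) R̃^l(z) M^l` on `L²(ℝ³)`, for `Im z > 0`, where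
`k = (z - Λ_q - c)^{1/2}` with `Re k > 0`, `Im k > 0`. For `f ∈ L²(ℝ³)` the function
`u = R̃^l(z) M^l f` decays exponentially in `x₃`, so that `P_q⁰ u` is defined; it belongs to
`e^{ε⟨x₃⟩} L²(ℝ³)`, and the extension of `M_l` to this space is applied to it. -/
def sandwichedResolvent (b c ε : ℝ) (q : ℕ) (K : Set E3) (l : BoundaryCondition)
    (M : L2 →L[ℂ] L2) (z : ℂ) : L2 →L[ℂ] L2 :=
  let k : ℂ := (z - landauLevel b c q) ^ (1 / 2 : ℂ)
  M ∘L obstacleResolvent b c K l z ∘L M.adjoint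
    + (Complex.I * k) • (weightedExtension ε M ∘L
        opOf fun f x => (weight ε x : ℂ) *
          thresholdOp b q (obstacleResolvent b c K l z (M.adjoint f)) x)

/-- `K` produces no isolated resonance at `Λ_q`: the operators `M_l (I + ik P_q⁰) R̃^l(z) M^l`
have a limit in operator norm as `z → Λ_q` in the sector `S_δ`. -/
def NoIsolatedResonance (b c ε δ : ℝ) (q : ℕ) (K : Set E3) (l : BoundaryCondition)
    (M : L2 →L[ℂ] L2) : Prop :=
  ∃ L : L2 →L[ℂ] L2, Tendsto (sandwichedResolvent b c ε q K l M)
    (𝓝[sector (landauLevel b c q) δ] (landauLevel b c q : ℂ)) (𝓝 L)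

end MagneticObstacle

end

/-!
The theorem combines a limit lemma for operator pencils with an analysis of the free resolvent at
a Landau level and of the difference of the free and the obstacle resolvents. Write `R₀` and `R`
for the values at `z = 0` of the two resolvents, `σ = ε(l)`, `M = M_l`, so that
`R₀ - R = σ M* M`, and `κ = ik`, so that `z = Λ - κ²`.

*Algebra.* Both resolvents are functions of their values at `0`, as in
`R₀(z) = R₀ (1 - z R₀)⁻¹`, and in these terms `A(κ) = -κ z M (1 - z R₀)⁻¹ M*` (`charOp_eq`). The
second resolvent identity shows that `1 - σ A(κ) / κ` is invertible, and expresses `M R̃(z) M*` by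
its inverse `F` (`perturbation_inverse_identities`). Since `P_q⁰ R₀(z) = -k⁻² P_q⁰`
(`threshold_mul_resolvent`), the operator `M (1 + ik P_q⁰) R̃(z) M*` is
`(Λ / (z κ)) P F + (σ / z²) (1 - F) - (κ / z) P - z⁻¹ M M*`, where `P = A(0) / Λ²`
(`sandwichedResolvent_eq`). So the question is whether
`κ⁻¹ σ A(0) F - (Λ / z) F` has a limit.

*The limit.* Up to the factor `Λ / z`, which tends to `1`, the last operator is the negative of the
inverse of `(κ - σ A(κ)) (κ - σ A(0))⁻¹`. In the sector `κ` stays away from the real axis, and `A(0)`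
is self-adjoint. Hence `κ (κ - σ A(0))⁻¹` is bounded and tends strongly to `Π_q`; composed with
`A'(0)`, which is compact, it converges in norm. Therefore `(κ - σ A(κ)) (κ - σ A(0))⁻¹` tends in
norm to `1 - σ A'(0) Π_q`, and its inverses converge if and only if this limit is invertible
(`exists_tendsto_iff_isUnit`).

*The free operator.* The operators `p_q ⊗ I₃` are superpositions of magnetic translations in the
plane with the Laguerre functions as densities. Their generating function is the Mehler semigroup,
a superposition with Gaussian densities, whose semigroup law is the twisted convolution of
Gaussians (`mehlerOp_mul`). Comparing coefficients gives the orthogonality relations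
(`landauOp_mul`), and strong continuity gives completeness (`hasSum_landauOp_apply`). In each band
the free resolvent is a convolution in `x₃` with an exponential (`resolvent_mul_landauOp`); this is
verified on products of Laguerre functions and test functions, and extended to the whole band by
the dual magnetic translations, which commute with `H₀`. Consequently `R₀(z)` preserves exponential
decay in `x₃` (`norm_mulWeight_resolvent_le`). If moreover `M = N e^{-ε⟨x₃⟩}` with a bounded `N`,
then the contributions of the bands up to the `q`-th one to `A` are analytic at `κ = 0` although
their exponents are imaginary there, and those of the higher bands are a Neumann series. This yields `A`
(`isCharFunction_charFun`); its germ is unique by the identity theorem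
(`IsCharFunction.eventuallyEq`).

*The obstacle.* It remains to see that `M` is compact and factors as `N e^{-ε⟨x₃⟩}`
(`exists_factor_comp_mulWeight`). By `‖M f‖² = |⟪f, (R₀ - R) f⟫|` both properties follow from
properties of `R₀ - R`. If a cutoff `χ` equals `1` near the obstacle, then `(1 - χ) R₀ f` solves the
obstacle problem whatever the boundary condition is, and so `(R₀ - R) f = χ R₀ f + R F`, where `F`
is supported near the obstacle and controlled by the Caccioppoli inequality
(`exists_perturbation_decomposition`). This gives the decay. Compactness of `χ R₀` and `χ R` is
local compactness of the form domains (`isCompactOperator_mulOp_extendOp`): near each point a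
domain with smooth boundary contains a cone of directions, and averaging magnetic translates over
small balls in this cone approximates the functions of the form domain, uniformly in terms of their
magnetic gradients, by the values of operators with square integrable kernels.
-/

noncomputable section

namespace MagneticObstacle

set_option linter.unusedSectionVars false

section

/-! ### Compact operators and bounded operators between Hilbert spaces -/

section Abstract

variable {H : Type*} [NormedAddCommGroup H] [InnerProductSpace ℂ H] [CompleteSpace H]

theorem isCompactOperator_of_totallyBounded {E G : Type*} [NormedAddCommGroup E] [NormedSpace ℂ E]
    [NormedAddCommGroup G] [NormedSpace ℂ G] [CompleteSpace G] (Y : E →L[ℂ] G)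
    (h : TotallyBounded (Y '' Metric.closedBall 0 1)) : IsCompactOperator Y :=
  (isCompactOperator_iff_isCompact_closure_image_closedBall (Y : E →ₗ[ℂ] G) one_pos).2
    (isCompact_iff_totallyBounded_isComplete.2 ⟨h.closure, isClosed_closure.isComplete⟩)

theorem totallyBounded_image_closedBall {E F : Type*} [NormedAddCommGroup E]
    [NormedSpace ℂ E] [NormedAddCommGroup F] [NormedSpace ℂ F] {X : E →L[ℂ] F}
    (hX : IsCompactOperator X) : TotallyBounded (X '' Metric.closedBall 0 1) :=
  ((isCompactOperator_iff_isCompact_closure_image_closedBall (X : E →ₗ[ℂ] F)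
    one_pos).1 hX).totallyBounded.subset subset_closure

/-- Compactness passes from `X` to `Y` when `‖Y g‖²` is controlled by `‖X g‖ ‖g‖`. -/
theorem isCompactOperator_of_sq_le {E F G : Type*} [NormedAddCommGroup E] [NormedSpace ℂ E]
    [NormedAddCommGroup F] [NormedSpace ℂ F] [NormedAddCommGroup G] [NormedSpace ℂ G]
    [CompleteSpace G] {X : E →L[ℂ] F} {Y : E →L[ℂ] G} (hX : IsCompactOperator X) {C : ℝ}
    (h : ∀ g, ‖Y g‖ ^ 2 ≤ C * ‖X g‖ * ‖g‖) : IsCompactOperator Y := by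
  apply isCompactOperator_of_totallyBounded
  rw [Metric.totallyBounded_iff]
  intro δ hδ
  set C' := max C 1
  have hC' : 0 < C' := lt_of_lt_of_le one_pos (le_max_right _ _)
  -- a net of the image under `X` that is fine enough for the differences, of norm at most `2`
  obtain ⟨t, hts, htf, htc⟩ := Metric.finite_approx_of_totallyBounded
    (totallyBounded_image_closedBall hX) (δ ^ 2 / (2 * C')) (by positivity)
  rw [Set.subset_image_iff] at hts
  choose! p hp1 hp2 using fun y (hy : y ∈ t) => (by
    obtain ⟨u, hu, rfl⟩ := hts
    obtain ⟨g, hg, rfl⟩ := hy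
    exact ⟨g, hu hg, rfl⟩ : ∃ g, g ∈ Metric.closedBall (0 : E) 1 ∧ X g = y)
  refine ⟨(fun y => Y (p y)) '' t, htf.image _, ?_⟩
  rintro _ ⟨g, hg, rfl⟩
  have hx := htc ⟨g, hg, rfl⟩
  simp only [Set.mem_iUnion] at hx ⊢
  obtain ⟨y, hy, hxy⟩ := hx
  refine ⟨_, ⟨y, hy, rfl⟩, ?_⟩
  rw [Metric.mem_ball, dist_eq_norm] at hxy ⊢
  rw [← hp2 y hy, ← map_sub] at hxy
  rw [← map_sub]
  have h2 : ‖g - p y‖ ≤ 2 := by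
    have h3 := hp1 y hy
    rw [mem_closedBall_zero_iff] at h3 hg
    linarith [norm_sub_le g (p y)]
  have h4 : ‖Y (g - p y)‖ ^ 2 < δ ^ 2 := by
    calc ‖Y (g - p y)‖ ^ 2 ≤ C * ‖X (g - p y)‖ * ‖g - p y‖ := h _
      _ ≤ C' * ‖X (g - p y)‖ * 2 := by
        gcongr
        exact le_max_left _ _
      _ < C' * (δ ^ 2 / (2 * C')) * 2 := by gcongr
      _ = δ ^ 2 := by field_simp
  exact lt_of_pow_lt_pow_left₀ 2 hδ.le h4

/-- The theorem of Schauder in Hilbert spaces: `‖T* g‖² = ⟪T T* g, g⟫`, and `T T*` is compact. -/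
theorem isCompactOperator_adjoint {E F : Type*} [NormedAddCommGroup E] [InnerProductSpace ℂ E]
    [CompleteSpace E] [NormedAddCommGroup F] [InnerProductSpace ℂ F] [CompleteSpace F]
    {T : E →L[ℂ] F} (hT : IsCompactOperator T) : IsCompactOperator T.adjoint := by
  have h1 : IsCompactOperator (T ∘L T.adjoint) := hT.comp_clm _
  refine isCompactOperator_of_sq_le h1 (C := 1) fun g => ?_
  have h2 : (‖T.adjoint g‖ : ℂ) ^ 2 = ⟪(T ∘L T.adjoint) g, g⟫_ℂ := by
    rw [ContinuousLinearMap.comp_apply, ← ContinuousLinearMap.adjoint_inner_right,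
      inner_self_eq_norm_sq_to_K]
    rfl
  have h3 : ‖T.adjoint g‖ ^ 2 = ‖⟪(T ∘L T.adjoint) g, g⟫_ℂ‖ := by
    rw [← h2]; simp
  rw [h3, one_mul]
  exact norm_inner_le_norm _ _

/-- Uniformly bounded operators that converge strongly to zero converge in norm after composition
with a compact operator. -/
theorem tendsto_comp_compact {E : Type*} [NormedAddCommGroup E] [NormedSpace ℂ E] {ι : Type*}
    {l : Filter ι} {T : ι → E →L[ℂ] E} {B : ℝ} (hB : ∀ᶠ i in l, ‖T i‖ ≤ B)
    (hT : ∀ x, Tendsto (fun i => T i x) l (𝓝 0)) {K : E →L[ℂ] E}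
    (hK : IsCompactOperator K) : Tendsto (fun i => T i ∘L K) l (𝓝 0) := by
  rw [Metric.tendsto_nhds]
  intro δ hδ
  set B' := max B 1
  have hB' : 0 < B' := lt_of_lt_of_le one_pos (le_max_right _ _)
  obtain ⟨t, htf, htc⟩ := Metric.totallyBounded_iff.1 (totallyBounded_image_closedBall hK)
    (δ / (4 * B')) (by positivity)
  have h1 : ∀ᶠ i in l, ∀ y ∈ t, ‖T i y‖ < δ / 4 := by
    rw [Filter.eventually_all_finite htf]
    intro y _
    have := (Metric.tendsto_nhds.1 (hT y)) (δ / 4) (by positivity)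
    simpa using this
  filter_upwards [hB, h1] with i hi1 hi2
  rw [dist_zero_right]
  refine lt_of_le_of_lt (ContinuousLinearMap.opNorm_le_of_unit_norm (C := δ / 2)
    (by positivity) fun x hx => ?_) (by linarith)
  have hx' := htc ⟨x, by simp [hx], rfl⟩
  simp only [Set.mem_iUnion] at hx'
  obtain ⟨y, hy, hxy⟩ := hx'
  rw [Metric.mem_ball, dist_eq_norm] at hxy
  have e : (T i ∘L K) x = T i (K x - y) + T i y := by simp
  rw [e]
  calc ‖T i (K x - y) + T i y‖ ≤ ‖T i (K x - y)‖ + ‖T i y‖ := norm_add_le _ _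
    _ ≤ B' * (δ / (4 * B')) + δ / 4 := by
        gcongr
        · refine ((T i).le_opNorm _).trans ?_
          gcongr
          exact hi1.trans (le_max_left _ _)
        · exact (hi2 y hy).le
    _ = δ / 2 := by field_simp; ring

/-- If `X` is dominated by `W`, and `W` has dense range, then `X` factors through `W`. -/
theorem exists_comp_eq_of_norm_le {E F G : Type*} [NormedAddCommGroup E] [NormedSpace ℂ E]
    [NormedAddCommGroup F] [NormedSpace ℂ F] [NormedAddCommGroup G] [NormedSpace ℂ G]
    [CompleteSpace G] (W : E →L[ℂ] F) (X : E →L[ℂ] G) (hW : DenseRange W) {C : ℝ}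
    (h : ∀ g, ‖X g‖ ≤ C * ‖W g‖) : ∃ B : F →L[ℂ] G, B ∘L W = X := by
  refine ⟨(X : E →ₗ[ℂ] G).extendOfNorm (W : E →ₗ[ℂ] F), ?_⟩
  ext g
  exact LinearMap.extendOfNorm_eq (f := (X : E →ₗ[ℂ] G)) (e := (W : E →ₗ[ℂ] F)) hW ⟨C, h⟩ g

theorem comp_right_injective_of_denseRange {E F G : Type*} [NormedAddCommGroup E]
    [NormedSpace ℂ E] [NormedAddCommGroup F] [NormedSpace ℂ F] [NormedAddCommGroup G]
    [NormedSpace ℂ G] {W : E →L[ℂ] F} (hW : DenseRange W) {B B' : F →L[ℂ] G}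
    (h : B ∘L W = B' ∘L W) : B = B' := by
  apply ContinuousLinearMap.coeFn_injective
  refine hW.equalizer B.continuous B'.continuous ?_
  ext g
  exact DFunLike.congr_fun h g

/-! ### Self-adjoint operators off the real axis -/

theorem inner_im_eq_zero_of_isSelfAdjoint {S : H →L[ℂ] H} (hS : IsSelfAdjoint S) (x : H) :
    (⟪S x, x⟫_ℂ).im = 0 := by
  have h := ContinuousLinearMap.adjoint_inner_left S x x
  rw [hS.adjoint_eq] at h
  have h2 := inner_conj_symm (𝕜 := ℂ) x (S x)
  rw [← h] at h2
  exact Complex.conj_eq_iff_im.1 h2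

/-- The numerical range of a self-adjoint operator is real. -/
theorem le_norm_inner_sub_selfAdjoint {S : H →L[ℂ] H} (hS : IsSelfAdjoint S) (κ : ℂ) (x : H) :
    ‖x‖ ^ 2 * |κ.im| ≤ ‖⟪(κ • (1 : H →L[ℂ] H) - S) x, x⟫_ℂ‖ := by
  have h1 : (⟪(κ • (1 : H →L[ℂ] H) - S) x, x⟫_ℂ).im = -κ.im * ‖x‖ ^ 2 := by
    have e : (κ • (1 : H →L[ℂ] H) - S) x = κ • x - S x := by simp
    rw [e, inner_sub_left, inner_smul_left, Complex.sub_im, inner_im_eq_zero_of_isSelfAdjoint hS,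
      inner_self_eq_norm_sq_to_K]
    have : ((‖x‖ : ℂ) ^ 2) = ((‖x‖ ^ 2 : ℝ) : ℂ) := by push_cast; rfl
    erw [this]
    rw [Complex.mul_im, Complex.ofReal_im, Complex.ofReal_re]
    simp
  calc ‖x‖ ^ 2 * |κ.im| = |(⟪(κ • (1 : H →L[ℂ] H) - S) x, x⟫_ℂ).im| := by
        rw [h1, abs_mul, abs_neg, abs_of_nonneg (sq_nonneg ‖x‖), mul_comm]
    _ ≤ _ := Complex.abs_im_le_norm _

theorem isUnit_sub_selfAdjoint {S : H →L[ℂ] H} (hS : IsSelfAdjoint S) {κ : ℂ} (hκ : κ.im ≠ 0) :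
    IsUnit (κ • (1 : H →L[ℂ] H) - S) :=
  ContinuousLinearMap.isUnit_of_forall_le_norm_inner_map _ (c := ⟨|κ.im|, abs_nonneg _⟩)
    (abs_pos.2 hκ) (le_norm_inner_sub_selfAdjoint hS κ)

theorem norm_inverse_sub_selfAdjoint_le {S : H →L[ℂ] H} (hS : IsSelfAdjoint S) {κ : ℂ}
    (hκ : κ.im ≠ 0) : ‖Ring.inverse (κ • (1 : H →L[ℂ] H) - S)‖ ≤ |κ.im|⁻¹ := by
  have hp : 0 < |κ.im| := abs_pos.2 hκ
  refine ContinuousLinearMap.opNorm_le_bound _ (by positivity) fun y => ?_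
  set x := Ring.inverse (κ • (1 : H →L[ℂ] H) - S) y
  have hx : (κ • (1 : H →L[ℂ] H) - S) x = y :=
    DFunLike.congr_fun (Ring.mul_inverse_cancel _ (isUnit_sub_selfAdjoint hS hκ)) y
  have h1 := le_norm_inner_sub_selfAdjoint hS κ x
  rw [hx] at h1
  have h2 := h1.trans (norm_inner_le_norm y x)
  rcases eq_or_lt_of_le (norm_nonneg x) with h0 | h0
  · rw [← h0]; positivity
  · rw [inv_mul_eq_div, le_div_iff₀ hp]
    nlinarith

theorem isUnit_one_sub_smul_selfAdjoint {S : H →L[ℂ] H} (hS : IsSelfAdjoint S) {z : ℂ}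
    (hz : z.im ≠ 0) : IsUnit (1 - z • S) := by
  have hz0 : z ≠ 0 := by rintro rfl; simp at hz
  have h1 : (z⁻¹).im ≠ 0 := by
    rw [Complex.inv_im]
    simp [hz, hz0]
  have h2 := isUnit_sub_selfAdjoint hS h1
  have h3 : 1 - z • S = z • (z⁻¹ • (1 : H →L[ℂ] H) - S) := by
    rw [smul_sub, smul_smul, mul_inv_cancel₀ hz0, one_smul]
  rw [h3]
  exact (IsUnit.smul (Units.mk0 z hz0) h2 :)

/-- The operators `κ (κ - S)⁻¹` tend strongly to the projection onto `Ker S`, as `κ → 0` away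
from the real axis. -/
theorem tendsto_smul_inverse_apply {ι : Type*} {l : Filter ι} {κ : ι → ℂ}
    (hκ : Tendsto κ l (𝓝 0)) {d : ℝ} (hd : 0 < d)
    (hκd : ∀ᶠ i in l, κ i ≠ 0 ∧ d * ‖κ i‖ ≤ |(κ i).im|) {S : H →L[ℂ] H}
    (hS : IsSelfAdjoint S) (x : H) :
    Tendsto (fun i => (κ i • Ring.inverse (κ i • (1 : H →L[ℂ] H) - S) -
      S.ker.starProjection) x) l (𝓝 0) := by
  have key : ∀ᶠ i in l, (κ i).im ≠ 0 ∧
      ‖κ i • Ring.inverse (κ i • (1 : H →L[ℂ] H) - S)‖ ≤ d⁻¹ := by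
    filter_upwards [hκd] with i ⟨h0, h1⟩
    have hpos : 0 < ‖κ i‖ := norm_pos_iff.2 h0
    have him : 0 < |(κ i).im| := lt_of_lt_of_le (by positivity) h1
    refine ⟨abs_pos.1 him, ?_⟩
    rw [norm_smul]
    calc ‖κ i‖ * _ ≤ ‖κ i‖ * |(κ i).im|⁻¹ := by
          gcongr
          exact norm_inverse_sub_selfAdjoint_le hS (abs_pos.1 him)
      _ ≤ ‖κ i‖ * (d * ‖κ i‖)⁻¹ := by gcongr
      _ = d⁻¹ := by field_simp
  -- on the kernel the operators are the identity, on the range they are of size `O(κ)`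
  have hker : ∀ y ∈ S.ker, ∀ᶠ i in l,
      (κ i • Ring.inverse (κ i • (1 : H →L[ℂ] H) - S)) y = y := by
    intro y hy
    filter_upwards [key] with i ⟨hi, _⟩
    have h1 : (κ i • (1 : H →L[ℂ] H) - S) y = κ i • y := by
      have : S y = 0 := hy
      simp [this]
    have h2 := DFunLike.congr_fun (Ring.inverse_mul_cancel _ (isUnit_sub_selfAdjoint hS hi)) y
    rw [mul_apply_eq_comp, h1, map_smul] at h2
    simpa using h2
  have hran : ∀ v, Tendsto (fun i => (κ i • Ring.inverse (κ i • (1 : H →L[ℂ] H) - S)) (S v))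
      l (𝓝 0) := by
    intro v
    have h0 : Tendsto (fun i => ‖κ i‖ * ((d⁻¹ + 1) * ‖v‖)) l (𝓝 0) := by
      simpa using hκ.norm.mul_const ((d⁻¹ + 1) * ‖v‖)
    refine squeeze_zero_norm' ?_ h0
    filter_upwards [key] with i ⟨hi, hb⟩
    have h2 := DFunLike.congr_fun (Ring.inverse_mul_cancel _ (isUnit_sub_selfAdjoint hS hi)) v
    have h3 : Ring.inverse (κ i • (1 : H →L[ℂ] H) - S) (S v) =
        (κ i • Ring.inverse (κ i • (1 : H →L[ℂ] H) - S)) v - v := by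
      rw [mul_apply_eq_comp] at h2
      simp only [sub_apply, smul_apply,
        one_apply_eq_self, map_sub, map_smul] at h2 ⊢
      rw [sub_eq_iff_eq_add] at h2
      rw [h2]
      abel
    rw [smul_apply, norm_smul, h3]
    gcongr
    calc _ ≤ ‖(κ i • Ring.inverse (κ i • (1 : H →L[ℂ] H) - S)) v‖ + ‖v‖ := norm_sub_le _ _
      _ ≤ d⁻¹ * ‖v‖ + ‖v‖ := by
        gcongr
        exact ContinuousLinearMap.le_of_opNorm_le _ hb v
      _ = _ := by ring
  have hclo : ∀ y ∈ S.kerᗮ, Tendsto (fun i =>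
      (κ i • Ring.inverse (κ i • (1 : H →L[ℂ] H) - S)) y) l (𝓝 0) := by
    intro y hy
    rw [ContinuousLinearMap.orthogonal_ker, hS.adjoint_eq] at hy
    rw [Metric.tendsto_nhds]
    intro δ hδ
    obtain ⟨_, ⟨v, rfl⟩, hv⟩ := Metric.mem_closure_iff.1 hy (δ / 2 * d) (by positivity)
    filter_upwards [key, Metric.tendsto_nhds.1 (hran v) (δ / 2) (by positivity)]
      with i ⟨_, hb⟩ hi
    rw [dist_zero_right] at hi ⊢
    rw [dist_eq_norm] at hv
    have e : (κ i • Ring.inverse (κ i • (1 : H →L[ℂ] H) - S)) y =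
        (κ i • Ring.inverse (κ i • (1 : H →L[ℂ] H) - S)) (y - S v) +
        (κ i • Ring.inverse (κ i • (1 : H →L[ℂ] H) - S)) (S v) := by
      rw [← map_add]; simp
    rw [e]
    calc _ ≤ _ := norm_add_le _ _
      _ < d⁻¹ * (δ / 2 * d) + δ / 2 := by
        refine add_lt_add_of_le_of_lt ?_ hi
        refine (ContinuousLinearMap.le_of_opNorm_le _ hb _).trans ?_
        gcongr
        exact hv.le
      _ = δ := by field_simp; ring
  have h1 := hclo (x - S.ker.starProjection x) (Submodule.sub_starProjection_mem_orthogonal x)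
  refine h1.congr' ?_
  filter_upwards [hker (S.ker.starProjection x) (Submodule.starProjection_apply_mem _ x)] with i hi
  rw [map_sub, hi]
  rfl

/-- Composed with a compact operator, `κ (κ - S)⁻¹` tends in norm to the projection onto `Ker S`. -/
theorem tendsto_compact_mul_smul_inverse {ι : Type*} {l : Filter ι} {κ : ι → ℂ}
    (hκ : Tendsto κ l (𝓝 0)) {d : ℝ} (hd : 0 < d)
    (hκd : ∀ᶠ i in l, κ i ≠ 0 ∧ d * ‖κ i‖ ≤ |(κ i).im|) {S : H →L[ℂ] H}
    (hS : IsSelfAdjoint S) {C : H →L[ℂ] H} (hC : IsCompactOperator C) :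
    Tendsto (fun i => C * (κ i • Ring.inverse (κ i • (1 : H →L[ℂ] H) - S))) l
      (𝓝 (C * S.ker.starProjection)) := by
  have hP : star S.ker.starProjection = S.ker.starProjection :=
    (isSelfAdjoint_starProjection S.ker).star_eq
  -- pass to adjoints: the adjoint of `κ (κ - S)⁻¹` is the same function at the conjugate point
  have hstar : ∀ i, star (κ i • Ring.inverse (κ i • (1 : H →L[ℂ] H) - S) -
      S.ker.starProjection) = starRingEnd ℂ (κ i) •
        Ring.inverse (starRingEnd ℂ (κ i) • (1 : H →L[ℂ] H) - S) - S.ker.starProjection := by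
    intro i
    rw [star_sub, star_smul, hP, ← Ring.inverse_star, star_sub, star_smul, star_one, hS.star_eq]
    rfl
  have h1 := tendsto_comp_compact (l := l)
    (T := fun i => star (κ i • Ring.inverse (κ i • (1 : H →L[ℂ] H) - S) -
      S.ker.starProjection)) (B := d⁻¹ + 1) ?_ ?_ (isCompactOperator_adjoint hC)
  · rw [tendsto_iff_norm_sub_tendsto_zero]
    rw [tendsto_zero_iff_norm_tendsto_zero] at h1
    refine h1.congr fun i => ?_
    rw [← mul_sub, ← norm_star (C * _), star_mul]
    rfl
  · filter_upwards [hκd] with i ⟨h0, h1⟩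
    have hpos : 0 < ‖κ i‖ := norm_pos_iff.2 h0
    have him : 0 < |(κ i).im| := lt_of_lt_of_le (by positivity) h1
    rw [norm_star]
    refine (norm_sub_le _ _).trans ?_
    gcongr
    · rw [norm_smul]
      calc ‖κ i‖ * _ ≤ ‖κ i‖ * |(κ i).im|⁻¹ := by
            gcongr
            exact norm_inverse_sub_selfAdjoint_le hS (abs_pos.1 him)
        _ ≤ ‖κ i‖ * (d * ‖κ i‖)⁻¹ := by gcongr
        _ = d⁻¹ := by field_simp
    · exact Submodule.starProjection_norm_le _
  · intro x
    simp only [hstar]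
    refine tendsto_smul_inverse_apply (κ := fun i => starRingEnd ℂ (κ i)) ?_ hd ?_ hS x
    · have := (Complex.continuous_conj.tendsto 0).comp hκ
      rwa [map_zero] at this
    · filter_upwards [hκd] with i hi
      simpa using hi

/-- If `a b` and `a` converge, and the limit of `a` is invertible, then `b` converges. -/
theorem tendsto_of_tendsto_mul {ι R : Type*} {l : Filter ι} [NormedRing R] [HasSummableGeomSeries R]
    {a b : ι → R} {x y : R} (hx : IsUnit x) (ha : Tendsto a l (𝓝 x))
    (hab : Tendsto (fun i => a i * b i) l (𝓝 y)) : Tendsto b l (𝓝 (Ring.inverse x * y)) := by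
  obtain ⟨u, rfl⟩ := hx
  have h1 : Tendsto (fun i => Ring.inverse (a i)) l (𝓝 (Ring.inverse (u : R))) :=
    (NormedRing.inverse_continuousAt u).tendsto.comp ha
  refine (h1.mul hab).congr' ?_
  filter_upwards [ha.eventually (Units.nhds u)] with i hi
  rw [← mul_assoc, Ring.inverse_mul_cancel _ hi, one_mul]

/-- Let `B` be differentiable at `0`, with self-adjoint value `S` and compact derivative `C` there.
The inverse `F` of `1 - B(κ) / κ` is such that `κ⁻¹ S F - F` has a limit as `κ → 0` away from the
real axis if and only if `1 - C Π` is invertible, with `Π` the projection onto `Ker S`: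
up to sign this expression is the inverse of `(κ - B(κ)) (κ - S)⁻¹`, which tends to `1 - C Π`. -/
theorem exists_tendsto_iff_isUnit {ι : Type*} {l : Filter ι} [l.NeBot] {κ : ι → ℂ}
    (hκ : Tendsto κ l (𝓝 0)) {d : ℝ} (hd : 0 < d)
    (hκd : ∀ᶠ i in l, κ i ≠ 0 ∧ d * ‖κ i‖ ≤ |(κ i).im|) {B : ℂ → H →L[ℂ] H} {C : H →L[ℂ] H}
    (hB : HasDerivAt B C 0) (hS : IsSelfAdjoint (B 0)) (hC : IsCompactOperator C)
    {F Y E : ι → H →L[ℂ] H} {E₀ : H →L[ℂ] H} {a b : ι → ℂ} {a₀ : ℂ}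
    (hF : ∀ᶠ i in l, (1 - (κ i)⁻¹ • B (κ i)) * F i = 1 ∧ F i * (1 - (κ i)⁻¹ • B (κ i)) = 1)
    (ha : Tendsto a l (𝓝 a₀)) (ha₀ : a₀ ≠ 0) (hb : Tendsto b l (𝓝 1)) (hE : Tendsto E l (𝓝 E₀))
    (hY : ∀ᶠ i in l, Y i = a i • ((κ i)⁻¹ • (B 0 * F i) - b i • F i) + E i) :
    (∃ L, Tendsto Y l (𝓝 L)) ↔ IsUnit (1 - C * (B 0).ker.starProjection) := by
  set S := B 0 with hSdef
  -- `W` and `Wi` are inverse to each other; `θ` accounts for the difference of `b` and `1`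
  let D : ι → H →L[ℂ] H := fun i => κ i • (1 : H →L[ℂ] H) - S
  let W : ι → H →L[ℂ] H := fun i => (κ i)⁻¹ • (D i * F i)
  let Wi : ι → H →L[ℂ] H := fun i => (κ i • 1 - B (κ i)) * Ring.inverse (D i)
  let θ : ι → H →L[ℂ] H := fun i => (1 - b i) • (κ i • Ring.inverse (D i))
  have him : ∀ᶠ i in l, κ i ≠ 0 ∧ (κ i).im ≠ 0 := by
    filter_upwards [hκd] with i ⟨h0, h1⟩
    have hpos : 0 < ‖κ i‖ := norm_pos_iff.2 h0
    exact ⟨h0, abs_pos.1 (lt_of_lt_of_le (by positivity) h1)⟩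
  have hinv : ∀ᶠ i in l, ‖κ i • Ring.inverse (D i)‖ ≤ d⁻¹ := by
    filter_upwards [hκd] with i ⟨h0, h1⟩
    have hpos : 0 < ‖κ i‖ := norm_pos_iff.2 h0
    have him : 0 < |(κ i).im| := lt_of_lt_of_le (by positivity) h1
    rw [norm_smul]
    calc ‖κ i‖ * _ ≤ ‖κ i‖ * |(κ i).im|⁻¹ := by
          gcongr
          exact norm_inverse_sub_selfAdjoint_le hS (abs_pos.1 him)
      _ ≤ ‖κ i‖ * (d * ‖κ i‖)⁻¹ := by gcongr
      _ = d⁻¹ := by field_simp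
  have hbdd : IsBoundedUnder (· ≤ ·) l (fun i => ‖κ i • Ring.inverse (D i)‖) := ⟨d⁻¹, hinv⟩
  have hθ : Tendsto θ l (𝓝 0) := by
    have h1 : Tendsto (fun i => 1 - b i) l (𝓝 0) := by simpa using hb.const_sub 1
    exact h1.zero_smul_isBoundedUnder_le hbdd
  have hWW : ∀ᶠ i in l, W i * Wi i = 1 ∧ Wi i * W i = 1 := by
    filter_upwards [him, hF] with i ⟨h0, h1⟩ ⟨hF1, hF2⟩
    have hD := isUnit_sub_selfAdjoint hS h1
    have e : κ i • (1 : H →L[ℂ] H) - B (κ i) = κ i • (1 - (κ i)⁻¹ • B (κ i)) := by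
      rw [smul_sub, smul_smul, mul_inv_cancel₀ h0, one_smul]
    constructor
    · simp only [W, Wi]
      rw [e, smul_mul_assoc, smul_mul_assoc, mul_smul_comm, smul_smul, inv_mul_cancel₀ h0, one_smul,
        mul_assoc, ← mul_assoc (F i), hF2, one_mul]
      exact Ring.mul_inverse_cancel _ hD
    · simp only [W, Wi]
      rw [e, mul_smul_comm, smul_mul_assoc, smul_mul_assoc, smul_smul, inv_mul_cancel₀ h0, one_smul,
        mul_assoc, ← mul_assoc (Ring.inverse _)]
      erw [Ring.inverse_mul_cancel _ hD]
      rw [one_mul, hF1]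
  have hWi : Tendsto Wi l (𝓝 (1 - C * S.ker.starProjection)) := by
    have h1 := (tendsto_compact_mul_smul_inverse hκ hd hκd hS hC).const_sub 1
    -- the Taylor remainder `o(κ)` of `B`, multiplied by the `O(1 / κ)` operator `(κ - S)⁻¹`
    have h2 : Tendsto (fun i => (κ i)⁻¹ • (B (κ i) - S - κ i • C)) l (𝓝 0) := by
      have h3 := (hasDerivAt_iff_isLittleO_nhds_zero.1 hB).comp_tendsto hκ
      have h4 := h3.norm_left.norm_right.tendsto_div_nhds_zero
      rw [tendsto_zero_iff_norm_tendsto_zero]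
      refine h4.congr fun i => ?_
      simp only [Function.comp, zero_add, norm_smul, norm_inv]
      rw [div_eq_inv_mul]
    have h5 : Tendsto (fun i => ((κ i)⁻¹ • (B (κ i) - S - κ i • C)) *
        (κ i • Ring.inverse (D i))) l (𝓝 0) := by
      rw [tendsto_zero_iff_norm_tendsto_zero] at h2 ⊢
      refine squeeze_zero_norm' (a := fun i => ‖(κ i)⁻¹ • (B (κ i) - S - κ i • C)‖ * d⁻¹) ?_
        (by simpa using h2.mul_const d⁻¹)
      filter_upwards [hinv] with i hi
      rw [norm_norm]
      refine (norm_mul_le _ _).trans ?_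
      gcongr
    have h6 := h1.sub h5
    rw [sub_zero] at h6
    refine h6.congr' ?_
    filter_upwards [him] with i ⟨h0, h1⟩
    have hD := isUnit_sub_selfAdjoint hS h1
    have e : κ i • (1 : H →L[ℂ] H) - B (κ i) = D i - κ i • C - (B (κ i) - S - κ i • C) := by
      simp only [D]; abel
    simp only [Wi]
    rw [e, sub_mul, sub_mul, Ring.mul_inverse_cancel _ hD, smul_mul_smul_comm,
      inv_mul_cancel₀ h0, one_smul, smul_mul_assoc, mul_smul_comm]
  have hYW : ∀ᶠ i in l, Y i = -(a i • ((1 - θ i) * W i)) + E i := by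
    filter_upwards [him, hY] with i ⟨h0, h1⟩ hi
    have hD := isUnit_sub_selfAdjoint hS h1
    have e1 : θ i * W i = (1 - b i) • F i := by
      simp only [θ, W]
      rw [smul_mul_assoc, smul_mul_smul_comm, mul_inv_cancel₀ h0, one_smul, ← mul_assoc]
      erw [Ring.inverse_mul_cancel _ hD]
      rw [one_mul]
    have e2 : W i = F i - (κ i)⁻¹ • (S * F i) := by
      simp only [W, D]
      rw [sub_mul, smul_mul_assoc, one_mul, smul_sub, smul_smul, inv_mul_cancel₀ h0, one_smul]
    rw [hi, sub_mul, one_mul, e1, e2, sub_smul, one_smul]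
    congr 1
    rw [← smul_neg]
    congr 1
    abel
  have hWlim : (∃ L, Tendsto W l (𝓝 L)) ↔ IsUnit (1 - C * S.ker.starProjection) := by
    constructor
    -- a limit of `W` is a two-sided inverse of the limit of `Wi`
    · rintro ⟨L, hL⟩
      have h1 : L * (1 - C * S.ker.starProjection) = 1 :=
        tendsto_nhds_unique ((hL.mul hWi).congr' (hWW.mono fun i hi => hi.1)) tendsto_const_nhds
      have h2 : (1 - C * S.ker.starProjection) * L = 1 :=
        tendsto_nhds_unique ((hWi.mul hL).congr' (hWW.mono fun i hi => hi.2)) tendsto_const_nhds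
      exact ⟨⟨_, L, h2, h1⟩, rfl⟩
    · intro hu
      exact ⟨_, tendsto_of_tendsto_mul hu hWi
        (tendsto_const_nhds.congr' (hWW.mono fun i hi => hi.2.symm))⟩
  rw [← hWlim]
  have h1θ : Tendsto (fun i => 1 - θ i) l (𝓝 1) := by simpa using hθ.const_sub 1
  constructor
  · rintro ⟨L, hL⟩
    have h1 : Tendsto (fun i => -((a i)⁻¹ • (Y i - E i))) l (𝓝 (-(a₀⁻¹ • (L - E₀)))) :=
      ((ha.inv₀ ha₀).smul (hL.sub hE)).neg
    have h2 : Tendsto (fun i => (1 - θ i) * W i) l (𝓝 (-(a₀⁻¹ • (L - E₀)))) := by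
      refine h1.congr' ?_
      filter_upwards [hYW, ha.eventually_ne ha₀] with i hi hai
      rw [hi, add_sub_cancel_right, smul_neg, neg_neg, smul_smul, inv_mul_cancel₀ hai, one_smul]
    exact ⟨_, tendsto_of_tendsto_mul isUnit_one h1θ h2⟩
  · rintro ⟨L, hL⟩
    exact ⟨_, ((ha.smul (h1θ.mul hL)).neg.add hE).congr' (hYW.mono fun i hi => hi.symm)⟩

end Abstract

/-! ### Resolvents of linear relations -/

section ResolventAlgebra

variable {H : Type} [NormedAddCommGroup H] [InnerProductSpace ℂ H]

/-- The resolvent identity, as a construction of `(T - ξ - z)⁻¹` from `R = (T - ξ)⁻¹`. -/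
theorem IsResolventAt.translate {T : Set (H × H)} {ξ : ℂ} {R : H →L[ℂ] H}
    (h : IsResolventAt T ξ R) {z : ℂ} (hu : IsUnit (1 - z • R)) :
    IsResolventAt T (ξ + z) (R * Ring.inverse (1 - z • R)) := by
  constructor
  · intro f
    set g := Ring.inverse (1 - z • R) f with hg
    have h1 : g - z • R g = f := by
      have := DFunLike.congr_fun (Ring.mul_inverse_cancel _ hu) f
      simpa using this
    have h2 := h.1 g
    have h3 : f + (ξ + z) • R g = g + ξ • R g := by
      rw [← h1, add_smul]; abel
    rw [mul_apply_eq_comp, ← hg, h3]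
    exact h2
  · intro p hp
    have h1 := h.2 p hp
    have h2 : p.2 - (ξ + z) • p.1 = (1 - z • R) (p.2 - ξ • p.1) := by
      rw [sub_apply, one_apply_eq_self, smul_apply, h1, add_smul]; abel
    have h3 := DFunLike.congr_fun (Ring.inverse_mul_cancel _ hu) (p.2 - ξ • p.1)
    rw [mul_apply_eq_comp] at h3
    rw [mul_apply_eq_comp, h2, h3, one_apply_eq_self, h1]

theorem IsResolventAt.isSelfAdjoint [CompleteSpace H] {T : Set (H × H)}
    (hT : ∀ p ∈ T, ∀ p' ∈ T, ⟪p.1, p'.2⟫_ℂ = ⟪p.2, p'.1⟫_ℂ) {ξ : ℝ} {R : H →L[ℂ] H}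
    (h : IsResolventAt T (ξ : ℂ) R) : IsSelfAdjoint R := by
  rw [ContinuousLinearMap.isSelfAdjoint_iff_isSymmetric]
  intro f g
  have h1 := hT _ (h.1 f) _ (h.1 g)
  simp only [inner_add_left, inner_add_right, inner_smul_left, inner_smul_right,
    Complex.conj_ofReal] at h1
  exact (add_right_cancel h1)

end ResolventAlgebra

/-- The resolvents of two operators whose inverses differ by `σ N M`: with `A = (1 - z R₀)⁻¹` and
`B = (1 - z R)⁻¹`, the operator `1 + σ z M A N` is invertible, and `B N = A N (1 + σ z M A N)⁻¹`. -/
theorem perturbation_inverse_identities {R : Type*} [Ring R] [Algebra ℂ R] {σ z : ℂ}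
    {R₀ R₁ M N A B : R} (hV : R₀ - R₁ = σ • (N * M))
    (hA : A * (1 - z • R₀) = 1) (hB : (1 - z • R₁) * B = 1)
    (hA' : (1 - z • R₀) * A = 1) (hB' : B * (1 - z • R₁) = 1) :
    (1 + (σ * z) • (M * A * N)) * (1 - (σ * z) • (M * B * N)) = 1 ∧
    (1 - (σ * z) • (M * B * N)) * (1 + (σ * z) • (M * A * N)) = 1 ∧
    B * N = A * N * (1 - (σ * z) • (M * B * N)) := by
  have e : (σ * z) • (N * M) = (1 - z • R₁) - (1 - z • R₀) := by
    rw [mul_comm, mul_smul, ← hV, smul_sub]; abel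
  have e1 : (σ * z) • (A * N * M * B) = A - B := by
    calc (σ * z) • (A * N * M * B) = A * ((σ * z) • (N * M)) * B := by
          rw [mul_smul_comm, smul_mul_assoc, mul_assoc A N M]
      _ = A * ((1 - z • R₁) * B) - (A * (1 - z • R₀)) * B := by
          rw [e]; noncomm_ring
      _ = A - B := by rw [hA, hB, mul_one, one_mul]
  have e2 : (σ * z) • (B * N * M * A) = A - B := by
    calc (σ * z) • (B * N * M * A) = B * ((σ * z) • (N * M)) * A := by
          rw [mul_smul_comm, smul_mul_assoc, mul_assoc B N M]
      _ = (B * (1 - z • R₁)) * A - B * ((1 - z • R₀) * A) := by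
          rw [e]; noncomm_ring
      _ = A - B := by rw [hA', hB', mul_one, one_mul]
  refine ⟨?_, ?_, ?_⟩
  · have : (M * A * N) * ((σ * z) • (M * B * N)) = M * (A - B) * N := by
      rw [← e1, mul_smul_comm, mul_smul_comm, smul_mul_assoc]; simp only [mul_assoc]
    rw [add_mul, one_mul, mul_sub, mul_one, smul_mul_assoc, this, mul_sub, sub_mul, smul_sub]
    abel
  · have : (M * B * N) * ((σ * z) • (M * A * N)) = M * (A - B) * N := by
      rw [← e2, mul_smul_comm, mul_smul_comm, smul_mul_assoc]; simp only [mul_assoc]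
    rw [sub_mul, one_mul, mul_add, mul_one, smul_mul_assoc, this, mul_sub, sub_mul, smul_sub]
    abel
  · have : A * N * ((σ * z) • (M * B * N)) = (A - B) * N := by
      rw [← e1, mul_smul_comm, smul_mul_assoc]; simp only [mul_assoc]
    rw [mul_sub, mul_one, this, sub_mul]
    abel

end

section

/-! ### Multiplication operators -/

section Multiplication

variable {α : Type*} [MeasurableSpace α] {μ : Measure α}

theorem norm_sq_eq_integral (f : Lp ℂ 2 μ) : ‖f‖ ^ 2 = ∫ x, ‖f x‖ ^ 2 ∂μ := by
  have h := L2.inner_def (𝕜 := ℂ) f f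
  rw [inner_self_eq_norm_sq_to_K] at h
  have h2 : ∀ x, ⟪f x, f x⟫_ℂ = ((‖f x‖ ^ 2 : ℝ) : ℂ) := fun x => by
    rw [inner_self_eq_norm_sq_to_K]; norm_cast
  simp only [h2] at h
  erw [integral_ofReal] at h
  exact_mod_cast h

/-- Bounded measurable functions: the symbols of the multiplication operators. -/
structure IsMultiplier (m : α → ℂ) : Prop where
  measurable : Measurable m
  bounded : ∃ C, ∀ x, ‖m x‖ ≤ C

open Classical in
/-- The operator of multiplication by a bounded measurable function (zero for other functions). -/
def mulOp (μ : Measure α) (m : α → ℂ) : Lp ℂ 2 μ →L[ℂ] Lp ℂ 2 μ :=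
  if h : ∃ T : Lp ℂ 2 μ →L[ℂ] Lp ℂ 2 μ, ∀ f, T f =ᵐ[μ] fun x => m x * f x then h.choose else 0

theorem IsMultiplier.exists_op {m : α → ℂ} (hm : IsMultiplier m) :
    ∃ T : Lp ℂ 2 μ →L[ℂ] Lp ℂ 2 μ, ∀ f, T f =ᵐ[μ] fun x => m x * f x := by
  obtain ⟨C, hC⟩ := hm.bounded
  have hmem : ∀ f : Lp ℂ 2 μ, MemLp (fun x => m x * f x) 2 μ := fun f =>
    (Lp.memLp f).of_le_mul (c := C)
      (hm.measurable.aestronglyMeasurable.mul (Lp.aestronglyMeasurable f))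
      (ae_of_all _ fun x => by rw [norm_mul]; gcongr; exact hC x)
  refine ⟨LinearMap.mkContinuous
    { toFun := fun f => (hmem f).toLp
      map_add' := fun f g => ?_
      map_smul' := fun c f => ?_ } C fun f => ?_, fun f => (hmem f).coeFn_toLp⟩
  · apply Lp.ext
    filter_upwards [(hmem (f + g)).coeFn_toLp, (hmem f).coeFn_toLp, (hmem g).coeFn_toLp,
      Lp.coeFn_add f g, Lp.coeFn_add (hmem f).toLp (hmem g).toLp] with x h1 h2 h3 h4 h5
    rw [h1, h5, Pi.add_apply, h2, h3, h4, Pi.add_apply, mul_add]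
  · apply Lp.ext
    filter_upwards [(hmem (c • f)).coeFn_toLp, (hmem f).coeFn_toLp,
      Lp.coeFn_smul c f, Lp.coeFn_smul c (hmem f).toLp] with x h1 h2 h4 h5
    rw [h1, RingHom.id_apply, h5, Pi.smul_apply, h2, h4, Pi.smul_apply, smul_eq_mul, smul_eq_mul]
    ring
  · refine Lp.norm_le_mul_norm_of_ae_le_mul ?_
    filter_upwards [(hmem f).coeFn_toLp] with x hx
    simp only [LinearMap.coe_mk, AddHom.coe_mk]
    rw [hx, norm_mul]
    gcongr
    exact hC x

theorem coeFn_mulOp {m : α → ℂ} (hm : IsMultiplier m) (f : Lp ℂ 2 μ) :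
    mulOp μ m f =ᵐ[μ] fun x => m x * f x := by
  have h := hm.exists_op (μ := μ)
  rw [mulOp, dif_pos h]
  exact h.choose_spec f

theorem norm_mulOp_apply_le {m : α → ℂ} (hm : IsMultiplier m) {C : ℝ} (hC : ∀ x, ‖m x‖ ≤ C)
    (f : Lp ℂ 2 μ) : ‖mulOp μ m f‖ ≤ C * ‖f‖ := by
  refine Lp.norm_le_mul_norm_of_ae_le_mul ?_
  filter_upwards [coeFn_mulOp hm f] with x hx
  rw [hx, norm_mul]
  gcongr
  exact hC x

/-- Pointwise domination of the symbols gives domination of the operators. -/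
theorem norm_mulOp_apply_le_mul {m m' : α → ℂ} (hm : IsMultiplier m) (hm' : IsMultiplier m')
    {C : ℝ} (hC : ∀ x, ‖m x‖ ≤ C * ‖m' x‖) (f : Lp ℂ 2 μ) :
    ‖mulOp μ m f‖ ≤ C * ‖mulOp μ m' f‖ := by
  refine Lp.norm_le_mul_norm_of_ae_le_mul ?_
  filter_upwards [coeFn_mulOp hm f, coeFn_mulOp hm' f] with x hx hx'
  rw [hx, hx', norm_mul, norm_mul, ← mul_assoc]
  gcongr
  exact hC x

theorem IsMultiplier.mul {m m' : α → ℂ} (hm : IsMultiplier m) (hm' : IsMultiplier m') :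
    IsMultiplier fun x => m x * m' x := by
  obtain ⟨C, hC⟩ := hm.bounded
  obtain ⟨C', hC'⟩ := hm'.bounded
  refine ⟨hm.measurable.mul hm'.measurable, C * C', fun x => ?_⟩
  rw [norm_mul]
  exact mul_le_mul (hC x) (hC' x) (norm_nonneg _) ((norm_nonneg _).trans (hC x))

theorem IsMultiplier.add {m m' : α → ℂ} (hm : IsMultiplier m) (hm' : IsMultiplier m') :
    IsMultiplier fun x => m x + m' x := by
  obtain ⟨C, hC⟩ := hm.bounded
  obtain ⟨C', hC'⟩ := hm'.bounded
  exact ⟨hm.measurable.add hm'.measurable, C + C', fun x =>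
    (norm_add_le _ _).trans (add_le_add (hC x) (hC' x))⟩

theorem IsMultiplier.const (c : ℂ) : IsMultiplier fun _ : α => c :=
  ⟨measurable_const, ‖c‖, fun _ => le_rfl⟩

theorem IsMultiplier.conj {m : α → ℂ} (hm : IsMultiplier m) :
    IsMultiplier fun x => starRingEnd ℂ (m x) := by
  obtain ⟨C, hC⟩ := hm.bounded
  exact ⟨Complex.continuous_conj.measurable.comp hm.measurable, C, fun x => by simpa using hC x⟩

theorem IsMultiplier.indicator {s : Set α} (hs : MeasurableSet s) :
    IsMultiplier (s.indicator fun _ => (1 : ℂ)) := by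
  refine ⟨measurable_const.indicator hs, 1, fun x => ?_⟩
  by_cases hx : x ∈ s <;> simp [hx]

theorem mulOp_comp_mulOp {m m' : α → ℂ} (hm : IsMultiplier m) (hm' : IsMultiplier m') :
    mulOp μ m ∘L mulOp μ m' = mulOp μ fun x => m x * m' x := by
  ext1 f
  apply Lp.ext
  filter_upwards [coeFn_mulOp hm (mulOp μ m' f), coeFn_mulOp hm' f,
    coeFn_mulOp (hm.mul hm') f] with x h1 h2 h3
  rw [ContinuousLinearMap.comp_apply, h1, h2, h3]; ring

theorem mulOp_one : mulOp μ (fun _ : α => (1 : ℂ)) = 1 := by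
  ext1 f
  apply Lp.ext
  filter_upwards [coeFn_mulOp (IsMultiplier.const 1) f] with x h1
  rw [h1, one_mul]; rfl

theorem mulOp_add {m m' : α → ℂ} (hm : IsMultiplier m) (hm' : IsMultiplier m') :
    mulOp μ (fun x => m x + m' x) = mulOp μ m + mulOp μ m' := by
  ext1 f
  apply Lp.ext
  filter_upwards [coeFn_mulOp hm f, coeFn_mulOp hm' f, coeFn_mulOp (hm.add hm') f,
    Lp.coeFn_add (mulOp μ m f) (mulOp μ m' f)] with x h1 h2 h3 h4
  rw [h3, add_apply, h4, Pi.add_apply, h1, h2, add_mul]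

theorem mulOp_adjoint {m : α → ℂ} (hm : IsMultiplier m) :
    (mulOp μ m).adjoint = mulOp μ fun x => starRingEnd ℂ (m x) := by
  refine ((ContinuousLinearMap.eq_adjoint_iff _ _).2 fun f g => ?_).symm
  rw [L2.inner_def, L2.inner_def]
  apply integral_congr_ae
  filter_upwards [coeFn_mulOp hm.conj f, coeFn_mulOp hm g] with x h1 h2
  rw [h1, h2]
  simp only [RCLike.inner_apply, map_mul, Complex.conj_conj]
  ring

theorem tendsto_mulOp_apply {ι : Type*} {l : Filter ι} [l.IsCountablyGenerated]
    {m : ι → α → ℂ} {m₀ : α → ℂ} {C : ℝ} (hm : ∀ i, Measurable (m i)) (hm₀ : Measurable m₀)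
    (hC : ∀ i x, ‖m i x‖ ≤ C) (hC₀ : ∀ x, ‖m₀ x‖ ≤ C)
    (h : ∀ x, Tendsto (fun i => m i x) l (𝓝 (m₀ x))) (f : Lp ℂ 2 μ) :
    Tendsto (fun i => mulOp μ (m i) f) l (𝓝 (mulOp μ m₀ f)) := by
  rw [tendsto_iff_norm_sub_tendsto_zero]
  have hsq : Tendsto (fun i => ‖mulOp μ (m i) f - mulOp μ m₀ f‖ ^ 2) l (𝓝 0) := by
    have e : ∀ i, ‖mulOp μ (m i) f - mulOp μ m₀ f‖ ^ 2 = ∫ x, ‖(m i x - m₀ x) * f x‖ ^ 2 ∂μ := by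
      intro i
      rw [norm_sq_eq_integral]
      apply integral_congr_ae
      filter_upwards [coeFn_mulOp ⟨hm i, C, hC i⟩ f, coeFn_mulOp ⟨hm₀, C, hC₀⟩ f,
        Lp.coeFn_sub (mulOp μ (m i) f) (mulOp μ m₀ f)] with x h1 h2 h3
      rw [h3, Pi.sub_apply, h1, h2, sub_mul]
    simp only [e]
    have hint : Integrable (fun x => (2 * C) ^ 2 * ‖f x‖ ^ 2) μ :=
      ((memLp_two_iff_integrable_sq_norm (Lp.aestronglyMeasurable f)).1 (Lp.memLp f)).const_mul _
    have := tendsto_integral_filter_of_dominated_convergence (l := l)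
      (F := fun i x => ‖(m i x - m₀ x) * f x‖ ^ 2) (f := fun _ => (0 : ℝ)) (μ := μ)
      (fun x => (2 * C) ^ 2 * ‖f x‖ ^ 2) ?_ ?_ hint ?_
    · simpa using this
    · refine Eventually.of_forall fun i => ?_
      exact ((((hm i).sub hm₀).aestronglyMeasurable.mul
        (Lp.aestronglyMeasurable f)).norm.pow 2)
    · refine Eventually.of_forall fun i => ae_of_all _ fun x => ?_
      rw [Real.norm_of_nonneg (by positivity), norm_mul, mul_pow]
      gcongr
      calc ‖m i x - m₀ x‖ ≤ ‖m i x‖ + ‖m₀ x‖ := norm_sub_le _ _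
        _ ≤ 2 * C := by linarith [hC i x, hC₀ x]
    · refine ae_of_all _ fun x => ?_
      have h1 : Tendsto (fun i => m i x - m₀ x) l (𝓝 0) := by simpa using (h x).sub_const (m₀ x)
      simpa using ((h1.mul_const (f x)).norm.pow 2)
  have := hsq.sqrt
  simpa using this

end Multiplication

/-! ### Strong integrals of contractions -/

section StrongIntegral

variable {H : Type*} [NormedAddCommGroup H] [InnerProductSpace ℂ H] [CompleteSpace H]
variable {S : Type*} [TopologicalSpace S] [MeasurableSpace S] [OpensMeasurableSpace S]
  [SecondCountableTopology S]
variable {S' : Type*} [TopologicalSpace S'] [MeasurableSpace S'] [OpensMeasurableSpace S']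
  [SecondCountableTopology S']

/-- A strongly continuous family of contractions. -/
structure IsContractionFamily (V : S → H →L[ℂ] H) : Prop where
  continuous : ∀ f, Continuous fun s => V s f
  norm_le : ∀ s f, ‖V s f‖ ≤ ‖f‖

variable {ν : Measure S} {ν' : Measure S'} {k k₁ k₂ : S → ℂ} {k' : S' → ℂ}
  {V : S → H →L[ℂ] H} {V' : S' → H →L[ℂ] H}

theorem IsContractionFamily.continuous_apply (hV : IsContractionFamily V) {T : Type*}
    [TopologicalSpace T] {g : T → H} (hg : Continuous g) :
    Continuous fun p : S × T => V p.1 (g p.2) := by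
  rw [continuous_iff_continuousAt]
  rintro ⟨s, t⟩
  rw [ContinuousAt, tendsto_iff_norm_sub_tendsto_zero]
  have h1 : Tendsto (fun p : S × T => ‖V p.1 (g t) - V s (g t)‖ + ‖g p.2 - g t‖) (𝓝 (s, t))
      (𝓝 0) := by
    have h2 : Continuous fun p : S × T => ‖V p.1 (g t) - V s (g t)‖ + ‖g p.2 - g t‖ :=
      ((((hV.continuous (g t)).comp continuous_fst).sub continuous_const).norm).add
        ((hg.comp continuous_snd).sub continuous_const).norm
    simpa using h2.tendsto (s, t)
  refine squeeze_zero (fun _ => norm_nonneg _) (fun p => ?_) h1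
  have e : V p.1 (g p.2) - V s (g t) = (V p.1 (g t) - V s (g t)) + V p.1 (g p.2 - g t) := by
    rw [map_sub]; abel
  rw [e]
  exact (norm_add_le _ _).trans (by gcongr; exact hV.norm_le _ _)

theorem IsContractionFamily.comp (hV : IsContractionFamily V) (hV' : IsContractionFamily V') :
    IsContractionFamily fun p : S × S' => V p.1 ∘L V' p.2 :=
  ⟨fun f => hV.continuous_apply (hV'.continuous f),
    fun _ _ => (hV.norm_le _ _).trans (hV'.norm_le _ _)⟩

theorem IsContractionFamily.integrable (hV : IsContractionFamily V) (hk : Integrable k ν) (f : H) :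
    Integrable (fun s => k s • V s f) ν :=
  (hk.norm.mul_const ‖f‖).mono'
    (hk.aestronglyMeasurable.smul (hV.continuous f).aestronglyMeasurable)
    (ae_of_all _ fun s => by rw [norm_smul]; gcongr; exact hV.norm_le s f)

open Classical in
/-- The operator `f ↦ ∫ k(s) V_s f dν(s)`, for an integrable function `k` and a strongly
continuous family `V` of contractions (zero in other cases). -/
def strongIntegral (ν : Measure S) (k : S → ℂ) (V : S → H →L[ℂ] H) : H →L[ℂ] H :=
  if h : Integrable k ν ∧ IsContractionFamily V then
    LinearMap.mkContinuous
      { toFun := fun f => ∫ s, k s • V s f ∂ν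
        map_add' := fun f g => by
          rw [← integral_add (h.2.integrable h.1 f) (h.2.integrable h.1 g)]
          simp only [map_add, smul_add]
        map_smul' := fun c f => by
          rw [RingHom.id_apply, ← integral_smul]
          simp only [map_smul, smul_comm c] } (∫ s, ‖k s‖ ∂ν) fun f => by
      rw [← integral_mul_const]
      refine norm_integral_le_of_norm_le (h.1.norm.mul_const _) (ae_of_all _ fun s => ?_)
      rw [norm_smul]
      gcongr
      exact h.2.norm_le s f
  else 0

theorem strongIntegral_apply (hk : Integrable k ν) (hV : IsContractionFamily V) (f : H) :
    strongIntegral ν k V f = ∫ s, k s • V s f ∂ν := by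
  rw [strongIntegral, dif_pos ⟨hk, hV⟩]; rfl

theorem norm_strongIntegral_le (hk : Integrable k ν) (hV : IsContractionFamily V) :
    ‖strongIntegral ν k V‖ ≤ ∫ s, ‖k s‖ ∂ν := by
  rw [strongIntegral, dif_pos ⟨hk, hV⟩]
  exact LinearMap.mkContinuous_norm_le _ (integral_nonneg fun _ => norm_nonneg _) _

theorem strongIntegral_sub (h₁ : Integrable k₁ ν) (h₂ : Integrable k₂ ν)
    (hV : IsContractionFamily V) : strongIntegral ν (fun s => k₁ s - k₂ s) V =
      strongIntegral ν k₁ V - strongIntegral ν k₂ V := by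
  ext1 f
  rw [sub_apply, strongIntegral_apply h₁ hV, strongIntegral_apply h₂ hV,
    strongIntegral_apply (k := fun s => k₁ s - k₂ s) (h₁.sub h₂) hV,
    ← integral_sub (hV.integrable h₁ f) (hV.integrable h₂ f)]
  simp only [sub_smul]

theorem strongIntegral_smul (c : ℂ) (hk : Integrable k ν) (hV : IsContractionFamily V) :
    strongIntegral ν (fun s => c * k s) V = c • strongIntegral ν k V := by
  ext1 f
  rw [smul_apply, strongIntegral_apply hk hV, strongIntegral_apply (hk.const_mul c) hV,
    ← integral_smul]
  simp only [mul_smul]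

theorem comp_strongIntegral_apply (hk : Integrable k ν) (hV : IsContractionFamily V)
    (A : H →L[ℂ] H) (f : H) : A (strongIntegral ν k V f) = ∫ s, k s • A (V s f) ∂ν := by
  rw [strongIntegral_apply hk hV, ← ContinuousLinearMap.integral_comp_comm _ (hV.integrable hk f)]
  simp only [map_smul]

theorem strongIntegral_comp_commute (hk : Integrable k ν) (hV : IsContractionFamily V)
    {A : H →L[ℂ] H} (hA : ∀ s, A * V s = V s * A) :
    A * strongIntegral ν k V = strongIntegral ν k V * A := by
  ext1 f
  rw [mul_apply_eq_comp, mul_apply_eq_comp, comp_strongIntegral_apply hk hV,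
    strongIntegral_apply hk hV]
  congr 1
  ext1 s
  have := DFunLike.congr_fun (hA s) f
  rw [mul_apply_eq_comp, mul_apply_eq_comp] at this
  rw [this]

theorem strongIntegral_mul_strongIntegral [SFinite ν] [SFinite ν'] (hk : Integrable k ν)
    (hV : IsContractionFamily V) (hk' : Integrable k' ν') (hV' : IsContractionFamily V') :
    strongIntegral ν k V * strongIntegral ν' k' V' =
      strongIntegral (ν.prod ν') (fun p => k p.1 * k' p.2) (fun p => V p.1 ∘L V' p.2) := by
  ext1 f
  have h1 := (hV.comp hV').integrable (hk.mul_prod hk') f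
  rw [mul_apply_eq_comp, strongIntegral_apply hk hV,
    strongIntegral_apply (hk.mul_prod hk') (hV.comp hV'), integral_prod _ h1]
  congr 1
  ext1 s
  rw [comp_strongIntegral_apply hk' hV', ← integral_smul]
  simp only [mul_smul]
  rfl

theorem strongIntegral_map {e : S ≃ᵐ S'} (he : MeasurePreserving e ν ν') (hk : Integrable k' ν')
    (hV : IsContractionFamily V') (hV₂ : IsContractionFamily fun s => V' (e s)) :
    strongIntegral ν (fun s => k' (e s)) (fun s => V' (e s)) = strongIntegral ν' k' V' := by
  ext1 f
  rw [strongIntegral_apply hk hV, strongIntegral_apply (k := fun s => k' (e s))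
    ((he.integrable_comp_emb e.measurableEmbedding).2 hk) hV₂]
  exact he.integral_comp' (fun s => k' s • V' s f)

theorem strongIntegral_adjoint (hk : Integrable k ν) (hV : IsContractionFamily V)
    (hV' : IsContractionFamily fun s => (V s).adjoint) :
    (strongIntegral ν k V).adjoint =
      strongIntegral ν (fun s => starRingEnd ℂ (k s)) fun s => (V s).adjoint := by
  have hk' : Integrable (fun s => starRingEnd ℂ (k s)) ν :=
    (Complex.conjCLE : ℂ →L[ℝ] ℂ).integrable_comp hk
  refine ((ContinuousLinearMap.eq_adjoint_iff _ _).2 fun f g => ?_).symm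
  rw [strongIntegral_apply hk hV, strongIntegral_apply hk' hV',
    ← integral_inner (hV.integrable hk g), ← inner_conj_symm,
    ← integral_inner (hV'.integrable hk' f), ← integral_conj]
  congr 1
  ext1 s
  rw [inner_conj_symm, inner_smul_left, inner_smul_right, Complex.conj_conj,
    ContinuousLinearMap.adjoint_inner_left]

end StrongIntegral

/-! ### Integrals in `L²` and pointwise integrals -/

/-- A Bochner integral in `L²` can be evaluated pointwise. -/
theorem coeFn_integral_ae {S α : Type*} [MeasurableSpace S] [MeasurableSpace α] {ν : Measure S}
    [SFinite ν] {μ : Measure α} [SigmaFinite μ] {F : S → Lp ℂ 2 μ} (hF : Integrable F ν)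
    {Φ : S × α → ℂ} (hΦ : AEStronglyMeasurable Φ (ν.prod μ))
    (h : ∀ᵐ s ∂ν, F s =ᵐ[μ] fun x => Φ (s, x)) :
    (∫ s, F s ∂ν : Lp ℂ 2 μ) =ᵐ[μ] fun x => ∫ s, Φ (s, x) ∂ν := by
  have hfin : ∀ A : Set α, MeasurableSet A → μ A < ⊤ →
      Integrable Φ (ν.prod (μ.restrict A)) := by
    intro A hA hμA
    have hac : ν.prod (μ.restrict A) ≪ ν.prod μ :=
      Measure.AbsolutelyContinuous.rfl.prod Measure.restrict_le_self.absolutelyContinuous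
    have hm : AEStronglyMeasurable Φ (ν.prod (μ.restrict A)) := hΦ.mono_ac hac
    have : IsFiniteMeasure (μ.restrict A) := ⟨by simpa using hμA⟩
    rw [integrable_prod_iff hm]
    refine ⟨?_, ?_⟩
    · filter_upwards [h] with s hs
      have h1 : MemLp (fun x => Φ (s, x)) 2 (μ.restrict A) :=
        ((memLp_congr_ae hs).1 (Lp.memLp (F s))).restrict A
      exact h1.integrable one_le_two
    · refine (hF.norm.mul_const ((μ A) ^ (1 / 2 : ℝ)).toReal).mono' hm.norm.integral_prod_right' ?_
      filter_upwards [h] with s hs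
      have h1 : MemLp (fun x => Φ (s, x)) 2 (μ.restrict A) :=
        ((memLp_congr_ae hs).1 (Lp.memLp (F s))).restrict A
      have h2 := eLpNorm_le_eLpNorm_mul_rpow_measure_univ (p := 1) (q := 2) one_le_two h1.1
      have h3 : eLpNorm (fun x => Φ (s, x)) 2 (μ.restrict A) ≤ eLpNorm (F s) 2 μ := by
        rw [eLpNorm_congr_ae hs]
        exact eLpNorm_mono_measure _ Measure.restrict_le_self
      have h4 : ∫ x in A, ‖Φ (s, x)‖ ∂μ = (eLpNorm (fun x => Φ (s, x)) 1 (μ.restrict A)).toReal := by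
        rw [eLpNorm_one_eq_lintegral_enorm, integral_norm_eq_lintegral_enorm h1.1]
      rw [Real.norm_of_nonneg (integral_nonneg fun _ => norm_nonneg _), h4, Lp.norm_def,
        ← ENNReal.toReal_mul]
      refine ENNReal.toReal_mono ?_ (h2.trans ?_)
      · refine ENNReal.mul_ne_top (Lp.eLpNorm_ne_top _) ?_
        exact ENNReal.rpow_ne_top_of_nonneg (by norm_num) hμA.ne
      · gcongr
        rw [Measure.restrict_apply_univ]
        norm_num
  apply ae_eq_of_forall_setIntegral_eq_of_sigmaFinite
  · intro A hA hμA
    have : IsFiniteMeasure (μ.restrict A) := ⟨by simpa using hμA⟩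
    exact ((Lp.memLp _).restrict A).integrable one_le_two
  · intro A hA hμA
    exact (hfin A hA hμA).integral_prod_right
  · intro A hA hμA
    have h1 := L2.inner_indicatorConstLp_one (𝕜 := ℂ) hA hμA.ne (∫ s, F s ∂ν)
    rw [← h1, ← integral_inner hF]
    have h2 : ∫ s, ⟪indicatorConstLp 2 hA hμA.ne (1 : ℂ), F s⟫_ℂ ∂ν =
        ∫ s, ∫ x in A, Φ (s, x) ∂μ ∂ν := by
      apply integral_congr_ae
      filter_upwards [h] with s hs
      rw [L2.inner_indicatorConstLp_one]
      exact integral_congr_ae (ae_restrict_of_ae hs)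
    rw [h2]
    exact integral_integral_swap (f := fun s x => Φ (s, x)) (hfin A hA hμA)

end

section

/-! ### Magnetic translations -/

/-- The point of `ℝ³` with perpendicular component `y` and third coordinate `t`. -/
def embed (y : E2) (t : ℝ) : E3 := !₂[y 0, y 1, t]

@[simp] theorem embed_zero (y : E2) (t : ℝ) : embed y t 0 = y 0 := rfl
@[simp] theorem embed_one (y : E2) (t : ℝ) : embed y t 1 = y 1 := rfl
@[simp] theorem embed_two (y : E2) (t : ℝ) : embed y t 2 = t := rfl
@[simp] theorem perp_zero (x : E3) : perp x 0 = x 0 := rfl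
@[simp] theorem perp_one (x : E3) : perp x 1 = x 1 := rfl

theorem perp_embed (y : E2) (t : ℝ) : perp (embed y t) = y := by
  ext i; fin_cases i <;> rfl

theorem embed_perp (x : E3) : embed (perp x) (x 2) = x := by
  ext i; fin_cases i <;> rfl

theorem continuous_embed : Continuous fun p : E2 × ℝ => embed p.1 p.2 := by
  refine (PiLp.continuous_toLp 2 _).comp (continuous_pi fun i => ?_)
  fin_cases i
  · exact (by fun_prop : Continuous fun p : E2 × ℝ => p.1 0)
  · exact (by fun_prop : Continuous fun p : E2 × ℝ => p.1 1)
  · exact continuous_snd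

theorem continuous_perp : Continuous perp := by
  refine (PiLp.continuous_toLp 2 _).comp (continuous_pi fun i => ?_)
  fin_cases i
  · exact (by fun_prop : Continuous fun x : E3 => x 0)
  · exact (by fun_prop : Continuous fun x : E3 => x 1)

theorem continuous_coord (i : Fin 3) : Continuous fun x : E3 => x i :=
  (continuous_apply i).comp (PiLp.continuous_ofLp 2 _)

theorem embed_add (y y' : E2) (t t' : ℝ) : embed (y + y') (t + t') = embed y t + embed y' t' := by
  ext i; fin_cases i <;> simp [embed]

theorem embed_neg (y : E2) (t : ℝ) : embed (-y) (-t) = -embed y t := by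
  ext i; fin_cases i <;> simp [embed]

theorem perp_sub (x y : E3) : perp (x - y) = perp x - perp y := by
  ext i; fin_cases i <;> simp [perp]

/-- The splitting `ℝ² × ℝ ≃ ℝ³`. -/
def splitEquiv : E2 × ℝ ≃ᵐ E3 where
  toFun p := embed p.1 p.2
  invFun x := (perp x, x 2)
  left_inv p := by simp [perp_embed]
  right_inv x := embed_perp x
  measurable_toFun := continuous_embed.measurable
  measurable_invFun := (continuous_perp.prodMk (continuous_coord 2)).measurable

theorem splitEquiv_apply (p : E2 × ℝ) : splitEquiv p = embed p.1 p.2 := rfl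

theorem measurePreserving_splitEquiv : MeasurePreserving splitEquiv volume volume := by
  have h1 := (volume_preserving_piFinSuccAbove (fun _ : Fin 3 => ℝ) 2).symm
  have h2 := PiLp.volume_preserving_ofLp (Fin 2)
  have h3 := PiLp.volume_preserving_toLp (Fin 3)
  have h4 : MeasurePreserving (fun p : E2 × ℝ => (p.2, WithLp.ofLp p.1)) volume volume :=
    (Measure.measurePreserving_swap (μ := (volume : Measure (Fin 2 → ℝ)))
      (ν := (volume : Measure ℝ))).comp (h2.prod (MeasurePreserving.id volume))
  have h5 := (h3.comp h1).comp h4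
  refine ⟨splitEquiv.measurable, ?_⟩
  rw [← h5.map_eq]
  congr 1
  ext p i
  fin_cases i <;> rfl

/-- The phase of the magnetic translation by `s`. -/
def magPhase (b : ℝ) (s x : E3) : ℂ :=
  Complex.exp (Complex.I * ((b / 2 * (x 0 * s 1 - x 1 * s 0) : ℝ) : ℂ))

theorem norm_magPhase (b : ℝ) (s x : E3) : ‖magPhase b s x‖ = 1 := by
  rw [magPhase, mul_comm, Complex.norm_exp_ofReal_mul_I]

theorem continuous_magPhase (b : ℝ) : Continuous fun p : E3 × E3 => magPhase b p.1 p.2 := by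
  unfold magPhase
  have h := fun i => (continuous_coord i)
  have h0 : ∀ i, Continuous fun p : E3 × E3 => p.1 i := fun i => (h i).comp continuous_fst
  have h1 : ∀ i, Continuous fun p : E3 × E3 => p.2 i := fun i => (h i).comp continuous_snd
  refine Complex.continuous_exp.comp (continuous_const.mul (Complex.continuous_ofReal.comp ?_))
  exact continuous_const.mul (((h1 0).mul (h0 1)).sub ((h1 1).mul (h0 0)))

theorem isMultiplier_magPhase (b : ℝ) (s : E3) : IsMultiplier (magPhase b s) :=
  ⟨((continuous_magPhase b).comp (by fun_prop : Continuous fun x : E3 => (s, x))).measurable, 1,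
    fun x => (norm_magPhase b s x).le⟩

/-- The magnetic translation `f ↦ exp (i (b / 2) (x₁ s₂ - x₂ s₁)) f(x - s)`. -/
def magTrans (b : ℝ) (s : E3) : L2 →L[ℂ] L2 :=
  mulOp volume (magPhase b s) ∘L (Lp.compMeasurePreservingₗᵢ ℂ (fun x : E3 => x - s)
    (measurePreserving_sub_right volume s)).toContinuousLinearMap

theorem coeFn_magTrans (b : ℝ) (s : E3) (f : L2) :
    magTrans b s f =ᵐ[volume] fun x => magPhase b s x * f (x - s) := by
  have h1 := coeFn_mulOp (isMultiplier_magPhase b s) (Lp.compMeasurePreserving (fun x : E3 => x - s)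
    (measurePreserving_sub_right volume s) f)
  filter_upwards [h1, Lp.coeFn_compMeasurePreserving f (measurePreserving_sub_right volume s)]
    with x hx hx'
  rw [hx'] at hx
  exact hx

theorem norm_magTrans (b : ℝ) (s : E3) (f : L2) : ‖magTrans b s f‖ = ‖f‖ := by
  rw [← Lp.norm_compMeasurePreserving f (measurePreserving_sub_right volume s)]
  apply le_antisymm
  · have := norm_mulOp_apply_le (isMultiplier_magPhase b s)
      (fun x => (norm_magPhase b s x).le) (Lp.compMeasurePreserving (fun x : E3 => x - s)
        (measurePreserving_sub_right volume s) f)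
    rw [one_mul] at this
    exact this
  · refine Lp.norm_le_norm_of_ae_le ?_
    filter_upwards [coeFn_magTrans b s f,
      Lp.coeFn_compMeasurePreserving f (measurePreserving_sub_right volume s)] with x hx hx'
    rw [hx, hx', norm_mul, norm_magPhase, one_mul]
    rfl

theorem continuous_magTrans_apply (b : ℝ) (f : L2) : Continuous fun s => magTrans b s f := by
  have hT : Continuous fun s : E3 => Lp.compMeasurePreserving (fun x : E3 => x - s)
      (measurePreserving_sub_right volume s) f := by
    let g : E3 → C(E3, E3) := fun s => ⟨fun x => x - s, by fun_prop⟩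
    have hg : Continuous g := ContinuousMap.continuous_of_continuous_uncurry _
      (by simp only [g]; exact (continuous_snd.sub continuous_fst))
    exact Continuous.compMeasurePreservingLp (continuous_const (y := f)) hg
      (fun s => measurePreserving_sub_right volume s) (by norm_num)
  rw [continuous_iff_continuousAt]
  intro s
  set h := Lp.compMeasurePreserving (fun x : E3 => x - s) (measurePreserving_sub_right volume s) f
  have h1 : Tendsto (fun t => mulOp volume (magPhase b t) h) (𝓝 s)
      (𝓝 (mulOp volume (magPhase b s) h)) :=
    tendsto_mulOp_apply (fun t => (isMultiplier_magPhase b t).measurable)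
      (isMultiplier_magPhase b s).measurable (fun t x => (norm_magPhase b t x).le)
      (fun x => (norm_magPhase b s x).le)
      (fun x => ((continuous_magPhase b).comp
        (by fun_prop : Continuous fun t : E3 => (t, x))).tendsto s) h
  have h2 : Tendsto (fun t => mulOp volume (magPhase b t)
      (Lp.compMeasurePreserving (fun x : E3 => x - t) (measurePreserving_sub_right volume t) f - h))
      (𝓝 s) (𝓝 0) := by
    have h3 := (hT.tendsto s).sub_const h
    rw [sub_self] at h3
    refine squeeze_zero_norm (fun t => ?_) (tendsto_zero_iff_norm_tendsto_zero.1 h3)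
    have := norm_mulOp_apply_le (isMultiplier_magPhase b t)
      (fun x => (norm_magPhase b t x).le) (Lp.compMeasurePreserving (fun x : E3 => x - t)
        (measurePreserving_sub_right volume t) f - h)
    rwa [one_mul] at this
  have h4 := h1.add h2
  rw [add_zero] at h4
  refine h4.congr fun t => ?_
  rw [← map_add, add_sub_cancel]
  rfl

theorem isContractionFamily_magTrans (b : ℝ) {S : Type*} [TopologicalSpace S] {e : S → E3}
    (he : Continuous e) : IsContractionFamily fun s => magTrans b (e s) :=
  ⟨fun f => (continuous_magTrans_apply b f).comp he, fun s f => (norm_magTrans b (e s) f).le⟩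

/-- The Weyl relation between magnetic translations. -/
theorem magTrans_mul (b : ℝ) (s t : E3) : magTrans b s * magTrans b t =
    Complex.exp (-Complex.I * ((b / 2 * (s 0 * t 1 - s 1 * t 0) : ℝ) : ℂ)) •
      magTrans b (s + t) := by
  ext1 f
  apply Lp.ext
  rw [mul_apply_eq_comp, smul_apply]
  have h1 := (measurePreserving_sub_right (volume : Measure E3) s).quasiMeasurePreserving.ae_eq_comp
    (coeFn_magTrans b t f)
  filter_upwards [coeFn_magTrans b s (magTrans b t f), h1, coeFn_magTrans b (s + t) f,
    Lp.coeFn_smul (Complex.exp (-Complex.I * ((b / 2 * (s 0 * t 1 - s 1 * t 0) : ℝ) : ℂ)))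
      (magTrans b (s + t) f)] with x h1 h2 h3 h4
  simp only [Function.comp] at h2
  rw [h1, h2, h4, Pi.smul_apply, h3, smul_eq_mul, ← mul_assoc, ← mul_assoc, sub_sub]
  congr 1
  rw [magPhase, magPhase, magPhase, ← Complex.exp_add, ← Complex.exp_add]
  congr 1
  simp only [PiLp.sub_apply, PiLp.add_apply]
  push_cast
  ring

theorem magTrans_zero (b : ℝ) : magTrans b 0 = 1 := by
  ext1 f
  apply Lp.ext
  filter_upwards [coeFn_magTrans b 0 f] with x h
  rw [h]
  simp [magPhase]

theorem magTrans_adjoint (b : ℝ) (s : E3) : (magTrans b s).adjoint = magTrans b (-s) := by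
  refine ((ContinuousLinearMap.eq_adjoint_iff _ _).2 fun f g => ?_).symm
  let u : L2 →ₗᵢ[ℂ] L2 := ⟨(magTrans b s : L2 →ₗ[ℂ] L2), norm_magTrans b s⟩
  have h1 : ∀ f g : L2, ⟪magTrans b s f, magTrans b s g⟫_ℂ = ⟪f, g⟫_ℂ := u.inner_map_map
  have h2 : magTrans b s (magTrans b (-s) f) = f := by
    have := DFunLike.congr_fun (magTrans_mul b s (-s)) f
    rw [mul_apply_eq_comp, smul_apply, add_neg_cancel, magTrans_zero] at this
    rw [this]
    simp [mul_comm]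
  rw [← h1 (magTrans b (-s) f), h2]

/-! ### Exponential weights -/

theorem isMultiplier_weight {ε : ℝ} (hε : 0 ≤ ε) : IsMultiplier fun x => (weight ε x : ℂ) := by
  have hc : Continuous fun x => weight ε x := by
    unfold weight
    have := continuous_coord 2
    fun_prop
  refine ⟨(Complex.continuous_ofReal.comp hc).measurable, 1, fun x => ?_⟩
  rw [Complex.norm_real, weight, Real.norm_of_nonneg (Real.exp_pos _).le, Real.exp_le_one_iff]
  have := Real.sqrt_nonneg (1 + x 2 ^ 2)
  nlinarith

theorem weight_pos (ε : ℝ) (x : E3) : 0 < weight ε x := Real.exp_pos _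

theorem mulWeight_eq {ε : ℝ} (hε : 0 ≤ ε) : mulWeight ε = mulOp volume fun x => (weight ε x : ℂ) :=
  opOf_eq fun f => coeFn_mulOp (isMultiplier_weight hε) f

theorem coeFn_mulWeight {ε : ℝ} (hε : 0 ≤ ε) (f : L2) :
    mulWeight ε f =ᵐ[volume] fun x => (weight ε x : ℂ) * f x := by
  rw [mulWeight_eq hε]
  exact coeFn_mulOp (isMultiplier_weight hε) f

theorem isSelfAdjoint_mulWeight {ε : ℝ} (hε : 0 ≤ ε) : IsSelfAdjoint (mulWeight ε) := by
  rw [ContinuousLinearMap.isSelfAdjoint_iff', mulWeight_eq hε, mulOp_adjoint (isMultiplier_weight hε)]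
  simp only [Complex.conj_ofReal]

theorem mulWeight_injective {ε : ℝ} (hε : 0 ≤ ε) : Function.Injective (mulWeight ε) := by
  rw [injective_iff_map_eq_zero]
  intro f hf
  apply Lp.ext
  have h := coeFn_mulWeight hε f
  rw [hf] at h
  filter_upwards [h, Lp.coeFn_zero ℂ 2 (volume : Measure E3)] with x hx h0
  rw [h0] at hx ⊢
  have hw : (weight ε x : ℂ) ≠ 0 := by exact_mod_cast (weight_pos ε x).ne'
  exact (mul_eq_zero.1 hx.symm).resolve_left hw

theorem denseRange_mulWeight {ε : ℝ} (hε : 0 ≤ ε) : DenseRange (mulWeight ε) := by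
  have h1 : (mulWeight ε).rangeᗮ = ⊥ := by
    rw [ContinuousLinearMap.orthogonal_range, (isSelfAdjoint_mulWeight hε).adjoint_eq]
    exact LinearMap.ker_eq_bot.2 (mulWeight_injective hε)
  exact Submodule.dense_iff_topologicalClosure_eq_top.2
    (Submodule.topologicalClosure_eq_top_iff.2 h1)

theorem mulWeight_mul_magTrans {ε : ℝ} (hε : 0 ≤ ε) (b : ℝ) (y : E2) :
    mulWeight ε * magTrans b (embed y 0) = magTrans b (embed y 0) * mulWeight ε := by
  ext1 f
  apply Lp.ext
  rw [mul_apply_eq_comp, mul_apply_eq_comp]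
  have h1 := (measurePreserving_sub_right (volume : Measure E3)
    (embed y 0)).quasiMeasurePreserving.ae_eq_comp (coeFn_mulWeight hε f)
  filter_upwards [coeFn_mulWeight hε (magTrans b (embed y 0) f), coeFn_magTrans b (embed y 0) f, h1,
    coeFn_magTrans b (embed y 0) (mulWeight ε f)] with x h1 h2 h3 h4
  simp only [Function.comp] at h3
  rw [h1, h2, h4, h3]
  have : weight ε (x - embed y 0) = weight ε x := by simp [weight]
  rw [this]
  ring

end

section

/-! ### Laguerre polynomials -/

theorem hasSum_choose_mul_pow (i : ℕ) {w : ℝ} (hw : |w| < 1) :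
    HasSum (fun j : ℕ => (j.choose i : ℝ) * w ^ j) (w ^ i / (1 - w) ^ (i + 1)) := by
  rw [← hasSum_nat_add_iff' i]
  have h0 : ∑ j ∈ Finset.range i, (j.choose i : ℝ) * w ^ j = 0 :=
    Finset.sum_eq_zero fun j hj => by
      rw [Nat.choose_eq_zero_of_lt (Finset.mem_range.1 hj)]; simp
  rw [h0, sub_zero]
  have h := (hasSum_choose_mul_geometric_of_norm_lt_one i (r := w) hw).mul_left (w ^ i)
  rw [mul_one_div] at h
  refine h.congr_fun fun n => ?_
  rw [pow_add]; ring

/-- The generating function of the Laguerre polynomials. -/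
theorem hasSum_pow_mul_laguerre {w : ℝ} (hw : |w| < 1) (x : ℝ) :
    HasSum (fun j : ℕ => w ^ j * laguerre j x) ((1 - w)⁻¹ * Real.exp (-(x * w / (1 - w)))) := by
  -- sum the double series over the degree `p.2` of the polynomial first
  let f : ℕ × ℕ → ℝ := fun p => (p.2.choose p.1 : ℝ) * w ^ p.2 * ((-x) ^ p.1 / p.1.factorial)
  have hw1 : 0 < 1 - w := by linarith [(abs_lt.1 hw).2]
  have hf : Summable f := by
    rw [← summable_abs_iff]
    have e : ∀ p : ℕ × ℕ, |f p| = (p.2.choose p.1 : ℝ) * |w| ^ p.2 * (|x| ^ p.1 / p.1.factorial) := by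
      intro p
      simp only [f, abs_mul, abs_div, abs_pow, abs_neg, Nat.abs_cast]
    rw [summable_congr e, summable_prod_of_nonneg (fun p => by positivity)]
    have h1 : ∀ i : ℕ, HasSum (fun j : ℕ => (j.choose i : ℝ) * |w| ^ j * (|x| ^ i / i.factorial))
        (|w| ^ i / (1 - |w|) ^ (i + 1) * (|x| ^ i / i.factorial)) := fun i =>
      (hasSum_choose_mul_pow i (by rwa [abs_abs])).mul_right _
    refine ⟨fun i => (h1 i).summable, ?_⟩
    simp only [fun i => (h1 i).tsum_eq]
    have h2 := (Real.summable_pow_div_factorial (|w| * |x| / (1 - |w|))).mul_left ((1 - |w|)⁻¹)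
    refine h2.congr fun i => ?_
    have : 1 - |w| ≠ 0 := by linarith
    rw [div_pow, mul_pow, pow_succ]
    field_simp
  have h1 : HasSum (fun i : ℕ => w ^ i / (1 - w) ^ (i + 1) * ((-x) ^ i / i.factorial))
      (∑' p, f p) := hf.hasSum.prod_fiberwise fun i => (hasSum_choose_mul_pow i hw).mul_right _
  have h2 : HasSum (fun i : ℕ => w ^ i / (1 - w) ^ (i + 1) * ((-x) ^ i / i.factorial))
      ((1 - w)⁻¹ * Real.exp (-(x * w / (1 - w)))) := by
    have h3 := (NormedSpace.expSeries_div_hasSum_exp (-(x * w / (1 - w)))).mul_left ((1 - w)⁻¹)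
    rw [← Real.exp_eq_exp_ℝ] at h3
    refine h3.congr_fun fun i => ?_
    have : -(x * w / (1 - w)) = (-x) * w / (1 - w) := by ring
    rw [this, div_pow, mul_pow, pow_succ]
    field_simp
  rw [h2.unique h1]
  have h4 : HasSum (fun p : ℕ × ℕ => f p.swap) (∑' p, f p) :=
    (Equiv.prodComm ℕ ℕ).hasSum_iff.2 hf.hasSum
  refine h4.prod_fiberwise fun j => ?_
  have h5 : w ^ j * laguerre j x = ∑ i ∈ Finset.range (j + 1), f (i, j) := by
    rw [laguerre, Finset.mul_sum]
    refine Finset.sum_congr rfl fun i _ => ?_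
    simp only [f]
    rw [neg_pow x i]
    ring
  rw [h5]
  refine hasSum_sum_of_ne_finset_zero fun i hi => ?_
  simp only [f, Prod.swap]
  rw [Nat.choose_eq_zero_of_lt (by simpa using hi)]
  simp

/-- The estimate `(t / 4)^i / i! ≤ e^{t/4}` in each term leads to the base `5 = 1 + 4`; the factor
`e^{t/4}` is small enough to leave a Gaussian in `landauRadial`. -/
theorem abs_laguerre_le (q : ℕ) {t : ℝ} (ht : 0 ≤ t) : |laguerre q t| ≤ 5 ^ q * Real.exp (t / 4) := by
  have h5 : (5 : ℝ) ^ q = ∑ i ∈ Finset.range (q + 1), (q.choose i : ℝ) * 4 ^ i := by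
    rw [show (5 : ℝ) = 4 + 1 by norm_num, add_pow]
    simp [mul_comm]
  rw [h5, Finset.sum_mul]
  refine (Finset.abs_sum_le_sum_abs _ _).trans (Finset.sum_le_sum fun i _ => ?_)
  rw [abs_div, abs_mul, abs_mul, abs_pow, abs_pow, abs_neg, abs_one, one_pow, one_mul,
    Nat.abs_cast, Nat.abs_cast, abs_of_nonneg ht, mul_div_assoc, mul_assoc]
  gcongr
  have := Real.pow_div_factorial_le_exp (t / 4) (by positivity) i
  rw [div_pow, div_div, div_le_iff₀ (by positivity)] at this
  rw [div_le_iff₀ (by positivity)]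
  linarith

/-! ### Landau projections -/

/-- The radial factor `(b / 2π) L_q(b |s|² / 2) exp (-b |s|² / 4)` of the kernel of `p_q`. -/
def landauRadial (b : ℝ) (q : ℕ) (s : E2) : ℂ :=
  ((b / (2 * Real.pi) * laguerre q (b * ‖s‖ ^ 2 / 2) * Real.exp (-(b / 4) * ‖s‖ ^ 2) : ℝ) : ℂ)

/-- The Mehler kernel `∑_q w^q landauRadial b q`. -/
def mehlerRadial (b w : ℝ) (s : E2) : ℂ :=
  ((b / (2 * Real.pi) * (1 - w)⁻¹ * Real.exp (-(b / 4 * ((1 + w) / (1 - w))) * ‖s‖ ^ 2) : ℝ) : ℂ)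

/-- Translations by horizontal vectors. -/
def horTrans (b : ℝ) (y : E2) : L2 →L[ℂ] L2 := magTrans b (embed y 0)

/-- The operator `p_q ⊗ I₃`, as a superposition of magnetic translations. -/
def landauOp (b : ℝ) (q : ℕ) : L2 →L[ℂ] L2 :=
  strongIntegral volume (landauRadial b q) (horTrans b)

/-- The operator `∑_q w^q (p_q ⊗ I₃)`, as a superposition of magnetic translations. -/
def mehlerOp (b w : ℝ) : L2 →L[ℂ] L2 :=
  strongIntegral volume (mehlerRadial b w) (horTrans b)

theorem continuous_embed_left : Continuous fun y : E2 => embed y 0 :=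
  continuous_embed.comp (by fun_prop : Continuous fun y : E2 => (y, (0 : ℝ)))

theorem isContractionFamily_horTrans (b : ℝ) : IsContractionFamily (horTrans b) :=
  isContractionFamily_magTrans b continuous_embed_left

variable {b : ℝ}

theorem continuous_laguerre (q : ℕ) : Continuous (laguerre q) := by
  unfold laguerre; fun_prop

theorem continuous_landauRadial (b : ℝ) (q : ℕ) : Continuous (landauRadial b q) := by
  unfold landauRadial
  refine Complex.continuous_ofReal.comp ?_
  exact (continuous_const.mul ((continuous_laguerre q).comp (by fun_prop))).mul (by fun_prop)

theorem integrable_gaussian_E2 {a : ℝ} (ha : 0 < a) :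
    Integrable fun s : E2 => Real.exp (-a * ‖s‖ ^ 2) := by
  have h := (GaussianFourier.integrable_cexp_neg_mul_sq_norm_add (b := (a : ℂ)) (V := E2)
    (by simpa using ha) 0 0).norm
  refine h.congr (ae_of_all _ fun s => ?_)
  simp only [zero_mul, add_zero, Complex.norm_exp]
  congr 1
  rw [← Complex.ofReal_pow, ← Complex.ofReal_neg, ← Complex.ofReal_mul, Complex.ofReal_re]

theorem norm_landauRadial_le (hb : 0 < b) (q : ℕ) (s : E2) :
    ‖landauRadial b q s‖ ≤ b / (2 * Real.pi) * 5 ^ q * Real.exp (-(b / 8) * ‖s‖ ^ 2) := by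
  rw [landauRadial, Complex.norm_real, Real.norm_eq_abs, abs_mul, abs_mul, Real.abs_exp,
    abs_of_nonneg (by positivity : 0 ≤ b / (2 * Real.pi))]
  have h1 := abs_laguerre_le q (t := b * ‖s‖ ^ 2 / 2) (by positivity)
  calc _ ≤ b / (2 * Real.pi) * (5 ^ q * Real.exp (b * ‖s‖ ^ 2 / 2 / 4)) *
        Real.exp (-(b / 4) * ‖s‖ ^ 2) := by gcongr
    _ = b / (2 * Real.pi) * 5 ^ q * (Real.exp (b * ‖s‖ ^ 2 / 2 / 4) *
        Real.exp (-(b / 4) * ‖s‖ ^ 2)) := by ring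
    _ = _ := by
        rw [← Real.exp_add]
        congr 2; ring

theorem integrable_landauRadial (hb : 0 < b) (q : ℕ) : Integrable (landauRadial b q) :=
  ((integrable_gaussian_E2 (by positivity : 0 < b / 8)).const_mul _).mono'
    (continuous_landauRadial b q).aestronglyMeasurable (ae_of_all _ (norm_landauRadial_le hb q))

theorem mehler_exponent_pos (hb : 0 < b) {w : ℝ} (hw : |w| < 1) :
    0 < b / 4 * ((1 + w) / (1 - w)) := by
  have h1 : 0 < 1 - w := by linarith [(abs_lt.1 hw).2]
  have h2 : 0 < 1 + w := by linarith [(abs_lt.1 hw).1]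
  positivity

theorem integrable_mehlerRadial (hb : 0 < b) {w : ℝ} (hw : |w| < 1) :
    Integrable (mehlerRadial b w) := by
  have h := (integrable_gaussian_E2 (mehler_exponent_pos hb hw)).const_mul
    (b / (2 * Real.pi) * (1 - w)⁻¹)
  exact h.ofReal

theorem hasSum_landauRadial (hb : 0 < b) {w : ℝ} (hw : |w| < 1) (s : E2) :
    HasSum (fun q : ℕ => (w : ℂ) ^ q * landauRadial b q s) (mehlerRadial b w s) := by
  have hw1 : 1 - w ≠ 0 := by linarith [(abs_lt.1 hw).2]
  have h := ((hasSum_pow_mul_laguerre hw (b * ‖s‖ ^ 2 / 2)).mul_left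
    (b / (2 * Real.pi) * Real.exp (-(b / 4) * ‖s‖ ^ 2)))
  have h2 := Complex.hasSum_ofReal.2 h
  have e : b / (2 * Real.pi) * Real.exp (-(b / 4) * ‖s‖ ^ 2) *
      ((1 - w)⁻¹ * Real.exp (-(b * ‖s‖ ^ 2 / 2 * w / (1 - w)))) =
      b / (2 * Real.pi) * (1 - w)⁻¹ *
        Real.exp (-(b / 4 * ((1 + w) / (1 - w))) * ‖s‖ ^ 2) := by
    rw [show -(b / 4 * ((1 + w) / (1 - w))) * ‖s‖ ^ 2 = -(b / 4) * ‖s‖ ^ 2 +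
      -(b * ‖s‖ ^ 2 / 2 * w / (1 - w)) by field_simp; ring, Real.exp_add]
    ring
  rw [e] at h2
  refine h2.congr_fun fun q => ?_
  simp only [landauRadial]
  push_cast
  ring

/-- For small `w` the Mehler operators are the generating function of the Landau projections. -/
theorem hasSum_landauOp (hb : 0 < b) {w : ℝ} (hw : |w| < 1 / 5) (f : L2) :
    HasSum (fun q : ℕ => (w : ℂ) ^ q • landauOp b q f) (mehlerOp b w f) := by
  have hw1 : |w| < 1 := hw.trans (by norm_num)
  have hint : ∀ q : ℕ, Integrable fun s => ((w : ℂ) ^ q * landauRadial b q s) • horTrans b s f :=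
    fun q => (isContractionFamily_horTrans b).integrable ((integrable_landauRadial hb q).const_mul _) f
  have h := hasSum_integral_of_summable_integral_norm hint ?_
  · rw [mehlerOp, strongIntegral_apply (integrable_mehlerRadial hb hw1)
      (isContractionFamily_horTrans b)]
    have e : ∀ s, ∑' q : ℕ, ((w : ℂ) ^ q * landauRadial b q s) • horTrans b s f =
        mehlerRadial b w s • horTrans b s f := fun s =>
      ((hasSum_landauRadial hb hw1 s).smul_const _).tsum_eq
    simp only [e] at h
    refine h.congr_fun fun q => ?_
    rw [landauOp, strongIntegral_apply (integrable_landauRadial hb q)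
      (isContractionFamily_horTrans b), ← integral_smul]
    simp only [mul_smul]
    rfl
  -- the bound `5^q` for the Laguerre polynomials restricts `w` to `|w| < 1 / 5`
  · set I := ∫ s : E2, Real.exp (-(b / 8) * ‖s‖ ^ 2)
    have hgeo : Summable fun q : ℕ => (b / (2 * Real.pi) * ‖f‖ * I) * (|w| * 5) ^ q :=
      (summable_geometric_of_lt_one (by positivity) (by linarith)).mul_left _
    refine hgeo.of_nonneg_of_le (fun q => integral_nonneg fun _ => norm_nonneg _) fun q => ?_
    have e : (b / (2 * Real.pi) * ‖f‖ * I) * (|w| * 5) ^ q = ∫ s : E2, |w| ^ q *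
        (b / (2 * Real.pi) * 5 ^ q * Real.exp (-(b / 8) * ‖s‖ ^ 2)) * ‖f‖ := by
      rw [integral_mul_const, integral_const_mul, integral_const_mul, mul_pow]
      simp only [I]; ring
    rw [e]
    refine integral_mono (hint q).norm
      ((((integrable_gaussian_E2 (by positivity : 0 < b / 8)).const_mul _).const_mul _).mul_const _)
      fun s => ?_
    simp only [norm_smul, norm_mul, norm_pow, Complex.norm_real, Real.norm_eq_abs]
    gcongr
    · exact norm_landauRadial_le hb q s
    · exact (isContractionFamily_horTrans b).norm_le s f

/-- The twisted convolution of two Gaussians. -/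
theorem integral_mehlerRadial_twisted (hb : 0 < b) {w w' : ℝ} (hw : |w| < 1) (hw' : |w'| < 1)
    (u : E2) : ∫ s : E2, mehlerRadial b w s * mehlerRadial b w' (u - s) *
      Complex.exp (-Complex.I * ((b / 2 * (s 0 * u 1 - s 1 * u 0) : ℝ) : ℂ)) =
        mehlerRadial b (w * w') u := by
  have h1 : 0 < 1 - w := by linarith [(abs_lt.1 hw).2]
  have h2 : 0 < 1 - w' := by linarith [(abs_lt.1 hw').2]
  have h3 : 0 < 1 - w * w' := by
    have : |w * w'| < 1 := by
      rw [abs_mul]; exact mul_lt_one_of_nonneg_of_lt_one_left (abs_nonneg _) hw hw'.le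
    linarith [(abs_lt.1 this).2]
  set α := b / 4 * ((1 + w) / (1 - w)) with hα
  set α' := b / 4 * ((1 + w') / (1 - w')) with hα'
  have hpos : 0 < α + α' := add_pos (mehler_exponent_pos hb hw) (mehler_exponent_pos hb hw')
  -- the exponent is a quadratic polynomial in `s`, with linear coefficients `c`
  let c : Fin 2 → ℂ := ![2 * α' * u 0 - Complex.I * (b / 2) * u 1,
    2 * α' * u 1 + Complex.I * (b / 2) * u 0]
  set A : ℝ := b / (2 * Real.pi) * (1 - w)⁻¹ with hA
  set A' : ℝ := b / (2 * Real.pi) * (1 - w')⁻¹ with hA'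
  have hn : ∀ v : E2, ‖v‖ ^ 2 = v 0 ^ 2 + v 1 ^ 2 := fun v => by
    rw [EuclideanSpace.norm_sq_eq]; simp
  have e1 : ∀ s : E2, mehlerRadial b w s * mehlerRadial b w' (u - s) *
      Complex.exp (-Complex.I * ((b / 2 * (s 0 * u 1 - s 1 * u 0) : ℝ) : ℂ)) =
      ((A * A' * Real.exp (-α' * ‖u‖ ^ 2) : ℝ) : ℂ) *
        Complex.exp (-((α + α' : ℝ) : ℂ) * ∑ i, ((WithLp.ofLp s i : ℝ) : ℂ) ^ 2 +
          ∑ i, c i * ((WithLp.ofLp s i : ℝ) : ℂ)) := by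
    intro s
    simp only [mehlerRadial, ← hα, ← hα', ← hA, ← hA']
    rw [hn, hn, hn]
    simp only [Fin.sum_univ_two, c, Matrix.cons_val_zero, Matrix.cons_val_one, PiLp.sub_apply]
    push_cast
    rw [show ∀ x y z t v : ℂ, x * Complex.exp y * (z * Complex.exp t) * Complex.exp v =
      x * z * Complex.exp (y + t + v) by intros; rw [Complex.exp_add, Complex.exp_add]; ring]
    rw [mul_assoc ((A : ℂ) * A'), ← Complex.exp_add]
    congr 2
    ring
  simp only [e1]
  rw [integral_const_mul]
  have e2 := GaussianFourier.integral_cexp_neg_mul_sum_add (b := ((α + α' : ℝ) : ℂ))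
    (by simpa using hpos) c
  have e3 := (PiLp.volume_preserving_ofLp (Fin 2)).integral_comp
    (MeasurableEquiv.toLp 2 (Fin 2 → ℝ)).symm.measurableEmbedding
    (fun v : Fin 2 → ℝ => Complex.exp (-((α + α' : ℝ) : ℂ) * ∑ i, ((v i : ℝ) : ℂ) ^ 2 +
          ∑ i, c i * ((v i : ℝ) : ℂ)))
  rw [e3, e2]
  have e4 : (∑ i, c i ^ 2) / (4 * ((α + α' : ℝ) : ℂ)) =
      (((4 * α' ^ 2 - b ^ 2 / 4) * ‖u‖ ^ 2 / (4 * (α + α')) : ℝ) : ℂ) := by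
    rw [hn]
    simp only [Fin.sum_univ_two, c, Matrix.cons_val_zero, Matrix.cons_val_one]
    push_cast
    congr 1
    linear_combination ((b : ℂ) ^ 2 / 4 * ((u 0 : ℂ) ^ 2 + (u 1 : ℂ) ^ 2)) * Complex.I_sq
  rw [e4]
  simp only [Fintype.card_fin, Nat.cast_ofNat, ne_eq, OfNat.ofNat_ne_zero, not_false_eq_true,
    div_self, Complex.cpow_one, mehlerRadial]
  rw [← Complex.ofReal_exp]
  norm_cast
  -- the addition theorem of the hyperbolic cotangent, in the variables `w`
  have e5 : -(b / 4 * ((1 + w * w') / (1 - w * w'))) * ‖u‖ ^ 2 =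
      -α' * ‖u‖ ^ 2 + (4 * α' ^ 2 - b ^ 2 / 4) * ‖u‖ ^ 2 / (4 * (α + α')) := by
    have hs : α + α' = b / 2 * (1 - w * w') / ((1 - w) * (1 - w')) := by
      rw [hα, hα']; field_simp; ring
    rw [hs, hα']
    field_simp
    ring
  have e6 : b / (2 * Real.pi) * (1 - w * w')⁻¹ = A * A' * (Real.pi / (α + α')) := by
    have hs : α + α' = b / 2 * (1 - w * w') / ((1 - w) * (1 - w')) := by
      rw [hα, hα']; field_simp; ring
    rw [hs, hA, hA']
    field_simp
    try ring
  rw [e5, Real.exp_add, e6]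
  ring

end

section

variable {b : ℝ}

/-! ### Orthogonality and completeness of the Landau projections -/

/-- `strongIntegral_apply` on the Hilbert space `L²(ℝ³)`; the Bochner integral refers to the real
normed space structure of `Lp`. -/
theorem strongIntegral_apply_L2 {S : Type*} [MeasurableSpace S] [TopologicalSpace S]
    [OpensMeasurableSpace S] [SecondCountableTopology S] {ν : Measure S} {k : S → ℂ}
    {V : S → L2 →L[ℂ] L2} (hk : Integrable k ν) (hV : IsContractionFamily V) (f : L2) :
    strongIntegral ν k V f = ∫ s, k s • V s f ∂ν :=
  strongIntegral_apply hk hV f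

theorem horTrans_mul (b : ℝ) (s t : E2) : horTrans b s * horTrans b t =
    Complex.exp (-Complex.I * ((b / 2 * (s 0 * t 1 - s 1 * t 0) : ℝ) : ℂ)) • horTrans b (s + t) := by
  have h := magTrans_mul b (embed s 0) (embed t 0)
  rw [← embed_add, add_zero] at h
  exact h

theorem horTrans_adjoint (b : ℝ) (s : E2) : (horTrans b s).adjoint = horTrans b (-s) := by
  rw [horTrans, magTrans_adjoint, ← embed_neg, neg_zero]
  rfl

/-- The semigroup property of the Mehler operators. -/
theorem mehlerOp_mul (hb : 0 < b) {w w' : ℝ} (hw : |w| < 1) (hw' : |w'| < 1) :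
    mehlerOp b w * mehlerOp b w' = mehlerOp b (w * w') := by
  have hww : |w * w'| < 1 := by
    rw [abs_mul]; exact mul_lt_one_of_nonneg_of_lt_one_left (abs_nonneg _) hw hw'.le
  have hV := isContractionFamily_horTrans b
  have hk := integrable_mehlerRadial hb hw
  have hk' := integrable_mehlerRadial hb hw'
  ext1 f
  rw [mehlerOp, mehlerOp, strongIntegral_mul_strongIntegral hk hV hk' hV,
    strongIntegral_apply_L2 (hk.mul_prod hk') (hV.comp hV), mehlerOp,
    strongIntegral_apply_L2 (integrable_mehlerRadial hb hww) hV]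
  -- the integrand in the variables `(s, s + t)`
  let Ψ : E2 × E2 → L2 := fun p => (mehlerRadial b w p.1 * mehlerRadial b w' (p.2 - p.1) *
      Complex.exp (-Complex.I * ((b / 2 * (p.1 0 * p.2 1 - p.1 1 * p.2 0) : ℝ) : ℂ))) •
        horTrans b p.2 f
  have hsh : MeasurePreserving (MeasurableEquiv.shearAddRight E2)
      ((volume : Measure E2).prod volume) (volume.prod volume) :=
    measurePreserving_prod_add volume volume
  have e : ∀ p : E2 × E2, (mehlerRadial b w p.1 * mehlerRadial b w' p.2) •
      (horTrans b p.1 ∘L horTrans b p.2) f = Ψ (MeasurableEquiv.shearAddRight E2 p) := by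
    rintro ⟨s, t⟩
    have h1 := DFunLike.congr_fun (horTrans_mul b s t) f
    rw [mul_apply_eq_comp, smul_apply] at h1
    simp only [Ψ, ContinuousLinearMap.comp_apply]
    rw [h1, smul_smul]
    have e0 : MeasurableEquiv.shearAddRight E2 (s, t) = (s, s + t) := rfl
    rw [e0]
    simp only [add_sub_cancel_left, PiLp.add_apply]
    congr 4
    push_cast
    ring
  have hint := (hV.comp hV).integrable (hk.mul_prod hk') f
  simp only [e] at hint ⊢
  rw [hsh.integral_comp' Ψ]
  have hint2 : Integrable Ψ (volume.prod volume) :=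
    (hsh.integrable_comp_emb (MeasurableEquiv.shearAddRight E2).measurableEmbedding).1 hint
  rw [integral_prod_symm _ hint2]
  congr 1
  ext1 u
  simp only [Ψ]
  rw [integral_smul_const, integral_mehlerRadial_twisted hb hw hw']

theorem eq_zero_of_hasSum_pow_mul {c : ℕ → ℂ} {r : ℝ} (hr : 0 < r)
    (h : ∀ w : ℝ, |w| < r → HasSum (fun n : ℕ => (w : ℂ) ^ n * c n) 0) (n : ℕ) : c n = 0 := by
  let p : FormalMultilinearSeries ℝ ℝ ℂ := fun n => ContinuousMultilinearMap.mkPiRing ℝ (Fin n) (c n)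
  have hp : HasFPowerSeriesAt (0 : ℝ → ℂ) p 0 := by
    rw [hasFPowerSeriesAt_iff]
    filter_upwards [Metric.ball_mem_nhds (0 : ℝ) hr] with w hw
    refine (h w (by simpa using hw)).congr_fun fun n => ?_
    simp [p, FormalMultilinearSeries.coeff]
  have h1 := hp.eq_zero
  have h2 : p.coeff n = 0 := by rw [h1]; rfl
  simpa [p, FormalMultilinearSeries.coeff] using h2

theorem eq_of_hasSum_pow_smul {a a' : ℕ → L2} {r : ℝ} (hr : 0 < r) {F : ℝ → L2}
    (h : ∀ w : ℝ, |w| < r → HasSum (fun n : ℕ => (w : ℂ) ^ n • a n) (F w))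
    (h' : ∀ w : ℝ, |w| < r → HasSum (fun n : ℕ => (w : ℂ) ^ n • a' n) (F w)) (n : ℕ) :
    a n = a' n := by
  refine ext_inner_left ℂ fun v => ?_
  rw [← sub_eq_zero]
  refine eq_zero_of_hasSum_pow_mul (c := fun n => ⟪v, a n⟫_ℂ - ⟪v, a' n⟫_ℂ) hr (fun w hw => ?_) n
  have h1 := ((h w hw).sub (h' w hw)).mapL (innerSL ℂ v)
  rw [sub_self, map_zero] at h1
  refine h1.congr_fun fun m => ?_
  rw [innerSL_apply_apply, inner_sub_right, inner_smul_right, inner_smul_right, mul_sub]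

/-- Both sides are coefficients of `v^q` in `mehlerOp b (v * w)`. -/
theorem landauOp_mul_mehlerOp (hb : 0 < b) (q : ℕ) {w : ℝ} (hw : |w| < 1) :
    landauOp b q * mehlerOp b w = (w : ℂ) ^ q • landauOp b q := by
  ext1 f
  have h5 : (0 : ℝ) < 1 / 5 := by norm_num
  refine eq_of_hasSum_pow_smul (a := fun q => (landauOp b q * mehlerOp b w) f)
    (a' := fun q => ((w : ℂ) ^ q • landauOp b q) f) h5 (F := fun v => mehlerOp b (v * w) f)
    (fun v hv => ?_) (fun v hv => ?_) q
  · have h1 := hasSum_landauOp hb hv (mehlerOp b w f)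
    have h2 := DFunLike.congr_fun (mehlerOp_mul hb (hv.trans (by norm_num)) hw) f
    rw [mul_apply_eq_comp] at h2
    rw [h2] at h1
    exact h1
  · have hvw : |v * w| < 1 / 5 := by
      rw [abs_mul]
      calc |v| * |w| ≤ |v| * 1 := by gcongr
        _ < 1 / 5 := by rwa [mul_one]
    refine (hasSum_landauOp hb hvw f).congr_fun fun n => ?_
    rw [smul_apply, smul_smul, Complex.ofReal_mul, mul_pow]

/-- The operators `p_q ⊗ I₃` are mutually orthogonal idempotents. -/
theorem landauOp_mul (hb : 0 < b) (q q' : ℕ) :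
    landauOp b q * landauOp b q' = if q = q' then landauOp b q else 0 := by
  ext1 f
  have h5 : (0 : ℝ) < 1 / 5 := by norm_num
  refine eq_of_hasSum_pow_smul (a := fun n => (landauOp b q * landauOp b n) f)
    (a' := fun n => (if q = n then landauOp b q else 0) f) h5
    (F := fun v => (v : ℂ) ^ q • landauOp b q f) (fun v hv => ?_) (fun v hv => ?_) q'
  · have h1 := (hasSum_landauOp hb hv f).mapL (landauOp b q)
    have h2 := DFunLike.congr_fun (landauOp_mul_mehlerOp hb q (hv.trans (by norm_num : _ < (1 : ℝ)))) f
    rw [mul_apply_eq_comp] at h2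
    rw [h2] at h1
    refine h1.congr_fun fun n => ?_
    rw [map_smul]; rfl
  · have h := hasSum_ite_eq q ((v : ℂ) ^ q • landauOp b q f)
    refine h.congr_fun fun n => ?_
    by_cases hn : n = q
    · subst hn; simp
    · rw [if_neg hn, if_neg (Ne.symm hn)]; simp

theorem isSelfAdjoint_strongIntegral_horTrans {k : E2 → ℂ} (hk : Integrable k)
    (hreal : ∀ s, starRingEnd ℂ (k s) = k s) (heven : ∀ s, k (-s) = k s) :
    IsSelfAdjoint (strongIntegral volume k (horTrans b)) := by
  have hV := isContractionFamily_horTrans b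
  have hV' : IsContractionFamily fun s : E2 => horTrans b (-s) :=
    ⟨fun f => (hV.continuous f).comp continuous_neg, fun s f => hV.norm_le (-s) f⟩
  rw [ContinuousLinearMap.isSelfAdjoint_iff',
    strongIntegral_adjoint hk hV (by simpa only [horTrans_adjoint] using hV')]
  simp only [horTrans_adjoint, hreal]
  have h := strongIntegral_map (e := MeasurableEquiv.neg E2) (Measure.measurePreserving_neg volume)
    hk hV hV'
  rw [← h]
  congr 1
  ext s
  exact (heven s).symm

theorem isSelfAdjoint_landauOp (hb : 0 < b) (q : ℕ) : IsSelfAdjoint (landauOp b q) :=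
  isSelfAdjoint_strongIntegral_horTrans (integrable_landauRadial hb q)
    (fun _ => Complex.conj_ofReal _) (fun s => by simp [landauRadial])

theorem isSelfAdjoint_mehlerOp (hb : 0 < b) {w : ℝ} (hw : |w| < 1) :
    IsSelfAdjoint (mehlerOp b w) :=
  isSelfAdjoint_strongIntegral_horTrans (integrable_mehlerRadial hb hw)
    (fun _ => Complex.conj_ofReal _) (fun s => by simp [mehlerRadial])

/-- The Mehler operators are an approximation of the identity as `w → 1`. -/
theorem tendsto_mehlerOp (hb : 0 < b) {w : ℕ → ℝ} (hw : ∀ n, 0 < w n) (hw' : ∀ n, w n < 1)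
    (h : Tendsto w atTop (𝓝 1)) (f : L2) : Tendsto (fun n => mehlerOp b (w n) f) atTop (𝓝 f) := by
  have hV := isContractionFamily_horTrans b
  have habs : ∀ n, |w n| < 1 := fun n => by rw [abs_of_pos (hw n)]; exact hw' n
  let ρ : ℕ → ℝ := fun n => Real.sqrt (1 - w n)
  have hρ : ∀ n, 0 < ρ n := fun n => Real.sqrt_pos.2 (by linarith [hw' n])
  have hρ2 : ∀ n, ρ n ^ 2 = 1 - w n := fun n => Real.sq_sqrt (by linarith [hw' n])
  have hρ0 : Tendsto ρ atTop (𝓝 0) := by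
    have := ((h.const_sub 1).sqrt)
    simpa using this
  -- rescale the Gaussians to a fixed width
  have e : ∀ n, mehlerOp b (w n) f = ∫ s : E2, ((b / (2 * Real.pi) *
      Real.exp (-(b / 4 * (1 + w n)) * ‖s‖ ^ 2) : ℝ) : ℂ) • horTrans b (ρ n • s) f := by
    intro n
    rw [mehlerOp, strongIntegral_apply_L2 (integrable_mehlerRadial hb (habs n)) hV]
    have h1 := Measure.integral_comp_smul (volume : Measure E2)
      (fun s => mehlerRadial b (w n) s • horTrans b s f) (ρ n)
    rw [finrank_euclideanSpace_fin, hρ2, abs_of_pos (inv_pos.2 (by linarith [hw' n]))] at h1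
    have hne : (1 - w n) ≠ 0 := by linarith [hw' n]
    have h2 : (1 - w n) • ∫ s : E2, mehlerRadial b (w n) (ρ n • s) • horTrans b (ρ n • s) f =
        ∫ s : E2, mehlerRadial b (w n) s • horTrans b s f := by
      rw [h1, smul_smul, mul_inv_cancel₀ hne, one_smul]
    rw [← h2, ← integral_smul]
    congr 1
    ext1 s
    rw [RCLike.real_smul_eq_coe_smul (K := ℂ) (1 - w n), RCLike.ofReal_eq_complex_ofReal, smul_smul]
    congr 1
    rw [mehlerRadial, norm_smul, mul_pow, Real.norm_of_nonneg (hρ n).le, hρ2, ← Complex.ofReal_mul]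
    congr 1
    rw [show -(b / 4 * ((1 + w n) / (1 - w n))) * ((1 - w n) * ‖s‖ ^ 2) =
      -(b / 4 * (1 + w n)) * ‖s‖ ^ 2 by field_simp]
    field_simp
  -- the limiting Gaussian has total mass `1`
  have hlim : f = ∫ s : E2, ((b / (2 * Real.pi) * Real.exp (-(b / 4 * (1 + 1)) * ‖s‖ ^ 2) : ℝ) : ℂ) •
      horTrans b ((0 : ℝ) • s) f := by
    have h0 : horTrans b (0 : E2) f = f := by
      rw [horTrans, show embed 0 0 = 0 by ext i; fin_cases i <;> simp [embed], magTrans_zero]; rfl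
    simp only [zero_smul, h0]
    rw [integral_smul_const, integral_complex_ofReal, integral_const_mul,
      GaussianFourier.integral_rexp_neg_mul_sq_norm (by positivity)]
    rw [finrank_euclideanSpace_fin]
    norm_num
    rw [show (b : ℂ) / (2 * Real.pi) * (Real.pi / (b / 4 * 2)) = 1 by
      have : (b : ℂ) ≠ 0 := by exact_mod_cast hb.ne'
      have : (Real.pi : ℂ) ≠ 0 := by exact_mod_cast Real.pi_ne_zero
      field_simp; norm_num]
    rw [one_smul]
  simp only [e]
  conv => rhs; rw [hlim]
  refine tendsto_integral_filter_of_dominated_convergence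
    (fun s => b / (2 * Real.pi) * Real.exp (-(b / 4) * ‖s‖ ^ 2) * ‖f‖)
    (Eventually.of_forall fun n => ?_) (Eventually.of_forall fun n => ae_of_all _ fun s => ?_)
    (((integrable_gaussian_E2 (by positivity)).const_mul _).mul_const _) (ae_of_all _ fun s => ?_)
  · refine Continuous.aestronglyMeasurable ?_
    exact (Complex.continuous_ofReal.comp (by fun_prop)).smul
      ((hV.continuous f).comp (by fun_prop))
  · rw [norm_smul, Complex.norm_real, Real.norm_of_nonneg (by positivity)]
    gcongr
    · have := hw n
      nlinarith
    · exact hV.norm_le _ f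
  · refine Tendsto.smul ?_ ?_
    · refine (Complex.continuous_ofReal.tendsto _).comp ?_
      refine Tendsto.const_mul _ ((Real.continuous_exp.tendsto _).comp ?_)
      exact ((((h.const_add 1).const_mul _).neg).mul_const _)
    · exact ((hV.continuous f).tendsto _).comp (hρ0.smul_const s)

/-- The Landau projections are complete. -/
theorem eq_zero_of_forall_landauOp (hb : 0 < b) {f : L2} (hf : ∀ q, landauOp b q f = 0) : f = 0 := by
  -- successive square roots, starting inside the disc of convergence of the power series and
  -- tending to `1`
  let w : ℕ → ℝ := fun n => (1 / 25 : ℝ) ^ ((1 / 2 : ℝ) ^ n)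
  have hw0 : ∀ n, 0 < w n := fun n => Real.rpow_pos_of_pos (by norm_num) _
  have hw1 : ∀ n, w n < 1 := fun n => Real.rpow_lt_one (by norm_num) (by norm_num) (by positivity)
  have habs : ∀ n, |w n| < 1 := fun n => by rw [abs_of_pos (hw0 n)]; exact hw1 n
  have hsq : ∀ n, w (n + 1) * w (n + 1) = w n := by
    intro n
    simp only [w]
    rw [← Real.rpow_add (by norm_num), pow_succ]
    congr 1
    ring
  have hlim : Tendsto w atTop (𝓝 1) := by
    have h1 : Tendsto (fun n : ℕ => (1 / 2 : ℝ) ^ n) atTop (𝓝 0) :=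
      tendsto_pow_atTop_nhds_zero_of_lt_one (by norm_num) (by norm_num)
    have h2 := (Real.continuous_const_rpow (a := 1 / 25) (by norm_num)).tendsto 0
    rw [Real.rpow_zero] at h2
    exact h2.comp h1
  have hz : ∀ n, mehlerOp b (w n) f = 0 := by
    intro n
    induction n with
    | zero =>
      have h5 : |w 0| < 1 / 5 := by simp only [w]; norm_num
      have h := hasSum_landauOp hb h5 f
      simp only [hf, smul_zero] at h
      exact h.unique hasSum_zero
    | succ n ih =>
      have h1 := DFunLike.congr_fun (mehlerOp_mul hb (habs (n + 1)) (habs (n + 1))) f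
      rw [hsq, ih, mul_apply_eq_comp] at h1
      -- `‖T f‖² = ⟪f, T² f⟫ = 0` for the self-adjoint square root `T` of the Mehler operator
      have h2 := ContinuousLinearMap.adjoint_inner_right (mehlerOp b (w (n + 1)))
        f (mehlerOp b (w (n + 1)) f)
      rw [(isSelfAdjoint_mehlerOp hb (habs _)).adjoint_eq, h1, inner_zero_right] at h2
      exact inner_self_eq_zero.1 h2.symm
  have h := tendsto_mehlerOp hb hw0 hw1 hlim f
  simp only [hz] at h
  exact (tendsto_nhds_unique h tendsto_const_nhds)

theorem norm_sq_sum_landauOp (hb : 0 < b) (s : Finset ℕ) (f : L2) :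
    ‖∑ q ∈ s, landauOp b q f‖ ^ 2 = ∑ q ∈ s, ‖landauOp b q f‖ ^ 2 := by
  classical
  have horth : ∀ q q', q ≠ q' → ⟪landauOp b q f, landauOp b q' f⟫_ℂ = 0 := by
    intro q q' hqq
    have h1 := ContinuousLinearMap.adjoint_inner_right (landauOp b q) f (landauOp b q' f)
    rw [(isSelfAdjoint_landauOp hb q).adjoint_eq] at h1
    have h2 := DFunLike.congr_fun (landauOp_mul hb q q') f
    rw [if_neg hqq, mul_apply_eq_comp] at h2
    rw [← h1, h2]; simp
  induction s using Finset.induction_on with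
  | empty => simp
  | insert q s hq ih =>
    rw [Finset.sum_insert hq, Finset.sum_insert hq, ← ih]
    have h0 : ⟪landauOp b q f, ∑ q' ∈ s, landauOp b q' f⟫_ℂ = 0 := by
      rw [inner_sum]
      exact Finset.sum_eq_zero fun q' hq' => horth q q' (by rintro rfl; exact hq hq')
    have := norm_add_sq_eq_norm_sq_add_norm_sq_of_inner_eq_zero _ _ h0
    simpa [sq] using this

theorem norm_landauOp_apply_sq (hb : 0 < b) (q : ℕ) (f : L2) :
    ((‖landauOp b q f‖ ^ 2 : ℝ) : ℂ) = ⟪f, landauOp b q f⟫_ℂ := by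
  have h1 := ContinuousLinearMap.adjoint_inner_right (landauOp b q) f (landauOp b q f)
  have h2 := DFunLike.congr_fun (landauOp_mul hb q q) f
  rw [if_pos rfl, mul_apply_eq_comp] at h2
  rw [(isSelfAdjoint_landauOp hb q).adjoint_eq, h2, inner_self_eq_norm_sq_to_K] at h1
  rw [h1]; norm_cast

theorem norm_sum_landauOp_le (hb : 0 < b) (s : Finset ℕ) (f : L2) :
    ‖∑ q ∈ s, landauOp b q f‖ ≤ ‖f‖ := by
  have h1 : ((‖∑ q ∈ s, landauOp b q f‖ ^ 2 : ℝ) : ℂ) = ⟪f, ∑ q ∈ s, landauOp b q f⟫_ℂ := by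
    rw [norm_sq_sum_landauOp hb, inner_sum, Complex.ofReal_sum]
    exact Finset.sum_congr rfl fun q _ => norm_landauOp_apply_sq hb q f
  have h2 : ‖∑ q ∈ s, landauOp b q f‖ ^ 2 ≤ ‖f‖ * ‖∑ q ∈ s, landauOp b q f‖ := by
    have := norm_inner_le_norm (𝕜 := ℂ) f (∑ q ∈ s, landauOp b q f)
    rw [← h1, Complex.norm_real, Real.norm_of_nonneg (by positivity)] at this
    exact this
  by_contra hcon
  push Not at hcon
  have : 0 < ‖∑ q ∈ s, landauOp b q f‖ := (norm_nonneg f).trans_lt hcon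
  nlinarith

/-- The Landau projections sum up to the identity. -/
theorem hasSum_landauOp_apply (hb : 0 < b) (f : L2) : HasSum (fun q => landauOp b q f) f := by
  have hsq : Summable fun q => ‖landauOp b q f‖ ^ 2 := by
    refine summable_of_sum_le (c := ‖f‖ ^ 2) (fun q => by positivity) fun s => ?_
    rw [← norm_sq_sum_landauOp hb]
    gcongr
    exact norm_sum_landauOp_le hb s f
  have hsum : Summable fun q => landauOp b q f := by
    rw [summable_iff_vanishing_norm]
    intro δ hδ
    obtain ⟨s, hs⟩ := summable_iff_vanishing_norm.1 hsq (δ ^ 2) (by positivity)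
    refine ⟨s, fun t ht => ?_⟩
    have h1 := hs t ht
    rw [← norm_sq_sum_landauOp hb, Real.norm_of_nonneg (by positivity)] at h1
    exact lt_of_pow_lt_pow_left₀ 2 hδ.le h1
  have h0 : f - ∑' q, landauOp b q f = 0 := by
    refine eq_zero_of_forall_landauOp hb fun q => ?_
    have h1 := hsum.hasSum.mapL (landauOp b q)
    have h2 : HasSum (fun n => landauOp b q (landauOp b n f)) (landauOp b q f) := by
      refine (hasSum_ite_eq q (landauOp b q f)).congr_fun fun n => ?_
      have h3 := DFunLike.congr_fun (landauOp_mul hb q n) f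
      rw [mul_apply_eq_comp] at h3
      rw [h3]
      by_cases hn : n = q
      · subst hn; simp
      · rw [if_neg hn, if_neg (Ne.symm hn)]; simp
    rw [map_sub, h1.unique h2, sub_self]
  have := hsum.hasSum
  rwa [← sub_eq_zero.1 h0] at this

/-- A bound between two operators that commute with the Landau projections can be checked on the
Landau levels. -/
theorem norm_le_of_forall_landauOp (hb : 0 < b) {X Y : L2 →L[ℂ] L2} {C : ℝ} (hC : 0 ≤ C)
    (hX : ∀ q, X * landauOp b q = landauOp b q * X) (hY : ∀ q, Y * landauOp b q = landauOp b q * Y)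
    (h : ∀ q f, ‖X (landauOp b q f)‖ ≤ C * ‖Y (landauOp b q f)‖) (f : L2) :
    ‖X f‖ ≤ C * ‖Y f‖ := by
  have key : ∀ s : Finset ℕ, ‖X (∑ q ∈ s, landauOp b q f)‖ ≤ C * ‖Y f‖ := by
    intro s
    have hX' : ∀ q, X (landauOp b q f) = landauOp b q (X f) := fun q => DFunLike.congr_fun (hX q) f
    have hY' : ∀ q, Y (landauOp b q f) = landauOp b q (Y f) := fun q => DFunLike.congr_fun (hY q) f
    refine le_of_sq_le_sq ?_ (by positivity)
    rw [map_sum]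
    simp only [hX']
    rw [norm_sq_sum_landauOp hb]
    calc ∑ q ∈ s, ‖landauOp b q (X f)‖ ^ 2 ≤ ∑ q ∈ s, C ^ 2 * ‖landauOp b q (Y f)‖ ^ 2 := by
          refine Finset.sum_le_sum fun q _ => ?_
          rw [← hX', ← hY', ← mul_pow]
          gcongr
          exact h q f
      _ = C ^ 2 * ‖∑ q ∈ s, landauOp b q (Y f)‖ ^ 2 := by
          rw [← Finset.mul_sum, norm_sq_sum_landauOp hb]
      _ ≤ C ^ 2 * ‖Y f‖ ^ 2 := by
          gcongr
          exact norm_sum_landauOp_le hb s _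
      _ = _ := by ring
  have h1 := ((X.continuous.tendsto _).comp (hasSum_landauOp_apply hb f)).norm
  exact le_of_tendsto h1 (Eventually.of_forall key)

end

section

variable {b : ℝ}

/-! ### Vertical convolution operators -/

/-- Translations in the vertical direction. -/
def vertTrans (b : ℝ) (t : ℝ) : L2 →L[ℂ] L2 := magTrans b (embed 0 t)

theorem continuous_embed_right : Continuous fun t : ℝ => embed 0 t :=
  continuous_embed.comp (by fun_prop : Continuous fun t : ℝ => ((0 : E2), t))

theorem isContractionFamily_vertTrans (b : ℝ) : IsContractionFamily (vertTrans b) :=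
  isContractionFamily_magTrans b continuous_embed_right

theorem horTrans_mul_vertTrans (b : ℝ) (y : E2) (t : ℝ) :
    horTrans b y * vertTrans b t = magTrans b (embed y t) := by
  rw [horTrans, vertTrans, magTrans_mul, ← embed_add]
  simp

theorem vertTrans_mul_horTrans (b : ℝ) (y : E2) (t : ℝ) :
    vertTrans b t * horTrans b y = magTrans b (embed y t) := by
  rw [horTrans, vertTrans, magTrans_mul, ← embed_add]
  simp

/-- The kernel `e^{ζ|t|} / 2`. -/
def vertKernel (ζ : ℂ) (t : ℝ) : ℂ := 1 / 2 * Complex.exp (ζ * ((|t| : ℝ) : ℂ))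

theorem continuous_vertKernel (ζ : ℂ) : Continuous (vertKernel ζ) := by
  unfold vertKernel; fun_prop

theorem norm_vertKernel (ζ : ℂ) (t : ℝ) : ‖vertKernel ζ t‖ = 1 / 2 * Real.exp (ζ.re * |t|) := by
  rw [vertKernel, norm_mul, Complex.norm_exp]
  simp

theorem integrable_exp_neg_mul_abs {a : ℝ} (ha : 0 < a) :
    Integrable fun t : ℝ => Real.exp (-a * |t|) := by
  rw [← integrableOn_univ, ← Set.Iic_union_Ioi (a := (0 : ℝ)), integrableOn_union]
  constructor
  · refine (integrableOn_exp_mul_Iic ha 0).congr_fun (fun t ht => ?_) measurableSet_Iic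
    simp only
    rw [abs_of_nonpos ht]; congr 1; ring
  · refine (integrableOn_exp_mul_Ioi (a := -a) (by linarith) 0).congr_fun (fun t ht => ?_)
      measurableSet_Ioi
    simp only
    rw [abs_of_pos ht]

theorem integral_exp_neg_mul_abs {a : ℝ} (ha : 0 < a) :
    ∫ t : ℝ, Real.exp (-a * |t|) = 2 / a := by
  rw [integral_comp_abs (f := fun t => Real.exp (-a * t)), integral_exp_mul_Ioi (by linarith)]
  simp
  field_simp

theorem integrable_vertKernel {ζ : ℂ} (hζ : ζ.re < 0) : Integrable (vertKernel ζ) := by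
  refine ((integrable_exp_neg_mul_abs (a := -ζ.re) (by linarith)).const_mul (1 / 2)).mono'
    (continuous_vertKernel ζ).aestronglyMeasurable (ae_of_all _ fun t => ?_)
  rw [norm_vertKernel, neg_neg]

theorem integral_norm_vertKernel {ζ : ℂ} (hζ : ζ.re < 0) :
    ∫ t, ‖vertKernel ζ t‖ = 1 / (-ζ.re) := by
  have h := integral_exp_neg_mul_abs (a := -ζ.re) (by linarith)
  simp only [norm_vertKernel, integral_const_mul]
  rw [neg_neg] at h
  rw [h]; ring

/-- The operator `I ⊗ r(ζ)`, for `Re ζ < 0`. -/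
def vertOp (b : ℝ) (ζ : ℂ) : L2 →L[ℂ] L2 := strongIntegral volume (vertKernel ζ) (vertTrans b)

theorem norm_vertOp_le (b : ℝ) {ζ : ℂ} (hζ : ζ.re < 0) : ‖vertOp b ζ‖ ≤ 1 / (-ζ.re) := by
  rw [← integral_norm_vertKernel hζ]
  exact norm_strongIntegral_le (integrable_vertKernel hζ) (isContractionFamily_vertTrans b)

theorem vertOp_adjoint (b : ℝ) {ζ : ℂ} (hζ : ζ.re < 0) :
    (vertOp b ζ).adjoint = vertOp b (starRingEnd ℂ ζ) := by
  have hV := isContractionFamily_vertTrans b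
  have hV' : IsContractionFamily fun s : ℝ => vertTrans b (-s) :=
    ⟨fun f => (hV.continuous f).comp continuous_neg, fun s f => hV.norm_le (-s) f⟩
  have hadj : ∀ t, (vertTrans b t).adjoint = vertTrans b (-t) := fun t => by
    rw [vertTrans, magTrans_adjoint, ← embed_neg, neg_zero]; rfl
  rw [vertOp, strongIntegral_adjoint (integrable_vertKernel hζ) hV (by simpa only [hadj] using hV')]
  simp only [hadj]
  have h := strongIntegral_map (e := MeasurableEquiv.neg ℝ) (Measure.measurePreserving_neg volume)
    (integrable_vertKernel (ζ := starRingEnd ℂ ζ) (by simpa using hζ)) hV hV'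
  rw [vertOp, ← h]
  congr 1
  ext s
  simp [vertKernel, ← Complex.exp_conj, Complex.conj_ofNat]

theorem landauOp_mul_vertOp (hb : 0 < b) (q : ℕ) {ζ : ℂ} (hζ : ζ.re < 0) :
    landauOp b q * vertOp b ζ = vertOp b ζ * landauOp b q := by
  refine strongIntegral_comp_commute (integrable_vertKernel hζ) (isContractionFamily_vertTrans b)
    fun t => ?_
  refine (strongIntegral_comp_commute (integrable_landauRadial hb q) (isContractionFamily_horTrans b)
    fun y => ?_).symm
  rw [horTrans_mul_vertTrans, vertTrans_mul_horTrans]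

theorem landauOp_mul_mulWeight (hb : 0 < b) (q : ℕ) {ε : ℝ} (hε : 0 ≤ ε) :
    landauOp b q * mulWeight ε = mulWeight ε * landauOp b q :=
  (strongIntegral_comp_commute (integrable_landauRadial hb q) (isContractionFamily_horTrans b)
    fun y => mulWeight_mul_magTrans hε b y).symm

theorem mulWeight_mul_mulWeight {ε ε' : ℝ} (hε : 0 ≤ ε) (hε' : 0 ≤ ε') :
    mulWeight ε * mulWeight ε' = mulWeight (ε + ε') := by
  rw [mulWeight_eq hε, mulWeight_eq hε', mulWeight_eq (add_nonneg hε hε')]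
  refine (mulOp_comp_mulOp (isMultiplier_weight hε) (isMultiplier_weight hε')).trans ?_
  congr 1
  ext x
  rw [← Complex.ofReal_mul, weight, weight, weight, ← Real.exp_add]
  congr 2
  ring

/-! ### Weighted vertical operators -/

theorem weight_shift_le {η : ℝ} (hη : 0 ≤ η) (x s : E3) :
    weight η x ≤ Real.exp (η * |s 2|) * weight η (x - s) := by
  rw [weight, weight, ← Real.exp_add]
  refine Real.exp_le_exp.2 ?_
  have h1 : Real.sqrt (1 + (x - s) 2 ^ 2) ≤ |s 2| + Real.sqrt (1 + x 2 ^ 2) := by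
    refine Real.sqrt_le_iff.2 ⟨by positivity, ?_⟩
    have h2 : |x 2| ≤ Real.sqrt (1 + x 2 ^ 2) := Real.abs_le_sqrt (by linarith [sq_nonneg (x 2)])
    have h3 := Real.sq_sqrt (by positivity : 0 ≤ 1 + x 2 ^ 2)
    have h4 : -(x 2 * s 2) ≤ |s 2| * |x 2| := by
      rw [← abs_mul, mul_comm]; exact neg_le_abs _
    have h5 : |s 2| * |x 2| ≤ |s 2| * Real.sqrt (1 + x 2 ^ 2) := by gcongr
    have h6 := sq_abs (s 2)
    simp only [PiLp.sub_apply]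
    nlinarith
  nlinarith

/-- Two weights absorb the growth `e^{η|s₃|}`, because `|s₃| ≤ ⟨x₃⟩ + ⟨x₃ - s₃⟩`. -/
theorem exp_mul_weight_mul_weight_le {η : ℝ} (hη : 0 ≤ η) (x s : E3) :
    Real.exp (η * |s 2|) * weight η x * weight η (x - s) ≤ 1 := by
  rw [weight, weight, ← Real.exp_add, ← Real.exp_add, Real.exp_le_one_iff]
  have h1 : |x 2| ≤ Real.sqrt (1 + x 2 ^ 2) := Real.abs_le_sqrt (by linarith [sq_nonneg (x 2)])
  have h2 : |(x - s) 2| ≤ Real.sqrt (1 + (x - s) 2 ^ 2) :=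
    Real.abs_le_sqrt (by linarith [sq_nonneg ((x - s) 2)])
  have h3 : |s 2| ≤ |x 2| + |(x - s) 2| := by
    have := abs_sub (x 2) ((x - s) 2)
    simpa using this
  nlinarith

theorem continuous_weight (η : ℝ) : Continuous (weight η) := by
  unfold weight
  have := continuous_coord 2
  fun_prop

/-- The translation by `s`, sandwiched between weights `e^{-η⟨x₃⟩}` and multiplied by
`e^{η|s₃|}`; a contraction. -/
def wTrans (b η : ℝ) (s : E3) : L2 →L[ℂ] L2 :=
  (Real.exp (η * |s 2|) : ℂ) • (mulWeight η * magTrans b s * mulWeight η)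

theorem coeFn_wTrans (b : ℝ) {η : ℝ} (hη : 0 ≤ η) (s : E3) (f : L2) :
    wTrans b η s f =ᵐ[volume] fun x => ((Real.exp (η * |s 2|) * weight η x * weight η (x - s) : ℝ) : ℂ)
      * magPhase b s x * f (x - s) := by
  rw [wTrans, smul_apply, mul_apply_eq_comp, mul_apply_eq_comp]
  have h1 := (measurePreserving_sub_right (volume : Measure E3) s).quasiMeasurePreserving.ae_eq_comp
    (coeFn_mulWeight hη f)
  filter_upwards [Lp.coeFn_smul (Real.exp (η * |s 2|) : ℂ) (mulWeight η (magTrans b s (mulWeight η f))),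
    coeFn_mulWeight hη (magTrans b s (mulWeight η f)), coeFn_magTrans b s (mulWeight η f), h1]
    with x e1 e2 e3 e4
  simp only [Function.comp] at e4
  rw [e1, Pi.smul_apply, e2, e3, e4, smul_eq_mul]
  push_cast
  ring

theorem isContractionFamily_wTrans (b : ℝ) {η : ℝ} (hη : 0 ≤ η) :
    IsContractionFamily (wTrans b η) := by
  constructor
  · intro f
    have h := continuous_magTrans_apply b (mulWeight η f)
    have h2 : Continuous fun s : E3 => (Real.exp (η * |s 2|) : ℂ) :=
      Complex.continuous_ofReal.comp (Real.continuous_exp.comp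
        (continuous_const.mul (continuous_coord 2).abs))
    exact h2.smul ((mulWeight η).continuous.comp h)
  · intro s f
    have hm : IsMultiplier fun x : E3 =>
        ((Real.exp (η * |s 2|) * weight η x * weight η (x - s) : ℝ) : ℂ) := by
      refine ⟨(Complex.continuous_ofReal.comp ?_).measurable, 1, fun x => ?_⟩
      · have := continuous_weight η
        fun_prop
      · rw [Complex.norm_real, Real.norm_of_nonneg (by have := weight_pos η x; have := weight_pos η (x - s); positivity)]
        exact exp_mul_weight_mul_weight_le hη x s
    have h : wTrans b η s f = mulOp volume (fun x : E3 =>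
        ((Real.exp (η * |s 2|) * weight η x * weight η (x - s) : ℝ) : ℂ)) (magTrans b s f) := by
      apply Lp.ext
      filter_upwards [coeFn_wTrans b hη s f, coeFn_mulOp hm (magTrans b s f), coeFn_magTrans b s f]
        with x e1 e2 e3
      rw [e1, e2, e3, mul_assoc]
    rw [h, ← norm_magTrans b s f]
    have := norm_mulOp_apply_le hm (C := 1) (fun x => ?_) (magTrans b s f)
    · rwa [one_mul] at this
    · rw [Complex.norm_real, Real.norm_of_nonneg (by have := weight_pos η x; have := weight_pos η (x - s); positivity)]
      exact exp_mul_weight_mul_weight_le hη x s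

/-- The operator `I ⊗ r(ζ)` between weighted spaces, defined for `Re ζ < η`. -/
def wVertOp (b η : ℝ) (ζ : ℂ) : L2 →L[ℂ] L2 :=
  strongIntegral volume (vertKernel (ζ - η)) fun t => wTrans b η (embed 0 t)

theorem isContractionFamily_wTrans_vert (b : ℝ) {η : ℝ} (hη : 0 ≤ η) :
    IsContractionFamily fun t => wTrans b η (embed 0 t) :=
  ⟨fun f => ((isContractionFamily_wTrans b hη).continuous f).comp continuous_embed_right,
    fun _ f => (isContractionFamily_wTrans b hη).norm_le _ f⟩

theorem vertKernel_add (ζ : ℂ) (η t : ℝ) :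
    vertKernel (ζ + η) t = vertKernel ζ t * (Real.exp (η * |t|) : ℂ) := by
  rw [vertKernel, vertKernel, mul_assoc, Complex.ofReal_exp, ← Complex.exp_add]
  congr 2
  push_cast
  ring

theorem integrable_vertKernel_sub {ζ : ℂ} {η : ℝ} (hζ : ζ.re < η) :
    Integrable (vertKernel (ζ - η)) :=
  integrable_vertKernel (by simpa using hζ)

theorem mulWeight_vertOp_mulWeight (b : ℝ) {η : ℝ} (hη : 0 ≤ η) {ζ : ℂ} (hζ : ζ.re < 0) :
    mulWeight η * vertOp b ζ * mulWeight η = wVertOp b η ζ := by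
  ext1 f
  rw [mul_apply_eq_comp, mul_apply_eq_comp, vertOp,
    comp_strongIntegral_apply (integrable_vertKernel hζ) (isContractionFamily_vertTrans b), wVertOp,
    strongIntegral_apply (integrable_vertKernel_sub (hζ.trans_le hη))
      (isContractionFamily_wTrans_vert b hη)]
  congr 1
  ext1 t
  rw [wTrans, smul_apply, smul_smul, embed_two, ← vertKernel_add, sub_add_cancel]
  rfl

theorem mulWeight_wVertOp_mulWeight (b : ℝ) {η δ : ℝ} (hη : 0 ≤ η) (hδ : 0 ≤ δ) {ζ : ℂ}
    (hζ : ζ.re < η) :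
    mulWeight δ * wVertOp b η ζ * mulWeight δ = wVertOp b (δ + η) ζ := by
  ext1 f
  rw [mul_apply_eq_comp, mul_apply_eq_comp, wVertOp,
    comp_strongIntegral_apply (integrable_vertKernel_sub hζ) (isContractionFamily_wTrans_vert b hη),
    wVertOp, strongIntegral_apply (integrable_vertKernel_sub (hζ.trans_le (by linarith)))
      (isContractionFamily_wTrans_vert b (by linarith))]
  congr 1
  ext1 t
  have h1 := vertKernel_add (ζ - ((δ + η : ℝ) : ℂ)) δ t
  rw [show ζ - ((δ + η : ℝ) : ℂ) + δ = ζ - η by push_cast; ring] at h1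
  rw [h1, wTrans, wTrans, smul_apply, smul_apply, map_smul, smul_smul, smul_smul, embed_two,
    mul_assoc, ← Complex.ofReal_mul, ← Real.exp_add, ← add_mul,
    ← mulWeight_mul_mulWeight hδ hη]
  congr 1
  change mulWeight δ (mulWeight η (magTrans b (embed 0 t) (mulWeight η (mulWeight δ f)))) =
    mulWeight δ (mulWeight η (magTrans b (embed 0 t) ((mulWeight δ * mulWeight η) f)))
  rw [mulWeight_mul_mulWeight hδ hη, add_comm, ← mulWeight_mul_mulWeight hη hδ]
  rfl

theorem horTrans_mul_wTrans (b : ℝ) {η : ℝ} (hη : 0 ≤ η) (y : E2) (t : ℝ) :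
    horTrans b y * wTrans b η (embed 0 t) = wTrans b η (embed y t) := by
  rw [wTrans, wTrans, mul_smul_comm, ← mul_assoc, ← mul_assoc, horTrans,
    ← mulWeight_mul_magTrans hη, embed_two, embed_two, mul_assoc (mulWeight η) (magTrans b (embed y 0))]
  rw [show magTrans b (embed y 0) * magTrans b (embed 0 t) = magTrans b (embed y t) from
    horTrans_mul_vertTrans b y t]

theorem wTrans_mul_horTrans (b : ℝ) {η : ℝ} (hη : 0 ≤ η) (y : E2) (t : ℝ) :
    wTrans b η (embed 0 t) * horTrans b y = wTrans b η (embed y t) := by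
  rw [wTrans, wTrans, smul_mul_assoc, mul_assoc, horTrans,
    mulWeight_mul_magTrans hη, embed_two, embed_two, ← mul_assoc,
    mul_assoc (mulWeight η) (magTrans b (embed 0 t))]
  rw [show magTrans b (embed 0 t) * magTrans b (embed y 0) = magTrans b (embed y t) from
    vertTrans_mul_horTrans b y t]

theorem landauOp_mul_wVertOp (hb : 0 < b) (q : ℕ) {η : ℝ} (hη : 0 ≤ η) {ζ : ℂ} (hζ : ζ.re < η) :
    landauOp b q * wVertOp b η ζ = wVertOp b η ζ * landauOp b q := by
  refine strongIntegral_comp_commute (integrable_vertKernel_sub hζ)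
    (isContractionFamily_wTrans_vert b hη) fun t => ?_
  refine (strongIntegral_comp_commute (integrable_landauRadial hb q) (isContractionFamily_horTrans b)
    fun y => ?_).symm
  rw [horTrans_mul_wTrans b hη, wTrans_mul_horTrans b hη]

theorem norm_mulWeight_magTrans_le (b : ℝ) {η : ℝ} (hη : 0 ≤ η) (s : E3) (h : L2) :
    ‖mulWeight η (magTrans b s h)‖ ≤ Real.exp (η * |s 2|) * ‖mulWeight η h‖ := by
  rw [← norm_magTrans b s (mulWeight η h)]
  refine Lp.norm_le_mul_norm_of_ae_le_mul ?_
  have h1 := (measurePreserving_sub_right (volume : Measure E3) s).quasiMeasurePreserving.ae_eq_comp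
    (coeFn_mulWeight hη h)
  filter_upwards [coeFn_mulWeight hη (magTrans b s h), coeFn_magTrans b s h,
    coeFn_magTrans b s (mulWeight η h), h1] with x e1 e2 e3 e4
  simp only [Function.comp] at e4
  rw [e1, e2, e3, e4, norm_mul, norm_mul, norm_mul, norm_mul, norm_magPhase, one_mul, one_mul,
    Complex.norm_real, Complex.norm_real, Real.norm_of_nonneg (weight_pos _ _).le,
    Real.norm_of_nonneg (weight_pos _ _).le, ← mul_assoc]
  gcongr
  exact weight_shift_le hη x s

theorem norm_mulWeight_vertOp_le (b : ℝ) {η : ℝ} (hη : 0 ≤ η) {ζ : ℂ} (hζ : ζ.re < -η) (h : L2) :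
    ‖mulWeight η (vertOp b ζ h)‖ ≤ 1 / (-ζ.re - η) * ‖mulWeight η h‖ := by
  have h0 : ζ.re < 0 := by linarith
  have h1 : (ζ + η).re < 0 := by simp; linarith
  have h2 := integral_norm_vertKernel h1
  rw [show -(ζ + η).re = -ζ.re - η by simp; ring] at h2
  rw [vertOp, comp_strongIntegral_apply (integrable_vertKernel h0) (isContractionFamily_vertTrans b),
    ← h2, ← integral_mul_const]
  refine norm_integral_le_of_norm_le ((integrable_vertKernel h1).norm.mul_const _)
    (ae_of_all _ fun t => ?_)
  rw [norm_smul, vertKernel_add, norm_mul, mul_assoc]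
  gcongr
  refine (norm_mulWeight_magTrans_le b hη (embed 0 t) h).trans_eq ?_
  rw [Complex.norm_real, Real.norm_of_nonneg (Real.exp_pos _).le, embed_two]

/-! ### Analyticity -/

theorem integrable_sq_mul_exp_neg_mul_abs {a : ℝ} (ha : 0 < a) :
    Integrable fun t : ℝ => |t| ^ 2 * Real.exp (-a * |t|) := by
  refine ((integrable_exp_neg_mul_abs (half_pos ha)).const_mul (8 / a ^ 2)).mono'
    (by fun_prop) (ae_of_all _ fun t => ?_)
  rw [Real.norm_of_nonneg (by positivity)]
  have h := Real.pow_div_factorial_le_exp (x := a / 2 * |t|) (by positivity) 2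
  rw [show -a * |t| = -(a / 2) * |t| + -(a / 2 * |t|) by ring, Real.exp_add, Real.exp_neg (a / 2 * |t|)]
  have h2 : |t| ^ 2 ≤ 8 / a ^ 2 * Real.exp (a / 2 * |t|) := by
    have : (a / 2 * |t|) ^ 2 / 2 = a ^ 2 / 8 * |t| ^ 2 := by ring
    norm_num at h
    rw [show (a / 2 * |t|) ^ 2 / 2 = a ^ 2 / 8 * |t| ^ 2 by ring] at h
    rw [show 8 / a ^ 2 * Real.exp (a / 2 * |t|) = (Real.exp (a / 2 * |t|)) / (a ^ 2 / 8) by field_simp,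
      le_div_iff₀ (by positivity)]
    linarith
  calc _ ≤ 8 / a ^ 2 * Real.exp (a / 2 * |t|) * (Real.exp (-(a / 2) * |t|) *
        (Real.exp (a / 2 * |t|))⁻¹) := by gcongr
    _ = _ := by field_simp

/-- The derivative is the superposition with the kernel `|t| e^{ζ|t|} / 2`. -/
theorem differentiableAt_strongIntegral_vertKernel {V : ℝ → L2 →L[ℂ] L2}
    (hV : IsContractionFamily V) {ζ : ℂ} (hζ : ζ.re < 0) :
    DifferentiableAt ℂ (fun ζ => strongIntegral volume (vertKernel ζ) V) ζ := by
  set d : ℝ := -ζ.re with hd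
  have hd0 : 0 < d := by simp [hd, hζ]
  let k' : ℝ → ℂ := fun t => ((|t| : ℝ) : ℂ) * vertKernel ζ t
  have hk' : Integrable k' := by
    refine (((integrable_exp_neg_mul_abs hd0).add
      (integrable_sq_mul_exp_neg_mul_abs hd0))).mono' ?_ (ae_of_all _ fun t => ?_)
    · have := continuous_vertKernel ζ
      exact (by fun_prop : Continuous k').aestronglyMeasurable
    · simp only [k', Pi.add_apply]
      rw [norm_mul, norm_vertKernel, Complex.norm_real, Real.norm_of_nonneg (abs_nonneg _),
        show ζ.re = -d by simp [hd]]
      have := Real.exp_pos (-d * |t|)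
      nlinarith [sq_nonneg (|t| - 1), sq_abs t]
  let S := fun k : ℝ → ℂ => strongIntegral volume k V
  let C := ∫ t : ℝ, |t| ^ 2 * Real.exp (-(d / 2) * |t|)
  have key : ∀ h : ℂ, ‖h‖ < d / 2 →
      ‖S (vertKernel (ζ + h)) - S (vertKernel ζ) - h • S k'‖ ≤ C * ‖h‖ ^ 2 := by
    intro h hh
    have hre := (abs_le.1 (Complex.abs_re_le_norm h)).2
    have h1 : (ζ + h).re < 0 := by simp; linarith
    have i1 := integrable_vertKernel h1
    have i2 := integrable_vertKernel hζ
    have e : S (vertKernel (ζ + h)) - S (vertKernel ζ) - h • S k' =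
        strongIntegral volume (fun t => (vertKernel (ζ + h) t - vertKernel ζ t) - h * k' t) V := by
      rw [strongIntegral_sub (k₁ := fun t => vertKernel (ζ + h) t - vertKernel ζ t) (i1.sub i2)
        (hk'.const_mul h) hV, strongIntegral_sub i1 i2 hV, strongIntegral_smul h hk' hV]
    rw [e]
    refine (norm_strongIntegral_le ((i1.sub i2).sub (hk'.const_mul h)) hV).trans ?_
    have iC : Integrable fun t : ℝ => |t| ^ 2 * Real.exp (-(d / 2) * |t|) :=
      integrable_sq_mul_exp_neg_mul_abs (by linarith)
    rw [← integral_mul_const]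
    refine integral_mono ((i1.sub i2).sub (hk'.const_mul h)).norm (iC.mul_const _) fun t => ?_
    change ‖vertKernel (ζ + h) t - vertKernel ζ t - h * k' t‖ ≤
      |t| ^ 2 * Real.exp (-(d / 2) * |t|) * ‖h‖ ^ 2
    -- the second-order Taylor remainder of the exponential
    have h2 := Complex.norm_exp_sub_sum_le_norm_mul_exp (h * ((|t| : ℝ) : ℂ)) 2
    have e2 : vertKernel (ζ + h) t - vertKernel ζ t - h * k' t = vertKernel ζ t *
        (Complex.exp (h * ((|t| : ℝ) : ℂ)) -
          ∑ m ∈ Finset.range 2, (h * ((|t| : ℝ) : ℂ)) ^ m / (m.factorial : ℂ)) := by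
      simp only [k', vertKernel, Finset.sum_range_succ, Finset.sum_range_zero]
      rw [add_mul, Complex.exp_add]
      simp
      ring
    rw [e2, norm_mul, norm_vertKernel, show ζ.re = -d by simp [hd]]
    have hn : ‖h * ((|t| : ℝ) : ℂ)‖ = ‖h‖ * |t| := by
      rw [norm_mul, Complex.norm_real, Real.norm_of_nonneg (abs_nonneg _)]
    rw [hn] at h2
    have hexp : Real.exp (-d * |t|) * Real.exp (‖h‖ * |t|) ≤ Real.exp (-(d / 2) * |t|) := by
      rw [← Real.exp_add]
      refine Real.exp_le_exp.2 ?_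
      nlinarith [abs_nonneg t]
    calc _ ≤ 1 / 2 * Real.exp (-d * |t|) * ((‖h‖ * |t|) ^ 2 * Real.exp (‖h‖ * |t|)) := by gcongr
      _ = 1 / 2 * ((‖h‖ * |t|) ^ 2 * (Real.exp (-d * |t|) * Real.exp (‖h‖ * |t|))) := by ring
      _ ≤ 1 * ((‖h‖ * |t|) ^ 2 * Real.exp (-(d / 2) * |t|)) := by gcongr; norm_num
      _ = _ := by ring
  have hO : (fun w => S (vertKernel w) - S (vertKernel ζ) - (w - ζ) • S k') =O[𝓝 ζ]
      fun w => ‖w - ζ‖ ^ 2 := by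
    refine Asymptotics.IsBigO.of_bound C ?_
    filter_upwards [Metric.ball_mem_nhds ζ (half_pos hd0)] with w hw
    rw [Metric.mem_ball, dist_eq_norm] at hw
    have := key (w - ζ) hw
    rw [add_sub_cancel] at this
    simpa using this
  have h3 := (hO.hasFDerivAt (𝕜 := ℂ) (by norm_num : 1 < 2)).differentiableAt
  have h4 : DifferentiableAt ℂ (fun w : ℂ => S (vertKernel ζ) + (w - ζ) • S k') ζ := by fun_prop
  refine (h3.add h4).congr_of_eventuallyEq (Eventually.of_forall fun w => ?_)
  simp only [Pi.add_apply, S]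
  abel

/-- The weights push the domain of analyticity beyond the imaginary axis. -/
theorem analyticAt_wVertOp (b : ℝ) {η : ℝ} (hη : 0 ≤ η) {ζ : ℂ} (hζ : ζ.re < η) :
    AnalyticAt ℂ (wVertOp b η) ζ := by
  have ho : IsOpen {ζ : ℂ | ζ.re < η} := isOpen_lt Complex.continuous_re continuous_const
  refine DifferentiableOn.analyticAt (s := {ζ : ℂ | ζ.re < η}) (fun w hw => ?_) (ho.mem_nhds hζ)
  have h1 := differentiableAt_strongIntegral_vertKernel (isContractionFamily_wTrans_vert b hη)
    (ζ := w - η) (by simpa using hw)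
  exact (h1.comp w (by fun_prop : DifferentiableAt ℂ (fun w : ℂ => w - η) w)).differentiableWithinAt

/-! ### Comparison with the integral kernels -/

theorem coeFn_strongIntegral {V : E3 → L2 →L[ℂ] L2} (hV : IsContractionFamily V)
    {m : E3 × E3 → ℂ} (hm : Measurable m)
    (hVm : ∀ s f, V s f =ᵐ[volume] fun x => m (s, x) * f (x - s))
    {k : E3 → ℂ} (hk : Integrable k) (hkm : Measurable k) (f : L2) :
    strongIntegral volume k V f =ᵐ[volume] fun x => ∫ y, k (x - y) * (m (x - y, x) * f y) := by
  rw [strongIntegral_apply_L2 hk hV]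
  have hΦ : Measurable fun p : E3 × E3 => k p.1 * (m p * f (p.2 - p.1)) := by
    have hf : Measurable f := (Lp.stronglyMeasurable f).measurable
    exact (hkm.comp measurable_fst).mul (hm.mul (hf.comp (by fun_prop)))
  have h := coeFn_integral_ae (hV.integrable hk f) (Φ := fun p => k p.1 * (m p * f (p.2 - p.1)))
    hΦ.aestronglyMeasurable (ae_of_all _ fun s => by
      filter_upwards [Lp.coeFn_smul (k s) (V s f), hVm s f] with x e1 e2
      rw [e1, Pi.smul_apply, e2, smul_eq_mul])
  refine h.trans (ae_of_all _ fun x => ?_)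
  simp only
  rw [← integral_sub_left_eq_self _ volume x]
  simp

theorem landauRadial_mul_magPhase (b : ℝ) (q : ℕ) (x : E3) (y : E2) (t : ℝ) :
    landauRadial b q (perp x - y) * magPhase b (embed (perp x - y) t) x =
      landauKernel b q (perp x) y := by
  rw [landauRadial, magPhase, landauKernel, Complex.ofReal_mul, Complex.ofReal_exp, mul_assoc,
    ← Complex.exp_add]
  congr 2
  simp
  ring

theorem coeFn_landauOp (hb : 0 < b) (q : ℕ) (f : L2) : landauOp b q f =ᵐ[volume]
    fun x => ∫ y : E2, landauKernel b q (perp x) y * f !₂[y 0, y 1, x 2] := by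
  have hk := integrable_landauRadial hb q
  have hV := isContractionFamily_horTrans b
  rw [landauOp, strongIntegral_apply_L2 hk hV]
  have hΦ : Measurable fun p : E2 × E3 =>
      landauRadial b q p.1 * (magPhase b (embed p.1 0) p.2 * f (p.2 - embed p.1 0)) := by
    have hf : Measurable f := (Lp.stronglyMeasurable f).measurable
    have he : Measurable fun p : E2 × E3 => embed p.1 0 :=
      (continuous_embed_left.comp continuous_fst).measurable
    refine ((continuous_landauRadial b q).measurable.comp measurable_fst).mul
      (Measurable.mul ?_ (hf.comp (measurable_snd.sub he)))
    exact (continuous_magPhase b).measurable.comp (he.prodMk measurable_snd)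
  have h := coeFn_integral_ae (hV.integrable hk f) (Φ := fun p : E2 × E3 =>
      landauRadial b q p.1 * (magPhase b (embed p.1 0) p.2 * f (p.2 - embed p.1 0)))
    hΦ.aestronglyMeasurable (ae_of_all _ fun s => by
      filter_upwards [Lp.coeFn_smul (landauRadial b q s) (horTrans b s f),
        coeFn_magTrans b (embed s 0) f] with x e1 e2
      rw [e1, Pi.smul_apply, horTrans, e2, smul_eq_mul])
  refine h.trans (ae_of_all _ fun x => ?_)
  simp only
  rw [← integral_sub_left_eq_self _ volume (perp x)]
  congr 1
  ext1 y
  rw [← mul_assoc, landauRadial_mul_magPhase]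
  congr 2
  ext i
  fin_cases i <;> simp [embed]

theorem landauOp_mul_strongIntegral (hb : 0 < b) (q : ℕ) {W : E3 → L2 →L[ℂ] L2}
    (hW : IsContractionFamily W) (hWV : ∀ y t, horTrans b y * W (embed 0 t) = W (embed y t))
    {k : ℝ → ℂ} (hk : Integrable k) :
    landauOp b q * strongIntegral volume k (fun t => W (embed 0 t)) =
      strongIntegral volume (fun s : E3 => landauRadial b q (perp s) * k (s 2)) W ∧
    Integrable (fun s : E3 => landauRadial b q (perp s) * k (s 2)) := by
  have hW' : IsContractionFamily fun t => W (embed 0 t) :=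
    ⟨fun f => (hW.continuous f).comp continuous_embed_right, fun t f => hW.norm_le _ f⟩
  have hk2 := (integrable_landauRadial hb q).mul_prod hk
  have hint : Integrable (fun s : E3 => landauRadial b q (perp s) * k (s 2)) := by
    rw [← measurePreserving_splitEquiv.integrable_comp_emb splitEquiv.measurableEmbedding]
    refine hk2.congr (ae_of_all _ fun p => ?_)
    simp [splitEquiv_apply, perp_embed]
  refine ⟨?_, hint⟩
  have hWs : IsContractionFamily fun p : E2 × ℝ => W (splitEquiv p) :=
    ⟨fun f => (hW.continuous f).comp continuous_embed, fun t f => hW.norm_le _ f⟩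
  have h := strongIntegral_map (e := splitEquiv) measurePreserving_splitEquiv hint hW hWs
  rw [← h, landauOp, strongIntegral_mul_strongIntegral (integrable_landauRadial hb q)
    (isContractionFamily_horTrans b) hk hW']
  have e1 : (fun p : E2 × ℝ => landauRadial b q p.1 * k p.2) =
      fun p => landauRadial b q (perp (splitEquiv p)) * k ((splitEquiv p : E3) 2) := by
    ext p; simp [splitEquiv_apply, perp_embed]
  have e2 : (fun p : E2 × ℝ => horTrans b p.1 ∘L W (embed 0 p.2)) = fun p => W (splitEquiv p) := by
    ext1 p; exact hWV p.1 p.2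
  rw [e1, e2]
  rfl

theorem landauProj_eq (hb : 0 < b) (q : ℕ) : landauProj b q = landauOp b q :=
  opOf_eq (coeFn_landauOp hb q)

theorem measurable_landauRadial_mul_vertKernel (b : ℝ) (q : ℕ) (ζ : ℂ) :
    Measurable fun s : E3 => landauRadial b q (perp s) * vertKernel ζ (s 2) :=
  (((continuous_landauRadial b q).comp continuous_perp).mul
    ((continuous_vertKernel ζ).comp (continuous_coord 2))).measurable

theorem embed_perp_sub (x y : E3) : x - y = embed (perp x - perp y) (x 2 - y 2) := by
  rw [← perp_sub, ← PiLp.sub_apply, embed_perp]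

theorem landauTensor_eq (hb : 0 < b) (q : ℕ) {ζ : ℂ} (hζ : ζ.re < 0) :
    landauTensor b q ζ = landauOp b q * vertOp b ζ := by
  refine opOf_eq fun f => ?_
  have hV : IsContractionFamily (magTrans b) := isContractionFamily_magTrans b continuous_id
  obtain ⟨h1, h2⟩ := landauOp_mul_strongIntegral hb q hV
    (fun y t => horTrans_mul_vertTrans b y t) (integrable_vertKernel hζ)
  have h3 : landauOp b q * vertOp b ζ = _ := h1
  rw [h3]
  refine (coeFn_strongIntegral hV (m := fun p => magPhase b p.1 p.2)
    (continuous_magPhase b).measurable (fun s f => coeFn_magTrans b s f) h2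
    (measurable_landauRadial_mul_vertKernel b q ζ) f).trans (ae_of_all _ fun x => ?_)
  simp only
  congr 1
  ext1 y
  rw [← landauRadial_mul_magPhase b q x (perp y) (x 2 - y 2), ← embed_perp_sub, perp_sub,
    PiLp.sub_apply, vertKernel]
  ring

/-- The operator `p_q ⊗ r(0)` between weighted spaces. -/
theorem coeFn_landauOp_mul_wVertOp_zero (hb : 0 < b) (q : ℕ) {η : ℝ} (hη : 0 < η) (f : L2) :
    (landauOp b q * wVertOp b η 0) f =ᵐ[volume]
      fun x => (weight η x : ℂ) * thresholdOp b q (mulWeight η f) x := by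
  have hV := isContractionFamily_wTrans b hη.le
  have hζ : ((0 : ℂ) - η).re < 0 := by simpa using hη
  obtain ⟨h1, h2⟩ := landauOp_mul_strongIntegral hb q hV
    (fun y t => horTrans_mul_wTrans b hη.le y t) (integrable_vertKernel hζ)
  have h3 : landauOp b q * wVertOp b η 0 = _ := h1
  rw [h3]
  have hm : Measurable fun p : E3 × E3 =>
      ((Real.exp (η * |p.1 2|) * weight η p.2 * weight η (p.2 - p.1) : ℝ) : ℂ) *
        magPhase b p.1 p.2 := by
    refine Continuous.measurable (Continuous.mul (Complex.continuous_ofReal.comp ?_)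
      (continuous_magPhase b))
    have := continuous_weight η
    have h2 : Continuous fun p : E3 × E3 => p.1 2 := (continuous_coord 2).comp continuous_fst
    fun_prop
  refine (coeFn_strongIntegral hV hm (fun s f => coeFn_wTrans b hη.le s f) h2
    (measurable_landauRadial_mul_vertKernel b q _) f).trans (ae_of_all _ fun x => ?_)
  simp only [thresholdOp]
  rw [← integral_const_mul]
  refine integral_congr_ae ?_
  filter_upwards [coeFn_mulWeight hη.le f] with y hy
  rw [hy, ← landauRadial_mul_magPhase b q x (perp y) (x 2 - y 2), ← embed_perp_sub, perp_sub,
    PiLp.sub_apply, sub_sub_cancel]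
  have e : vertKernel (0 - η) (x 2 - y 2) * (Real.exp (η * |x 2 - y 2|) : ℂ) = 1 / 2 := by
    rw [← vertKernel_add]; simp [vertKernel]
  push_cast
  push_cast at e
  linear_combination (landauRadial b q (perp x - perp y) * magPhase b (x - y) x * weight η x *
    weight η y * f y) * e

end

section

/-! ### Operators associated with forms -/

section FormOp

variable {H : Type} [NormedAddCommGroup H] [InnerProductSpace ℂ H]

/-- The graph of the operator associated with a form: `D` consists of the pairs `(u, g)` of a
function in the form domain and its generalized gradient (boundary values included), and the form
is `B(g, g)`. -/
def formOp {G : Type*} (D : Set (H × G)) (B : G → G → ℂ) : Set (H × H) :=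
  {p | ∃ g, (p.1, g) ∈ D ∧ ∀ v h, (v, h) ∈ D → B h g = ⟪v, p.2⟫_ℂ}

theorem formOp_symm {G : Type*} {D : Set (H × G)} {B : G → G → ℂ}
    (hB : ∀ h g, starRingEnd ℂ (B h g) = B g h) :
    ∀ p ∈ formOp D B, ∀ p' ∈ formOp D B, ⟪p.1, p'.2⟫_ℂ = ⟪p.2, p'.1⟫_ℂ := by
  rintro ⟨u, w⟩ ⟨g, hg, h⟩ ⟨u', w'⟩ ⟨g', hg', h'⟩
  have h1 := h' u g hg
  have h2 := h u' g' hg'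
  simp only at h1 h2 ⊢
  rw [← h1, ← inner_conj_symm, ← h2, hB]

/-- Bounded dependence of the gradient on the right-hand side, by the open mapping theorem. -/
theorem exists_gradient_bound [CompleteSpace H] {G : Type*} [NormedAddCommGroup G]
    [NormedSpace ℂ G] [CompleteSpace G] {D : Submodule ℂ (H × G)}
    (hD : IsClosed (D : Set (H × G))) {B : G → G → ℂ} {ξ : ℂ} {R : H →L[ℂ] H}
    (hR : IsResolventAt (formOp (D : Set (H × G)) B) ξ R) :
    ∃ C > 0, ∀ f, ∃ g, (R f, g) ∈ D ∧ ‖g‖ ≤ C * ‖f‖ := by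
  -- the pairs `(f, g)` such that `g` is a gradient of `R f` form a Banach space over `H`
  let L : H × G →L[ℂ] H × G :=
    (R ∘L ContinuousLinearMap.fst ℂ H G).prod (ContinuousLinearMap.snd ℂ H G)
  let E : Submodule ℂ (H × G) := D.comap (L : H × G →ₗ[ℂ] H × G)
  have hE : IsClosed (E : Set (H × G)) := hD.preimage L.continuous
  have : CompleteSpace E := hE.completeSpace_coe
  let π : E →L[ℂ] H := ContinuousLinearMap.fst ℂ H G ∘L E.subtypeL
  have hsurj : Function.Surjective π := by
    intro f
    obtain ⟨g, hg, -⟩ := hR.1 f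
    exact ⟨⟨(f, g), hg⟩, rfl⟩
  obtain ⟨C, hC, h⟩ := π.exists_preimage_norm_le hsurj
  refine ⟨C, hC, fun f => ?_⟩
  obtain ⟨⟨⟨f', g⟩, hfg⟩, h1, h2⟩ := h f
  have h1' : f' = f := h1
  subst h1'
  exact ⟨g, hfg, (norm_snd_le ((f', g) : H × G)).trans h2⟩

/-- The Riesz representation theorem: a closed form that is bounded below by a positive constant
has a resolvent on the half-line `(-∞, 0]`, and gradients depend linearly on the right-hand
side. -/
theorem exists_resolvent_formOp [CompleteSpace H] (D : Submodule ℂ (H × (Fin 3 → H)))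
    (hD : IsClosed (D : Set (H × (Fin 3 → H)))) {b c : ℝ} (hb : 0 < b) (hc : 0 ≤ c)
    (hlow : ∀ u g, (u, g) ∈ D → b * ‖u‖ ^ 2 ≤ ∑ j, ‖g j‖ ^ 2) :
    ∃ (R : H →L[ℂ] H) (G : Fin 3 → H →L[ℂ] H),
      IsResolventAt (formOp (D : Set (H × (Fin 3 → H))) fun h g => ∑ j, ⟪h j, g j⟫_ℂ)
        (-(c : ℂ)) R ∧ ∀ f, (R f, fun j => G j f) ∈ D := by
  -- The form domain is a closed subspace `F` of `H⁴`, with orthogonal projection `P`. The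
  -- resolvent at `-1` and its gradient are the components of `P` on the first summand.
  let A : Type := PiLp 2 (fun _ : Fin 4 => H)
  let pr : Fin 4 → A →L[ℂ] H := fun i => PiLp.proj 2 (fun _ : Fin 4 => H) i
  let L : A →L[ℂ] H × (Fin 3 → H) := (pr 0).prod (ContinuousLinearMap.pi fun j : Fin 3 => pr j.succ)
  let ι : H →L[ℂ] A := (PiLp.continuousLinearEquiv 2 ℂ (fun _ : Fin 4 => H)).symm.toContinuousLinearMap
    ∘L ContinuousLinearMap.single ℂ (fun _ : Fin 4 => H) 0
  let F : Submodule ℂ A := D.comap (L : A →ₗ[ℂ] H × (Fin 3 → H))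
  have hF : IsClosed (F : Set A) := hD.preimage L.continuous
  have hFc : CompleteSpace F := hF.completeSpace_coe
  let P := F.starProjection
  have hι0 : ∀ f, ι f 0 = f := fun f => by simp [ι]
  have hιs : ∀ f (j : Fin 3), ι f j.succ = 0 := fun f j => by simp [ι]
  have hinner : ∀ p p' : A, ⟪p, p'⟫_ℂ = ⟪p 0, p' 0⟫_ℂ + ∑ j : Fin 3, ⟪p j.succ, p' j.succ⟫_ℂ := by
    intro p p'
    rw [PiLp.inner_apply, Fin.sum_univ_succ]
  have hinnerι : ∀ (p : A) f, ⟪p, ι f⟫_ℂ = ⟪p 0, f⟫_ℂ := by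
    intro p f
    rw [hinner, hι0]
    simp only [hιs, inner_zero_right, Finset.sum_const_zero, add_zero]
  let R₁ : H →L[ℂ] H := pr 0 ∘L P ∘L ι
  let G₁ : Fin 3 → H →L[ℂ] H := fun j => pr j.succ ∘L P ∘L ι
  have hP : ∀ f, P (ι f) ∈ F := fun f => Submodule.starProjection_apply_mem F _
  have hmem : ∀ f, (R₁ f, fun j => G₁ j f) ∈ D := fun f => hP f
  have hPi : ∀ f, ∀ p ∈ F, ⟪p, P (ι f)⟫_ℂ = ⟪p, ι f⟫_ℂ := by
    intro f p hp
    have h1 := Submodule.starProjection_inner_eq_zero (K := F) (ι f) p hp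
    have h2 := inner_eq_zero_symm.1 h1
    rw [inner_sub_right] at h2
    exact (sub_eq_zero.1 h2).symm
  let lift : H × (Fin 3 → H) → A := fun p => WithLp.toLp 2 (Fin.cons p.1 p.2 : Fin 4 → H)
  have hlift : ∀ p ∈ D, lift p ∈ F := fun p hp => by
    change ((lift p 0, fun j : Fin 3 => lift p j.succ) : H × (Fin 3 → H)) ∈ D
    simpa [lift] using hp
  have hweak : ∀ f v h, (v, h) ∈ D → ⟪v, R₁ f⟫_ℂ + ∑ j, ⟪h j, G₁ j f⟫_ℂ = ⟪v, f⟫_ℂ := by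
    intro f v h hvh
    have h1 := hPi f _ (hlift _ hvh)
    rw [hinnerι, hinner] at h1
    exact h1
  have hR₁ : IsResolventAt (formOp (D : Set (H × (Fin 3 → H))) fun h g => ∑ j, ⟪h j, g j⟫_ℂ)
      (-1) R₁ := by
    constructor
    · intro f
      refine ⟨fun j => G₁ j f, hmem f, fun v h hvh => ?_⟩
      rw [inner_add_right, neg_one_smul, inner_neg_right, ← hweak f v h hvh]
      ring
    · rintro ⟨u, w⟩ ⟨g, hg, h⟩
      rw [neg_one_smul, sub_neg_eq_add]
      have h1 : P (ι (w + u)) = lift (u, g) := by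
        refine Submodule.eq_starProjection_of_mem_of_inner_eq_zero (hlift _ hg) fun p hp => ?_
        rw [inner_sub_left, sub_eq_zero, ← inner_conj_symm, ← inner_conj_symm (lift (u, g)),
          hinnerι, hinner, inner_add_right]
        have h2 : ∑ j : Fin 3, ⟪p j.succ, g j⟫_ℂ = ⟪p 0, w⟫_ℂ := h _ _ hp
        congr 1
        rw [← h2, add_comm]
        rfl
      change (P (ι (w + u))) 0 = u
      rw [h1]; simp [lift]
  have hnorm : ∀ f, (1 + b) * ‖R₁ f‖ ^ 2 ≤ (⟪R₁ f, f⟫_ℂ).re := by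
    intro f
    rw [← hweak f _ _ (hmem f), Complex.add_re, Complex.re_sum]
    have h1 : ∀ x : H, (⟪x, x⟫_ℂ).re = ‖x‖ ^ 2 := fun x => by
      rw [inner_self_eq_norm_sq_to_K]; norm_cast
    simp only [h1]
    have := hlow _ _ (hmem f)
    linarith
  have hle : ∀ f, ‖R₁ f‖ ≤ 1 / (1 + b) * ‖f‖ := by
    intro f
    have h1 := (hnorm f).trans ((Complex.re_le_norm _).trans (norm_inner_le_norm _ _))
    by_cases h0 : ‖R₁ f‖ = 0
    · rw [h0]; positivity
    · have hp : 0 < ‖R₁ f‖ := lt_of_le_of_ne (norm_nonneg _) (Ne.symm h0)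
      rw [one_div_mul_eq_div, le_div_iff₀ (by positivity)]
      nlinarith
  -- the lower bound `b` of the form leads from the point `-1` to the point `-c`
  have hunit : IsUnit (1 - ((1 - c : ℝ) : ℂ) • R₁) := by
    have hd : 0 < 1 - 1 / (1 + b) := by
      rw [sub_pos, div_lt_one (by positivity)]; linarith
    refine ContinuousLinearMap.isUnit_of_forall_le_norm_inner_map _ (c := ⟨_, hd.le⟩) hd
      fun x => ?_
    refine le_trans ?_ (Complex.re_le_norm _)
    rw [sub_apply, smul_apply, inner_sub_left, inner_smul_left, Complex.conj_ofReal, Complex.sub_re,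
      Complex.re_ofReal_mul, one_apply_eq_self, inner_self_eq_norm_sq_to_K]
    have h1 : ((‖x‖ : ℂ) ^ 2).re = ‖x‖ ^ 2 := by norm_cast
    erw [h1]
    have h2 := (Complex.re_le_norm _).trans (norm_inner_le_norm (𝕜 := ℂ) (R₁ x) x)
    have h3 : 0 ≤ (⟪R₁ x, x⟫_ℂ).re := le_trans (by positivity) (hnorm x)
    have h4 : (⟪R₁ x, x⟫_ℂ).re ≤ 1 / (1 + b) * ‖x‖ ^ 2 :=
      h2.trans (by have := hle x; nlinarith [norm_nonneg x])
    change ‖x‖ ^ 2 * (1 - 1 / (1 + b)) ≤ _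
    have h5 := mul_nonneg hc h3
    linarith
  have hR := hR₁.translate hunit
  have hξ : (-1 : ℂ) + ((1 - c : ℝ) : ℂ) = -(c : ℂ) := by push_cast; ring
  rw [hξ] at hR
  exact ⟨_, fun j => G₁ j * Ring.inverse (1 - ((1 - c : ℝ) : ℂ) • R₁), hR, fun f => hmem _⟩

end FormOp

/-! ### Restriction and extension by zero -/

section Restrict

variable {U : Set E3}

theorem coeFn_restrictTo (U : Set E3) (f : L2) : restrictTo U f =ᵐ[volume.restrict U] f :=
  LpToLpRestrictCLM_coeFn ℂ U f

/-- Extension by zero, the adjoint of the restriction. -/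
def extendZero (U : Set E3) : L2on U →L[ℂ] L2 := (restrictTo U).adjoint

theorem extendZero_spec (hU : MeasurableSet U) (f : L2on U) :
    ∃ F : L2, extendZero U f = F ∧ F =ᵐ[volume] U.indicator f := by
  have hmem : MemLp (U.indicator f) 2 (volume : Measure E3) :=
    (memLp_indicator_iff_restrict hU).2 (Lp.memLp f)
  refine ⟨hmem.toLp _, ?_, hmem.coeFn_toLp⟩
  refine ext_inner_right ℂ fun g => ?_
  rw [extendZero, ContinuousLinearMap.adjoint_inner_left, L2.inner_def, L2.inner_def,
    ← integral_indicator hU]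
  have h1 := (ae_restrict_iff' hU).1 (coeFn_restrictTo U g)
  refine integral_congr_ae ?_
  filter_upwards [h1, hmem.coeFn_toLp] with x e1 e2
  by_cases hx : x ∈ U
  · rw [Set.indicator_of_mem hx, e1 hx, e2, Set.indicator_of_mem hx]
  · rw [Set.indicator_of_notMem hx, e2, Set.indicator_of_notMem hx, inner_zero_left]

theorem coeFn_extendZero (hU : MeasurableSet U) (f : L2on U) :
    extendZero U f =ᵐ[volume] U.indicator f := by
  obtain ⟨F, h1, h2⟩ := extendZero_spec hU f
  rw [h1]; exact h2

theorem restrictTo_extendZero (hU : MeasurableSet U) (f : L2on U) :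
    restrictTo U (extendZero U f) = f := by
  apply Lp.ext
  have h1 := ae_restrict_of_ae (s := U) (coeFn_extendZero hU f)
  filter_upwards [coeFn_restrictTo U (extendZero U f), h1, ae_restrict_mem hU] with x e1 e2 e3
  rw [e1, e2, Set.indicator_of_mem e3]

theorem extendZero_restrictTo (hU : MeasurableSet U) (f : L2) :
    extendZero U (restrictTo U f) = mulOp volume (U.indicator fun _ => (1 : ℂ)) f := by
  apply Lp.ext
  have h1 := (ae_restrict_iff' hU).1 (coeFn_restrictTo U f)
  filter_upwards [coeFn_extendZero hU (restrictTo U f), h1,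
    coeFn_mulOp (IsMultiplier.indicator hU) f] with x e1 e2 e3
  rw [e1, e3]
  by_cases hx : x ∈ U
  · rw [Set.indicator_of_mem hx, Set.indicator_of_mem hx, e2 hx, one_mul]
  · rw [Set.indicator_of_notMem hx, Set.indicator_of_notMem hx, zero_mul]

theorem inner_extendZero (f : L2on U) (g : L2) :
    ⟪extendZero U f, g⟫_ℂ = ⟪f, restrictTo U g⟫_ℂ :=
  ContinuousLinearMap.adjoint_inner_left _ _ _

theorem inner_extendZero' (f : L2on U) (g : L2) :
    ⟪g, extendZero U f⟫_ℂ = ⟪restrictTo U g, f⟫_ℂ :=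
  ContinuousLinearMap.adjoint_inner_right _ _ _

theorem norm_extendZero (hU : MeasurableSet U) (f : L2on U) : ‖extendZero U f‖ = ‖f‖ := by
  have h : ‖extendZero U f‖ ^ 2 = ‖f‖ ^ 2 := by
    have h1 := inner_extendZero f (extendZero U f)
    rw [restrictTo_extendZero hU, inner_self_eq_norm_sq_to_K, inner_self_eq_norm_sq_to_K] at h1
    exact_mod_cast h1
  exact (sq_eq_sq₀ (norm_nonneg _) (norm_nonneg _)).1 h

theorem norm_restrictTo_le (f : L2) : ‖restrictTo U f‖ ≤ ‖f‖ :=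
  norm_Lp_toLp_restrict_le U f

theorem extendZero_univ_restrictTo (f : L2) : extendZero Set.univ (restrictTo Set.univ f) = f := by
  rw [extendZero_restrictTo MeasurableSet.univ, Set.indicator_univ, mulOp_one]; rfl

theorem extendOp_apply (U : Set E3) (R : L2on U →L[ℂ] L2on U) (f : L2) :
    extendOp U R f = extendZero U (R (restrictTo U f)) := rfl

theorem extendOp_mul (hU : MeasurableSet U) (R S : L2on U →L[ℂ] L2on U) :
    extendOp U (R * S) = extendOp U R * extendOp U S := by
  ext1 f
  simp only [extendOp_apply, mul_apply_eq_comp, restrictTo_extendZero hU]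

theorem extendOp_mul_of_disjoint {U' : Set E3} (hU : MeasurableSet U) (hU' : MeasurableSet U')
    (hUU : Disjoint U U') (R : L2on U →L[ℂ] L2on U) (S : L2on U' →L[ℂ] L2on U') :
    extendOp U R * extendOp U' S = 0 := by
  ext1 f
  have h : restrictTo U (extendZero U' (S (restrictTo U' f))) = 0 := by
    apply Lp.ext
    have h1 := ae_restrict_of_ae (s := U) (coeFn_extendZero hU' (S (restrictTo U' f)))
    filter_upwards [coeFn_restrictTo U (extendZero U' (S (restrictTo U' f))), h1,
      ae_restrict_mem hU, Lp.coeFn_zero ℂ 2 (volume.restrict U)] with x e1 e2 e3 e4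
    rw [e1, e2, e4, Set.indicator_of_notMem (fun h => Set.disjoint_left.1 hUU e3 h)]; rfl
  rw [mul_apply_eq_comp, extendOp_apply, extendOp_apply, h]
  simp

theorem isSelfAdjoint_extendOp {R : L2on U →L[ℂ] L2on U} (hR : IsSelfAdjoint R) :
    IsSelfAdjoint (extendOp U R) := by
  rw [ContinuousLinearMap.isSelfAdjoint_iff_isSymmetric]
  intro f g
  have h := ContinuousLinearMap.isSelfAdjoint_iff_isSymmetric.1 hR (restrictTo U f) (restrictTo U g)
  change ⟪extendZero U (R (restrictTo U f)), g⟫_ℂ = ⟪f, extendZero U (R (restrictTo U g))⟫_ℂ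
  rw [inner_extendZero, inner_extendZero']
  exact h

end Restrict

end

section

variable {b : ℝ}

/-! ### Calculus with the magnetic gradient -/

/-- The partial derivative `∂_j φ`. -/
def partialD (j : Fin 3) (φ : E3 → ℂ) (x : E3) : ℂ := fderiv ℝ φ x (EuclideanSpace.single j 1)

theorem magGrad_eq (b : ℝ) (φ : E3 → ℂ) (j : Fin 3) (x : E3) :
    magGrad b φ j x = partialD j φ x - Complex.I * magPotential b j x * φ x := rfl

theorem contDiff_coord (i : Fin 3) : ContDiff ℝ ∞ fun x : E3 => x i :=
  (EuclideanSpace.proj (𝕜 := ℝ) i : E3 →L[ℝ] ℝ).contDiff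

theorem contDiff_magPotential (b : ℝ) (j : Fin 3) : ContDiff ℝ ∞ (magPotential b j) := by
  have h0 := contDiff_coord 0
  have h1 := contDiff_coord 1
  unfold magPotential
  fin_cases j
  · exact (contDiff_const.mul h1).div_const _
  · exact (contDiff_const.mul h0).div_const _
  · exact contDiff_const

theorem contDiff_ofReal {f : E3 → ℝ} (hf : ContDiff ℝ ∞ f) : ContDiff ℝ ∞ fun x => (f x : ℂ) :=
  Complex.ofRealCLM.contDiff.comp hf

theorem contDiff_partialD {φ : E3 → ℂ} (hφ : ContDiff ℝ ∞ φ) (j : Fin 3) :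
    ContDiff ℝ ∞ (partialD j φ) :=
  (hφ.fderiv_right (m := ∞) (by simp)).clm_apply contDiff_const

theorem contDiff_magGrad (b : ℝ) {φ : E3 → ℂ} (hφ : ContDiff ℝ ∞ φ) (j : Fin 3) :
    ContDiff ℝ ∞ (magGrad b φ j) :=
  (contDiff_partialD hφ j).sub ((contDiff_const.mul (contDiff_ofReal (contDiff_magPotential b j))).mul hφ)

theorem magGrad_eq_zero (b : ℝ) {φ : E3 → ℂ} (j : Fin 3) {x : E3} (hx : x ∉ tsupport φ) :
    magGrad b φ j x = 0 := by
  have h : φ =ᶠ[𝓝 x] 0 := notMem_tsupport_iff_eventuallyEq.1 hx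
  rw [magGrad, h.fderiv_eq, h.eq_of_nhds]
  simp

theorem tsupport_magGrad_subset (b : ℝ) (φ : E3 → ℂ) (j : Fin 3) :
    tsupport (magGrad b φ j) ⊆ tsupport φ :=
  closure_minimal (fun x hx => by
    by_contra h
    exact hx (magGrad_eq_zero b j h)) (isClosed_tsupport φ)

theorem hasCompactSupport_magGrad (b : ℝ) {φ : E3 → ℂ} (hφ : HasCompactSupport φ) (j : Fin 3) :
    HasCompactSupport (magGrad b φ j) :=
  hφ.of_isClosed_subset (isClosed_tsupport _) (tsupport_magGrad_subset b φ j)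

theorem differentiable_of_contDiff {φ : E3 → ℂ} (hφ : ContDiff ℝ ∞ φ) : Differentiable ℝ φ :=
  hφ.differentiable (by simp)

theorem partialD_mul {χ φ : E3 → ℂ} (hχ : ContDiff ℝ ∞ χ) (hφ : ContDiff ℝ ∞ φ) (j : Fin 3) (x : E3) :
    partialD j (fun y => χ y * φ y) x = χ x * partialD j φ x + partialD j χ x * φ x := by
  rw [partialD, fderiv_fun_mul (differentiable_of_contDiff hχ x) (differentiable_of_contDiff hφ x)]
  simp [partialD]
  ring

theorem partialD_add {χ φ : E3 → ℂ} (hχ : ContDiff ℝ ∞ χ) (hφ : ContDiff ℝ ∞ φ) (j : Fin 3) (x : E3) :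
    partialD j (fun y => χ y + φ y) x = partialD j χ x + partialD j φ x := by
  rw [partialD, fderiv_fun_add (differentiable_of_contDiff hχ x) (differentiable_of_contDiff hφ x)]
  rfl

theorem magGrad_mul (b : ℝ) {χ φ : E3 → ℂ} (hχ : ContDiff ℝ ∞ χ) (hφ : ContDiff ℝ ∞ φ) (j : Fin 3)
    (x : E3) : magGrad b (fun y => χ y * φ y) j x = χ x * magGrad b φ j x + partialD j χ x * φ x := by
  rw [magGrad_eq, magGrad_eq, partialD_mul hχ hφ]
  ring

theorem magGrad_add (b : ℝ) {χ φ : E3 → ℂ} (hχ : ContDiff ℝ ∞ χ) (hφ : ContDiff ℝ ∞ φ) (j : Fin 3)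
    (x : E3) : magGrad b (fun y => χ y + φ y) j x = magGrad b χ j x + magGrad b φ j x := by
  rw [magGrad_eq, magGrad_eq, magGrad_eq, partialD_add hχ hφ]
  ring

theorem magGrad_const_mul (b : ℝ) {φ : E3 → ℂ} (a : ℂ) (hφ : ContDiff ℝ ∞ φ) (j : Fin 3)
    (x : E3) : magGrad b (fun y => a * φ y) j x = a * magGrad b φ j x := by
  rw [magGrad_mul b contDiff_const hφ]
  simp [partialD]

theorem integrable_of_continuous_of_hasCompactSupport {f : E3 → ℂ} (hf : Continuous f)
    (hc : HasCompactSupport f) : Integrable f := hf.integrable_of_hasCompactSupport hc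

/-- Integration by parts for the magnetic gradient. -/
theorem integral_conj_magGrad_mul (b : ℝ) {φ ψ : E3 → ℂ} (hφ : ContDiff ℝ ∞ φ)
    (hc : HasCompactSupport φ) (hψ : ContDiff ℝ ∞ ψ) (j : Fin 3) :
    ∫ x, starRingEnd ℂ (magGrad b φ j x) * ψ x = -∫ x, starRingEnd ℂ (φ x) * magGrad b ψ j x := by
  let φ' : E3 → ℂ := fun x => starRingEnd ℂ (φ x)
  have hφ' : ContDiff ℝ ∞ φ' := (Complex.conjCLE : ℂ →L[ℝ] ℂ).contDiff.comp hφ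
  have hc' : HasCompactSupport φ' := hc.comp_left (map_zero _)
  have hpd : ∀ x, partialD j φ' x = starRingEnd ℂ (partialD j φ x) := by
    intro x
    have h := ((Complex.conjCLE : ℂ →L[ℝ] ℂ).hasFDerivAt.comp x
      (differentiable_of_contDiff hφ x).hasFDerivAt).fderiv
    have h2 : fderiv ℝ φ' x = _ := h
    rw [partialD, h2]; rfl
  have i1 : Integrable fun x => partialD j φ' x * ψ x :=
    integrable_of_continuous_of_hasCompactSupport
      ((contDiff_partialD hφ' j).continuous.mul hψ.continuous)
      ((hc'.fderiv_apply ℝ _).mul_right)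
  have i2 : Integrable fun x => φ' x * partialD j ψ x :=
    integrable_of_continuous_of_hasCompactSupport
      (hφ'.continuous.mul (contDiff_partialD hψ j).continuous) hc'.mul_right
  have i3 : Integrable fun x => φ' x * ψ x :=
    integrable_of_continuous_of_hasCompactSupport (hφ'.continuous.mul hψ.continuous) hc'.mul_right
  have i4 : Integrable fun x => Complex.I * magPotential b j x * (φ' x * ψ x) :=
    integrable_of_continuous_of_hasCompactSupport
      ((continuous_const.mul (contDiff_ofReal (contDiff_magPotential b j)).continuous).mul
        (hφ'.continuous.mul hψ.continuous)) hc'.mul_right.mul_left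
  have h := integral_mul_fderiv_eq_neg_fderiv_mul_of_integrable (v := EuclideanSpace.single j (1 : ℝ))
    i1 i2 i3 (fun x _ => differentiable_of_contDiff hφ' x)
    (fun x _ => differentiable_of_contDiff hψ x)
  have h' : ∫ x, φ' x * partialD j ψ x = -∫ x, partialD j φ' x * ψ x := h
  have e1 : ∀ x, starRingEnd ℂ (magGrad b φ j x) * ψ x =
      partialD j φ' x * ψ x + Complex.I * magPotential b j x * (φ' x * ψ x) := by
    intro x
    rw [hpd, magGrad_eq, map_sub, map_mul, map_mul, Complex.conj_I, Complex.conj_ofReal]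
    simp only [φ']
    ring
  have e2 : ∀ x, starRingEnd ℂ (φ x) * magGrad b ψ j x =
      φ' x * partialD j ψ x - Complex.I * magPotential b j x * (φ' x * ψ x) := by
    intro x
    rw [magGrad_eq]
    simp only [φ']
    ring
  simp only [e1, e2]
  rw [integral_add i1 i4, integral_sub i2 i4, h']
  ring

theorem partialD_magPotential_zero_one (b : ℝ) (x : E3) :
    partialD 0 (fun y => (magPotential b 1 y : ℂ)) x = (b / 2 : ℝ) := by
  have h : HasFDerivAt (fun y : E3 => ((b / 2 * y 0 : ℝ) : ℂ))
      (Complex.ofRealCLM ∘L ((b / 2) • (EuclideanSpace.proj (𝕜 := ℝ) 0 : E3 →L[ℝ] ℝ))) x :=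
    (Complex.ofRealCLM ∘L ((b / 2) • (EuclideanSpace.proj (𝕜 := ℝ) 0 : E3 →L[ℝ] ℝ))).hasFDerivAt
  have e : (fun y => (magPotential b 1 y : ℂ)) = fun y : E3 => ((b / 2 * y 0 : ℝ) : ℂ) := by
    ext y; simp [magPotential]; ring
  rw [partialD, e, h.fderiv]
  simp

theorem partialD_magPotential_one_zero (b : ℝ) (x : E3) :
    partialD 1 (fun y => (magPotential b 0 y : ℂ)) x = (-(b / 2) : ℝ) := by
  have h : HasFDerivAt (fun y : E3 => ((-(b / 2) * y 1 : ℝ) : ℂ))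
      (Complex.ofRealCLM ∘L ((-(b / 2)) • (EuclideanSpace.proj (𝕜 := ℝ) 1 : E3 →L[ℝ] ℝ))) x :=
    (Complex.ofRealCLM ∘L ((-(b / 2)) • (EuclideanSpace.proj (𝕜 := ℝ) 1 : E3 →L[ℝ] ℝ))).hasFDerivAt
  have e : (fun y => (magPotential b 0 y : ℂ)) = fun y : E3 => ((-(b / 2) * y 1 : ℝ) : ℂ) := by
    ext y; simp [magPotential]; ring
  rw [partialD, e, h.fderiv]
  simp

theorem partialD_comm {φ : E3 → ℂ} (hφ : ContDiff ℝ ∞ φ) (i j : Fin 3) (x : E3) :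
    partialD i (partialD j φ) x = partialD j (partialD i φ) x := by
  have h1 : DifferentiableAt ℝ (fderiv ℝ φ) x :=
    (hφ.fderiv_right (m := ∞) (by simp)).differentiable (by simp) x
  have e : ∀ i j : Fin 3, partialD i (partialD j φ) x =
      fderiv ℝ (fderiv ℝ φ) x (EuclideanSpace.single i 1) (EuclideanSpace.single j 1) := by
    intro i j
    have h := fderiv_clm_apply (u := fun _ => EuclideanSpace.single j (1 : ℝ)) h1
      (differentiableAt_const _)
    rw [partialD]
    unfold partialD
    rw [h]
    simp
  rw [e, e]
  exact (hφ.contDiffAt.isSymmSndFDerivAt (by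
    rw [minSmoothness_of_isRCLikeNormedField]
    exact WithTop.coe_le_coe.2 (le_top : (2 : ℕ∞) ≤ ⊤))).eq _ _

/-- The commutation relation `[D₁, D₂] = -ib` of the components of the magnetic gradient. -/
theorem magGrad_commutator (b : ℝ) {φ : E3 → ℂ} (hφ : ContDiff ℝ ∞ φ) (x : E3) :
    magGrad b (magGrad b φ 1) 0 x - magGrad b (magGrad b φ 0) 1 x = -Complex.I * b * φ x := by
  have hA := fun j => contDiff_ofReal (contDiff_magPotential b j)
  have key : ∀ i j : Fin 3, partialD i (magGrad b φ j) x = partialD i (partialD j φ) x -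
      Complex.I * (magPotential b j x * partialD i φ x +
        partialD i (fun y => (magPotential b j y : ℂ)) x * φ x) := by
    intro i j
    have e : magGrad b φ j = fun y => partialD j φ y +
        (-Complex.I) * ((magPotential b j y : ℂ) * φ y) := by
      ext y; rw [magGrad_eq]; ring
    rw [e, partialD_add (contDiff_partialD hφ j) (contDiff_const.mul ((hA j).mul hφ)),
      partialD_mul contDiff_const ((hA j).mul hφ), partialD_mul (hA j) hφ]
    simp only [partialD, fderiv_fun_const, Pi.zero_apply, zero_apply]
    ring
  rw [magGrad_eq, magGrad_eq b (magGrad b φ 0), key, key, magGrad_eq, magGrad_eq,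
    partialD_comm hφ 1 0, partialD_magPotential_zero_one, partialD_magPotential_one_zero]
  push_cast
  ring

theorem integrable_conj_mul {f g : E3 → ℂ} (hf : Continuous f) (hfc : HasCompactSupport f)
    (hg : Continuous g) : Integrable fun x => starRingEnd ℂ (f x) * g x :=
  integrable_of_continuous_of_hasCompactSupport
    ((Complex.continuous_conj.comp hf).mul hg) ((hfc.comp_left (map_zero _)).mul_right)

theorem integrable_norm_sq {f : E3 → ℂ} (hf : Continuous f) (hfc : HasCompactSupport f) :
    Integrable fun x => ‖f x‖ ^ 2 :=
  Continuous.integrable_of_hasCompactSupport (hf.norm.pow 2)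
    (hfc.comp_left (g := fun z : ℂ => ‖z‖ ^ 2) (by rw [norm_zero]; exact zero_pow two_ne_zero))

theorem integral_magGrad_commutator (b : ℝ) {φ : E3 → ℂ} (hφ : ContDiff ℝ ∞ φ)
    (hc : HasCompactSupport φ) :
    (∫ x, starRingEnd ℂ (magGrad b φ 1 x) * magGrad b φ 0 x) -
      ∫ x, starRingEnd ℂ (magGrad b φ 0 x) * magGrad b φ 1 x =
        -Complex.I * b * ((∫ x, ‖φ x‖ ^ 2 : ℝ) : ℂ) := by
  have hD := fun j => contDiff_magGrad b hφ j
  rw [integral_conj_magGrad_mul b hφ hc (hD 1) 0, integral_conj_magGrad_mul b hφ hc (hD 0) 1,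
    neg_sub_neg, ← integral_sub
      (integrable_conj_mul hφ.continuous hc (contDiff_magGrad b (hD 1) 0).continuous)
      (integrable_conj_mul hφ.continuous hc (contDiff_magGrad b (hD 0) 1).continuous),
    ← integral_complex_ofReal, ← integral_const_mul]
  congr 1
  ext1 x
  rw [← mul_sub, magGrad_commutator b hφ]
  have : starRingEnd ℂ (φ x) * φ x = ((‖φ x‖ ^ 2 : ℝ) : ℂ) := by
    rw [Complex.conj_mul']; norm_cast
  rw [← this]
  ring

/-- The lowest Landau level bounds the magnetic Dirichlet form from below. -/
theorem landau_lower_bound (b : ℝ) (hb : 0 < b) {φ : E3 → ℂ} (hφ : ContDiff ℝ ∞ φ)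
    (hc : HasCompactSupport φ) :
    b * ∫ x, ‖φ x‖ ^ 2 ≤ (∫ x, ‖magGrad b φ 0 x‖ ^ 2) + ∫ x, ‖magGrad b φ 1 x‖ ^ 2 := by
  have hD := fun j => (contDiff_magGrad b hφ j).continuous
  have hDc := fun j => hasCompactSupport_magGrad b hc j
  have h5 := congrArg norm (integral_magGrad_commutator b hφ hc)
  rw [← integral_sub (integrable_conj_mul (hD 1) (hDc 1) (hD 0))
    (integrable_conj_mul (hD 0) (hDc 0) (hD 1)), norm_mul, norm_mul, norm_neg, Complex.norm_I,
    one_mul, Complex.norm_real, Complex.norm_real,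
    Real.norm_of_nonneg hb.le, Real.norm_of_nonneg (integral_nonneg fun x => by positivity)] at h5
  rw [← h5, ← integral_add (integrable_norm_sq (hD 0) (hDc 0)) (integrable_norm_sq (hD 1) (hDc 1))]
  refine norm_integral_le_of_norm_le
    ((integrable_norm_sq (hD 0) (hDc 0)).add (integrable_norm_sq (hD 1) (hDc 1)))
    (ae_of_all _ fun x => ?_)
  refine (norm_sub_le _ _).trans ?_
  rw [norm_mul, norm_mul, RCLike.norm_conj, RCLike.norm_conj]
  nlinarith [sq_nonneg (‖magGrad b φ 0 x‖ - ‖magGrad b φ 1 x‖)]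

/-! ### The form domains as subspaces -/

/-- The pairs `(φ, ∇^A φ)` for test functions `φ ∈ C_c^∞(U)`. -/
def dirichletCore (b : ℝ) (μ : Measure E3) (U : Set E3) :
    Submodule ℂ (Lp ℂ 2 μ × (Fin 3 → Lp ℂ 2 μ)) where
  carrier := {p | ∃ φ : E3 → ℂ, ContDiff ℝ ∞ φ ∧ HasCompactSupport φ ∧ tsupport φ ⊆ U ∧
    p.1 =ᵐ[μ] φ ∧ ∀ j, p.2 j =ᵐ[μ] magGrad b φ j}
  add_mem' := by
    rintro p p' ⟨φ, h1, h2, h3, h4, h5⟩ ⟨φ', h1', h2', h3', h4', h5'⟩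
    refine ⟨fun x => φ x + φ' x, h1.add h1', h2.add h2', (tsupport_add φ φ').trans
      (Set.union_subset h3 h3'), ?_, fun j => ?_⟩
    · filter_upwards [Lp.coeFn_add p.1 p'.1, h4, h4'] with x e1 e2 e3
      rw [Prod.fst_add, e1, Pi.add_apply, e2, e3]
    · filter_upwards [Lp.coeFn_add (p.2 j) (p'.2 j), h5 j, h5' j] with x e1 e2 e3
      rw [Prod.snd_add, Pi.add_apply, e1, Pi.add_apply, e2, e3, magGrad_add b h1 h1']
  zero_mem' := by
    refine ⟨fun _ => 0, contDiff_const, HasCompactSupport.zero, by simp [tsupport], ?_, fun j => ?_⟩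
    · exact Lp.coeFn_zero _ _ _
    · filter_upwards [Lp.coeFn_zero ℂ 2 μ] with x hx
      rw [Prod.snd_zero, Pi.zero_apply, hx, Pi.zero_apply, magGrad]
      simp
  smul_mem' := by
    rintro a p ⟨φ, h1, h2, h3, h4, h5⟩
    refine ⟨fun x => a * φ x, contDiff_const.mul h1, h2.mul_left, ?_, ?_, fun j => ?_⟩
    · exact (closure_mono (Function.support_mul_subset_right _ _)).trans h3
    · filter_upwards [Lp.coeFn_smul a p.1, h4] with x e1 e2
      rw [Prod.smul_fst, e1, Pi.smul_apply, e2, smul_eq_mul]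
    · filter_upwards [Lp.coeFn_smul a (p.2 j), h5 j] with x e1 e2
      rw [Prod.smul_snd, Pi.smul_apply, e1, Pi.smul_apply, e2, smul_eq_mul, magGrad_const_mul b a h1]

/-- The form domain of the Dirichlet realization, with gradients, as a closed subspace. -/
def dirichletForm (b : ℝ) (U : Set E3) : Submodule ℂ (L2on U × (Fin 3 → L2on U)) :=
  (dirichletCore b (volume.restrict U) U).topologicalClosure

theorem coe_dirichletForm (b : ℝ) (U : Set E3) :
    (dirichletForm b U : Set (L2on U × (Fin 3 → L2on U))) = dirichletFormDomain b U :=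
  Submodule.topologicalClosure_coe _

theorem dirichletOp_eq (b : ℝ) (U : Set E3) : dirichletOp b U =
    formOp (dirichletForm b U : Set (L2on U × (Fin 3 → L2on U))) fun h g => ∑ j, ⟪h j, g j⟫_ℂ := by
  rw [coe_dirichletForm]; rfl

/-- The form domain on the whole space `ℝ³`. -/
def freeForm (b : ℝ) : Submodule ℂ (L2 × (Fin 3 → L2)) :=
  (dirichletCore b volume Set.univ).topologicalClosure

/-- The operator `H₀` on `L²(ℝ³)`. -/
def freeOp (b : ℝ) : Set (L2 × L2) :=
  formOp (freeForm b : Set (L2 × (Fin 3 → L2))) fun h g => ∑ j, ⟪h j, g j⟫_ℂ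

/-- The triples `(φ, ∇^A φ, φ|_{∂U})` for test functions `φ ∈ C_c^∞(ℝ³)`. -/
def robinCore (b : ℝ) (U : Set E3) :
    Submodule ℂ (L2on U × (Fin 3 → L2on U) × L2surface (frontier U)) where
  carrier := {p | ∃ φ : E3 → ℂ, ContDiff ℝ ∞ φ ∧ HasCompactSupport φ ∧
    p.1 =ᵐ[volume.restrict U] φ ∧ (∀ j, p.2.1 j =ᵐ[volume.restrict U] magGrad b φ j) ∧
    p.2.2 =ᵐ[(μHE[2] : Measure E3).restrict (frontier U)] φ}
  add_mem' := by
    rintro p p' ⟨φ, h1, h2, h4, h5, h6⟩ ⟨φ', h1', h2', h4', h5', h6'⟩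
    refine ⟨fun x => φ x + φ' x, h1.add h1', h2.add h2', ?_, fun j => ?_, ?_⟩
    · filter_upwards [Lp.coeFn_add p.1 p'.1, h4, h4'] with x e1 e2 e3
      rw [Prod.fst_add, e1, Pi.add_apply, e2, e3]
    · filter_upwards [Lp.coeFn_add (p.2.1 j) (p'.2.1 j), h5 j, h5' j] with x e1 e2 e3
      rw [Prod.snd_add, Prod.fst_add, Pi.add_apply, e1, Pi.add_apply, e2, e3, magGrad_add b h1 h1']
    · filter_upwards [Lp.coeFn_add p.2.2 p'.2.2, h6, h6'] with x e1 e2 e3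
      rw [Prod.snd_add, Prod.snd_add, e1, Pi.add_apply, e2, e3]
  zero_mem' := by
    refine ⟨fun _ => 0, contDiff_const, HasCompactSupport.zero, ?_, fun j => ?_, ?_⟩
    · exact Lp.coeFn_zero _ _ _
    · filter_upwards [Lp.coeFn_zero ℂ 2 (volume.restrict U)] with x hx
      rw [Prod.snd_zero, Prod.fst_zero, Pi.zero_apply, hx, Pi.zero_apply, magGrad]
      simp
    · exact Lp.coeFn_zero _ _ _
  smul_mem' := by
    rintro a p ⟨φ, h1, h2, h4, h5, h6⟩
    refine ⟨fun x => a * φ x, contDiff_const.mul h1, h2.mul_left, ?_, fun j => ?_, ?_⟩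
    · filter_upwards [Lp.coeFn_smul a p.1, h4] with x e1 e2
      rw [Prod.smul_fst, e1, Pi.smul_apply, e2, smul_eq_mul]
    · filter_upwards [Lp.coeFn_smul a (p.2.1 j), h5 j] with x e1 e2
      rw [Prod.smul_snd, Prod.smul_fst, Pi.smul_apply, e1, Pi.smul_apply, e2, smul_eq_mul,
        magGrad_const_mul b a h1]
    · filter_upwards [Lp.coeFn_smul a p.2.2, h6] with x e1 e2
      rw [Prod.smul_snd, Prod.smul_snd, e1, Pi.smul_apply, e2, smul_eq_mul]

/-- The magnetic Sobolev space `H¹_A(U)`, with gradients and traces, as a closed subspace. -/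
def robinForm (b : ℝ) (U : Set E3) :
    Submodule ℂ (L2on U × (Fin 3 → L2on U) × L2surface (frontier U)) :=
  (robinCore b U).topologicalClosure

/-- The sesquilinear Robin form as a function of gradients and traces. -/
def robinPairing (γ : E3 → ℝ) (U : Set E3)
    (h g : (Fin 3 → L2on U) × L2surface (frontier U)) : ℂ :=
  ∑ j, ⟪h.1 j, g.1 j⟫_ℂ
    + ∫ x in frontier U, (γ x : ℂ) * (starRingEnd ℂ (h.2 x) * g.2 x) ∂(μHE[2] : Measure E3)

theorem coe_robinForm (b : ℝ) (U : Set E3) :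
    (robinForm b U : Set (L2on U × (Fin 3 → L2on U) × L2surface (frontier U))) =
      robinFormDomain b U :=
  Submodule.topologicalClosure_coe _

theorem robinOp_eq (b : ℝ) (γ : E3 → ℝ) (U : Set E3) : robinOp b γ U =
    formOp (robinForm b U : Set (L2on U × (Fin 3 → L2on U) × L2surface (frontier U)))
      (robinPairing γ U) := by
  rw [coe_robinForm]
  ext p
  constructor
  · rintro ⟨g, s, h1, h2⟩
    exact ⟨(g, s), h1, fun v h hv => h2 v h.1 h.2 hv⟩
  · rintro ⟨⟨g, s⟩, h1, h2⟩
    exact ⟨g, s, h1, fun v h t hv => h2 v (h, t) hv⟩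

theorem dirichletOp_symm (b : ℝ) (U : Set E3) : ∀ p ∈ dirichletOp b U, ∀ p' ∈ dirichletOp b U,
    ⟪p.1, p'.2⟫_ℂ = ⟪p.2, p'.1⟫_ℂ := by
  rw [dirichletOp_eq]
  refine formOp_symm fun h g => ?_
  rw [map_sum]
  exact Finset.sum_congr rfl fun j _ => inner_conj_symm _ _

theorem freeOp_symm (b : ℝ) : ∀ p ∈ freeOp b, ∀ p' ∈ freeOp b, ⟪p.1, p'.2⟫_ℂ = ⟪p.2, p'.1⟫_ℂ := by
  refine formOp_symm fun h g => ?_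
  rw [map_sum]
  exact Finset.sum_congr rfl fun j _ => inner_conj_symm _ _

theorem robinOp_symm (b : ℝ) (γ : E3 → ℝ) (U : Set E3) : ∀ p ∈ robinOp b γ U, ∀ p' ∈ robinOp b γ U,
    ⟪p.1, p'.2⟫_ℂ = ⟪p.2, p'.1⟫_ℂ := by
  rw [robinOp_eq]
  refine formOp_symm fun h g => ?_
  rw [robinPairing, robinPairing, map_add, map_sum, ← integral_conj]
  congr 1
  · exact Finset.sum_congr rfl fun j _ => inner_conj_symm _ _
  · congr 1
    ext x
    simp only [map_mul, Complex.conj_conj, Complex.conj_ofReal]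
    ring

theorem norm_sq_core {μ : Measure E3} {f : Lp ℂ 2 μ} {φ : E3 → ℂ} (h : f =ᵐ[μ] φ) :
    ‖f‖ ^ 2 = ∫ x, ‖φ x‖ ^ 2 ∂μ := by
  rw [norm_sq_eq_integral]
  refine integral_congr_ae ?_
  filter_upwards [h] with x hx
  rw [hx]

theorem mem_of_mem_topologicalClosure {E : Type*} [NormedAddCommGroup E] [NormedSpace ℂ E]
    {C : Submodule ℂ E} {S : Set E} (hS : IsClosed S) (h : ∀ x ∈ C, x ∈ S) {x : E}
    (hx : x ∈ C.topologicalClosure) : x ∈ S := by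
  rw [← SetLike.mem_coe, Submodule.topologicalClosure_coe] at hx
  exact closure_minimal h hS hx

theorem norm_sq_core_of_support {U : Set E3} {f : L2on U} {φ : E3 → ℂ}
    (h : f =ᵐ[volume.restrict U] φ) (hz : ∀ x ∉ U, φ x = 0) : ‖f‖ ^ 2 = ∫ x, ‖φ x‖ ^ 2 := by
  rw [norm_sq_core h]
  refine setIntegral_eq_integral_of_forall_compl_eq_zero fun x hx => ?_
  rw [hz x hx, norm_zero]
  exact zero_pow two_ne_zero

theorem dirichletCore_lower_bound (hb : 0 < b) (U : Set E3) (p : L2on U × (Fin 3 → L2on U))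
    (h : p ∈ dirichletCore b (volume.restrict U) U) : b * ‖p.1‖ ^ 2 ≤ ∑ j, ‖p.2 j‖ ^ 2 := by
  obtain ⟨φ, h1, h2, h3, h4, h5⟩ := h
  have e := norm_sq_core_of_support h4 fun x hx => image_eq_zero_of_notMem_tsupport fun h => hx (h3 h)
  have e' := fun j => norm_sq_core_of_support (h5 j) fun x hx =>
    magGrad_eq_zero b j fun h => hx (h3 h)
  rw [Fin.sum_univ_three, e, e', e']
  exact (landau_lower_bound b hb h1 h2).trans (le_add_of_nonneg_right (sq_nonneg _))

theorem dirichletForm_lower_bound (hb : 0 < b) (U : Set E3) (u : L2on U) (g : Fin 3 → L2on U)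
    (h : (u, g) ∈ dirichletForm b U) : b * ‖u‖ ^ 2 ≤ ∑ j, ‖g j‖ ^ 2 := by
  have hcl : IsClosed {p : L2on U × (Fin 3 → L2on U) | b * ‖p.1‖ ^ 2 ≤ ∑ j, ‖p.2 j‖ ^ 2} :=
    isClosed_le (continuous_const.mul (continuous_fst.norm.pow 2))
      (continuous_finsetSum _ fun j _ => ((continuous_apply j).comp continuous_snd).norm.pow 2)
  have h1 := mem_of_mem_topologicalClosure hcl (dirichletCore_lower_bound hb U) h
  exact h1

/-- The Dirichlet realization is bounded below by `b`. -/
theorem exists_resolvent_dirichletOp (hb : 0 < b) {c : ℝ} (hc : 0 ≤ c) (U : Set E3) :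
    ∃ R, IsResolventAt (dirichletOp b U) (-(c : ℂ)) R := by
  obtain ⟨R, -, h, -⟩ := exists_resolvent_formOp (dirichletForm b U)
    (Submodule.isClosed_topologicalClosure _) hb hc (dirichletForm_lower_bound hb U)
  rw [dirichletOp_eq]
  exact ⟨R, h⟩

/-! ### The free operator -/

theorem restrictTo_ae_eq {U : Set E3} {f : L2} {φ : E3 → ℂ} (h : f =ᵐ[volume] φ) :
    restrictTo U f =ᵐ[volume.restrict U] φ :=
  (coeFn_restrictTo U f).trans (ae_restrict_of_ae h)

theorem mem_freeForm_iff (b : ℝ) (u : L2) (g : Fin 3 → L2) : (u, g) ∈ freeForm b ↔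
    (restrictTo Set.univ u, fun j => restrictTo Set.univ (g j)) ∈ dirichletForm b Set.univ := by
  constructor
  · intro h
    refine map_mem_closure (f := fun p : L2 × (Fin 3 → L2) =>
      (restrictTo Set.univ p.1, fun j => restrictTo Set.univ (p.2 j))) (by fun_prop) h ?_
    rintro p ⟨φ, h1, h2, h3, h4, h5⟩
    exact ⟨φ, h1, h2, h3, restrictTo_ae_eq h4, fun j => restrictTo_ae_eq (h5 j)⟩
  · intro h
    have h2 := map_mem_closure (t := (dirichletCore b volume Set.univ : Set _))
      (f := fun p : L2on Set.univ × (Fin 3 → L2on Set.univ) =>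
      (extendZero Set.univ p.1, fun j => extendZero Set.univ (p.2 j))) (by fun_prop) h ?_
    · simp only [extendZero_univ_restrictTo] at h2
      exact h2
    · have e : ∀ (f : L2on Set.univ) (φ : E3 → ℂ), f =ᵐ[volume.restrict Set.univ] φ →
          extendZero Set.univ f =ᵐ[volume] φ := by
        intro f φ h
        have h1 := coeFn_extendZero MeasurableSet.univ f
        rw [Set.indicator_univ] at h1
        filter_upwards [h1, (ae_restrict_iff' MeasurableSet.univ).1 h] with x e1 e2
        rw [e1, e2 (Set.mem_univ x)]
      rintro p ⟨φ, h1, h2, h3, h4, h5⟩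
      exact ⟨φ, h1, h2, h3, e _ _ h4, fun j => e _ _ (h5 j)⟩

theorem inner_restrictTo_univ (f g : L2) :
    ⟪restrictTo Set.univ f, restrictTo Set.univ g⟫_ℂ = ⟪f, g⟫_ℂ := by
  rw [← inner_extendZero, extendZero_univ_restrictTo]

theorem norm_restrictTo_univ (f : L2) : ‖restrictTo Set.univ f‖ = ‖f‖ := by
  rw [← norm_extendZero MeasurableSet.univ, extendZero_univ_restrictTo]

theorem mem_freeOp_iff (b : ℝ) (u w : L2) : (u, w) ∈ freeOp b ↔
    (restrictTo Set.univ u, restrictTo Set.univ w) ∈ dirichletOp b Set.univ := by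
  rw [dirichletOp_eq]
  constructor
  · rintro ⟨g, hg, h⟩
    refine ⟨_, (mem_freeForm_iff b u g).1 hg, fun v h' hv => ?_⟩
    have h2 := h (extendZero Set.univ v) (fun j => extendZero Set.univ (h' j))
      ((mem_freeForm_iff b _ _).2 (by simp only [restrictTo_extendZero MeasurableSet.univ]; exact hv))
    simpa only [inner_extendZero] using h2
  · rintro ⟨g, hg, h⟩
    refine ⟨fun j => extendZero Set.univ (g j), (mem_freeForm_iff b _ _).2
      (by simp only [restrictTo_extendZero MeasurableSet.univ]; exact hg), fun v h' hv => ?_⟩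
    have h2 := h _ _ ((mem_freeForm_iff b v h').1 hv)
    simp only [inner_extendZero', inner_restrictTo_univ] at h2 ⊢
    exact h2

theorem freeForm_lower_bound (hb : 0 < b) (u : L2) (g : Fin 3 → L2)
    (h : (u, g) ∈ freeForm b) : b * ‖u‖ ^ 2 ≤ ∑ j, ‖g j‖ ^ 2 := by
  have := dirichletForm_lower_bound hb _ _ _ ((mem_freeForm_iff b u g).1 h)
  simpa only [norm_restrictTo_univ] using this

/-- The resolvent `(H₀ + c)⁻¹` and the operators `∇^A (H₀ + c)⁻¹`. -/
theorem exists_resolvent_freeOp (hb : 0 < b) {c : ℝ} (hc : 0 ≤ c) :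
    ∃ (R : L2 →L[ℂ] L2) (G : Fin 3 → L2 →L[ℂ] L2), IsResolventAt (freeOp b) (-(c : ℂ)) R ∧
      ∀ f, (R f, fun j => G j f) ∈ freeForm b :=
  exists_resolvent_formOp (freeForm b) (Submodule.isClosed_topologicalClosure _) hb hc
    (freeForm_lower_bound hb)

theorem freeResolvent_eq {c : ℝ} {z : ℂ} {R : L2 →L[ℂ] L2}
    (h : IsResolventAt (freeOp b) (z - c) R) : freeResolvent b c z = R := by
  have h1 : IsResolventAt (dirichletOp b Set.univ) (z - c)
      (restrictTo Set.univ ∘L R ∘L extendZero Set.univ) := by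
    constructor
    · intro f
      have h2 := (mem_freeOp_iff b _ _).1 (h.1 (extendZero Set.univ f))
      rw [map_add, map_smul, restrictTo_extendZero MeasurableSet.univ] at h2
      exact h2
    · rintro ⟨u, w⟩ hp
      have h2 := h.2 (extendZero Set.univ u, extendZero Set.univ w) ((mem_freeOp_iff b _ _).2
        (by simpa only [restrictTo_extendZero MeasurableSet.univ] using hp))
      simp only [← map_smul, ← map_sub] at h2
      simp only [ContinuousLinearMap.comp_apply]
      rw [h2, restrictTo_extendZero MeasurableSet.univ]
  rw [freeResolvent, h1.eq_resolventAt]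
  ext1 f
  rw [extendOp_apply]
  simp only [ContinuousLinearMap.comp_apply, extendZero_univ_restrictTo]

end

section

variable {b : ℝ}

/-! ### Smooth functions in the domain of the free operator -/

/-- Dilations of one bump function: they exhaust `ℝ³`, and their gradients tend to zero
uniformly. -/
theorem exists_cutoff_sequence : ∃ (χ : ℕ → E3 → ℂ) (C : ℝ), (∀ n, ContDiff ℝ ∞ (χ n)) ∧
    (∀ n, HasCompactSupport (χ n)) ∧ (∀ n x, ‖χ n x‖ ≤ 1) ∧
    (∀ x, Tendsto (fun n => χ n x) atTop (𝓝 1)) ∧ 0 ≤ C ∧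
    ∀ n j x, ‖partialD j (χ n) x‖ ≤ C * (1 / ((n : ℝ) + 1)) := by
  let θ : ContDiffBump (0 : E3) := ⟨1, 2, one_pos, one_lt_two⟩
  let Θ : E3 → ℂ := fun x => (θ x : ℂ)
  have hΘ : ContDiff ℝ ∞ Θ := contDiff_ofReal θ.contDiff
  have hΘc : HasCompactSupport Θ := θ.hasCompactSupport.comp_left (g := Complex.ofReal) rfl
  have hr : ∀ n : ℕ, (1 / ((n : ℝ) + 1)) ≠ 0 := fun n => by positivity
  have hlim : Tendsto (fun n : ℕ => 1 / ((n : ℝ) + 1)) atTop (𝓝 0) :=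
    tendsto_one_div_add_atTop_nhds_zero_nat
  have hbd : ∀ j, ∃ C, ∀ x, ‖partialD j Θ x‖ ≤ C := fun j =>
    (hΘc.fderiv_apply ℝ _).exists_bound_of_continuous (contDiff_partialD hΘ j).continuous
  choose C hC using hbd
  have hC0 : ∀ j, 0 ≤ C j := fun j => (norm_nonneg _).trans (hC j 0)
  refine ⟨fun n x => Θ ((1 / ((n : ℝ) + 1)) • x), ∑ j, C j, fun n => hΘ.comp (contDiff_const_smul _),
    fun n => hΘc.comp_smul (hr n), fun n x => ?_, fun x => ?_, Finset.sum_nonneg fun j _ => hC0 j,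
    fun n j x => ?_⟩
  · simp only [Θ, Complex.norm_real, Real.norm_of_nonneg θ.nonneg]
    exact θ.le_one
  · have h1 : Tendsto (fun n : ℕ => (1 / ((n : ℝ) + 1)) • x) atTop (𝓝 0) := by
      simpa using hlim.smul_const x
    have h2 := (hΘ.continuous.tendsto 0).comp h1
    have h3 : Θ 0 = 1 := by
      simp only [Θ]
      rw [θ.one_of_mem_closedBall (by simp [θ.rIn_pos.le]), Complex.ofReal_one]
    rwa [h3] at h2
  · have h1 : partialD j (fun x => Θ ((1 / ((n : ℝ) + 1)) • x)) x =
        (1 / ((n : ℝ) + 1)) • partialD j Θ ((1 / ((n : ℝ) + 1)) • x) := by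
      rw [partialD, fderiv_comp_smul]
      rfl
    rw [h1, norm_smul, Real.norm_of_nonneg (by positivity), mul_comm]
    gcongr
    exact (hC j _).trans (Finset.single_le_sum (fun j _ => hC0 j) (Finset.mem_univ j))

theorem isMultiplier_of_compact {χ : E3 → ℂ} (h : Continuous χ) (hc : HasCompactSupport χ) :
    IsMultiplier χ :=
  ⟨h.measurable, hc.exists_bound_of_continuous h⟩

theorem hasCompactSupport_partialD {χ : E3 → ℂ} (hc : HasCompactSupport χ) (j : Fin 3) :
    HasCompactSupport (partialD j χ) := hc.fderiv_apply ℝ _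

/-- Smooth square-integrable functions with square-integrable magnetic gradient belong to the form
domain. -/
theorem mem_freeForm_of_contDiff {Ψ : E3 → ℂ} (hΨ : ContDiff ℝ ∞ Ψ) {u : L2} {g : Fin 3 → L2}
    (hu : u =ᵐ[volume] Ψ) (hg : ∀ j, g j =ᵐ[volume] magGrad b Ψ j) : (u, g) ∈ freeForm b := by
  obtain ⟨χ, C, h1, h2, h3, h4, h5, h6⟩ := exists_cutoff_sequence
  have hm : ∀ n, IsMultiplier (χ n) := fun n => isMultiplier_of_compact (h1 n).continuous (h2 n)
  have hmd : ∀ n j, IsMultiplier (partialD j (χ n)) := fun n j =>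
    isMultiplier_of_compact (contDiff_partialD (h1 n) j).continuous
      (hasCompactSupport_partialD (h2 n) j)
  let p : ℕ → L2 × (Fin 3 → L2) := fun n => (mulOp volume (χ n) u,
    fun j => mulOp volume (χ n) (g j) + mulOp volume (partialD j (χ n)) u)
  have hp : ∀ n, p n ∈ dirichletCore b volume Set.univ := by
    intro n
    refine ⟨fun x => χ n x * Ψ x, (h1 n).mul hΨ, (h2 n).mul_right, Set.subset_univ _, ?_, fun j => ?_⟩
    · filter_upwards [coeFn_mulOp (hm n) u, hu] with x e1 e2
      rw [e1, e2]
    · filter_upwards [Lp.coeFn_add (mulOp volume (χ n) (g j)) (mulOp volume (partialD j (χ n)) u),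
        coeFn_mulOp (hm n) (g j), coeFn_mulOp (hmd n j) u, hu, hg j] with x e1 e2 e3 e4 e5
      rw [e1, Pi.add_apply, e2, e3, e4, e5, magGrad_mul b (h1 n) hΨ]
  have hlim : Tendsto p atTop (𝓝 (u, g)) := by
    have l1 : ∀ f : L2, Tendsto (fun n => mulOp volume (χ n) f) atTop (𝓝 f) := fun f => by
      have := tendsto_mulOp_apply (μ := volume) (m := χ) (m₀ := fun _ => (1 : ℂ)) (l := atTop) (C := 1)
        (fun n => (hm n).measurable) measurable_const h3 (fun x => by simp) h4 f
      rwa [mulOp_one] at this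
    refine Tendsto.prodMk_nhds (l1 u) (tendsto_pi_nhds.2 fun j => ?_)
    have l2 : Tendsto (fun n => mulOp volume (partialD j (χ n)) u) atTop (𝓝 0) := by
      rw [tendsto_zero_iff_norm_tendsto_zero]
      have l3 : Tendsto (fun n : ℕ => C * (1 / ((n : ℝ) + 1)) * ‖u‖) atTop (𝓝 0) := by
        simpa using (tendsto_one_div_add_atTop_nhds_zero_nat.const_mul C).mul_const ‖u‖
      exact squeeze_zero (fun n => norm_nonneg _)
        (fun n => norm_mulOp_apply_le (hmd n j) (h6 n j) u) l3
    simpa using (l1 (g j)).add l2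
  rw [freeForm, ← SetLike.mem_coe, Submodule.topologicalClosure_coe]
  exact mem_closure_of_tendsto hlim (Eventually.of_forall hp)

theorem inner_eq_integral {μ : Measure E3} {f g : Lp ℂ 2 μ} {φ ψ : E3 → ℂ} (hf : f =ᵐ[μ] φ)
    (hg : g =ᵐ[μ] ψ) : ⟪f, g⟫_ℂ = ∫ x, starRingEnd ℂ (φ x) * ψ x ∂μ := by
  rw [L2.inner_def]
  refine integral_congr_ae ?_
  filter_upwards [hf, hg] with x e1 e2
  rw [e1, e2, RCLike.inner_apply, mul_comm]

theorem mem_freeOp_of_forall_core {u w : L2} {g : Fin 3 → L2} (hg : (u, g) ∈ freeForm b)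
    (h : ∀ φ : E3 → ℂ, ContDiff ℝ ∞ φ → HasCompactSupport φ → ∀ (v : L2) (h : Fin 3 → L2),
      v =ᵐ[volume] φ → (∀ j, h j =ᵐ[volume] magGrad b φ j) → ∑ j, ⟪h j, g j⟫_ℂ = ⟪v, w⟫_ℂ) :
    (u, w) ∈ freeOp b := by
  refine ⟨g, hg, fun v h' hv => ?_⟩
  have hcl : IsClosed {p : L2 × (Fin 3 → L2) | ∑ j, ⟪p.2 j, g j⟫_ℂ = ⟪p.1, w⟫_ℂ} :=
    isClosed_eq (continuous_finsetSum _ fun j _ =>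
      ((continuous_apply j).comp continuous_snd).inner continuous_const)
      (continuous_fst.inner continuous_const)
  have h1 := mem_of_mem_topologicalClosure hcl ?_ hv
  · exact h1
  · rintro ⟨v, h'⟩ ⟨φ, h1, h2, -, h4, h5⟩
    exact h φ h1 h2 v h' h4 h5

/-- Smooth functions in the domain of the free operator. -/
theorem mem_freeOp_of_contDiff {Ψ : E3 → ℂ} (hΨ : ContDiff ℝ ∞ Ψ) {u w : L2} {g : Fin 3 → L2}
    (hu : u =ᵐ[volume] Ψ) (hg : ∀ j, g j =ᵐ[volume] magGrad b Ψ j)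
    (hw : w =ᵐ[volume] fun x => -∑ j, magGrad b (magGrad b Ψ j) j x) : (u, w) ∈ freeOp b := by
  refine mem_freeOp_of_forall_core (mem_freeForm_of_contDiff hΨ hu hg) fun φ hφ hc v h hv hh => ?_
  rw [inner_eq_integral hv hw]
  have hD := fun j => contDiff_magGrad b hΨ j
  have e1 : ∀ j, ⟪h j, g j⟫_ℂ = -∫ x, starRingEnd ℂ (φ x) * magGrad b (magGrad b Ψ j) j x :=
    fun j => by rw [inner_eq_integral (hh j) (hg j), integral_conj_magGrad_mul b hφ hc (hD j) j]
  simp only [e1]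
  rw [Finset.sum_neg_distrib, ← integral_finsetSum _ fun j _ =>
    integrable_conj_mul hφ.continuous hc (contDiff_magGrad b (hD j) j).continuous, ← integral_neg]
  congr 1
  ext1 x
  rw [← Finset.mul_sum]
  ring

/-! ### Invariance under the dual magnetic translations -/

theorem contDiff_magPhase (b : ℝ) (s : E3) : ContDiff ℝ ∞ (magPhase b s) := by
  have h0 := contDiff_coord 0
  have h1 := contDiff_coord 1
  unfold magPhase
  exact (contDiff_const.mul (contDiff_ofReal (contDiff_const.mul
    ((h0.mul contDiff_const).sub (h1.mul contDiff_const))))).cexp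

theorem partialD_magPhase (b : ℝ) (s x : E3) (j : Fin 3) : partialD j (magPhase b s) x =
    Complex.I * (b / 2 * ![s 1, -s 0, 0] j : ℝ) * magPhase b s x := by
  let L : E3 →L[ℝ] ℝ := (b / 2) • (s 1 • (EuclideanSpace.proj (𝕜 := ℝ) 0 : E3 →L[ℝ] ℝ) -
    s 0 • (EuclideanSpace.proj (𝕜 := ℝ) 1 : E3 →L[ℝ] ℝ))
  have e : magPhase b s = fun x => Complex.exp (Complex.I * ((L x : ℝ) : ℂ)) := by
    ext x
    simp [magPhase, L]
    ring_nf
  have h := ((Complex.ofRealCLM ∘L L).hasFDerivAt (x := x)).const_mul Complex.I |>.cexp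
  have h2 : fderiv ℝ (fun x => Complex.exp (Complex.I * ((L x : ℝ) : ℂ))) x =
    Complex.exp (Complex.I * ((L x : ℝ) : ℂ)) • Complex.I • (Complex.ofRealCLM ∘L L) := h.fderiv
  rw [partialD, e, h2]
  fin_cases j <;> simp [L] <;> ring_nf

/-- The components of the magnetic gradient commute with the dual magnetic translations. -/
theorem magGrad_translate (b : ℝ) (s : E3) {φ : E3 → ℂ} (hφ : ContDiff ℝ ∞ φ) (j : Fin 3) (x : E3) :
    magGrad b (fun y => magPhase (-b) s y * φ (y - s)) j x =
      magPhase (-b) s x * magGrad b φ j (x - s) := by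
  have h1 : ContDiff ℝ ∞ fun y => φ (y - s) := hφ.comp (contDiff_id.sub contDiff_const)
  have h2 : partialD j (fun y => φ (y - s)) x = partialD j φ (x - s) := by
    rw [partialD, fderiv_comp_sub]; rfl
  rw [magGrad_mul b (contDiff_magPhase _ s) h1, magGrad_eq, magGrad_eq, h2, partialD_magPhase]
  fin_cases j <;> simp [magPotential] <;> ring_nf

theorem translate_mem_freeForm (s : E3) {u : L2} {g : Fin 3 → L2} (h : (u, g) ∈ freeForm b) :
    (magTrans (-b) s u, fun j => magTrans (-b) s (g j)) ∈ freeForm b := by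
  have h' : (u, g) ∈ closure (dirichletCore b volume Set.univ : Set (L2 × (Fin 3 → L2))) := by
    rwa [freeForm, ← SetLike.mem_coe, Submodule.topologicalClosure_coe] at h
  have h2 := map_mem_closure (t := (dirichletCore b volume Set.univ : Set (L2 × (Fin 3 → L2))))
    (f := fun p : L2 × (Fin 3 → L2) => (magTrans (-b) s p.1, fun j => magTrans (-b) s (p.2 j)))
    (by fun_prop) h' ?_
  · rwa [freeForm, ← SetLike.mem_coe, Submodule.topologicalClosure_coe]
  · rintro p ⟨φ, h1, h2, h3, h4, h5⟩
    have hq : ∀ {f : L2} {ψ : E3 → ℂ}, f =ᵐ[volume] ψ →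
        magTrans (-b) s f =ᵐ[volume] fun x => magPhase (-b) s x * ψ (x - s) := by
      intro f ψ hf
      have e := (measurePreserving_sub_right (volume : Measure E3) s).quasiMeasurePreserving.ae_eq_comp hf
      filter_upwards [coeFn_magTrans (-b) s f, e] with x e1 e2
      simp only [Function.comp] at e2
      rw [e1, e2]
    refine ⟨fun x => magPhase (-b) s x * φ (x - s),
      (contDiff_magPhase _ s).mul (h1.comp (contDiff_id.sub contDiff_const)), ?_, Set.subset_univ _,
      hq h4, fun j => ?_⟩
    · have : HasCompactSupport fun x => φ (x - s) :=
        h2.comp_homeomorph (Homeomorph.subRight s)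
      exact this.mul_left
    · filter_upwards [hq (h5 j)] with x hx
      rw [hx, magGrad_translate b s h1]

theorem translate_mem_freeOp (s : E3) {u w : L2} (h : (u, w) ∈ freeOp b) :
    (magTrans (-b) s u, magTrans (-b) s w) ∈ freeOp b := by
  obtain ⟨g, hg, h⟩ := h
  refine ⟨_, translate_mem_freeForm s hg, fun v h' hv => ?_⟩
  have h2 := h _ _ (translate_mem_freeForm (-s) hv)
  have e : ∀ f f' : L2, ⟪magTrans (-b) (-s) f, f'⟫_ℂ = ⟪f, magTrans (-b) s f'⟫_ℂ := fun f f' => by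
    rw [← magTrans_adjoint, ContinuousLinearMap.adjoint_inner_left]
  simp only [e] at h2 ⊢
  exact h2

/-- The resolvent of the free operator commutes with the dual magnetic translations. -/
theorem resolvent_mul_magTrans {ξ : ℂ} {R : L2 →L[ℂ] L2} (hR : IsResolventAt (freeOp b) ξ R)
    (s : E3) : R * magTrans (-b) s = magTrans (-b) s * R := by
  ext1 f
  have h1 := hR.2 _ (translate_mem_freeOp s (hR.1 f))
  rw [map_add, map_smul, add_sub_cancel_right] at h1
  exact h1

end

section

variable {b : ℝ}

/-! ### Laguerre functions -/

open Polynomial in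
/-- The Laguerre polynomial, as a polynomial. -/
def laguerrePoly (q : ℕ) : ℝ[X] :=
  ∑ i ∈ Finset.range (q + 1), C ((-1) ^ i * (q.choose i : ℝ) / (i.factorial : ℝ)) * X ^ i

theorem eval_laguerrePoly (q : ℕ) (t : ℝ) : (laguerrePoly q).eval t = laguerre q t := by
  rw [laguerrePoly, laguerre, Polynomial.eval_finsetSum]
  refine Finset.sum_congr rfl fun i _ => ?_
  simp
  ring

theorem coeff_laguerrePoly (q n : ℕ) :
    (laguerrePoly q).coeff n = (-1) ^ n * (q.choose n : ℝ) / (n.factorial : ℝ) := by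
  rw [laguerrePoly, Polynomial.finsetSum_coeff]
  simp only [Polynomial.coeff_C_mul_X_pow]
  rw [Finset.sum_ite_eq]
  split_ifs with h
  · rfl
  · rw [Nat.choose_eq_zero_of_lt (by simpa using h)]; simp

open Polynomial in
/-- The Laguerre differential equation. -/
theorem laguerrePoly_ode (q : ℕ) :
    X * derivative (derivative (laguerrePoly q)) + (1 - X) * derivative (laguerrePoly q)
      + (q : ℝ[X]) * laguerrePoly q = 0 := by
  ext n
  have key : ∀ m : ℕ, ((q.choose (m + 1) : ℕ) : ℝ) * (m + 1) = q.choose m * ((q : ℝ) - m) := by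
    intro m
    have h := Nat.choose_succ_right_eq q m
    rcases le_or_gt m q with hm | hm
    · have h2 : ((q.choose (m + 1) * (m + 1) : ℕ) : ℝ) = ((q.choose m * (q - m) : ℕ) : ℝ) := by
        rw [h]
      rw [Nat.cast_mul, Nat.cast_mul, Nat.cast_sub hm] at h2
      push_cast at h2
      exact h2
    · rw [Nat.choose_eq_zero_of_lt hm, Nat.choose_eq_zero_of_lt (by omega)]; simp
  have hcast : (q : ℝ[X]) = C (q : ℝ) := by simp
  have e : (1 - X) * derivative (laguerrePoly q) =
      derivative (laguerrePoly q) - X * derivative (laguerrePoly q) := by ring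
  rw [e, hcast, coeff_add, coeff_add, coeff_sub, coeff_C_mul, coeff_zero]
  rcases n with _ | m
  · simp [coeff_derivative, coeff_laguerrePoly]
  · rw [coeff_X_mul, coeff_X_mul, coeff_derivative, coeff_derivative, coeff_derivative,
      coeff_laguerrePoly, coeff_laguerrePoly]
    have h1 := key (m + 1)
    push_cast at h1 ⊢
    have h2 : (((m + 1).factorial : ℕ) : ℝ) ≠ 0 := by positivity
    have h3 : (((m + 1 + 1).factorial : ℕ) : ℝ) = ((m : ℝ) + 1 + 1) * ((m + 1).factorial : ℕ) := by
      rw [Nat.factorial_succ (m + 1)]; push_cast; ring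
    rw [h3]
    have h4 : ((m : ℝ) + 1 + 1) ≠ 0 := by positivity
    field_simp
    rw [pow_succ]
    linear_combination (-1 : ℝ) ^ (m + 1) * (-1) * h1

/-- The function `P(t) e^{-t/2}`, for a polynomial `P`. -/
def expPoly (P : Polynomial ℝ) (t : ℝ) : ℝ := P.eval t * Real.exp (-t / 2)

open Polynomial in
/-- The polynomial `P' - P/2` of the derivative of `P(t) e^{-t/2}`. -/
def expPolyD (P : ℝ[X]) : ℝ[X] := derivative P - C (1 / 2) * P

theorem hasDerivAt_expPoly (P : Polynomial ℝ) (t : ℝ) :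
    HasDerivAt (expPoly P) (expPoly (expPolyD P) t) t := by
  have h1 := P.hasDerivAt t
  have h2 : HasDerivAt (fun t : ℝ => Real.exp (-t / 2)) (Real.exp (-t / 2) * (-1 / 2)) t :=
    ((hasDerivAt_id t).neg.div_const 2).exp
  refine (h1.mul h2).congr_deriv ?_
  simp [expPoly, expPolyD]
  ring

theorem contDiff_expPoly (P : Polynomial ℝ) : ContDiff ℝ ∞ (expPoly P) := by
  unfold expPoly
  have h : (fun t => P.eval t) = fun t => Polynomial.aeval t P := by
    ext t; rw [Polynomial.coe_aeval_eq_eval]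
  rw [show (fun t => P.eval t * Real.exp (-t / 2)) =
    fun t => Polynomial.aeval t P * Real.exp (-t / 2) by simp only [← congrFun h]]
  exact (P.contDiff_aeval (𝕜 := ℝ) ∞).mul ((contDiff_neg.div_const 2).exp)

theorem expPoly_ode (q : ℕ) (t : ℝ) :
    t * expPoly (expPolyD (expPolyD (laguerrePoly q))) t + expPoly (expPolyD (laguerrePoly q)) t =
      (t / 4 - (q + 1 / 2)) * expPoly (laguerrePoly q) t := by
  have h := congrArg (fun P => P.eval t) (laguerrePoly_ode q)
  simp at h
  simp [expPoly, expPolyD]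
  linear_combination Real.exp (-t / 2) * h

theorem exists_poly_bound (P : Polynomial ℝ) :
    ∃ C, 0 ≤ C ∧ ∀ t, 0 ≤ t → |P.eval t| ≤ C * Real.exp (t / 4) := by
  induction P using Polynomial.induction_on' with
  | add P Q hP hQ =>
    obtain ⟨C, h0, h⟩ := hP
    obtain ⟨C', h0', h'⟩ := hQ
    refine ⟨C + C', add_nonneg h0 h0', fun t ht => ?_⟩
    rw [Polynomial.eval_add, add_mul]
    exact (abs_add_le _ _).trans (add_le_add (h t ht) (h' t ht))
  | monomial n a =>
    refine ⟨|a| * (4 ^ n * n.factorial), by positivity, fun t ht => ?_⟩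
    rw [Polynomial.eval_monomial, abs_mul, mul_assoc, abs_of_nonneg (by positivity : 0 ≤ t ^ n)]
    gcongr
    have h := Real.pow_div_factorial_le_exp (x := t / 4) (by positivity) n
    rw [div_le_iff₀ (by positivity), div_pow, div_le_iff₀ (by positivity)] at h
    linarith

theorem exists_expPoly_bound (P : Polynomial ℝ) :
    ∃ C, 0 ≤ C ∧ ∀ t, 0 ≤ t → |expPoly P t| ≤ C * Real.exp (-t / 4) := by
  obtain ⟨C, h0, h⟩ := exists_poly_bound P
  refine ⟨C, h0, fun t ht => ?_⟩
  rw [expPoly, abs_mul, Real.abs_exp]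
  calc _ ≤ C * Real.exp (t / 4) * Real.exp (-t / 2) := by gcongr; exact h t ht
    _ = _ := by rw [mul_assoc, ← Real.exp_add]; congr 2; ring

/-! ### Separated functions -/

/-- The variable `b |x_⊥|² / 2`. -/
def radialVar (b : ℝ) (x : E3) : ℝ := b / 2 * (x 0 ^ 2 + x 1 ^ 2)

theorem contDiff_radialVar (b : ℝ) : ContDiff ℝ ∞ (radialVar b) :=
  contDiff_const.mul (((contDiff_coord 0).pow 2).add ((contDiff_coord 1).pow 2))

theorem radialVar_nonneg (hb : 0 < b) (x : E3) : 0 ≤ radialVar b x := by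
  unfold radialVar; positivity

theorem hasFDerivAt_coord (i : Fin 3) (x : E3) :
    HasFDerivAt (fun x : E3 => x i) (EuclideanSpace.proj (𝕜 := ℝ) i : E3 →L[ℝ] ℝ) x :=
  (EuclideanSpace.proj (𝕜 := ℝ) i : E3 →L[ℝ] ℝ).hasFDerivAt

theorem partialD_coord (i j : Fin 3) (x : E3) :
    partialD j (fun x => ((x i : ℝ) : ℂ)) x = if i = j then 1 else 0 := by
  have h : HasFDerivAt (fun x : E3 => ((x i : ℝ) : ℂ))
      (Complex.ofRealCLM ∘L (EuclideanSpace.proj (𝕜 := ℝ) i : E3 →L[ℝ] ℝ)) x :=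
    (Complex.ofRealCLM ∘L (EuclideanSpace.proj (𝕜 := ℝ) i : E3 →L[ℝ] ℝ)).hasFDerivAt
  rw [partialD, h.fderiv]
  simp
  split_ifs <;> simp

theorem partialD_comp_radialVar (b : ℝ) {f f' : ℝ → ℝ} (hf : ∀ t, HasDerivAt f (f' t) t)
    (j : Fin 3) (x : E3) : partialD j (fun x => ((f (radialVar b x) : ℝ) : ℂ)) x =
      b * (![x 0, x 1, 0] j : ℝ) * (f' (radialVar b x) : ℝ) := by
  have h1 : HasFDerivAt (radialVar b) _ x :=
    (((hasFDerivAt_coord 0 x).pow 2).add ((hasFDerivAt_coord 1 x).pow 2)).const_mul (b / 2)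
  have h2 := Complex.ofRealCLM.hasFDerivAt.comp x ((hf (radialVar b x)).hasFDerivAt.comp x h1)
  have h3 : fderiv ℝ (fun x => ((f (radialVar b x) : ℝ) : ℂ)) x = _ := h2.fderiv
  rw [partialD, h3]
  fin_cases j <;> simp <;> ring

theorem partialD_comp_vert {g g' : ℝ → ℂ} (hg : ∀ t, HasDerivAt g (g' t) t) (j : Fin 3) (x : E3) :
    partialD j (fun x => g (x 2)) x = if j = 2 then g' (x 2) else 0 := by
  have h2 := (hg (x 2)).hasFDerivAt.comp x (hasFDerivAt_coord 2 x)
  have h3 : fderiv ℝ (fun x : E3 => g (x 2)) x = _ := h2.fderiv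
  rw [partialD, h3]
  fin_cases j <;> simp

theorem magGrad_separated (b : ℝ) (P : Polynomial ℝ) {g g' : ℝ → ℂ} (hgs : ContDiff ℝ ∞ g)
    (hg : ∀ t, HasDerivAt g (g' t) t) (j : Fin 3) (x : E3) :
    magGrad b (fun x => (expPoly P (radialVar b x) : ℂ) * g (x 2)) j x =
      ![(b * x 0 * expPoly (expPolyD P) (radialVar b x)
          + Complex.I * (b / 2) * x 1 * expPoly P (radialVar b x)) * g (x 2),
        (b * x 1 * expPoly (expPolyD P) (radialVar b x)
          - Complex.I * (b / 2) * x 0 * expPoly P (radialVar b x)) * g (x 2),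
        expPoly P (radialVar b x) * g' (x 2)] j := by
  have hF : ContDiff ℝ ∞ fun x => (expPoly P (radialVar b x) : ℂ) :=
    contDiff_ofReal ((contDiff_expPoly P).comp (contDiff_radialVar b))
  have hG : ContDiff ℝ ∞ fun x : E3 => g (x 2) := hgs.comp (contDiff_coord 2)
  rw [magGrad_mul b hF hG, magGrad_eq, partialD_comp_radialVar b (hasDerivAt_expPoly P),
    partialD_comp_vert hg]
  fin_cases j <;> simp [magPotential] <;> ring

/-- The action of the free operator on products of a Laguerre function of `x_⊥` and a function
of `x₃`. -/
theorem laplacian_separated (b : ℝ) (q : ℕ) {g g' g'' : ℝ → ℂ} (hgs : ContDiff ℝ ∞ g)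
    (hg : ∀ t, HasDerivAt g (g' t) t) (hgs' : ContDiff ℝ ∞ g') (hg' : ∀ t, HasDerivAt g' (g'' t) t)
    (x : E3) :
    -∑ j, magGrad b (magGrad b (fun x => (expPoly (laguerrePoly q) (radialVar b x) : ℂ) * g (x 2)) j) j x =
      ((2 * q + 1) * b : ℝ) * (expPoly (laguerrePoly q) (radialVar b x) * g (x 2)) -
        expPoly (laguerrePoly q) (radialVar b x) * g'' (x 2) := by
  set P := laguerrePoly q with hP
  set P₁ := expPolyD P with hP1
  set P₂ := expPolyD P₁ with hP2
  have hF : ∀ Q : Polynomial ℝ, ContDiff ℝ ∞ fun x => (expPoly Q (radialVar b x) : ℂ) := fun Q =>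
    contDiff_ofReal ((contDiff_expPoly Q).comp (contDiff_radialVar b))
  have hX : ∀ i : Fin 3, ContDiff ℝ ∞ fun x : E3 => ((x i : ℝ) : ℂ) := fun i =>
    contDiff_ofReal (contDiff_coord i)
  have hG : ContDiff ℝ ∞ fun x : E3 => g (x 2) := hgs.comp (contDiff_coord 2)
  have hc : ∀ a : ℂ, ContDiff ℝ ∞ fun _ : E3 => a := fun a => contDiff_const
  have e0 : magGrad b (fun x => (expPoly P (radialVar b x) : ℂ) * g (x 2)) 0 = fun x =>
      ((b : ℂ) * ((x 0 : ℝ) * ((expPoly P₁ (radialVar b x) : ℂ) * g (x 2)))) +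
        (Complex.I * (b / 2) * ((x 1 : ℝ) * ((expPoly P (radialVar b x) : ℂ) * g (x 2)))) := by
    ext x; rw [magGrad_separated b P hgs hg]; simp; ring
  have e1 : magGrad b (fun x => (expPoly P (radialVar b x) : ℂ) * g (x 2)) 1 = fun x =>
      ((b : ℂ) * ((x 1 : ℝ) * ((expPoly P₁ (radialVar b x) : ℂ) * g (x 2)))) +
        (-(Complex.I * (b / 2)) * ((x 0 : ℝ) * ((expPoly P (radialVar b x) : ℂ) * g (x 2)))) := by
    ext x; rw [magGrad_separated b P hgs hg]; simp; ring
  have e2 : magGrad b (fun x => (expPoly P (radialVar b x) : ℂ) * g (x 2)) 2 = fun x =>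
      (expPoly P (radialVar b x) : ℂ) * g' (x 2) := by
    ext x; rw [magGrad_separated b P hgs hg]; simp
  have hS : ∀ Q : Polynomial ℝ, ContDiff ℝ ∞ fun x : E3 => (expPoly Q (radialVar b x) : ℂ) * g (x 2) :=
    fun Q => (hF Q).mul hG
  have hXS : ∀ (i : Fin 3) (Q : Polynomial ℝ), ContDiff ℝ ∞ fun x : E3 =>
      ((x i : ℝ) : ℂ) * ((expPoly Q (radialVar b x) : ℂ) * g (x 2)) := fun i Q => (hX i).mul (hS Q)
  have ht : (radialVar b x : ℂ) = b / 2 * ((x 0 : ℂ) ^ 2 + (x 1 : ℂ) ^ 2) := by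
    rw [radialVar]; push_cast; ring
  have hode : (radialVar b x : ℂ) * expPoly P₂ (radialVar b x) + expPoly P₁ (radialVar b x) =
      (radialVar b x / 4 - (q + 1 / 2)) * expPoly P (radialVar b x) := by
    have h := congrArg (fun r : ℝ => (r : ℂ)) (expPoly_ode q (radialVar b x))
    push_cast at h
    exact h
  rw [Fin.sum_univ_three, e0, e1, e2, magGrad_separated b P hgs' hg',
    magGrad_add b ((hc _).mul (hXS 0 P₁)) ((hc _).mul (hXS 1 P)),
    magGrad_add b ((hc _).mul (hXS 1 P₁)) ((hc _).mul (hXS 0 P)),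
    magGrad_const_mul b _ (hXS 0 P₁), magGrad_const_mul b _ (hXS 1 P),
    magGrad_const_mul b _ (hXS 1 P₁), magGrad_const_mul b _ (hXS 0 P),
    magGrad_mul b (hX 0) (hS P₁), magGrad_mul b (hX 1) (hS P), magGrad_mul b (hX 1) (hS P₁),
    magGrad_mul b (hX 0) (hS P)]
  simp only [magGrad_separated b _ hgs hg, partialD_coord]
  rw [← hP1, ← hP2]
  generalize expPoly P₂ (radialVar b x) = F2 at *
  generalize expPoly P₁ (radialVar b x) = F1 at *
  generalize expPoly P (radialVar b x) = F0 at *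
  rw [ht] at hode
  simp
  ring_nf
  ring_nf at hode
  rw [Complex.I_sq]
  linear_combination (-2 * b * g (x 2)) * hode

/-- A Gaussian bound in `x_⊥` and a square integrable bound in `x₃` imply square integrability. -/
theorem memLp_separated (hb : 0 < b) {g : ℝ → ℂ} (hg : MemLp g 2) {f : E3 → ℂ} (hf : Continuous f)
    {C : ℝ} (h : ∀ x, ‖f x‖ ≤ C * (Real.exp (-radialVar b x / 4) * ‖g (x 2)‖)) : MemLp f 2 := by
  have hmp := measurePreserving_splitEquiv
  have hint : Integrable fun x : E3 => Real.exp (-radialVar b x / 2) * ‖g (x 2)‖ ^ 2 := by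
    rw [← hmp.integrable_comp_emb splitEquiv.measurableEmbedding]
    have h1 := (integrable_gaussian_E2 (a := b / 4) (by positivity)).mul_prod
      ((memLp_two_iff_integrable_sq_norm hg.1).1 hg)
    refine h1.congr (ae_of_all _ fun p => ?_)
    simp only [Function.comp, splitEquiv_apply, embed_two, radialVar, embed_zero, embed_one]
    rw [EuclideanSpace.norm_sq_eq, Fin.sum_univ_two]
    simp only [Real.norm_eq_abs, sq_abs]
    congr 2
    ring
  rw [memLp_two_iff_integrable_sq_norm hf.aestronglyMeasurable]
  refine (hint.const_mul (C ^ 2)).mono' (hf.norm.pow 2).aestronglyMeasurable (ae_of_all _ fun x => ?_)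
  rw [Real.norm_of_nonneg (by positivity)]
  calc ‖f x‖ ^ 2 ≤ (C * (Real.exp (-radialVar b x / 4) * ‖g (x 2)‖)) ^ 2 := by
        gcongr; exact h x
    _ = C ^ 2 * (Real.exp (-radialVar b x / 4) ^ 2 * ‖g (x 2)‖ ^ 2) := by ring
    _ = _ := by
        rw [← Real.exp_nat_mul]; congr 3; push_cast; ring

theorem exists_separated_bound (hb : 0 < b) (P : Polynomial ℝ) :
    ∃ C, 0 ≤ C ∧ ∀ x, |expPoly P (radialVar b x)| ≤ C * Real.exp (-radialVar b x / 4) ∧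
      |x 0| * |expPoly P (radialVar b x)| ≤ C * Real.exp (-radialVar b x / 4) ∧
      |x 1| * |expPoly P (radialVar b x)| ≤ C * Real.exp (-radialVar b x / 4) := by
  -- the factor `1 + 2 t / b` dominates the coordinates
  obtain ⟨C, h0, h⟩ := exists_expPoly_bound ((1 + Polynomial.C (2 / b) * Polynomial.X) * P)
  have key : ∀ (x : E3) (r : ℝ), 0 ≤ r → r ≤ 1 + 2 / b * radialVar b x →
      r * |expPoly P (radialVar b x)| ≤ C * Real.exp (-radialVar b x / 4) := by
    intro x r hr hrx
    refine le_trans ?_ (h _ (radialVar_nonneg hb x))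
    have e : expPoly ((1 + Polynomial.C (2 / b) * Polynomial.X) * P) (radialVar b x) =
        (1 + 2 / b * radialVar b x) * expPoly P (radialVar b x) := by
      simp [expPoly]; ring
    rw [e, abs_mul]
    gcongr
    exact hrx.trans (le_abs_self _)
  have hτ : ∀ x : E3, 2 / b * radialVar b x = x 0 ^ 2 + x 1 ^ 2 := fun x => by
    unfold radialVar; field_simp
  refine ⟨C, h0, fun x => ⟨?_, ?_, ?_⟩⟩
  · have := key x 1 zero_le_one (by rw [hτ]; nlinarith [sq_nonneg (x 0), sq_nonneg (x 1)])
    rwa [one_mul] at this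
  · exact key x _ (abs_nonneg _) (by
      rw [hτ, ← sq_abs (x 0)]; nlinarith [sq_nonneg (|x 0| - 1), sq_nonneg (x 1)])
  · exact key x _ (abs_nonneg _) (by
      rw [hτ, ← sq_abs (x 1)]; nlinarith [sq_nonneg (|x 1| - 1), sq_nonneg (x 0)])

theorem memLp_expPoly_mul (hb : 0 < b) (P : Polynomial ℝ) {g : ℝ → ℂ} (hg : MemLp g 2)
    (hgc : Continuous g) : MemLp (fun x : E3 => (expPoly P (radialVar b x) : ℂ) * g (x 2)) 2 := by
  obtain ⟨C, h0, h⟩ := exists_separated_bound hb P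
  refine memLp_separated hb hg (C := C) ?_ fun x => ?_
  · exact (contDiff_ofReal ((contDiff_expPoly P).comp (contDiff_radialVar b))).continuous.mul
      (hgc.comp (continuous_coord 2))
  · rw [norm_mul, Complex.norm_real, Real.norm_eq_abs, ← mul_assoc]
    gcongr
    exact (h x).1

theorem memLp_magGrad_separated (hb : 0 < b) (P : Polynomial ℝ) {g g' : ℝ → ℂ}
    (hgs : ContDiff ℝ ∞ g) (hgd : ∀ t, HasDerivAt g (g' t) t) (hgc' : Continuous g')
    (hg : MemLp g 2) (hg' : MemLp g' 2) (j : Fin 3) :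
    MemLp (magGrad b (fun x => (expPoly P (radialVar b x) : ℂ) * g (x 2)) j) 2 := by
  have hF : ContDiff ℝ ∞ fun x => (expPoly P (radialVar b x) : ℂ) :=
    contDiff_ofReal ((contDiff_expPoly P).comp (contDiff_radialVar b))
  have hG : ContDiff ℝ ∞ fun x : E3 => g (x 2) := hgs.comp (contDiff_coord 2)
  have hcont := (contDiff_magGrad b (hF.mul hG) j).continuous
  obtain ⟨C, h0, h⟩ := exists_separated_bound hb P
  obtain ⟨C', h0', h'⟩ := exists_separated_bound hb (expPolyD P)
  have hbn : ‖(b : ℂ)‖ = b := by rw [Complex.norm_real, Real.norm_of_nonneg hb.le]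
  have bound : ∀ (a a' : ℂ) (x : E3) (r s : ℝ), ‖a‖ ≤ b → ‖a'‖ ≤ b →
      |r| * |expPoly (expPolyD P) (radialVar b x)| ≤ C' * Real.exp (-radialVar b x / 4) →
      |s| * |expPoly P (radialVar b x)| ≤ C * Real.exp (-radialVar b x / 4) →
      ‖(a * r * expPoly (expPolyD P) (radialVar b x) + a' * s * expPoly P (radialVar b x))
        * g (x 2)‖ ≤ (b * C' + b * C) * (Real.exp (-radialVar b x / 4) * ‖g (x 2)‖) := by
    intro a a' x r s ha ha' h1 h2
    rw [norm_mul, ← mul_assoc]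
    gcongr
    refine (norm_add_le _ _).trans ?_
    rw [norm_mul, norm_mul, norm_mul, norm_mul, Complex.norm_real, Complex.norm_real,
      Complex.norm_real, Complex.norm_real, Real.norm_eq_abs, Real.norm_eq_abs, Real.norm_eq_abs,
      Real.norm_eq_abs, add_mul, mul_assoc ‖a‖, mul_assoc ‖a'‖, mul_assoc b, mul_assoc b]
    gcongr
  have hI : ‖Complex.I * ((b : ℂ) / 2)‖ ≤ b := by
    rw [norm_mul, Complex.norm_I, one_mul, norm_div, hbn]; norm_num; linarith
  have hI' : ‖-(Complex.I * ((b : ℂ) / 2))‖ ≤ b := by rwa [norm_neg]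
  fin_cases j
  · refine memLp_separated hb hg (C := b * C' + b * C) hcont fun x => ?_
    rw [magGrad_separated b P hgs hgd]
    exact bound b (Complex.I * (b / 2)) x (x 0) (x 1) hbn.le hI (h' x).2.1 (h x).2.2
  · refine memLp_separated hb hg (C := b * C' + b * C) hcont fun x => ?_
    rw [magGrad_separated b P hgs hgd]
    have := bound b (-(Complex.I * (b / 2))) x (x 1) (x 0) hbn.le hI' (h' x).2.2 (h x).2.1
    simp only [neg_mul, ← sub_eq_add_neg] at this
    exact this
  · have e : magGrad b (fun x => (expPoly P (radialVar b x) : ℂ) * g (x 2)) 2 = fun x =>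
        (expPoly P (radialVar b x) : ℂ) * g' (x 2) := by
      ext x; rw [magGrad_separated b P hgs hgd]; simp
    have h2 := memLp_expPoly_mul hb P hg' hgc'
    rw [← e] at h2
    exact h2

end

section

variable {b : ℝ}

/-! ### The free resolvent in a Landau band -/

/-- `r(ζ)` is `-ζ` times the inverse of `ζ² - ∂²`. -/
theorem integral_vertKernel_mul (ζ : ℂ) {g : ℝ → ℂ} (hg : ContDiff ℝ ∞ g)
    (hc : HasCompactSupport g) (s : ℝ) :
    ∫ t, vertKernel ζ t * (ζ ^ 2 * g (s - t) - deriv (deriv g) (s - t)) = -ζ * g s := by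
  have hg1 : ContDiff ℝ ∞ (deriv g) := (contDiff_infty_iff_deriv.1 hg).2
  have hg2 : ContDiff ℝ ∞ (deriv (deriv g)) := (contDiff_infty_iff_deriv.1 hg1).2
  have hd : ∀ t, HasDerivAt (fun t => g (s - t)) (-deriv g (s - t)) t := fun t => by
    have h1 := ((hg.differentiable (by simp)) (s - t)).hasDerivAt.scomp t
      ((hasDerivAt_id t).const_sub s)
    simpa [Function.comp_def] using h1
  have hd1 : ∀ t, HasDerivAt (fun t => deriv g (s - t)) (-deriv (deriv g) (s - t)) t := fun t => by
    have h1 := ((hg1.differentiable (by simp)) (s - t)).hasDerivAt.scomp t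
      ((hasDerivAt_id t).const_sub s)
    simpa [Function.comp_def] using h1
  have hcs : ∀ {f : ℝ → ℂ}, HasCompactSupport f → HasCompactSupport fun t => f (s - t) :=
    fun h => h.comp_homeomorph (Homeomorph.subLeft s)
  -- the primitive of the integrand on each half-line
  have key : ∀ a : ℂ, ∃ Q : ℝ → ℂ, ContDiff ℝ ∞ Q ∧ HasCompactSupport Q ∧
      (∀ t, Q t = Complex.exp (a * t) * (a * g (s - t) + deriv g (s - t))) ∧
      ∀ t, deriv Q t = Complex.exp (a * t) * (a ^ 2 * g (s - t) - deriv (deriv g) (s - t)) := by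
    intro a
    have hE : ContDiff ℝ ∞ fun t : ℝ => Complex.exp (a * t) :=
      (contDiff_const.mul Complex.ofRealCLM.contDiff).cexp
    have hsub : ContDiff ℝ ∞ fun t : ℝ => s - t := contDiff_const.sub contDiff_id
    refine ⟨fun t => Complex.exp (a * t) * (a * g (s - t) + deriv g (s - t)),
      hE.mul ((contDiff_const.mul (hg.comp hsub)).add (hg1.comp hsub)), ?_, fun t => rfl,
      fun t => ?_⟩
    · exact HasCompactSupport.mul_left (((hcs hc).mul_left).add (hcs hc.deriv))
    · have hexp : HasDerivAt (fun t : ℝ => Complex.exp (a * t)) (Complex.exp (a * t) * a) t := by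
        have h1 : HasDerivAt (fun t : ℝ => a * (t : ℂ)) a t := by
          simpa using ((hasDerivAt_id t).ofReal_comp).const_mul a
        exact h1.cexp
      have hQ := (hexp.mul (((hd t).const_mul a).add (hd1 t))).deriv
      simp only [Pi.mul_def, Pi.add_def] at hQ
      rw [hQ]
      ring
  obtain ⟨Q, hQ, hQc, hQe, hQd⟩ := key ζ
  obtain ⟨Q', hQ', hQc', hQe', hQd'⟩ := key (-ζ)
  have hcont : Continuous fun t => vertKernel ζ t * (ζ ^ 2 * g (s - t) - deriv (deriv g) (s - t)) :=
    (continuous_vertKernel ζ).mul ((continuous_const.mul (hg.continuous.comp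
      (continuous_const.sub continuous_id))).sub (hg2.continuous.comp
      (continuous_const.sub continuous_id)))
  have hint := hcont.integrable_of_hasCompactSupport (μ := volume)
    (HasCompactSupport.mul_left (((hcs hc).mul_left).sub (hcs hc.deriv.deriv)))
  rw [← intervalIntegral.integral_Iic_add_Ioi (b := 0) hint.integrableOn hint.integrableOn,
    setIntegral_congr_fun (g := fun t => 1 / 2 * deriv Q' t) measurableSet_Iic, integral_const_mul,
    hQc'.integral_Iic_deriv_eq (hQ'.of_le (by simp)),
    setIntegral_congr_fun (g := fun t => 1 / 2 * deriv Q t) measurableSet_Ioi, integral_const_mul,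
    hQc.integral_Ioi_deriv_eq (hQ.of_le (by simp)), hQe, hQe']
  · simp; ring
  · intro t (ht : 0 < t)
    simp only
    rw [hQd, vertKernel, abs_of_pos ht]; ring
  · intro t (ht : t ≤ 0)
    simp only
    rw [hQd', vertKernel, abs_of_nonpos ht]; push_cast
    rw [show ζ * -(t : ℂ) = -ζ * t by ring]; ring

theorem vertTrans_mul (b : ℝ) (s t : ℝ) : vertTrans b s * vertTrans b t = vertTrans b (s + t) := by
  rw [vertTrans, vertTrans, magTrans_mul, ← embed_add]
  simp [vertTrans, embed]

/-- `integral_vertKernel_mul`, for operators. -/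
theorem vertOp_mul_strongIntegral (b : ℝ) {ζ : ℂ} (hζ : ζ.re < 0) {g : ℝ → ℂ} (hg : ContDiff ℝ ∞ g)
    (hc : HasCompactSupport g) :
    vertOp b ζ * strongIntegral volume (fun t => ζ ^ 2 * g t - deriv (deriv g) t) (vertTrans b) =
      (-ζ) • strongIntegral volume g (vertTrans b) := by
  have hg1 : ContDiff ℝ ∞ (deriv g) := (contDiff_infty_iff_deriv.1 hg).2
  have hg2 : ContDiff ℝ ∞ (deriv (deriv g)) := (contDiff_infty_iff_deriv.1 hg1).2
  set h : ℝ → ℂ := fun t => ζ ^ 2 * g t - deriv (deriv g) t with hh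
  have hhc : Continuous h := (continuous_const.mul hg.continuous).sub hg2.continuous
  have hhi : Integrable h := hhc.integrable_of_hasCompactSupport
    ((hc.mul_left).sub hc.deriv.deriv)
  have hgi : Integrable g := hg.continuous.integrable_of_hasCompactSupport hc
  have hV := isContractionFamily_vertTrans b
  have hk := integrable_vertKernel hζ
  ext1 f
  rw [mul_apply_eq_comp, vertOp, strongIntegral_apply_L2 hk hV, smul_apply,
    strongIntegral_apply_L2 hgi hV]
  have e1 : ∀ t, vertKernel ζ t • vertTrans b t (strongIntegral volume h (vertTrans b) f) =
      ∫ s, (vertKernel ζ t * h (s - t)) • vertTrans b s f := by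
    intro t
    rw [strongIntegral_apply_L2 hhi hV]
    have h1 : vertTrans b t (∫ s, h s • vertTrans b s f) = ∫ s, h s • vertTrans b (t + s) f := by
      rw [← ContinuousLinearMap.integral_comp_comm _ (hV.integrable hhi f)]
      refine integral_congr_ae (ae_of_all _ fun s => ?_)
      simp only
      rw [map_smul, ← mul_apply_eq_comp, vertTrans_mul]
    rw [h1, ← integral_sub_right_eq_self _ t, ← integral_smul]
    refine integral_congr_ae (ae_of_all _ fun s => ?_)
    simp only
    rw [smul_smul, add_sub_cancel]
  rw [integral_congr_ae (ae_of_all _ e1), integral_integral_swap, ← integral_smul]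
  · refine integral_congr_ae (ae_of_all _ fun s => ?_)
    simp only
    rw [integral_smul_const, integral_vertKernel_mul ζ hg hc, smul_smul]
  · have h1 := (Integrable.convolution_integrand (ContinuousLinearMap.mul ℂ ℂ) (μ := volume)
      (ν := volume) hk hhi).swap
    have h2 : Continuous fun p : ℝ × ℝ => vertTrans b p.2 f := (hV.continuous f).comp continuous_snd
    refine (h1.norm.mul_const ‖f‖).mono' ?_ (ae_of_all _ fun p => ?_)
    · refine Continuous.aestronglyMeasurable ?_
      simp only [Function.uncurry_def]
      have := continuous_vertKernel ζ
      fun_prop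
    · simp only [Function.uncurry_def, Function.comp]
      rw [norm_smul]
      exact mul_le_mul_of_nonneg_left (hV.norm_le _ _) (norm_nonneg _)

/-- A vector is determined by its averages over the translations in `x₃`. -/
theorem eq_zero_of_forall_strongIntegral_vertTrans (b : ℝ) {f : L2}
    (h : ∀ g : ℝ → ℂ, ContDiff ℝ ∞ g → HasCompactSupport g →
      strongIntegral volume g (vertTrans b) f = 0) : f = 0 := by
  have hV := isContractionFamily_vertTrans b
  have hcont : Continuous fun t => ⟪f, vertTrans b t f⟫_ℂ :=
    continuous_const.inner (hV.continuous f)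
  have h1 : ∀ᵐ t : ℝ, ⟪f, vertTrans b t f⟫_ℂ = 0 := by
    refine ae_eq_zero_of_integral_contDiff_smul_eq_zero hcont.locallyIntegrable fun g hg hc => ?_
    have hg' : ContDiff ℝ ∞ fun t => (g t : ℂ) := Complex.ofRealCLM.contDiff.comp hg
    have hc' : HasCompactSupport fun t => (g t : ℂ) := hc.comp_left Complex.ofReal_zero
    have hi := hg'.continuous.integrable_of_hasCompactSupport (μ := volume) hc'
    have h2 := congrArg (fun u => ⟪f, u⟫_ℂ) (h _ hg' hc')
    simp only [inner_zero_right] at h2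
    rw [strongIntegral_apply_L2 hi hV] at h2
    rw [← h2, ← integral_inner (hV.integrable hi f)]
    refine integral_congr_ae (ae_of_all _ fun t => ?_)
    simp only
    rw [inner_smul_right, Complex.real_smul]
  have h2 : ⟪f, vertTrans b 0 f⟫_ℂ = 0 :=
    congrFun ((hcont.ae_eq_iff_eq volume continuous_const).1 h1) 0
  have h3 : vertTrans b 0 = 1 := by
    rw [vertTrans, show embed 0 0 = 0 by ext i; fin_cases i <;> simp [embed], magTrans_zero]
  rw [h3, one_apply_eq_self] at h2
  exact inner_self_eq_zero.1 h2

theorem landauRadial_perp (b : ℝ) (j : ℕ) (x : E3) : landauRadial b j (perp x) =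
    ((b / (2 * Real.pi) : ℝ) : ℂ) * (expPoly (laguerrePoly j) (radialVar b x) : ℂ) := by
  have h : ‖perp x‖ ^ 2 = x 0 ^ 2 + x 1 ^ 2 := by
    rw [EuclideanSpace.norm_sq_eq, Fin.sum_univ_two]
    simp [perp]
  rw [landauRadial, h, expPoly, eval_laguerrePoly, radialVar, ← Complex.ofReal_mul]
  congr 1
  rw [show b * (x 0 ^ 2 + x 1 ^ 2) / 2 = b / 2 * (x 0 ^ 2 + x 1 ^ 2) by ring,
    show -(b / 4) * (x 0 ^ 2 + x 1 ^ 2) = -(b / 2 * (x 0 ^ 2 + x 1 ^ 2)) / 2 by ring]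
  ring

/-- The action of the free resolvent on products of a Landau eigenfunction of `x_⊥` and a test
function of `x₃`. -/
theorem exists_resolvent_separated (hb : 0 < b) (j : ℕ) {ξ ζ : ℂ}
    (hζ : ζ ^ 2 = ((2 * j + 1) * b : ℝ) - ξ) {R : L2 →L[ℂ] L2} (hR : IsResolventAt (freeOp b) ξ R)
    {g : ℝ → ℂ} (hg : ContDiff ℝ ∞ g) (hc : HasCompactSupport g) :
    ∃ u w : L2, u =ᵐ[volume] (fun x => landauRadial b j (perp x) * g (x 2)) ∧
      w =ᵐ[volume] (fun x => landauRadial b j (perp x) *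
        (ζ ^ 2 * g (x 2) - deriv (deriv g) (x 2))) ∧ R w = u := by
  have hg1 : ContDiff ℝ ∞ (deriv g) := (contDiff_infty_iff_deriv.1 hg).2
  have hg2 : ContDiff ℝ ∞ (deriv (deriv g)) := (contDiff_infty_iff_deriv.1 hg1).2
  have hd : ∀ t, HasDerivAt g (deriv g t) t := fun t =>
    (hg.differentiable (by simp) t).hasDerivAt
  have hd1 : ∀ t, HasDerivAt (deriv g) (deriv (deriv g) t) t := fun t =>
    (hg1.differentiable (by simp) t).hasDerivAt
  have hL : ∀ {f : ℝ → ℂ}, ContDiff ℝ ∞ f → HasCompactSupport f → MemLp f 2 :=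
    fun hf hfc => hf.continuous.memLp_of_hasCompactSupport hfc
  have m0 := memLp_expPoly_mul hb (laguerrePoly j) (hL hg hc) hg.continuous
  have m2 := memLp_expPoly_mul hb (laguerrePoly j) (hL hg2 hc.deriv.deriv) hg2.continuous
  have mg := fun i => memLp_magGrad_separated hb (laguerrePoly j) hg hd hg1.continuous (hL hg hc)
    (hL hg1 hc.deriv) i
  set β : ℂ := ((b / (2 * Real.pi) : ℝ) : ℂ) with hβ
  have hmem : (m0.toLp _, (((2 * j + 1) * b : ℝ) : ℂ) • m0.toLp _ - m2.toLp _) ∈ freeOp b := by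
    refine mem_freeOp_of_contDiff (Ψ := fun x => (expPoly (laguerrePoly j) (radialVar b x) : ℂ) *
      g (x 2)) ?_ m0.coeFn_toLp (g := fun i => (mg i).toLp _) (fun i => (mg i).coeFn_toLp) ?_
    · exact (contDiff_ofReal ((contDiff_expPoly _).comp (contDiff_radialVar b))).mul
        (hg.comp (contDiff_coord 2))
    · filter_upwards [Lp.coeFn_sub ((((2 * j + 1) * b : ℝ) : ℂ) • m0.toLp _) (m2.toLp _),
        Lp.coeFn_smul (((2 * j + 1) * b : ℝ) : ℂ) (m0.toLp _), m0.coeFn_toLp, m2.coeFn_toLp]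
        with x h1 h2 h3 h4
      rw [h1, Pi.sub_apply, h2, Pi.smul_apply, h3, h4, laplacian_separated b j hg hd hg1 hd1,
        smul_eq_mul]
  have hRw := hR.2 _ hmem
  simp only at hRw
  refine ⟨β • m0.toLp _, β • ((((2 * j + 1) * b : ℝ) : ℂ) • m0.toLp _ - m2.toLp _ -
    ξ • m0.toLp _), ?_, ?_, by rw [map_smul, hRw]⟩
  · filter_upwards [Lp.coeFn_smul β (m0.toLp _), m0.coeFn_toLp] with x h1 h2
    rw [h1, Pi.smul_apply, h2, landauRadial_perp, smul_eq_mul, mul_assoc]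
  · have e : β • ((((2 * j + 1) * b : ℝ) : ℂ) • m0.toLp _ - m2.toLp _ - ξ • m0.toLp _) =
        (β * ζ ^ 2) • m0.toLp _ - β • m2.toLp _ := by
      rw [hζ, mul_sub, sub_smul, smul_sub, smul_sub, smul_smul, smul_smul]; abel
    rw [e]
    filter_upwards [Lp.coeFn_sub ((β * ζ ^ 2) • m0.toLp _) (β • m2.toLp _),
      Lp.coeFn_smul (β * ζ ^ 2) (m0.toLp _), Lp.coeFn_smul β (m2.toLp _), m0.coeFn_toLp,
      m2.coeFn_toLp] with x h1 h2 h3 h4 h5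
    rw [h1, Pi.sub_apply, h2, h3, Pi.smul_apply, Pi.smul_apply, h4, h5, landauRadial_perp,
      smul_eq_mul, smul_eq_mul]
    ring

/-- A superposition of magnetic translations evaluates the pairing with the translates, by the
dual family of magnetic translations, of one function. -/
theorem coeFn_strongIntegral_magTrans (b : ℝ) {κ : E3 → ℂ} (hκ : Integrable κ) (hκm : Measurable κ)
    {u : L2} (hu : u =ᵐ[volume] fun x => starRingEnd ℂ (κ (-x))) (f : L2) :
    strongIntegral volume κ (magTrans b) f =ᵐ[volume] fun x => ⟪magTrans (-b) x u, f⟫_ℂ := by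
  have hV : IsContractionFamily (magTrans b) := isContractionFamily_magTrans b continuous_id
  refine (coeFn_strongIntegral hV (m := fun p => magPhase b p.1 p.2)
    (continuous_magPhase b).measurable (fun s f => coeFn_magTrans b s f) hκ hκm f).trans
    (ae_of_all _ fun x => ?_)
  have hux : magTrans (-b) x u =ᵐ[volume] fun y => magPhase (-b) x y *
      starRingEnd ℂ (κ (-(y - x))) := by
    filter_upwards [coeFn_magTrans (-b) x u,
      (measurePreserving_sub_right volume x).quasiMeasurePreserving.ae hu] with y h1 h2
    rw [h1, h2]
  simp only
  rw [inner_eq_integral hux (ae_eq_refl f)]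
  congr 1
  ext1 y
  have e1 : starRingEnd ℂ (magPhase (-b) x y) = magPhase b (x - y) x := by
    rw [magPhase, magPhase, ← Complex.exp_conj, map_mul, Complex.conj_I, Complex.conj_ofReal]
    congr 1
    simp only [PiLp.sub_apply]
    push_cast
    ring
  rw [map_mul, e1, starRingEnd_self_apply, neg_sub]
  ring

theorem coeFn_landauOp_mul_strongIntegral (hb : 0 < b) (j : ℕ) {g : ℝ → ℂ} (hg : Continuous g)
    (hc : HasCompactSupport g) {u : L2}
    (hu : u =ᵐ[volume] fun x => landauRadial b j (perp x) * starRingEnd ℂ (g (-x 2))) (f : L2) :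
    (landauOp b j * strongIntegral volume g (vertTrans b)) f =ᵐ[volume]
      fun x => ⟪magTrans (-b) x u, f⟫_ℂ := by
  have hV : IsContractionFamily (magTrans b) := isContractionFamily_magTrans b continuous_id
  obtain ⟨h1, h2⟩ := landauOp_mul_strongIntegral hb j hV
    (fun y t => horTrans_mul_vertTrans b y t) (hg.integrable_of_hasCompactSupport hc)
  have h3 : landauOp b j * strongIntegral volume g (vertTrans b) = _ := h1
  rw [h3]
  refine coeFn_strongIntegral_magTrans b h2 (((continuous_landauRadial b j).comp
    continuous_perp).mul (hg.comp (continuous_coord 2))).measurable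
    (hu.trans (ae_of_all _ fun x => ?_)) f
  have e : perp (-x) = -perp x := by
    rw [← zero_sub, perp_sub, ← zero_sub (perp x)]
    congr 1
    ext i; fin_cases i <;> simp [perp]
  simp only
  rw [map_mul, landauRadial, landauRadial, Complex.conj_ofReal, e, norm_neg, PiLp.neg_apply]

/-- In the `j`-th Landau band, the free resolvent is the resolvent of `-∂²` in the variable
`x₃`. -/
theorem resolvent_mul_landauOp (hb : 0 < b) (j : ℕ) {ξ ζ : ℂ} (hζr : ζ.re < 0)
    (hζ : ζ ^ 2 = ((2 * j + 1) * b : ℝ) - ξ) {R : L2 →L[ℂ] L2} (hR : IsResolventAt (freeOp b) ξ R) :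
    R * landauOp b j = (-ζ⁻¹) • (vertOp b ζ * landauOp b j) := by
  set ζ' := starRingEnd ℂ ζ with hζ'
  have hζr' : ζ'.re < 0 := by rwa [hζ', Complex.conj_re]
  have hζ0 : ζ' ≠ 0 := fun h => by rw [h] at hζr'; simp at hζr'
  have hV := isContractionFamily_vertTrans b
  have hp := isSelfAdjoint_landauOp hb j
  have hpa : (landauOp b j).adjoint = landauOp b j := hp.adjoint_eq
  -- The adjoint identity: after averaging over translations in `x₃`, both sides become pairings
  -- with one separated function, on which the resolvent is known, because the dual magnetic
  -- translations commute with the resolvent.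
  have main : ∀ f, landauOp b j (R.adjoint f) = (-ζ'⁻¹) • vertOp b ζ' (landauOp b j f) := by
    intro f
    rw [← sub_eq_zero]
    refine eq_zero_of_forall_strongIntegral_vertTrans b fun G hG hGc => ?_
    have hG1 : ContDiff ℝ ∞ (deriv G) := (contDiff_infty_iff_deriv.1 hG).2
    have hG2 : ContDiff ℝ ∞ (deriv (deriv G)) := (contDiff_infty_iff_deriv.1 hG1).2
    set g : ℝ → ℂ := fun t => starRingEnd ℂ (G (-t)) with hgdef
    have hg : ContDiff ℝ ∞ g := Complex.conjCLE.contDiff.comp (hG.comp contDiff_neg)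
    have hgc : HasCompactSupport g :=
      (hGc.comp_homeomorph (Homeomorph.neg ℝ)).comp_left (map_zero (starRingEnd ℂ))
    have hder : ∀ {F : ℝ → ℂ}, ContDiff ℝ ∞ F → ∀ t,
        deriv (fun t => starRingEnd ℂ (F (-t))) t = -starRingEnd ℂ (deriv F (-t)) := by
      intro F hF t
      have h1 := ((hF.differentiable (by simp)) (-t)).hasDerivAt.scomp t (hasDerivAt_neg t)
      have h2 := (Complex.conjCLE.toContinuousLinearMap.hasFDerivAt.comp_hasDerivAt t h1).deriv
      have h3 : deriv (fun t => starRingEnd ℂ (F (-t))) t = _ := h2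
      rw [h3]
      simp
    have hg2 : ∀ t, deriv (deriv g) t = starRingEnd ℂ (deriv (deriv G) (-t)) := by
      intro t
      have e : deriv g = fun t => -starRingEnd ℂ (deriv G (-t)) := funext (hder hG)
      rw [e, deriv.fun_neg, hder hG1, neg_neg]
    obtain ⟨u, w, hu, hw, huw⟩ := exists_resolvent_separated hb j hζ hR hg hgc
    set H : ℝ → ℂ := fun t => ζ' ^ 2 * G t - deriv (deriv G) t with hH
    have hHc : Continuous H := (continuous_const.mul hG.continuous).sub hG2.continuous
    have hHs : HasCompactSupport H := (hGc.mul_left).sub hGc.deriv.deriv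
    have hHi : Integrable H := hHc.integrable_of_hasCompactSupport hHs
    have hGi : Integrable G := hG.continuous.integrable_of_hasCompactSupport hGc
    have e1 := coeFn_landauOp_mul_strongIntegral hb j hHc hHs (u := w) (hw.trans
      (ae_of_all _ fun x => by
        simp only [hH, map_sub, map_mul, map_pow, hg2]
        rw [hζ', starRingEnd_self_apply])) (R.adjoint f)
    have e2 := coeFn_landauOp_mul_strongIntegral hb j hG.continuous hGc (u := u) hu f
    have e3 : (landauOp b j * strongIntegral volume H (vertTrans b)) (R.adjoint f) =
        (landauOp b j * strongIntegral volume G (vertTrans b)) f := by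
      refine Lp.ext (e1.trans (EventuallyEq.trans (ae_of_all _ fun x => ?_) e2.symm))
      simp only
      rw [ContinuousLinearMap.adjoint_inner_right, ← mul_apply_eq_comp, resolvent_mul_magTrans hR,
        mul_apply_eq_comp, huw]
    have hcomm : ∀ {k : ℝ → ℂ}, Integrable k →
        landauOp b j * strongIntegral volume k (vertTrans b) =
          strongIntegral volume k (vertTrans b) * landauOp b j := by
      intro k hk
      refine strongIntegral_comp_commute hk hV fun t => ?_
      refine (strongIntegral_comp_commute (integrable_landauRadial hb j)
        (isContractionFamily_horTrans b) fun y => ?_).symm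
      rw [vertTrans_mul_horTrans, horTrans_mul_vertTrans]
    have hcomm' : ∀ {k : ℝ → ℂ}, Integrable k →
        vertOp b ζ' * strongIntegral volume k (vertTrans b) =
          strongIntegral volume k (vertTrans b) * vertOp b ζ' := by
      intro k hk
      refine strongIntegral_comp_commute hk hV fun t => ?_
      refine (strongIntegral_comp_commute (integrable_vertKernel hζr') hV fun y => ?_).symm
      rw [vertTrans_mul, vertTrans_mul, add_comm]
    rw [hcomm hHi, hcomm hGi, mul_apply_eq_comp, mul_apply_eq_comp] at e3
    have e4 := congrArg (vertOp b ζ') e3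
    rw [← mul_apply_eq_comp, vertOp_mul_strongIntegral b hζr' hG hGc, smul_apply,
      ← mul_apply_eq_comp (vertOp b ζ'), hcomm' hGi, mul_apply_eq_comp] at e4
    rw [map_sub, map_smul, ← e4, smul_smul, sub_eq_zero]
    rw [show -ζ'⁻¹ * -ζ' = 1 by field_simp, one_smul]
  have main' : landauOp b j * R.adjoint = (-ζ'⁻¹) • (vertOp b ζ' * landauOp b j) := by
    ext1 f
    rw [mul_apply_eq_comp, main f]
    rfl
  have h1 := congrArg ContinuousLinearMap.adjoint main'
  have hadj : ∀ A B : L2 →L[ℂ] L2, (A * B).adjoint = B.adjoint * A.adjoint :=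
    fun A B => ContinuousLinearMap.adjoint_comp A B
  rw [hadj, ContinuousLinearMap.adjoint_adjoint, hpa, map_smulₛₗ, hadj, hpa, vertOp_adjoint b hζr',
    hζ', starRingEnd_self_apply, landauOp_mul_vertOp hb j hζr, map_neg, map_inv₀,
    starRingEnd_self_apply] at h1
  exact h1

/-- The completeness of the Landau projections turns invariance of their ranges into
commutation. -/
theorem resolvent_mul_landauOp_comm (hb : 0 < b) (j : ℕ) {R : L2 →L[ℂ] L2}
    (h : ∀ i, ∃ X : L2 →L[ℂ] L2, R * landauOp b i = landauOp b i * X) :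
    R * landauOp b j = landauOp b j * R := by
  ext1 f
  have h1 := ((hasSum_landauOp_apply hb f).mapL R).mapL (landauOp b j)
  have h2 : ∀ i, landauOp b j (R (landauOp b i f)) = if i = j then R (landauOp b j f) else 0 := by
    intro i
    obtain ⟨X, hX⟩ := h i
    have e : landauOp b j (R (landauOp b i f)) = (landauOp b j * (R * landauOp b i)) f := rfl
    rw [e, hX, ← mul_assoc, landauOp_mul hb]
    split_ifs with h3 h4 h4
    · rw [h3, ← hX]; rfl
    · exact absurd h3.symm h4
    · exact absurd h4.symm h3
    · rw [zero_mul, zero_apply]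
  rw [mul_apply_eq_comp, mul_apply_eq_comp]
  refine HasSum.unique ?_ h1
  simp only [h2]
  exact hasSum_ite_eq j _

end

section

variable {b : ℝ}

/-! ### Shifted resolvents -/

/-- `(T - z)⁻¹ = R (1 - z R)⁻¹`, for `R = T⁻¹`. -/
def shiftedResolvent {A : Type*} [Ring A] [Algebra ℂ A] (R : A) (z : ℂ) : A :=
  R * Ring.inverse (1 - z • R)

theorem adjoint_shiftedResolvent {R : L2 →L[ℂ] L2} (hR : IsSelfAdjoint R) (z : ℂ) :
    (shiftedResolvent R z).adjoint = shiftedResolvent R (starRingEnd ℂ z) := by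
  rw [← ContinuousLinearMap.star_eq_adjoint, shiftedResolvent, star_mul, ← Ring.inverse_star,
    hR.star_eq, star_sub, star_one, star_smul, hR.star_eq, shiftedResolvent]
  have h : Commute R (1 - starRingEnd ℂ z • R) :=
    (Commute.one_right R).sub_right ((Commute.refl R).smul_right _)
  change Ring.inverse (1 - starRingEnd ℂ z • R) * R = R * Ring.inverse (1 - starRingEnd ℂ z • R)
  by_cases hu : IsUnit (1 - starRingEnd ℂ z • R)
  · have e : Ring.inverse (1 - starRingEnd ℂ z • R) * (R * (1 - starRingEnd ℂ z • R)) *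
        Ring.inverse (1 - starRingEnd ℂ z • R) = Ring.inverse (1 - starRingEnd ℂ z • R) * R := by
      rw [mul_assoc, mul_assoc, Ring.mul_inverse_cancel _ hu, mul_one]
    rw [← e, h.eq, ← mul_assoc, Ring.inverse_mul_cancel _ hu, one_mul]
  · rw [Ring.inverse_non_unit _ hu, zero_mul, mul_zero]

/-- `1 + z (T - z)⁻¹ = (1 - z T⁻¹)⁻¹`. -/
theorem one_add_smul_shiftedResolvent {A : Type*} [Ring A] [Algebra ℂ A] {R : A} {z : ℂ}
    (hu : IsUnit (1 - z • R)) : 1 + z • shiftedResolvent R z = Ring.inverse (1 - z • R) := by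
  have h : (1 - z • R + z • R) * Ring.inverse (1 - z • R) = Ring.inverse (1 - z • R) := by
    rw [sub_add_cancel, one_mul]
  rw [add_mul, Ring.mul_inverse_cancel _ hu, smul_mul_assoc] at h
  exact h

theorem isResolventAt_shiftedResolvent {T : Set (L2 × L2)} {ξ : ℂ} {R : L2 →L[ℂ] L2}
    (h : IsResolventAt T ξ R) (hR : IsSelfAdjoint R) {z : ℂ} (hz : z.im ≠ 0) :
    IsResolventAt T (ξ + z) (shiftedResolvent R z) :=
  h.translate (isUnit_one_sub_smul_selfAdjoint hR hz)

/-! ### Exponential weights and the free resolvent -/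

/-- The square roots of `Λ_j - ξ` in the left half plane stay away from the imaginary axis,
uniformly in `j`, for non-real `ξ`. -/
theorem exists_landau_roots (hb : 0 < b) {ξ : ℂ} (hξ : ξ.im ≠ 0) :
    ∃ δ > 0, ∀ j : ℕ, ∃ ζ : ℂ, ζ.re ≤ -δ ∧ ζ ^ 2 = ((2 * j + 1) * b : ℝ) - ξ := by
  set m := |ξ.im| with hm
  set a := |ξ.re| with ha
  have hm0 : 0 < m := abs_pos.2 hξ
  have ha0 : 0 ≤ a := abs_nonneg _
  -- if `|Re ζ| < δ`, then `m = 2 |Re ζ| |Im ζ|` and `(Im ζ)² ≤ δ² + a` contradict each other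
  refine ⟨m / (2 * (m + a + 1)), by positivity, fun j => ?_⟩
  set δ := m / (2 * (m + a + 1)) with hδ
  have hδ0 : 0 < δ := by positivity
  have hδe : δ * (2 * (m + a + 1)) = m := by rw [hδ]; field_simp
  have hδ1 : δ ≤ 1 / 2 := by
    rw [hδ, div_le_iff₀ (by positivity)]; nlinarith
  set w : ℂ := ((2 * j + 1) * b : ℝ) - ξ with hw
  -- the two square roots of `w` are opposite to each other
  obtain ⟨ζ, hζr, hζ⟩ : ∃ ζ : ℂ, ζ.re ≤ 0 ∧ ζ ^ 2 = w := by
    obtain ⟨ζ, hζ⟩ := IsAlgClosed.exists_pow_nat_eq w (n := 2) (by norm_num)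
    rcases le_total ζ.re 0 with h | h
    · exact ⟨ζ, h, hζ⟩
    · exact ⟨-ζ, by simpa using h, by rw [neg_sq, hζ]⟩
  refine ⟨ζ, ?_, hζ⟩
  have hre : ζ.re ^ 2 - ζ.im ^ 2 = w.re := by rw [← hζ, sq ζ]; simp [sq]
  have him : 2 * ζ.re * ζ.im = w.im := by rw [← hζ, sq ζ]; simp; ring
  have hwre : -a ≤ w.re := by
    have h1 : w.re = (2 * j + 1) * b - ξ.re := by
      rw [hw, Complex.sub_re, Complex.ofReal_re]
    have h2 := le_abs_self ξ.re
    have h3 : 0 ≤ (2 * (j : ℝ) + 1) * b := by positivity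
    rw [h1]; linarith
  have hwim : w.im ^ 2 = m ^ 2 := by
    rw [hw, Complex.sub_im, Complex.ofReal_im, hm, sq_abs]; ring
  by_contra hcon
  have h1 : ζ.re ^ 2 < δ ^ 2 := by nlinarith
  have h2 : ζ.im ^ 2 ≤ δ ^ 2 + a := by linarith
  have h3 : m ^ 2 ≤ 4 * δ ^ 2 * (δ ^ 2 + a) := by
    rw [← hwim, ← him]
    calc (2 * ζ.re * ζ.im) ^ 2 = 4 * ζ.re ^ 2 * ζ.im ^ 2 := by ring
      _ ≤ _ := by gcongr
  have h4 : δ ^ 2 ≤ 1 := by nlinarith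
  have h5 : m ^ 2 = 4 * δ ^ 2 * (m + a + 1) ^ 2 := by
    have h : (δ * (2 * (m + a + 1))) ^ 2 = m ^ 2 := by rw [hδe]
    linear_combination -h
  have h6 : 4 * δ ^ 2 * (δ ^ 2 + a) < 4 * δ ^ 2 * (m + a + 1) ^ 2 := by
    apply mul_lt_mul_of_pos_left _ (by positivity)
    nlinarith
  linarith

/-- At `ξ = -c ≤ 0` the roots are the real numbers `-√(Λ_j + c)`, at distance at least `√b` from the
imaginary axis. -/
theorem exists_landau_roots_of_nonneg (hb : 0 < b) {c : ℝ} (hc : 0 ≤ c) (j : ℕ) :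
    ∃ ζ : ℂ, ζ.re ≤ -Real.sqrt b ∧ ζ ^ 2 = ((2 * j + 1) * b : ℝ) - (-(c : ℂ)) ∧
      ‖ζ‖ ^ 2 = landauLevel b c j ∧ ζ.re = -‖ζ‖ := by
  have h0 : 0 ≤ landauLevel b c j := by rw [landauLevel]; positivity
  refine ⟨((-Real.sqrt (landauLevel b c j) : ℝ) : ℂ), ?_, ?_, ?_, ?_⟩
  · rw [Complex.ofReal_re, neg_le_neg_iff]
    refine Real.sqrt_le_sqrt ?_
    rw [landauLevel]
    have : 0 ≤ (j : ℝ) * b := by positivity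
    linarith
  · rw [← Complex.ofReal_pow, neg_sq, Real.sq_sqrt h0, landauLevel]
    push_cast; ring
  · rw [Complex.norm_real, norm_neg, Real.norm_of_nonneg (Real.sqrt_nonneg _), Real.sq_sqrt h0]
  · rw [Complex.ofReal_re, Complex.norm_real, norm_neg, Real.norm_of_nonneg (Real.sqrt_nonneg _)]

/-- The free resolvent is bounded in `L²` with weight `e^{-η⟨x₃⟩}`: this holds in each Landau band,
where it is a convolution with an exponential of rate at least `δ > η`, and the weight commutes
with the Landau projections. -/
theorem norm_mulWeight_resolvent_le (hb : 0 < b) {ξ : ℂ} {R : L2 →L[ℂ] L2}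
    (hR : IsResolventAt (freeOp b) ξ R) {δ η : ℝ} (hη : 0 ≤ η) (hηδ : η < δ)
    (hroots : ∀ j : ℕ, ∃ ζ : ℂ, ζ.re ≤ -δ ∧ ζ ^ 2 = ((2 * j + 1) * b : ℝ) - ξ) (f : L2) :
    ‖mulWeight η (R f)‖ ≤ δ⁻¹ * (1 / (δ - η)) * ‖mulWeight η f‖ := by
  have hδ : 0 < δ := by linarith
  have hRp : ∀ j, R * landauOp b j = landauOp b j * R := by
    refine fun j => resolvent_mul_landauOp_comm hb j fun i => ?_
    obtain ⟨ζ, hζr, hζ⟩ := hroots i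
    refine ⟨(-ζ⁻¹) • vertOp b ζ, ?_⟩
    rw [resolvent_mul_landauOp hb i (by linarith) hζ hR, mul_smul_comm,
      landauOp_mul_vertOp hb i (by linarith)]
  have hW : ∀ j, mulWeight η * landauOp b j = landauOp b j * mulWeight η :=
    fun j => (landauOp_mul_mulWeight hb j hη).symm
  refine norm_le_of_forall_landauOp hb (X := mulWeight η * R) (Y := mulWeight η)
    (mul_nonneg (inv_nonneg.2 hδ.le) (one_div_nonneg.2 (by linarith)))
    (fun j => by rw [mul_assoc, hRp, ← mul_assoc, hW, mul_assoc]) hW (fun j f => ?_) f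
  obtain ⟨ζ, hζr, hζ⟩ := hroots j
  have e : (mulWeight η * R) (landauOp b j f) =
      (-ζ⁻¹) • mulWeight η (vertOp b ζ (landauOp b j f)) := by
    have h1 : R (landauOp b j f) = (R * landauOp b j) f := rfl
    rw [mul_apply_eq_comp, h1, resolvent_mul_landauOp hb j (by linarith) hζ hR, smul_apply,
      map_smul, mul_apply_eq_comp]
  have hn : δ ≤ ‖ζ‖ := by
    have := Complex.abs_re_le_norm ζ
    have := neg_le_abs ζ.re
    linarith
  rw [e, norm_smul, norm_neg, norm_inv, mul_assoc]
  refine mul_le_mul (inv_anti₀ hδ hn) ?_ (norm_nonneg _) (inv_nonneg.2 hδ.le)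
  refine (norm_mulWeight_vertOp_le b hη (by linarith) _).trans ?_
  gcongr
  linarith

/-- The free resolvent preserves exponential decay in `x₃`. -/
theorem exists_resolvent_mul_mulWeight (hb : 0 < b) {ξ : ℂ} {R R' : L2 →L[ℂ] L2}
    (hR : IsResolventAt (freeOp b) ξ R) (hRR : R.adjoint = R') {δ η : ℝ} (hη : 0 ≤ η) (hηδ : η < δ)
    (hroots : ∀ j : ℕ, ∃ ζ : ℂ, ζ.re ≤ -δ ∧ ζ ^ 2 = ((2 * j + 1) * b : ℝ) - ξ) :
    ∃ B, R' * mulWeight η = mulWeight η * B := by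
  obtain ⟨B, hB⟩ := exists_comp_eq_of_norm_le (mulWeight η) (mulWeight η * R)
    (denseRange_mulWeight hη) (norm_mulWeight_resolvent_le hb hR hη hηδ hroots)
  refine ⟨B.adjoint, ?_⟩
  have h1 := congrArg ContinuousLinearMap.adjoint hB
  have hadj : ∀ A B : L2 →L[ℂ] L2, (A * B).adjoint = B.adjoint * A.adjoint :=
    fun A B => ContinuousLinearMap.adjoint_comp A B
  rw [hadj, hRR, (isSelfAdjoint_mulWeight hη).adjoint_eq, ContinuousLinearMap.adjoint_comp,
    (isSelfAdjoint_mulWeight hη).adjoint_eq] at h1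
  exact h1.symm

/-- `P_q⁰ R₀(z) = -k⁻² P_q⁰`: the integral of `r(ζ) f` is `-ζ⁻¹` times the integral of `f`. -/
theorem threshold_mul_resolvent (hb : 0 < b) (q : ℕ) {c : ℝ} {R₀ : L2 →L[ℂ] L2}
    (hR₀ : IsResolventAt (freeOp b) (-(c : ℂ)) R₀) (hs : IsSelfAdjoint R₀) {z : ℂ} (hz : z.im ≠ 0)
    {η : ℝ} (hη : 0 < η) {B : L2 →L[ℂ] L2}
    (hB : shiftedResolvent R₀ z * mulWeight η = mulWeight η * B) :
    landauOp b q * wVertOp b η 0 * B =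
      (landauLevel b c q - z)⁻¹ • (landauOp b q * wVertOp b η 0) := by
  have hR := isResolventAt_shiftedResolvent hR₀ hs hz
  set R := shiftedResolvent R₀ z with hRdef
  set Λ : ℂ := ((landauLevel b c q : ℝ) : ℂ) with hΛ
  have hΛz : Λ - z ≠ 0 := fun h => hz (by
    have h1 := congrArg Complex.im h
    rw [Complex.sub_im, hΛ, Complex.ofReal_im, Complex.zero_im] at h1
    linarith)
  have hW := landauOp_mul_mulWeight hb q hη.le
  set S := mulWeight η * landauOp b q * R * mulWeight η with hS
  -- the identity at `ζ ≠ 0` in the left half plane with `ζ²` non-real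
  have key : ∀ ζ : ℂ, ζ.re < 0 → ζ.im ≠ 0 → ζ ^ 2 - (Λ - z) ≠ 0 →
      landauOp b q * wVertOp b η ζ * B =
        (Λ - z - ζ ^ 2)⁻¹ • (landauOp b q * wVertOp b η ζ + ζ • S) := by
    intro ζ hζr hζi hne
    have hz₁ : (Λ - ζ ^ 2).im ≠ 0 := by
      have h1 : (Λ - ζ ^ 2).im = -(2 * ζ.re * ζ.im) := by
        rw [Complex.sub_im, hΛ, Complex.ofReal_im, sq]; simp; ring
      rw [h1]
      exact neg_ne_zero.2 (mul_ne_zero (mul_ne_zero two_ne_zero hζr.ne) hζi)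
    have hR₁ := isResolventAt_shiftedResolvent hR₀ hs hz₁
    set R₁ := shiftedResolvent R₀ (Λ - ζ ^ 2) with hR₁def
    -- the resolvent identity between `z` and `Λ - ζ²`
    have hres : (Λ - z - ζ ^ 2) • (R₁ * R) = R₁ - R := by
      ext1 f
      have h1 := hR₁.2 _ (hR.1 f)
      simp only at h1
      rw [show f + (-(c : ℂ) + z) • R f - (-(c : ℂ) + (Λ - ζ ^ 2)) • R f =
        f - (Λ - z - ζ ^ 2) • R f by module, map_sub, map_smul] at h1
      rw [sub_eq_iff_eq_add] at h1
      rw [smul_apply, sub_apply, mul_apply_eq_comp, h1, add_sub_cancel_left]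
    have hζ2 : ζ ^ 2 = ((2 * q + 1) * b : ℝ) - (-(c : ℂ) + (Λ - ζ ^ 2)) := by
      rw [hΛ, landauLevel]; push_cast; ring
    have hp := resolvent_mul_landauOp hb q hζr hζ2 hR₁
    have hζ0 : ζ ≠ 0 := fun h => hζi (by rw [h]; rfl)
    have hp' : vertOp b ζ * landauOp b q = (-ζ) • (landauOp b q * R₁) := by
      have hcomm : R₁ * landauOp b q = landauOp b q * R₁ := by
        obtain ⟨δ, hδ, hroots⟩ := exists_landau_roots hb (ξ := -(c : ℂ) + (Λ - ζ ^ 2)) (by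
          rwa [Complex.add_im, Complex.neg_im, Complex.ofReal_im, neg_zero, zero_add])
        refine resolvent_mul_landauOp_comm hb q fun i => ?_
        obtain ⟨ζ', hζr', hζ'⟩ := hroots i
        refine ⟨(-ζ'⁻¹) • vertOp b ζ', ?_⟩
        rw [resolvent_mul_landauOp hb i (by linarith) hζ' hR₁, mul_smul_comm,
          landauOp_mul_vertOp hb i (by linarith)]
      rw [← hcomm, hp, smul_smul, show -ζ * -ζ⁻¹ = 1 by field_simp, one_smul]
    have hne' : Λ - z - ζ ^ 2 ≠ 0 := fun h => hne (by linear_combination -h)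
    rw [eq_inv_smul_iff₀ hne', ← mulWeight_vertOp_mulWeight b hη.le hζr]
    have e1 : landauOp b q * (mulWeight η * vertOp b ζ * mulWeight η) * B =
        mulWeight η * (vertOp b ζ * landauOp b q) * (R * mulWeight η) := by
      rw [hB, ← landauOp_mul_vertOp hb q hζr]
      simp only [← mul_assoc]
      rw [hW]
    have e2 : landauOp b q * (mulWeight η * vertOp b ζ * mulWeight η) =
        mulWeight η * (vertOp b ζ * landauOp b q) * mulWeight η := by
      rw [← landauOp_mul_vertOp hb q hζr]
      simp only [← mul_assoc]
      rw [hW]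
    have e3 : mulWeight η * ((-ζ) • (landauOp b q * R₁)) * (R * mulWeight η) =
        (-ζ) • (mulWeight η * landauOp b q * (R₁ * R) * mulWeight η) := by
      simp only [mul_smul_comm, smul_mul_assoc, mul_assoc]
    have e4 : (Λ - z - ζ ^ 2) • (mulWeight η * landauOp b q * (R₁ * R) * mulWeight η) =
        mulWeight η * landauOp b q * (R₁ - R) * mulWeight η := by
      rw [← hres, mul_smul_comm, smul_mul_assoc]
    rw [e1, e2, hp', e3, smul_comm, e4, hS]
    simp only [mul_smul_comm, smul_mul_assoc, mul_assoc, sub_mul, mul_sub, smul_sub, neg_smul,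
      mul_neg, neg_mul]
    abel
  -- pass to the limit `ζ → 0`
  set ζ : ℕ → ℂ := fun n => (1 / ((n : ℝ) + 1) : ℝ) * (-1 + Complex.I) with hζdef
  have hζlim : Tendsto ζ atTop (𝓝 0) := by
    have h1 := (Complex.continuous_ofReal.tendsto 0).comp
      (tendsto_one_div_add_atTop_nhds_zero_nat (𝕜 := ℝ))
    have h2 := h1.mul_const (-1 + Complex.I)
    simpa [hζdef] using h2
  have hcw : Tendsto (fun n => wVertOp b η (ζ n)) atTop (𝓝 (wVertOp b η 0)) :=
    ((analyticAt_wVertOp b hη.le (by simpa using hη)).continuousAt.tendsto).comp hζlim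
  have hev : ∀ᶠ n in atTop, landauOp b q * wVertOp b η (ζ n) * B =
      (Λ - z - ζ n ^ 2)⁻¹ • (landauOp b q * wVertOp b η (ζ n) + ζ n • S) := by
    have h1 : Tendsto (fun n => ζ n ^ 2 - (Λ - z)) atTop (𝓝 (0 ^ 2 - (Λ - z))) :=
      (hζlim.pow 2).sub tendsto_const_nhds
    have h2 : (0 : ℂ) ^ 2 - (Λ - z) ≠ 0 := by
      rw [zero_pow two_ne_zero, zero_sub]; exact neg_ne_zero.2 hΛz
    filter_upwards [h1.eventually_ne h2] with n hn
    have hpos : 0 < 1 / ((n : ℝ) + 1) := by positivity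
    refine key _ ?_ ?_ hn
    · rw [hζdef, Complex.re_ofReal_mul]; simp; positivity
    · rw [hζdef, Complex.im_ofReal_mul]; simp; positivity
  have l1 : Tendsto (fun n => landauOp b q * wVertOp b η (ζ n) * B) atTop
      (𝓝 (landauOp b q * wVertOp b η 0 * B)) := (hcw.const_mul _).mul_const _
  have l2 : Tendsto (fun n => (Λ - z - ζ n ^ 2)⁻¹ • (landauOp b q * wVertOp b η (ζ n) + ζ n • S))
      atTop (𝓝 ((Λ - z - 0 ^ 2)⁻¹ • (landauOp b q * wVertOp b η 0 + (0 : ℂ) • S))) := by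
    refine Tendsto.smul (Tendsto.inv₀ (tendsto_const_nhds.sub (hζlim.pow 2)) ?_)
      ((hcw.const_mul _).add (hζlim.smul_const S))
    simpa using hΛz
  have := tendsto_nhds_unique (l1.congr' hev) l2
  rw [this, zero_smul, add_zero, zero_pow two_ne_zero, sub_zero]

end

section

variable {b : ℝ}

/-! ### The operator function of the threshold -/

/-- The part of the free resolvent above the `q`-th Landau band. -/
def gapOp (b : ℝ) (q : ℕ) (R₀ : L2 →L[ℂ] L2) : L2 →L[ℂ] L2 :=
  R₀ * (1 - ∑ j ∈ Finset.range (q + 1), landauOp b j)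

theorem resolvent_mul_landauOp_comm' (hb : 0 < b) {c : ℝ} (hc : 0 ≤ c) {R₀ : L2 →L[ℂ] L2}
    (hR₀ : IsResolventAt (freeOp b) (-(c : ℂ)) R₀) (j : ℕ) :
    R₀ * landauOp b j = landauOp b j * R₀ := by
  refine resolvent_mul_landauOp_comm hb j fun i => ?_
  obtain ⟨ζ, hζr, hζ, -⟩ := exists_landau_roots_of_nonneg hb hc i
  have h0 : ζ.re < 0 := hζr.trans_lt (neg_lt_zero.2 (Real.sqrt_pos.2 hb))
  refine ⟨(-ζ⁻¹) • vertOp b ζ, ?_⟩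
  rw [resolvent_mul_landauOp hb i h0 hζ hR₀, mul_smul_comm, landauOp_mul_vertOp hb i h0]

/-- On the bands above the `q`-th one, the free resolvent at `0` has norm at most
`1 / (Λ_{q+1} + c)`. -/
theorem norm_gapOp_lt (hb : 0 < b) {c : ℝ} (hc : 0 ≤ c) (q : ℕ) {R₀ : L2 →L[ℂ] L2}
    (hR₀ : IsResolventAt (freeOp b) (-(c : ℂ)) R₀) :
    ‖(landauLevel b c q : ℂ) • gapOp b q R₀‖ < 1 := by
  have hΛ : 0 < landauLevel b c q := by rw [landauLevel]; positivity
  have hΛ1 : 0 < landauLevel b c (q + 1) := by rw [landauLevel]; positivity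
  have hlt : landauLevel b c q < landauLevel b c (q + 1) := by
    rw [landauLevel, landauLevel]; push_cast; nlinarith
  have hcomm := resolvent_mul_landauOp_comm' hb hc hR₀
  have hP : ∀ j, (1 - ∑ i ∈ Finset.range (q + 1), landauOp b i) * landauOp b j =
      if j ∈ Finset.range (q + 1) then 0 else landauOp b j := by
    intro j
    rw [sub_mul, one_mul, Finset.sum_mul]
    simp only [landauOp_mul hb]
    have e : ∑ i ∈ Finset.range (q + 1), (if i = j then landauOp b i else 0) =
        if j ∈ Finset.range (q + 1) then landauOp b j else 0 := by
      simp
    rw [e]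
    split_ifs <;> simp
  have hP' : ∀ j, landauOp b j * (1 - ∑ i ∈ Finset.range (q + 1), landauOp b i) =
      (1 - ∑ i ∈ Finset.range (q + 1), landauOp b i) * landauOp b j := by
    intro j
    rw [sub_mul, mul_sub, one_mul, mul_one, Finset.sum_mul, Finset.mul_sum]
    congr 1
    refine Finset.sum_congr rfl fun i _ => ?_
    rw [landauOp_mul hb, landauOp_mul hb]
    split_ifs with h1 h2 h2
    · rw [h1]
    · exact absurd h1.symm h2
    · exact absurd h2.symm h1
    · rfl
  have hbound : ∀ f, ‖gapOp b q R₀ f‖ ≤ (landauLevel b c (q + 1))⁻¹ * ‖(1 : L2 →L[ℂ] L2) f‖ := by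
    refine norm_le_of_forall_landauOp hb (inv_nonneg.2 hΛ1.le) (fun j => ?_) (fun j => by
      rw [one_mul, mul_one]) fun j f => ?_
    · rw [gapOp, mul_assoc, ← hP', ← mul_assoc, hcomm, mul_assoc]
    · have e : gapOp b q R₀ (landauOp b j f) =
          (R₀ * ((1 - ∑ i ∈ Finset.range (q + 1), landauOp b i) * landauOp b j)) f := by
        rw [← mul_assoc]; rfl
      rw [e, hP]
      split_ifs with hj
      · rw [mul_zero, zero_apply, norm_zero]
        exact mul_nonneg (inv_nonneg.2 hΛ1.le) (norm_nonneg _)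
      · obtain ⟨ζ, hζr, hζ, hζn, hζe⟩ := exists_landau_roots_of_nonneg hb hc j
        have h0 : ζ.re < 0 := hζr.trans_lt (neg_lt_zero.2 (Real.sqrt_pos.2 hb))
        have hj' : landauLevel b c (q + 1) ≤ landauLevel b c j := by
          have h1 : q + 1 ≤ j := by simpa using hj
          have h2 : ((q + 1 : ℕ) : ℝ) ≤ j := by exact_mod_cast h1
          rw [landauLevel, landauLevel]
          gcongr
        rw [resolvent_mul_landauOp hb j h0 hζ hR₀, smul_apply, norm_smul, norm_neg, norm_inv,
          mul_apply_eq_comp, one_apply_eq_self]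
        calc ‖ζ‖⁻¹ * ‖vertOp b ζ (landauOp b j f)‖
            ≤ ‖ζ‖⁻¹ * (1 / (-ζ.re) * ‖landauOp b j f‖) := by
              gcongr
              exact ((vertOp b ζ).le_opNorm _).trans (by gcongr; exact norm_vertOp_le b h0)
          _ = (‖ζ‖ ^ 2)⁻¹ * ‖landauOp b j f‖ := by
              rw [hζe, neg_neg, one_div, ← mul_assoc, ← mul_inv, sq]
          _ ≤ _ := by
              rw [hζn]; gcongr
  have h1 : ‖gapOp b q R₀‖ ≤ (landauLevel b c (q + 1))⁻¹ :=
    ContinuousLinearMap.opNorm_le_bound _ (inv_nonneg.2 hΛ1.le) hbound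
  rw [norm_smul, Complex.norm_real, Real.norm_of_nonneg hΛ.le]
  calc _ ≤ landauLevel b c q * (landauLevel b c (q + 1))⁻¹ := by gcongr
    _ < 1 := by rw [← div_eq_mul_inv, div_lt_one hΛ1]; exact hlt

/-- The free resolvent splits into the contributions of the bands below the `q`-th one and of the
bands above it. -/
theorem shiftedResolvent_mul_one_sub (hb : 0 < b) {c : ℝ} (hc : 0 ≤ c) (q : ℕ)
    {R₀ : L2 →L[ℂ] L2} (hR₀ : IsResolventAt (freeOp b) (-(c : ℂ)) R₀) {z : ℂ}
    (hu : IsUnit (1 - z • R₀)) (hu' : IsUnit (1 - z • gapOp b q R₀)) :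
    shiftedResolvent R₀ z * (1 - landauOp b q) =
      ∑ j ∈ Finset.range q, shiftedResolvent R₀ z * landauOp b j +
        shiftedResolvent (gapOp b q R₀) z := by
  set P := ∑ j ∈ Finset.range (q + 1), landauOp b j with hP
  have hcomm := resolvent_mul_landauOp_comm' hb hc hR₀
  have hPP : P * P = P := by
    rw [hP, Finset.sum_mul_sum]
    refine Finset.sum_congr rfl fun i hi => ?_
    simp only [landauOp_mul hb]
    rw [Finset.sum_ite_eq, if_pos hi]
  have hRP : R₀ * P = P * R₀ := by
    rw [hP, Finset.mul_sum, Finset.sum_mul]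
    exact Finset.sum_congr rfl fun i _ => hcomm i
  have hg : gapOp b q R₀ = R₀ * (1 - P) := rfl
  have e1 : (1 - z • R₀) * (1 - P) = (1 - P) * (1 - z • gapOp b q R₀) := by
    have h1 : (1 - P) * (R₀ * (1 - P)) = R₀ * (1 - P) := by
      rw [← mul_assoc, sub_mul, one_mul, ← hRP, sub_mul, mul_sub, mul_one, mul_sub, mul_one,
        mul_assoc R₀ P P, hPP]
      abel
    rw [hg, sub_mul, one_mul, smul_mul_assoc, mul_sub (1 - P) 1, mul_one, mul_smul_comm, h1]
  have e2 : Ring.inverse (1 - z • R₀) * (1 - P) = (1 - P) * Ring.inverse (1 - z • gapOp b q R₀) := by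
    have h1 := congrArg (fun X => Ring.inverse (1 - z • R₀) * X *
      Ring.inverse (1 - z • gapOp b q R₀)) e1
    rw [← mul_assoc, Ring.inverse_mul_cancel _ hu, one_mul, mul_assoc, mul_assoc,
      Ring.mul_inverse_cancel _ hu', mul_one] at h1
    exact h1.symm
  have e3 : shiftedResolvent (gapOp b q R₀) z = shiftedResolvent R₀ z * (1 - P) := by
    rw [shiftedResolvent, hg, mul_assoc, ← hg, ← e2, shiftedResolvent, mul_assoc]
  rw [e3, ← Finset.mul_sum, ← mul_add]
  congr 1
  rw [hP, Finset.sum_range_succ]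
  abel

/-- The function `i (Λ_q - Λ_j - κ²)^{1/2}`: the root `ζ` of `ζ² = Λ_j - z`, `z = Λ_q - κ²`, that
lies in the left half plane at the points of interest. -/
def lowerRoot (b : ℝ) (q j : ℕ) (κ : ℂ) : ℂ :=
  Complex.I * ((2 * ((q : ℝ) - j) * b : ℝ) - κ ^ 2) ^ (1 / 2 : ℂ)

theorem analyticAt_lowerRoot (hb : 0 < b) {q j : ℕ} (hj : j < q) :
    AnalyticAt ℂ (lowerRoot b q j) 0 ∧ (lowerRoot b q j 0).re = 0 ∧ lowerRoot b q j 0 ≠ 0 := by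
  have hd : 0 < 2 * ((q : ℝ) - j) * b := by
    have : (j : ℝ) < q := by exact_mod_cast hj
    have := sub_pos.2 this
    positivity
  refine ⟨?_, ?_, ?_⟩
  · refine analyticAt_const.mul (AnalyticAt.cpow ?_ analyticAt_const ?_)
    · exact analyticAt_const.sub (analyticAt_id.pow 2)
    · rw [zero_pow two_ne_zero, sub_zero]
      exact Complex.ofReal_mem_slitPlane.2 hd
  · rw [lowerRoot, zero_pow two_ne_zero, sub_zero,
      show (1 / 2 : ℂ) = ((1 / 2 : ℝ) : ℂ) by push_cast; rfl, ← Complex.ofReal_cpow hd.le]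
    simp [Complex.mul_re]
  · rw [lowerRoot, zero_pow two_ne_zero, sub_zero]
    refine mul_ne_zero Complex.I_ne_zero ?_
    rw [Complex.cpow_def_of_ne_zero (by exact_mod_cast hd.ne')]
    exact Complex.exp_ne_zero _

/-- The principal square root maps the upper half plane to the open first quadrant. -/
theorem sqrt_mem_quadrant {w : ℂ} (hw : 0 < w.im) :
    0 < (w ^ (1 / 2 : ℂ)).re ∧ 0 < (w ^ (1 / 2 : ℂ)).im ∧ (w ^ (1 / 2 : ℂ)) ^ 2 = w := by
  have h2 : (w ^ (1 / 2 : ℂ)) ^ 2 = w := by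
    rw [one_div]
    exact Complex.cpow_ofNat_inv_pow w 2
  have h0 : w ≠ 0 := fun h => by rw [h] at hw; simp at hw
  have harg := Complex.arg_nonneg_iff.2 hw.le
  have harg2 : 0 < Complex.arg w := by
    refine lt_of_le_of_ne harg fun h => ?_
    have := (Complex.arg_eq_zero_iff).1 h.symm
    rw [this.2] at hw; exact lt_irrefl _ hw
  have harg3 : Complex.arg w < Real.pi := by
    refine lt_of_le_of_ne (Complex.arg_le_pi w) fun h => ?_
    have := (Complex.arg_eq_pi_iff).1 h
    rw [this.2] at hw; exact lt_irrefl _ hw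
  have e : w ^ (1 / 2 : ℂ) = Complex.exp (Complex.log w * (1 / 2)) :=
    Complex.cpow_def_of_ne_zero h0 _
  have him : (Complex.log w * (1 / 2)).im = Complex.arg w / 2 := by
    rw [show (1 / 2 : ℂ) = ((1 / 2 : ℝ) : ℂ) by push_cast; rfl, Complex.im_mul_ofReal,
      Complex.log_im]
    ring
  refine ⟨?_, ?_, h2⟩
  · rw [e, Complex.exp_re, him]
    exact mul_pos (Real.exp_pos _) (Real.cos_pos_of_mem_Ioo ⟨by linarith, by linarith⟩)
  · rw [e, Complex.exp_im, him]
    exact mul_pos (Real.exp_pos _) (Real.sin_pos_of_pos_of_lt_pi (by linarith) (by linarith))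

theorem lowerRoot_spec (c : ℝ) (q j : ℕ) {κ z : ℂ} (hz : z = landauLevel b c q - κ ^ 2)
    (hzi : 0 < z.im) : (lowerRoot b q j κ).re < 0 ∧
      lowerRoot b q j κ ^ 2 = ((2 * j + 1) * b : ℝ) - (-(c : ℂ) + z) := by
  set w : ℂ := (2 * ((q : ℝ) - j) * b : ℝ) - κ ^ 2 with hw
  have hwz : w = z - landauLevel b c j := by
    rw [hw, hz, landauLevel, landauLevel]; push_cast; ring
  have hwi : 0 < w.im := by
    rw [hwz, Complex.sub_im, Complex.ofReal_im, sub_zero]; exact hzi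
  obtain ⟨h1, h2, h3⟩ := sqrt_mem_quadrant hwi
  constructor
  · rw [lowerRoot, Complex.mul_re, Complex.I_re, Complex.I_im]
    linarith
  · rw [lowerRoot, mul_pow, Complex.I_sq, h3, hwz, landauLevel]; push_cast; ring

/-- The operator function `A_q^l`, for `M = N e^{-ε⟨x₃⟩}`. -/
def charFun (b c ε : ℝ) (q : ℕ) (R₀ N M : L2 →L[ℂ] L2) (κ : ℂ) : L2 →L[ℂ] L2 :=
  let z : ℂ := landauLevel b c q - κ ^ 2
  z ^ 2 • (N * (landauOp b q * wVertOp b ε κ) * N.adjoint) -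
    κ • (z • (M * M.adjoint) + z ^ 2 •
      (∑ j ∈ Finset.range q, (-(lowerRoot b q j κ)⁻¹) •
        (N * (landauOp b j * wVertOp b ε (lowerRoot b q j κ)) * N.adjoint) +
      M * shiftedResolvent (gapOp b q R₀) z * M.adjoint))

/-- The weights continue the terms of the finitely many bands up to the `q`-th one across the
imaginary axis, on which their exponents lie for `κ = 0`; the contribution of the higher bands is
a Neumann series. -/
theorem analyticAt_charFun (hb : 0 < b) {c ε : ℝ} (hc : 0 ≤ c) (hε : 0 < ε) (q : ℕ)
    {R₀ : L2 →L[ℂ] L2} (hR₀ : IsResolventAt (freeOp b) (-(c : ℂ)) R₀) (N M : L2 →L[ℂ] L2) :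
    AnalyticAt ℂ (charFun b c ε q R₀ N M) 0 := by
  have hz : AnalyticAt ℂ (fun κ : ℂ => (landauLevel b c q : ℂ) - κ ^ 2) 0 :=
    analyticAt_const.sub (analyticAt_id.pow 2)
  have hsand : ∀ (j : ℕ) {ζ : ℂ → ℂ}, AnalyticAt ℂ ζ 0 → (ζ 0).re < ε →
      AnalyticAt ℂ (fun κ => N * (landauOp b j * wVertOp b ε (ζ κ)) * N.adjoint) 0 := by
    intro j ζ h1 h2
    have h3 : AnalyticAt ℂ (fun κ => wVertOp b ε (ζ κ)) 0 :=
      (analyticAt_wVertOp b hε.le h2).fun_comp h1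
    exact (analyticAt_const.mul (analyticAt_const.mul h3)).mul analyticAt_const
  have hgap : AnalyticAt ℂ (fun κ : ℂ =>
      shiftedResolvent (gapOp b q R₀) ((landauLevel b c q : ℂ) - κ ^ 2)) 0 := by
    have hu := isUnit_one_sub_of_norm_lt_one (norm_gapOp_lt hb hc q hR₀)
    have h1 : AnalyticAt ℂ (fun κ : ℂ =>
        1 - ((landauLevel b c q : ℂ) - κ ^ 2) • gapOp b q R₀) 0 :=
      analyticAt_const.sub (hz.smul analyticAt_const)
    refine analyticAt_const.mul (AnalyticAt.fun_comp (g := Ring.inverse) ?_ h1)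
    rw [zero_pow two_ne_zero, sub_zero]
    obtain ⟨u, hu⟩ := hu
    rw [← hu]
    exact analyticAt_inverse u
  refine AnalyticAt.sub (AnalyticAt.smul (hz.pow 2) (hsand q analyticAt_id (by simpa using hε)))
    (AnalyticAt.smul analyticAt_id (AnalyticAt.add (AnalyticAt.smul hz analyticAt_const)
      (AnalyticAt.smul (hz.pow 2) (AnalyticAt.add (Finset.analyticAt_fun_sum _ fun j hj => ?_)
        ((analyticAt_const.mul hgap).mul analyticAt_const)))))
  obtain ⟨h1, h2, h3⟩ := analyticAt_lowerRoot hb (Finset.mem_range.1 hj)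
  exact AnalyticAt.smul (h1.inv h3).neg (hsand j h1 (by rw [h2]; exact hε))

theorem charOp_eq_charFun (hb : 0 < b) {c ε : ℝ} (hc : 0 ≤ c) (hε : 0 < ε) (q : ℕ)
    {R₀ : L2 →L[ℂ] L2} (hR₀ : IsResolventAt (freeOp b) (-(c : ℂ)) R₀) (hs : IsSelfAdjoint R₀)
    {N M : L2 →L[ℂ] L2} (hN : N * mulWeight ε = M) {k : ℂ} (hkr : 0 < k.re) (hki : 0 < k.im)
    (hu' : IsUnit (1 - ((landauLevel b c q : ℂ) + k ^ 2) • gapOp b q R₀)) :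
    charOp b c q M k = charFun b c ε q R₀ N M (Complex.I * k) := by
  set z : ℂ := (landauLevel b c q : ℂ) + k ^ 2 with hz
  have hzi : 0 < z.im := by
    rw [hz, Complex.add_im, Complex.ofReal_im, zero_add, sq, Complex.mul_im]
    nlinarith [mul_pos hkr hki]
  have hz' : (landauLevel b c q : ℂ) - (Complex.I * k) ^ 2 = z := by
    rw [hz, mul_pow, Complex.I_sq]; ring
  have hres := isResolventAt_shiftedResolvent hR₀ hs hzi.ne'
  have hfree : freeResolvent b c z = shiftedResolvent R₀ z :=
    freeResolvent_eq (by rw [sub_eq_neg_add]; exact hres)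
  have hκ : (Complex.I * k).re < 0 := by simp; exact hki
  have hMa : M.adjoint = mulWeight ε * N.adjoint := by
    rw [← hN]
    exact (ContinuousLinearMap.adjoint_comp _ _).trans (by
      rw [(isSelfAdjoint_mulWeight hε.le).adjoint_eq]; rfl)
  have hsand : ∀ (j : ℕ) {ζ : ℂ}, ζ.re < 0 → M * (landauOp b j * vertOp b ζ) * M.adjoint =
      N * (landauOp b j * wVertOp b ε ζ) * N.adjoint := by
    intro j ζ hζ
    rw [← mulWeight_vertOp_mulWeight b hε.le hζ, hMa, ← hN]
    simp only [← mul_assoc]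
    rw [mul_assoc N (landauOp b j), landauOp_mul_mulWeight hb j hε.le, ← mul_assoc]
  have hsplit := shiftedResolvent_mul_one_sub hb hc q hR₀
    (isUnit_one_sub_smul_selfAdjoint hs hzi.ne') hu'
  have hc1 : charOp b c q M k = z ^ 2 • (M * landauTensor b q (Complex.I * k) * M.adjoint) -
      (Complex.I * k) • (M * (z • 1 + z ^ 2 • (freeResolvent b c z * (1 - landauProj b q))) *
        M.adjoint) := rfl
  rw [hc1, landauTensor_eq hb q hκ, hsand q hκ, hfree, landauProj_eq hb, hsplit, charFun]
  simp only [hz']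
  congr 2
  rw [mul_add, add_mul, mul_smul_comm, mul_one, smul_mul_assoc, mul_smul_comm, smul_mul_assoc,
    mul_add, add_mul, Finset.mul_sum, Finset.sum_mul]
  congr 3
  refine Finset.sum_congr rfl fun j _ => ?_
  obtain ⟨h1, h2⟩ := lowerRoot_spec (b := b) c q j hz'.symm hzi
  rw [resolvent_mul_landauOp hb j h1 h2 hres, mul_smul_comm, smul_mul_assoc,
    ← landauOp_mul_vertOp hb j h1, hsand j h1]

theorem isCharFunction_charFun (hb : 0 < b) {c ε : ℝ} (hc : 0 ≤ c) (hε : 0 < ε) (q : ℕ)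
    {R₀ : L2 →L[ℂ] L2} (hR₀ : IsResolventAt (freeOp b) (-(c : ℂ)) R₀) (hs : IsSelfAdjoint R₀)
    {N M : L2 →L[ℂ] L2} (hN : N * mulWeight ε = M) :
    IsCharFunction b c q M (charFun b c ε q R₀ N M) := by
  refine ⟨analyticAt_charFun hb hc hε q hR₀ N M, ?_⟩
  have h1 : Tendsto (fun k : ℂ => ‖((landauLevel b c q : ℂ) + k ^ 2) • gapOp b q R₀‖) (𝓝 0)
      (𝓝 ‖(landauLevel b c q : ℂ) • gapOp b q R₀‖) := by
    have h : Continuous fun k : ℂ => ‖((landauLevel b c q : ℂ) + k ^ 2) • gapOp b q R₀‖ := by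
      fun_prop
    have h2 := h.tendsto 0
    rwa [zero_pow two_ne_zero, add_zero] at h2
  filter_upwards [h1.eventually_lt_const (norm_gapOp_lt hb hc q hR₀)] with k hk hkr hki
  exact (charOp_eq_charFun hb hc hε q hR₀ hs hN hkr hki (isUnit_one_sub_of_norm_lt_one hk)).symm

/-- The quadrant `Re k, Im k > 0` accumulates at `0`, along the diagonal. -/
theorem eventually_quadrant (p : ℂ → Prop) (h : ∀ᶠ k : ℂ in 𝓝 0, 0 < k.re → 0 < k.im → p k) :
    ∃ᶠ κ : ℂ in 𝓝[≠] 0, p (-Complex.I * κ) := by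
  have hlim : Tendsto (fun n : ℕ => (1 / ((n : ℝ) + 1) : ℝ) * (1 + Complex.I)) atTop (𝓝 0) := by
    have h1 := (Complex.continuous_ofReal.tendsto 0).comp
      (tendsto_one_div_add_atTop_nhds_zero_nat (𝕜 := ℝ))
    have h2 := h1.mul_const (1 + Complex.I)
    simpa using h2
  have hpos : ∀ n : ℕ, 0 < 1 / ((n : ℝ) + 1) := fun n => by positivity
  have hre : ∀ n : ℕ, 0 < (((1 / ((n : ℝ) + 1) : ℝ) : ℂ) * (1 + Complex.I)).re := fun n => by
    rw [Complex.re_ofReal_mul]; simp; positivity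
  have him : ∀ n : ℕ, 0 < (((1 / ((n : ℝ) + 1) : ℝ) : ℂ) * (1 + Complex.I)).im := fun n => by
    rw [Complex.im_ofReal_mul]; simp; positivity
  have h2 : Tendsto (fun n : ℕ => Complex.I * ((1 / ((n : ℝ) + 1) : ℝ) * (1 + Complex.I))) atTop
      (𝓝[≠] 0) := by
    refine tendsto_nhdsWithin_iff.2 ⟨by simpa using hlim.const_mul Complex.I, ?_⟩
    refine Eventually.of_forall fun n => mul_ne_zero Complex.I_ne_zero fun h => ?_
    have := hre n
    rw [h] at this
    exact lt_irrefl _ this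
  refine h2.frequently (Eventually.frequently ?_)
  filter_upwards [hlim.eventually h] with n hn
  rw [← mul_assoc, neg_mul, Complex.I_mul_I, neg_neg, one_mul]
  exact hn (hre n) (him n)

/-- The germ of `A_q^l` at `0` is unique. -/
theorem IsCharFunction.eventuallyEq {c : ℝ} {q : ℕ} {M : L2 →L[ℂ] L2} {A A' : ℂ → L2 →L[ℂ] L2}
    (h : IsCharFunction b c q M A) (h' : IsCharFunction b c q M A') : A =ᶠ[𝓝 0] A' := by
  refine (h.1.frequently_eq_iff_eventually_eq h'.1).1 ?_
  have h1 := eventually_quadrant (fun k => A (Complex.I * k) = A' (Complex.I * k)) (by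
    filter_upwards [h.2, h'.2] with k h1 h2 hr hi
    rw [h1 hr hi, h2 hr hi])
  refine h1.mono fun κ hκ => ?_
  rwa [← mul_assoc, mul_neg, Complex.I_mul_I, neg_neg, one_mul] at hκ

/-- The operator `e^{-ε⟨x₃⟩} P_q⁰ e^{-ε⟨x₃⟩}` is self-adjoint. -/
theorem isSelfAdjoint_landauOp_mul_wVertOp_zero (hb : 0 < b) (q : ℕ) {ε : ℝ} (hε : 0 < ε) :
    IsSelfAdjoint (landauOp b q * wVertOp b ε 0) := by
  have hadj : ∀ A B : L2 →L[ℂ] L2, (A * B).adjoint = B.adjoint * A.adjoint :=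
    fun A B => ContinuousLinearMap.adjoint_comp A B
  -- a limit of the operators with `ζ < 0`
  have hlim : Tendsto (fun n : ℕ => (((-(1 / ((n : ℝ) + 1))) : ℝ) : ℂ)) atTop (𝓝 0) := by
    have h1 := (Complex.continuous_ofReal.tendsto 0).comp
      (by simpa using (tendsto_one_div_add_atTop_nhds_zero_nat (𝕜 := ℝ)).neg :
        Tendsto (fun n : ℕ => -(1 / ((n : ℝ) + 1))) atTop (𝓝 0))
    simpa [Function.comp_def] using h1
  have hw : Tendsto (fun n : ℕ => wVertOp b ε (((-(1 / ((n : ℝ) + 1))) : ℝ) : ℂ)) atTop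
      (𝓝 (wVertOp b ε 0)) :=
    (analyticAt_wVertOp b hε.le (by simpa using hε)).continuousAt.tendsto.comp hlim
  have hsa : ∀ n : ℕ, IsSelfAdjoint (wVertOp b ε (((-(1 / ((n : ℝ) + 1))) : ℝ) : ℂ)) := by
    intro n
    have hneg : (((-(1 / ((n : ℝ) + 1)) : ℝ) : ℂ)).re < 0 := by
      rw [Complex.ofReal_re, neg_lt_zero]; positivity
    rw [← mulWeight_vertOp_mulWeight b hε.le hneg, IsSelfAdjoint,
      ContinuousLinearMap.star_eq_adjoint, hadj, hadj, vertOp_adjoint b hneg, Complex.conj_ofReal,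
      (isSelfAdjoint_mulWeight hε.le).adjoint_eq, mul_assoc]
  have h1 : IsSelfAdjoint (wVertOp b ε 0) := by
    have h2 := (continuous_star.tendsto _).comp hw
    refine tendsto_nhds_unique h2 (hw.congr fun n => ?_)
    exact ((hsa n).star_eq).symm
  rw [IsSelfAdjoint, ContinuousLinearMap.star_eq_adjoint, hadj, h1.adjoint_eq,
    (isSelfAdjoint_landauOp hb q).adjoint_eq,
    landauOp_mul_wVertOp hb q hε.le (by simpa using hε)]

end

section

variable {b : ℝ}

/-! ### Localization of form domains -/

/-- A real smooth function that is bounded together with its derivatives of orders one and two. -/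
structure IsCutoff (ψ : E3 → ℂ) : Prop where
  contDiff : ContDiff ℝ ∞ ψ
  conj_eq : ∀ x, starRingEnd ℂ (ψ x) = ψ x
  multiplier : IsMultiplier ψ
  multiplier_partialD : ∀ j, IsMultiplier (partialD j ψ)
  multiplier_partialD_partialD : ∀ j, IsMultiplier (partialD j (partialD j ψ))

theorem conj_partialD {ψ : E3 → ℂ} (hψ : ContDiff ℝ ∞ ψ) (h : ∀ x, starRingEnd ℂ (ψ x) = ψ x)
    (j : Fin 3) (x : E3) : starRingEnd ℂ (partialD j ψ x) = partialD j ψ x := by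
  have h1 := (Complex.conjCLE.toContinuousLinearMap.hasFDerivAt (x := ψ x)).comp x
    (differentiable_of_contDiff hψ x).hasFDerivAt
  have h2 : (Complex.conjCLE.toContinuousLinearMap : ℂ → ℂ) ∘ ψ = ψ := funext h
  rw [h2] at h1
  have h3 := congrArg (fun L => L (EuclideanSpace.single j 1)) h1.fderiv
  exact h3.symm

theorem partialD_eq_zero {φ : E3 → ℂ} {j : Fin 3} {x : E3} (hx : x ∉ tsupport φ) :
    partialD j φ x = 0 := by
  rw [partialD, fderiv_of_notMem_tsupport ℝ hx, zero_apply]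

theorem tsupport_partialD_subset (j : Fin 3) (φ : E3 → ℂ) : tsupport (partialD j φ) ⊆ tsupport φ :=
  closure_minimal (fun _ hx => by_contra fun h => hx (partialD_eq_zero h)) (isClosed_tsupport φ)

theorem isCutoff_of_hasCompactSupport {χ : E3 → ℂ} (h : ContDiff ℝ ∞ χ) (hc : HasCompactSupport χ)
    (hr : ∀ x, starRingEnd ℂ (χ x) = χ x) : IsCutoff χ :=
  ⟨h, hr, isMultiplier_of_compact h.continuous hc,
    fun j => isMultiplier_of_compact (contDiff_partialD h j).continuous
      (hasCompactSupport_partialD hc j),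
    fun j => isMultiplier_of_compact (contDiff_partialD (contDiff_partialD h j) j).continuous
      (hasCompactSupport_partialD (hasCompactSupport_partialD hc j) j)⟩

theorem partialD_one_sub {χ : E3 → ℂ} (j : Fin 3) :
    partialD j (fun x => 1 - χ x) = fun x => -partialD j χ x := by
  ext x
  rw [partialD, fderiv_const_sub, neg_apply]
  rfl

theorem IsCutoff.neg_multiplier {m : E3 → ℂ} (h : IsMultiplier m) : IsMultiplier fun x => -m x := by
  simpa using (IsMultiplier.const (-1 : ℂ)).mul h

theorem IsCutoff.one_sub {χ : E3 → ℂ} (h : IsCutoff χ) : IsCutoff fun x => 1 - χ x := by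
  have h2 : ∀ j, partialD j (fun x => -partialD j χ x) = fun x => -partialD j (partialD j χ) x := by
    intro j
    ext x
    rw [partialD, fderiv_fun_neg, neg_apply]
    rfl
  refine ⟨contDiff_const.sub h.contDiff, fun x => by rw [map_sub, map_one, h.conj_eq], ?_, ?_, ?_⟩
  · have := (IsMultiplier.const (1 : ℂ)).add (IsCutoff.neg_multiplier h.multiplier)
    simpa [sub_eq_add_neg] using this
  · intro j
    rw [partialD_one_sub]
    exact IsCutoff.neg_multiplier (h.multiplier_partialD j)
  · intro j
    rw [partialD_one_sub, h2]
    exact IsCutoff.neg_multiplier (h.multiplier_partialD_partialD j)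

theorem inner_mulOp_left {m : E3 → ℂ} (hm : IsMultiplier m) (hr : ∀ x, starRingEnd ℂ (m x) = m x)
    (f g : L2) : ⟪mulOp volume m f, g⟫_ℂ = ⟪f, mulOp volume m g⟫_ℂ := by
  rw [← ContinuousLinearMap.adjoint_inner_right, mulOp_adjoint hm]
  simp only [hr]

/-- The gradient of `ψ u`. -/
def cutGrad (ψ : E3 → ℂ) (u : L2) (G : Fin 3 → L2) (j : Fin 3) : L2 :=
  mulOp volume ψ (G j) + mulOp volume (partialD j ψ) u

/-- The right-hand side `ψ w - 2 ∇ψ · G - (Δψ) u` of the equation of `ψ u`. -/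
def cutSource (ψ : E3 → ℂ) (u : L2) (G : Fin 3 → L2) (w : L2) : L2 :=
  mulOp volume ψ w - (2 : ℂ) • ∑ j, mulOp volume (partialD j ψ) (G j) -
    ∑ j, mulOp volume (partialD j (partialD j ψ)) u

theorem coeFn_cutGrad {ψ φ : E3 → ℂ} (hψ : IsCutoff ψ) (hφ : ContDiff ℝ ∞ φ) {u : L2}
    {G : Fin 3 → L2} (hu : u =ᵐ[volume] φ) (hG : ∀ j, G j =ᵐ[volume] magGrad b φ j) (j : Fin 3) :
    cutGrad ψ u G j =ᵐ[volume] magGrad b (fun x => ψ x * φ x) j := by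
  filter_upwards [Lp.coeFn_add (mulOp volume ψ (G j)) (mulOp volume (partialD j ψ) u),
    coeFn_mulOp hψ.multiplier (G j), coeFn_mulOp (hψ.multiplier_partialD j) u, hu, hG j]
    with x e1 e2 e3 e4 e5
  rw [cutGrad, e1, Pi.add_apply, e2, e3, e4, e5, magGrad_mul b hψ.contDiff hφ]

theorem coeFn_mulOp_of_ae {m φ : E3 → ℂ} (hm : IsMultiplier m) {u : L2} (hu : u =ᵐ[volume] φ) :
    mulOp volume m u =ᵐ[volume] fun x => m x * φ x := by
  filter_upwards [coeFn_mulOp hm u, hu] with x e1 e2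
  rw [e1, e2]

theorem mem_closure_core {D : Submodule ℂ (L2 × (Fin 3 → L2))} {x : L2 × (Fin 3 → L2)}
    (h : x ∈ D.topologicalClosure) : x ∈ closure (D : Set (L2 × (Fin 3 → L2))) := by
  rwa [← SetLike.mem_coe, Submodule.topologicalClosure_coe] at h

theorem cutGrad_mem_freeForm {ψ : E3 → ℂ} (hψ : IsCutoff ψ) {u : L2} {G : Fin 3 → L2}
    (h : (u, G) ∈ freeForm b) : (mulOp volume ψ u, cutGrad ψ u G) ∈ freeForm b := by
  have h2 := map_mem_closure (t := (dirichletCore b volume Set.univ : Set (L2 × (Fin 3 → L2))))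
    (f := fun p : L2 × (Fin 3 → L2) => (mulOp volume ψ p.1, cutGrad ψ p.1 p.2))
    (by unfold cutGrad; fun_prop) (mem_closure_core h) ?_
  · rwa [freeForm, ← SetLike.mem_coe, Submodule.topologicalClosure_coe]
  · rintro p ⟨φ, h1, h2, -, h4, h5⟩
    exact ⟨fun x => ψ x * φ x, hψ.contDiff.mul h1, h2.mul_left, Set.subset_univ _,
      coeFn_mulOp_of_ae hψ.multiplier h4, fun j => coeFn_cutGrad hψ h1 h4 h5 j⟩

theorem restrict_cutGrad_mem_dirichletForm {U : Set E3} {ψ : E3 → ℂ} (hψ : IsCutoff ψ)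
    (hU : tsupport ψ ⊆ U) {u : L2} {G : Fin 3 → L2} (h : (u, G) ∈ freeForm b) :
    (restrictTo U (mulOp volume ψ u), fun j => restrictTo U (cutGrad ψ u G j)) ∈
      dirichletForm b U := by
  have h2 := map_mem_closure
    (t := (dirichletCore b (volume.restrict U) U : Set (L2on U × (Fin 3 → L2on U))))
    (f := fun p : L2 × (Fin 3 → L2) =>
      (restrictTo U (mulOp volume ψ p.1), fun j => restrictTo U (cutGrad ψ p.1 p.2 j)))
    (by unfold cutGrad; fun_prop) (mem_closure_core h) ?_
  · rwa [dirichletForm, ← SetLike.mem_coe, Submodule.topologicalClosure_coe]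
  · rintro p ⟨φ, h1, h2, -, h4, h5⟩
    exact ⟨fun x => ψ x * φ x, hψ.contDiff.mul h1, h2.mul_left,
      (closure_mono (Function.support_mul_subset_left _ _)).trans hU,
      restrictTo_ae_eq (coeFn_mulOp_of_ae hψ.multiplier h4),
      fun j => restrictTo_ae_eq (coeFn_cutGrad hψ h1 h4 h5 j)⟩

/-- A cutoff that vanishes on the boundary produces elements with trace zero. -/
theorem restrict_cutGrad_mem_robinForm {U : Set E3} {ψ : E3 → ℂ} (hψ : IsCutoff ψ)
    (hU : ∀ x ∈ frontier U, ψ x = 0) {u : L2} {G : Fin 3 → L2} (h : (u, G) ∈ freeForm b) :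
    (restrictTo U (mulOp volume ψ u), (fun j => restrictTo U (cutGrad ψ u G j)), 0) ∈
      robinForm b U := by
  have h2 := map_mem_closure
    (t := (robinCore b U : Set (L2on U × (Fin 3 → L2on U) × L2surface (frontier U))))
    (f := fun p : L2 × (Fin 3 → L2) =>
      (restrictTo U (mulOp volume ψ p.1), (fun j => restrictTo U (cutGrad ψ p.1 p.2 j)),
        (0 : L2surface (frontier U))))
    (by unfold cutGrad; fun_prop) (mem_closure_core h) ?_
  · rwa [robinForm, ← SetLike.mem_coe, Submodule.topologicalClosure_coe]
  · rintro p ⟨φ, h1, h2, -, h4, h5⟩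
    refine ⟨fun x => ψ x * φ x, hψ.contDiff.mul h1, h2.mul_left,
      restrictTo_ae_eq (coeFn_mulOp_of_ae hψ.multiplier h4),
      fun j => restrictTo_ae_eq (coeFn_cutGrad hψ h1 h4 h5 j), ?_⟩
    filter_upwards [Lp.coeFn_zero ℂ 2 ((μHE[2] : Measure E3).restrict (frontier U)),
      ae_restrict_mem isClosed_frontier.measurableSet] with x e1 e2
    rw [e1, hU x e2, zero_mul, Pi.zero_apply]

/-- Integration by parts in the form domain. -/
theorem inner_grad_eq_neg {u v : L2} {G h : Fin 3 → L2} (hu : (u, G) ∈ freeForm b)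
    (hv : (v, h) ∈ freeForm b) (j : Fin 3) : ⟪h j, u⟫_ℂ = -⟪v, G j⟫_ℂ := by
  have h1 : (u, G) ∈ {p : L2 × (Fin 3 → L2) | ∀ q ∈ dirichletCore b volume Set.univ,
      ⟪q.2 j, p.1⟫_ℂ = -⟪q.1, p.2 j⟫_ℂ} := by
    refine mem_of_mem_topologicalClosure ?_ ?_ hu
    · simp only [Set.ofPred_forall]
      exact isClosed_iInter fun q => isClosed_iInter fun _ =>
        isClosed_eq (by fun_prop) (by fun_prop)
    · rintro p ⟨φ, p1, p2, -, p4, p5⟩ q ⟨ψ, q1, q2, -, q4, q5⟩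
      rw [inner_eq_integral (q5 j) p4, inner_eq_integral q4 (p5 j),
        integral_conj_magGrad_mul b q1 q2 p1 j]
  have h2 : (v, h) ∈ {q : L2 × (Fin 3 → L2) | ⟪q.2 j, u⟫_ℂ = -⟪q.1, G j⟫_ℂ} :=
    mem_of_mem_topologicalClosure (isClosed_eq (by fun_prop) (by fun_prop))
      (fun q hq => h1 q hq) hv
  exact h2

/-- The weak form of the product rule: if `u` solves the free equation with right-hand side `w`,
then `ψ u` solves it with right-hand side `cutSource ψ u G w`. -/
theorem sum_inner_cutGrad {ψ : E3 → ℂ} (hψ : IsCutoff ψ) {u w v : L2} {G h : Fin 3 → L2}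
    (hu : (u, G) ∈ freeForm b)
    (hw : ∀ v h, (v, h) ∈ freeForm b → ∑ j, ⟪h j, G j⟫_ℂ = ⟪v, w⟫_ℂ) (hv : (v, h) ∈ freeForm b) :
    ∑ j, ⟪h j, cutGrad ψ u G j⟫_ℂ = ⟪v, cutSource ψ u G w⟫_ℂ := by
  have hr1 := fun j => conj_partialD hψ.contDiff hψ.conj_eq j
  have h1 := hw _ _ (cutGrad_mem_freeForm hψ hv)
  have h2 : ∀ j, ⟪h j, mulOp volume (partialD j ψ) u⟫_ℂ =
      -⟪v, mulOp volume (partialD j ψ) (G j)⟫_ℂ -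
        ⟪v, mulOp volume (partialD j (partialD j ψ)) u⟫_ℂ := by
    intro j
    have hd : ContDiff ℝ ∞ (partialD j ψ) := contDiff_partialD hψ.contDiff j
    -- integrate by parts in the `j`-th direction alone: of the derivatives of `ψ`, only those in
    -- this direction enter, and they are bounded
    have hcl : (u, G) ∈ {p : L2 × (Fin 3 → L2) | ⟪h j, mulOp volume (partialD j ψ) p.1⟫_ℂ =
        -⟪v, mulOp volume (partialD j ψ) (p.2 j)⟫_ℂ -
          ⟪v, mulOp volume (partialD j (partialD j ψ)) p.1⟫_ℂ} := by
      refine mem_of_mem_topologicalClosure (isClosed_eq (by fun_prop) (by fun_prop)) ?_ hu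
      rintro p ⟨φ, p1, p2, -, p4, p5⟩
      have hΨ : ContDiff ℝ ∞ fun x => partialD j ψ x * φ x := hd.mul p1
      have hc : HasCompactSupport fun x => partialD j ψ x * φ x := p2.mul_left
      have hL : ∀ i, MemLp (magGrad b (fun x => partialD j ψ x * φ x) i) 2 := fun i =>
        (contDiff_magGrad b hΨ i).continuous.memLp_of_hasCompactSupport
          (hasCompactSupport_magGrad b hc i)
      have hmem := mem_freeForm_of_contDiff hΨ
        (coeFn_mulOp_of_ae (hψ.multiplier_partialD j) p4) (g := fun i => (hL i).toLp _)
        (fun i => (hL i).coeFn_toLp)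
      have e : (hL j).toLp _ = mulOp volume (partialD j ψ) (p.2 j) +
          mulOp volume (partialD j (partialD j ψ)) p.1 := by
        refine Lp.ext ?_
        filter_upwards [(hL j).coeFn_toLp, Lp.coeFn_add (mulOp volume (partialD j ψ) (p.2 j))
          (mulOp volume (partialD j (partialD j ψ)) p.1),
          coeFn_mulOp_of_ae (hψ.multiplier_partialD j) (p5 j),
          coeFn_mulOp_of_ae (hψ.multiplier_partialD_partialD j) p4] with x e1 e2 e3 e4
        rw [e1, e2, Pi.add_apply, e3, e4, magGrad_mul b hd p1]
      have h3 := inner_grad_eq_neg hmem hv j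
      rw [e, inner_add_right, neg_add] at h3
      exact h3
    exact hcl
  have h3 : ∀ j, ⟪cutGrad ψ v h j, G j⟫_ℂ = ⟪h j, mulOp volume ψ (G j)⟫_ℂ +
      ⟪v, mulOp volume (partialD j ψ) (G j)⟫_ℂ := by
    intro j
    rw [cutGrad, inner_add_left, inner_mulOp_left hψ.multiplier hψ.conj_eq,
      inner_mulOp_left (hψ.multiplier_partialD j) (hr1 j)]
  simp only [h3, Finset.sum_add_distrib] at h1
  rw [inner_mulOp_left hψ.multiplier hψ.conj_eq] at h1
  simp only [cutGrad, inner_add_right, h2, Finset.sum_add_distrib, Finset.sum_sub_distrib,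
    Finset.sum_neg_distrib, cutSource, inner_sub_right, inner_smul_right, inner_sum]
  rw [← h1]
  ring

/-- The closure of the pairs `(φ, ∇^A φ)` on `U`, for test functions `φ` on `ℝ³`. -/
def neumannForm (b : ℝ) (U : Set E3) : Submodule ℂ (L2on U × (Fin 3 → L2on U)) :=
  (dirichletCore b (volume.restrict U) Set.univ).topologicalClosure

theorem dirichletForm_le_neumannForm (b : ℝ) (U : Set E3) : dirichletForm b U ≤ neumannForm b U :=
  Submodule.topologicalClosure_mono fun _ ⟨φ, h1, h2, _, h4, h5⟩ =>
    ⟨φ, h1, h2, Set.subset_univ _, h4, h5⟩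

theorem mem_neumannForm_of_mem_robinForm {U : Set E3} {v : L2on U} {h : Fin 3 → L2on U}
    {t : L2surface (frontier U)} (hv : (v, h, t) ∈ robinForm b U) : (v, h) ∈ neumannForm b U := by
  have h1 : (v, h, t) ∈ closure
      (robinCore b U : Set (L2on U × (Fin 3 → L2on U) × L2surface (frontier U))) := by
    rwa [robinForm, ← SetLike.mem_coe, Submodule.topologicalClosure_coe] at hv
  have h2 := map_mem_closure
    (t := (dirichletCore b (volume.restrict U) Set.univ : Set (L2on U × (Fin 3 → L2on U))))
    (f := fun p : L2on U × (Fin 3 → L2on U) × L2surface (frontier U) => (p.1, p.2.1))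
    (by fun_prop) h1 ?_
  · rwa [neumannForm, ← SetLike.mem_coe, Submodule.topologicalClosure_coe]
  · rintro p ⟨φ, h1, h2, h4, h5, -⟩
    exact ⟨φ, h1, h2, Set.subset_univ _, h4, h5⟩

theorem inner_restrictTo_of_indicator {U : Set E3} (hU : MeasurableSet U) (f : L2) {g : L2}
    (hg : mulOp volume (U.indicator fun _ => (1 : ℂ)) g = g) :
    ⟪restrictTo U f, restrictTo U g⟫_ℂ = ⟪f, g⟫_ℂ := by
  rw [← inner_extendZero', extendZero_restrictTo hU, hg]

theorem indicator_mulOp {U : Set E3} (hU : MeasurableSet U) {m : E3 → ℂ} (hm : IsMultiplier m)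
    (h : ∀ x ∉ U, m x = 0) (f : L2) :
    mulOp volume (U.indicator fun _ => (1 : ℂ)) (mulOp volume m f) = mulOp volume m f := by
  have h1 := congrArg (fun T : L2 →L[ℂ] L2 => T f)
    (mulOp_comp_mulOp (μ := (volume : Measure E3)) (IsMultiplier.indicator hU) hm)
  have h2 : (fun x => U.indicator (fun _ => (1 : ℂ)) x * m x) = m := by
    ext x
    by_cases hx : x ∈ U
    · rw [Set.indicator_of_mem hx, one_mul]
    · rw [h x hx, mul_zero]
  rw [h2] at h1
  exact h1

theorem cutoff_eq_zero {U : Set E3} {ψ : E3 → ℂ} (hU : tsupport ψ ⊆ U) (j : Fin 3) :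
    ∀ x ∉ U, ψ x = 0 ∧ partialD j ψ x = 0 ∧ partialD j (partialD j ψ) x = 0 := fun _ hx =>
  ⟨image_eq_zero_of_notMem_tsupport fun h => hx (hU h), partialD_eq_zero fun h => hx (hU h),
    partialD_eq_zero fun h => hx (hU (tsupport_partialD_subset j ψ h))⟩

theorem indicator_cutGrad {U : Set E3} (hUm : MeasurableSet U) {ψ : E3 → ℂ} (hψ : IsCutoff ψ)
    (hU : tsupport ψ ⊆ U) (u : L2) (G : Fin 3 → L2) (j : Fin 3) :
    mulOp volume (U.indicator fun _ => (1 : ℂ)) (cutGrad ψ u G j) = cutGrad ψ u G j := by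
  have h := cutoff_eq_zero hU j
  rw [cutGrad, map_add, indicator_mulOp hUm hψ.multiplier fun x hx => (h x hx).1,
    indicator_mulOp hUm (hψ.multiplier_partialD j) fun x hx => (h x hx).2.1]

theorem indicator_cutSource {U : Set E3} (hUm : MeasurableSet U) {ψ : E3 → ℂ} (hψ : IsCutoff ψ)
    (hU : tsupport ψ ⊆ U) (u w : L2) (G : Fin 3 → L2) :
    mulOp volume (U.indicator fun _ => (1 : ℂ)) (cutSource ψ u G w) = cutSource ψ u G w := by
  have h := fun j => cutoff_eq_zero hU j
  rw [cutSource, map_sub, map_sub, map_smul, map_sum, map_sum,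
    indicator_mulOp hUm hψ.multiplier fun x hx => (h 0 x hx).1]
  congr 2
  · congr 1
    exact Finset.sum_congr rfl fun j _ =>
      indicator_mulOp hUm (hψ.multiplier_partialD j) (fun x hx => (h j x hx).2.1) _
  · ext1 j
    exact indicator_mulOp hUm (hψ.multiplier_partialD_partialD j) (fun x hx => (h j x hx).2.2) _

/-- The equation of `ψ u` in `U ⊇ supp ψ`, tested with functions that need not vanish on the
boundary of `U`. -/
theorem sum_inner_restrict_cutGrad {U : Set E3} (hUm : MeasurableSet U) {ψ : E3 → ℂ}
    (hψ : IsCutoff ψ) (hU : tsupport ψ ⊆ U) {u w : L2} {G : Fin 3 → L2} (hu : (u, G) ∈ freeForm b)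
    (hw : ∀ v h, (v, h) ∈ freeForm b → ∑ j, ⟪h j, G j⟫_ℂ = ⟪v, w⟫_ℂ) {v : L2on U}
    {h : Fin 3 → L2on U} (hv : (v, h) ∈ neumannForm b U) :
    ∑ j, ⟪h j, restrictTo U (cutGrad ψ u G j)⟫_ℂ =
      ⟪v, restrictTo U (cutSource ψ u G w)⟫_ℂ := by
  have hcl : (v, h) ∈ {p : L2on U × (Fin 3 → L2on U) |
      ∑ j, ⟪p.2 j, restrictTo U (cutGrad ψ u G j)⟫_ℂ =
        ⟪p.1, restrictTo U (cutSource ψ u G w)⟫_ℂ} := by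
    refine mem_of_mem_topologicalClosure (isClosed_eq (by fun_prop) (by fun_prop)) ?_ hv
    rintro p ⟨φ, p1, p2, -, p4, p5⟩
    have hL0 : MemLp φ 2 := p1.continuous.memLp_of_hasCompactSupport p2
    have hL : ∀ i, MemLp (magGrad b φ i) 2 := fun i =>
      (contDiff_magGrad b p1 i).continuous.memLp_of_hasCompactSupport
        (hasCompactSupport_magGrad b p2 i)
    have hmem := mem_freeForm_of_contDiff p1 hL0.coeFn_toLp (g := fun i => (hL i).toLp _)
      (fun i => (hL i).coeFn_toLp)
    have e0 : p.1 = restrictTo U (hL0.toLp _) :=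
      Lp.ext (p4.trans (restrictTo_ae_eq hL0.coeFn_toLp).symm)
    have e1 : ∀ j, p.2 j = restrictTo U ((hL j).toLp _) := fun j =>
      Lp.ext ((p5 j).trans (restrictTo_ae_eq (hL j).coeFn_toLp).symm)
    have h1 := sum_inner_cutGrad hψ hu hw hmem
    simp only [Set.mem_ofPred_eq, e0, e1]
    rw [inner_restrictTo_of_indicator hUm _ (indicator_cutSource hUm hψ hU u w G), ← h1]
    exact Finset.sum_congr rfl fun j _ =>
      inner_restrictTo_of_indicator hUm _ (indicator_cutGrad hUm hψ hU u G j)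
  exact hcl

theorem restrict_cutoff_mem_dirichletOp {U : Set E3} (hUm : MeasurableSet U) {ψ : E3 → ℂ}
    (hψ : IsCutoff ψ) (hU : tsupport ψ ⊆ U) {u w : L2} {G : Fin 3 → L2} (hu : (u, G) ∈ freeForm b)
    (hw : ∀ v h, (v, h) ∈ freeForm b → ∑ j, ⟪h j, G j⟫_ℂ = ⟪v, w⟫_ℂ) :
    (restrictTo U (mulOp volume ψ u), restrictTo U (cutSource ψ u G w)) ∈ dirichletOp b U := by
  rw [dirichletOp_eq]
  exact ⟨fun j => restrictTo U (cutGrad ψ u G j), restrict_cutGrad_mem_dirichletForm hψ hU hu,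
    fun v h hv => sum_inner_restrict_cutGrad hUm hψ hU hu hw (dirichletForm_le_neumannForm b U hv)⟩

theorem restrict_cutoff_mem_robinOp {U : Set E3} (hUm : MeasurableSet U) (γ : E3 → ℝ) {ψ : E3 → ℂ}
    (hψ : IsCutoff ψ) (hU : tsupport ψ ⊆ U) (hψ0 : ∀ x ∈ frontier U, ψ x = 0) {u w : L2}
    {G : Fin 3 → L2} (hu : (u, G) ∈ freeForm b)
    (hw : ∀ v h, (v, h) ∈ freeForm b → ∑ j, ⟪h j, G j⟫_ℂ = ⟪v, w⟫_ℂ) :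
    (restrictTo U (mulOp volume ψ u), restrictTo U (cutSource ψ u G w)) ∈ robinOp b γ U := by
  rw [robinOp_eq]
  refine ⟨(fun j => restrictTo U (cutGrad ψ u G j), 0),
    restrict_cutGrad_mem_robinForm hψ hψ0 hu, fun v h hv => ?_⟩
  have h1 := sum_inner_restrict_cutGrad hUm hψ hU hu hw (mem_neumannForm_of_mem_robinForm hv)
  rw [robinPairing, ← h1]
  have h2 : ∫ x in frontier U, (γ x : ℂ) * (starRingEnd ℂ (h.2 x) *
      (0 : L2surface (frontier U)) x) ∂(μHE[2] : Measure E3) = 0 := by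
    rw [← integral_zero E3 ℂ]
    refine integral_congr_ae ?_
    filter_upwards [Lp.coeFn_zero ℂ 2 ((μHE[2] : Measure E3).restrict (frontier U))] with x hx
    rw [hx, Pi.zero_apply, mul_zero, mul_zero]
  simp only [h2, add_zero]

/-- The Caccioppoli inequality. -/
theorem sum_norm_sq_cutoff_le {ρ : E3 → ℂ} (hρ : IsCutoff ρ) {u w : L2} {G : Fin 3 → L2}
    (hu : (u, G) ∈ freeForm b)
    (hw : ∀ v h, (v, h) ∈ freeForm b → ∑ j, ⟪h j, G j⟫_ℂ = ⟪v, w⟫_ℂ) :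
    ∑ j, ‖mulOp volume ρ (G j)‖ ^ 2 ≤ 2 * (‖mulOp volume ρ u‖ * ‖mulOp volume ρ w‖) +
      4 * ∑ j, ‖mulOp volume (partialD j ρ) u‖ ^ 2 := by
  have hr1 := fun j => conj_partialD hρ.contDiff hρ.conj_eq j
  -- test the equation with `ρ² u`
  have h1 := hw _ _ (cutGrad_mem_freeForm hρ (cutGrad_mem_freeForm hρ hu))
  have h2 : ∀ j, ⟪cutGrad ρ (mulOp volume ρ u) (cutGrad ρ u G) j, G j⟫_ℂ =
      ((‖mulOp volume ρ (G j)‖ ^ 2 : ℝ) : ℂ) +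
        2 * ⟪mulOp volume (partialD j ρ) u, mulOp volume ρ (G j)⟫_ℂ := by
    intro j
    have e : mulOp volume (partialD j ρ) (mulOp volume ρ u) =
        mulOp volume ρ (mulOp volume (partialD j ρ) u) := by
      have h := mulOp_comp_mulOp (μ := (volume : Measure E3)) (hρ.multiplier_partialD j)
        hρ.multiplier
      have h' := mulOp_comp_mulOp (μ := (volume : Measure E3)) hρ.multiplier
        (hρ.multiplier_partialD j)
      simp only [mul_comm] at h h'
      exact congrArg (fun T : L2 →L[ℂ] L2 => T u) (h.trans h'.symm)
    rw [cutGrad, cutGrad, e, map_add, inner_add_left, inner_add_left,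
      inner_mulOp_left hρ.multiplier hρ.conj_eq (mulOp volume ρ (G j)) (G j),
      inner_mulOp_left hρ.multiplier hρ.conj_eq (mulOp volume (partialD j ρ) u) (G j),
      inner_self_eq_norm_sq_to_K]
    push_cast
    simp only [Complex.coe_algebraMap]
    ring
  simp only [h2, Finset.sum_add_distrib] at h1
  rw [inner_mulOp_left hρ.multiplier hρ.conj_eq] at h1
  have h3 : ∑ j, ‖mulOp volume ρ (G j)‖ ^ 2 =
      (⟪mulOp volume ρ u, mulOp volume ρ w⟫_ℂ -
        ∑ j, 2 * ⟪mulOp volume (partialD j ρ) u, mulOp volume ρ (G j)⟫_ℂ).re := by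
    rw [← h1, add_sub_cancel_right, ← Complex.ofReal_sum, Complex.ofReal_re]
  have h4 : ∀ j, ‖2 * ⟪mulOp volume (partialD j ρ) u, mulOp volume ρ (G j)⟫_ℂ‖ ≤
      2 * ‖mulOp volume (partialD j ρ) u‖ ^ 2 + 1 / 2 * ‖mulOp volume ρ (G j)‖ ^ 2 := by
    intro j
    rw [norm_mul, Complex.norm_two]
    have := norm_inner_le_norm (𝕜 := ℂ) (mulOp volume (partialD j ρ) u) (mulOp volume ρ (G j))
    nlinarith [sq_nonneg (2 * ‖mulOp volume (partialD j ρ) u‖ - ‖mulOp volume ρ (G j)‖)]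
  have h5 : ∑ j, ‖mulOp volume ρ (G j)‖ ^ 2 ≤ ‖mulOp volume ρ u‖ * ‖mulOp volume ρ w‖ +
      ∑ j, (2 * ‖mulOp volume (partialD j ρ) u‖ ^ 2 + 1 / 2 * ‖mulOp volume ρ (G j)‖ ^ 2) := by
    rw [h3]
    refine (Complex.re_le_norm _).trans ((norm_sub_le _ _).trans ?_)
    exact add_le_add (norm_inner_le_norm _ _)
      ((norm_sum_le _ _).trans (Finset.sum_le_sum fun j _ => h4 j))
  rw [Finset.sum_add_distrib, ← Finset.mul_sum, ← Finset.mul_sum] at h5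
  linarith

end

section

variable {b : ℝ}

/-! ### Local compactness -/

/-- The Cauchy–Schwarz inequality for an increment over a unit interval. -/
theorem sq_norm_sub_le_integral {f f' : ℝ → ℂ} (hf : ∀ t, HasDerivAt f (f' t) t)
    (hc : Continuous f') : ‖f 1 - f 0‖ ^ 2 ≤ ∫ t in (0 : ℝ)..1, ‖f' t‖ ^ 2 := by
  have h1 : f 1 - f 0 = ∫ t in (0 : ℝ)..1, f' t :=
    (intervalIntegral.integral_eq_sub_of_hasDerivAt (fun t _ => hf t)
      (hc.intervalIntegrable 0 1)).symm
  set m := ‖f 1 - f 0‖ with hm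
  have h2 : m ≤ ∫ t in (0 : ℝ)..1, ‖f' t‖ := by
    rw [hm, h1]
    exact intervalIntegral.norm_integral_le_integral_norm zero_le_one
  have h3 : ∫ t in (0 : ℝ)..1, (2 * m * ‖f' t‖ - m ^ 2) ≤ ∫ t in (0 : ℝ)..1, ‖f' t‖ ^ 2 := by
    refine intervalIntegral.integral_mono_on zero_le_one ?_ ?_ fun t _ => ?_
    · exact Continuous.intervalIntegrable (by fun_prop) _ _
    · exact Continuous.intervalIntegrable (by fun_prop) _ _
    · nlinarith [sq_nonneg (‖f' t‖ - m)]
  rw [intervalIntegral.integral_sub (Continuous.intervalIntegrable (by fun_prop) _ _)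
    (Continuous.intervalIntegrable (by fun_prop) _ _), intervalIntegral.integral_const_mul,
    intervalIntegral.integral_const] at h3
  simp at h3
  nlinarith [norm_nonneg (f 1 - f 0)]

/-- Along a segment, the magnetic gradient controls the deviation of a function from its parallel
transport. -/
theorem sq_norm_sub_transport_le (b : ℝ) {φ : E3 → ℂ} (hφ : ContDiff ℝ ∞ φ) (y s : E3) :
    ‖φ y - magPhase b (-s) y * φ (y + s)‖ ^ 2 ≤
      ∫ t in (0 : ℝ)..1, ‖s‖ ^ 2 * ∑ j, ‖magGrad b φ j (y + t • s)‖ ^ 2 := by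
  set θ : ℝ := b / 2 * (y 0 * s 1 - y 1 * s 0) with hθ
  have hphase : ∀ t : ℝ, magPhase b (-(t • s)) y = Complex.exp (-Complex.I * θ * t) := by
    intro t
    rw [magPhase, hθ]
    congr 1
    simp only [PiLp.neg_apply, PiLp.smul_apply, smul_eq_mul]
    push_cast
    ring
  set F : ℝ → ℂ := fun t => magPhase b (-(t • s)) y * φ (y + t • s) with hF
  set F' : ℝ → ℂ := fun t => magPhase b (-(t • s)) y * ∑ j, (s j : ℂ) * magGrad b φ j (y + t • s)
    with hF'
  have hline : ∀ t : ℝ, HasDerivAt (fun t : ℝ => y + t • s) s t := fun t => by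
    simpa using ((hasDerivAt_id t).smul_const s).const_add y
  have hexp : ∀ t : ℝ, HasDerivAt (fun t : ℝ => Complex.exp (-Complex.I * θ * t))
      (Complex.exp (-Complex.I * θ * t) * (-Complex.I * θ)) t := fun t => by
    have h1 : HasDerivAt (fun t : ℝ => -Complex.I * θ * (t : ℂ)) (-Complex.I * θ) t := by
      simpa using ((hasDerivAt_id t).ofReal_comp).const_mul (-Complex.I * θ)
    exact h1.cexp
  have hs : s = ∑ j, s j • EuclideanSpace.single j (1 : ℝ) := by
    ext i; fin_cases i <;> simp [Fin.sum_univ_three]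
  have hlin : ∀ L : E3 →L[ℝ] ℂ, L s = ∑ j, (s j : ℂ) * L (EuclideanSpace.single j 1) := by
    intro L
    conv_lhs => rw [hs]
    simp only [map_sum, map_smul, Complex.real_smul]
  have hder : ∀ t, HasDerivAt F (F' t) t := by
    intro t
    have h1 := ((hφ.differentiable (by simp)) (y + t • s)).hasFDerivAt.comp_hasDerivAt t (hline t)
    have h2 := (hexp t).mul h1
    simp only [hF, hF', hphase]
    refine h2.congr_deriv ?_
    simp only [Function.comp]
    rw [mul_assoc, ← mul_add]
    congr 1
    rw [hlin, Fin.sum_univ_three, Fin.sum_univ_three]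
    simp only [magGrad, magPotential, hθ, PiLp.add_apply,
      PiLp.smul_apply, smul_eq_mul, Matrix.cons_val_zero, Matrix.cons_val_one, Matrix.cons_val]
    push_cast
    ring
  have hcont : Continuous F' := by
    have h1 := fun j => (contDiff_magGrad b hφ j).continuous
    simp only [hF', hphase]
    fun_prop
  have h := sq_norm_sub_le_integral hder hcont
  have h0 : F 0 = φ y := by simp [hF, hphase]
  have h1 : F 1 = magPhase b (-s) y * φ (y + s) := by simp [hF]
  rw [h0, h1, norm_sub_rev] at h
  refine h.trans (intervalIntegral.integral_mono_on zero_le_one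
    (Continuous.intervalIntegrable (by fun_prop) _ _) ?_ fun t _ => ?_)
  · have h1 := fun j => (contDiff_magGrad b hφ j).continuous
    exact Continuous.intervalIntegrable (by fun_prop) _ _
  · simp only [hF']
    rw [norm_mul, norm_magPhase, one_mul, EuclideanSpace.norm_sq_eq]
    have h3 : ‖∑ j, (s j : ℂ) * magGrad b φ j (y + t • s)‖ ≤
        ∑ j, ‖s j‖ * ‖magGrad b φ j (y + t • s)‖ := by
      refine (norm_sum_le _ _).trans (Finset.sum_le_sum fun j _ => ?_)
      rw [norm_mul, Complex.norm_real]
    exact (pow_le_pow_left₀ (norm_nonneg _) h3 2).trans (Finset.sum_mul_sq_le_sq_mul_sq _ _ _)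

/-- The estimate along segments, integrated over their initial points in `W`. -/
theorem norm_sq_indicator_sub_magTrans_core {U W : Set E3} (hU : MeasurableSet U)
    (hW : MeasurableSet W) (hWU : W ⊆ U) {s : E3}
    (hs : ∀ y ∈ W, ∀ t : ℝ, 0 < t → t ≤ 1 → y + t • s ∈ U) {φ : E3 → ℂ} (hφ : ContDiff ℝ ∞ φ)
    (hc : HasCompactSupport φ) {u : L2on U} {G : Fin 3 → L2on U} (hu : u =ᵐ[volume.restrict U] φ)
    (hG : ∀ j, G j =ᵐ[volume.restrict U] magGrad b φ j) :
    ‖mulOp volume (W.indicator fun _ => (1 : ℂ))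
      (extendZero U u - magTrans b (-s) (extendZero U u))‖ ^ 2 ≤ ‖s‖ ^ 2 * ∑ j, ‖G j‖ ^ 2 := by
  have hgc := fun j => (contDiff_magGrad b hφ j).continuous
  set Φ : E3 → ℝ := fun x => ‖s‖ ^ 2 * ∑ j, ‖magGrad b φ j x‖ ^ 2 with hΦ
  have hΦc : Continuous Φ := by fun_prop
  have hΦ0 : ∀ x, 0 ≤ Φ x := fun x => by positivity
  have hext : extendZero U u =ᵐ[volume] U.indicator φ := by
    filter_upwards [coeFn_extendZero hU u, (ae_restrict_iff' hU).1 hu] with x h1 h2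
    rw [h1]
    by_cases hx : x ∈ U
    · rw [Set.indicator_of_mem hx, Set.indicator_of_mem hx, h2 hx]
    · rw [Set.indicator_of_notMem hx, Set.indicator_of_notMem hx]
  have hext' : ∀ᵐ x, extendZero U u (x - -s) = U.indicator φ (x - -s) :=
    (measurePreserving_sub_right volume (-s)).quasiMeasurePreserving.ae hext
  have hX : ∀ᵐ x, ENNReal.ofReal (‖mulOp volume (W.indicator fun _ => (1 : ℂ))
      (extendZero U u - magTrans b (-s) (extendZero U u)) x‖ ^ 2) ≤
      ∫⁻ t in Set.Ioc (0 : ℝ) 1, U.indicator (fun y => ENNReal.ofReal (Φ y)) (x + t • s) := by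
    filter_upwards [hext, hext', coeFn_magTrans b (-s) (extendZero U u),
      coeFn_mulOp (IsMultiplier.indicator hW) (extendZero U u - magTrans b (-s) (extendZero U u)),
      Lp.coeFn_sub (extendZero U u) (magTrans b (-s) (extendZero U u))] with x h1 h2 h3 h4 h5
    rw [h4, h5, Pi.sub_apply, h3, h1, h2]
    by_cases hx : x ∈ W
    · have hxs : x + s ∈ U := by simpa using hs x hx 1 zero_lt_one le_rfl
      rw [Set.indicator_of_mem hx, Set.indicator_of_mem (hWU hx), sub_neg_eq_add,
        Set.indicator_of_mem hxs, one_mul]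
      refine (ENNReal.ofReal_le_ofReal (sq_norm_sub_transport_le b hφ x s)).trans ?_
      rw [intervalIntegral.integral_of_le zero_le_one, ofReal_integral_eq_lintegral_ofReal
        (Continuous.integrableOn_Ioc (by fun_prop)) (ae_of_all _ fun t => by positivity)]
      refine (setLIntegral_congr_fun measurableSet_Ioc fun t ht => ?_).le
      rw [Set.indicator_of_mem (hs x hx t ht.1 ht.2)]
    · rw [Set.indicator_of_notMem hx, zero_mul, norm_zero]
      simp
  have hmeas : Measurable (U.indicator fun y => ENNReal.ofReal (Φ y)) :=
    (ENNReal.measurable_ofReal.comp hΦc.measurable).indicator hU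
  have hint : IntegrableOn Φ U := by
    refine Integrable.integrableOn (Integrable.const_mul ?_ _)
    exact integrable_finsetSum _ fun j _ => integrable_norm_sq (hgc j) (hasCompactSupport_magGrad b hc j)
  rw [norm_sq_eq_integral, integral_eq_lintegral_of_nonneg_ae (ae_of_all _ fun x => by positivity)
    ((continuous_pow 2).comp_aestronglyMeasurable (Lp.aestronglyMeasurable _).norm)]
  refine ENNReal.toReal_le_of_le_ofReal (by positivity) ?_
  calc _ ≤ ∫⁻ x, ∫⁻ t in Set.Ioc (0 : ℝ) 1,
        U.indicator (fun y => ENNReal.ofReal (Φ y)) (x + t • s) := lintegral_mono_ae hX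
    _ = ∫⁻ t in Set.Ioc (0 : ℝ) 1, ∫⁻ x,
        U.indicator (fun y => ENNReal.ofReal (Φ y)) (x + t • s) := by
        refine lintegral_lintegral_swap (Measurable.aemeasurable ?_)
        exact hmeas.comp (by fun_prop)
    _ = ∫⁻ t in Set.Ioc (0 : ℝ) 1, ∫⁻ x in U, ENNReal.ofReal (Φ x) := by
        congr 1
        ext t
        rw [lintegral_add_right_eq_self (fun x => U.indicator (fun y => ENNReal.ofReal (Φ y)) x),
          lintegral_indicator hU]
    _ = ENNReal.ofReal (∫ x in U, Φ x) := by
        rw [lintegral_const, ofReal_integral_eq_lintegral_ofReal hint (ae_of_all _ hΦ0)]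
        simp
    _ ≤ _ := by
        refine ENNReal.ofReal_le_ofReal (le_of_eq ?_)
        rw [hΦ, integral_const_mul, integral_finsetSum]
        · simp only [norm_sq_core (hG _)]
        · exact fun j _ => (integrable_norm_sq (hgc j) (hasCompactSupport_magGrad b hc j)).integrableOn

/-- On a set from which the segments in the direction `s` stay in `U`, the gradient controls the
difference of a function of the form domain and its magnetic translate. -/
theorem norm_indicator_sub_magTrans_le {U W : Set E3} (hU : MeasurableSet U)
    (hW : MeasurableSet W) (hWU : W ⊆ U) {s : E3}
    (hs : ∀ y ∈ W, ∀ t : ℝ, 0 < t → t ≤ 1 → y + t • s ∈ U) {u : L2on U} {G : Fin 3 → L2on U}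
    (hu : (u, G) ∈ neumannForm b U) :
    ‖mulOp volume (W.indicator fun _ => (1 : ℂ))
      (extendZero U u - magTrans b (-s) (extendZero U u))‖ ^ 2 ≤ ‖s‖ ^ 2 * ∑ j, ‖G j‖ ^ 2 := by
  refine mem_of_mem_topologicalClosure (S := {p : L2on U × (Fin 3 → L2on U) |
    ‖mulOp volume (W.indicator fun _ => (1 : ℂ))
      (extendZero U p.1 - magTrans b (-s) (extendZero U p.1))‖ ^ 2 ≤ ‖s‖ ^ 2 * ∑ j, ‖p.2 j‖ ^ 2})
    (isClosed_le (by fun_prop) (by fun_prop)) ?_ hu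
  rintro p ⟨φ, h1, h2, -, h4, h5⟩
  exact norm_sq_indicator_sub_magTrans_core hU hW hWU hs h1 h2 h4 h5

/-- An operator into `L²` with a square integrable kernel is compact. -/
theorem isCompactOperator_of_ae_eq_inner {α : Type*} [MeasurableSpace α] {μ : Measure α}
    {H : Type*} [NormedAddCommGroup H] [InnerProductSpace ℂ H] {Φ : α → H} (hΦ : MemLp Φ 2 μ)
    {X : H →L[ℂ] Lp ℂ 2 μ} (hX : ∀ f, X f =ᵐ[μ] fun x => ⟪Φ x, f⟫_ℂ) : IsCompactOperator X := by
  have key : ∀ ε : ℝ, 0 < ε → ∃ Y : H →L[ℂ] Lp ℂ 2 μ, IsCompactOperator Y ∧ ‖X - Y‖ ≤ ε := by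
    intro ε hε
    let P : (α → H) → Prop := fun g => MemLp g 2 μ ∧ ∃ Y : H →L[ℂ] Lp ℂ 2 μ, IsCompactOperator Y ∧
      ∀ f, Y f =ᵐ[μ] fun x => ⟪g x, f⟫_ℂ
    have hd : ∃ g, eLpNorm (Φ - g) 2 μ ≤ ENNReal.ofReal ε ∧ P g := by
      refine hΦ.induction_dense (by simp) P ?_ ?_ ?_ (by simpa using hε)
      · intro v s hs hμ η hη
        refine ⟨s.indicator fun _ => v, by simp, memLp_indicator_const 2 hs v (Or.inr hμ.ne),
          (innerSL ℂ v).smulRight (indicatorConstLp 2 hs hμ.ne (1 : ℂ)), ?_, fun f => ?_⟩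
        · exact (isCompactOperator_of_locallyCompactSpace_dom (innerSL ℂ v)).clm_comp
            (ContinuousLinearMap.toSpanSingleton ℂ (indicatorConstLp 2 hs hμ.ne (1 : ℂ)))
        · filter_upwards [Lp.coeFn_smul (⟪v, f⟫_ℂ) (indicatorConstLp 2 hs hμ.ne (1 : ℂ)),
            indicatorConstLp_coeFn (p := 2) (hs := hs) (hμs := hμ.ne) (c := (1 : ℂ))] with x h1 h2
          rw [ContinuousLinearMap.smulRight_apply, innerSL_apply_apply, h1, Pi.smul_apply, h2]
          by_cases hx : x ∈ s <;> simp [hx]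
      · rintro g g' ⟨h1, Y, h2, h3⟩ ⟨h1', Y', h2', h3'⟩
        refine ⟨h1.add h1', Y + Y', h2.add h2', fun f => ?_⟩
        filter_upwards [h3 f, h3' f, Lp.coeFn_add (Y f) (Y' f)] with x e1 e2 e3
        rw [add_apply, e3, Pi.add_apply, e1, e2, Pi.add_apply, inner_add_left]
      · exact fun g h => h.1.1
    obtain ⟨g, hg, hg2, Y, hY, hYg⟩ := hd
    refine ⟨Y, hY, ContinuousLinearMap.opNorm_le_bound _ hε.le fun f => ?_⟩
    have h1 : ‖(hΦ.sub hg2).toLp‖ ≤ ε := by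
      rw [Lp.norm_toLp]
      exact ENNReal.toReal_le_of_le_ofReal hε.le hg
    refine (Lp.norm_le_mul_norm_of_ae_le_mul (g := (hΦ.sub hg2).toLp) (c := ‖f‖) ?_).trans ?_
    · filter_upwards [hX f, hYg f, Lp.coeFn_sub (X f) (Y f), (hΦ.sub hg2).coeFn_toLp]
        with x h2 h3 h4 h5
      rw [sub_apply, h4, Pi.sub_apply, h2, h3, h5, ← inner_sub_left, mul_comm]
      exact norm_inner_le_norm _ _
    · rw [mul_comm]
      gcongr
  choose Y hY hYX using fun n : ℕ => key (1 / ((n : ℝ) + 1)) (by positivity)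
  refine isCompactOperator_of_tendsto (l := atTop) (F := Y) ?_ (Eventually.of_forall hY)
  rw [tendsto_iff_norm_sub_tendsto_zero]
  refine squeeze_zero (fun _ => norm_nonneg _) (fun n => ?_) tendsto_one_div_add_atTop_nhds_zero_nat
  rw [norm_sub_rev]
  exact hYX n

end

section

variable {b : ℝ}

/-! ### Inner cones -/

/-- The inner cone property: near each point there are a direction `e` and an aperture `θ` such
that short segments in the directions of the ball of radius `θ` around `e` stay in `U`. -/
def HasInnerCone (U : Set E3) : Prop :=
  ∀ x₀, ∃ Q ∈ 𝓝 x₀, ∃ (e : E3) (θ t₀ : ℝ), 0 < θ ∧ 0 < t₀ ∧ ∀ y ∈ Q, y ∈ U →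
    ∀ t, 0 < t → t ≤ t₀ → ∀ w : E3, ‖w‖ < θ → y + t • (e + w) ∈ U

/-- The average of the magnetic translations over a ball, with a smooth weight. -/
def bumpAverage (b : ℝ) {s₀ : E3} (β : ContDiffBump s₀) : L2 →L[ℂ] L2 :=
  strongIntegral volume (fun s => ((β.normed volume s : ℝ) : ℂ)) (magTrans b)

/-- A localized average has a square integrable kernel. -/
theorem isCompactOperator_indicator_bumpAverage {s₀ : E3} (β : ContDiffBump s₀) {B : Set E3}
    (hB : MeasurableSet B) (hBb : Bornology.IsBounded B) :
    IsCompactOperator (mulOp volume (B.indicator fun _ => (1 : ℂ)) ∘L bumpAverage b β) := by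
  have hc : Continuous fun s => ((β.normed volume s : ℝ) : ℂ) :=
    Complex.continuous_ofReal.comp β.continuous_normed
  have hcs : HasCompactSupport fun s => ((β.normed volume s : ℝ) : ℂ) :=
    β.hasCompactSupport_normed.comp_left Complex.ofReal_zero
  have hu : MemLp (fun x => starRingEnd ℂ ((β.normed volume (-x) : ℝ) : ℂ)) 2 volume := by
    refine Continuous.memLp_of_hasCompactSupport (Complex.continuous_conj.comp (hc.comp continuous_neg)) ?_
    exact (hcs.comp_homeomorph (Homeomorph.neg E3)).comp_left (map_zero _)
  obtain ⟨u, hu⟩ : ∃ u : L2, u =ᵐ[volume] fun x => starRingEnd ℂ ((β.normed volume (-x) : ℝ) : ℂ) :=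
    ⟨hu.toLp, hu.coeFn_toLp⟩
  have hS := coeFn_strongIntegral_magTrans b (hc.integrable_of_hasCompactSupport hcs) hc.measurable hu
  have hcont := continuous_magTrans_apply (-b) u
  refine isCompactOperator_of_ae_eq_inner (μ := volume)
    (Φ := B.indicator fun x => magTrans (-b) x u) ?_ fun f => ?_
  · have : Fact (volume B < ⊤) := ⟨hBb.measure_lt_top⟩
    refine (memLp_indicator_iff_restrict hB).2 (MemLp.of_bound (C := ‖u‖) ?_ ?_)
    · exact hcont.aestronglyMeasurable
    · exact ae_of_all _ fun x => (norm_magTrans (-b) x u).le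
  · filter_upwards [coeFn_mulOp (IsMultiplier.indicator hB) (bumpAverage b β f), hS f] with x h1 h2
    rw [ContinuousLinearMap.comp_apply, h1]
    by_cases hx : x ∈ B
    · rw [Set.indicator_of_mem hx, Set.indicator_of_mem hx, one_mul]
      exact h2
    · rw [Set.indicator_of_notMem hx, Set.indicator_of_notMem hx, zero_mul, inner_zero_left]

/-- The error of an average is at most the largest error of the translates it involves. -/
theorem norm_apply_sub_bumpAverage_le {s₀ : E3} (β : ContDiffBump s₀) (T : L2 →L[ℂ] L2) (f : L2)
    {C : ℝ} (hC : ∀ s ∈ Metric.ball s₀ β.rOut, ‖T (f - magTrans b s f)‖ ≤ C) :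
    ‖T (f - bumpAverage b β f)‖ ≤ C := by
  have hc : Continuous fun s => ((β.normed volume s : ℝ) : ℂ) :=
    Complex.continuous_ofReal.comp β.continuous_normed
  have hi : Integrable fun s => ((β.normed volume s : ℝ) : ℂ) :=
    hc.integrable_of_hasCompactSupport (β.hasCompactSupport_normed.comp_left Complex.ofReal_zero)
  have hV : IsContractionFamily (magTrans b) := isContractionFamily_magTrans b continuous_id
  have h1 : T (f - bumpAverage b β f) =
      ∫ s, ((β.normed volume s : ℝ) : ℂ) • T (f - magTrans b s f) := by
    have e1 : f = ∫ s, ((β.normed volume s : ℝ) : ℂ) • f := by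
      rw [integral_smul_const, integral_complex_ofReal, β.integral_normed, Complex.ofReal_one, one_smul]
    have e2 : f - bumpAverage b β f =
        ∫ s, ((β.normed volume s : ℝ) : ℂ) • (f - magTrans b s f) := by
      simp only [smul_sub]
      rw [integral_sub (hi.smul_const f) (hV.integrable hi f), ← e1, bumpAverage,
        strongIntegral_apply_L2 hi hV]
    rw [e2, ← ContinuousLinearMap.integral_comp_comm]
    · simp only [map_smul]
    · simp only [smul_sub]
      exact (hi.smul_const f).sub (hV.integrable hi f)
  rw [h1]
  refine (norm_integral_le_of_norm_le (g := fun s => β.normed volume s * C)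
    (β.integrable_normed.mul_const C) (ae_of_all _ fun s => ?_)).trans ?_
  · rw [norm_smul, Complex.norm_real, Real.norm_of_nonneg (β.nonneg_normed s)]
    by_cases hs : s ∈ Metric.ball s₀ β.rOut
    · exact mul_le_mul_of_nonneg_left (hC s hs) (β.nonneg_normed s)
    · rw [← β.support_normed_eq (μ := volume), Function.notMem_support] at hs
      rw [hs, zero_mul, zero_mul]
  · rw [integral_mul_const, β.integral_normed, one_mul]

theorem indicator_inter_extendZero {U : Set E3} (hU : MeasurableSet U) {Q : Set E3}
    (hQ : MeasurableSet Q) (u : L2on U) :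
    mulOp volume ((Q ∩ U).indicator fun _ => (1 : ℂ)) (extendZero U u) =
      mulOp volume (Q.indicator fun _ => (1 : ℂ)) (extendZero U u) := by
  refine Lp.ext ?_
  filter_upwards [coeFn_mulOp (IsMultiplier.indicator (hQ.inter hU)) (extendZero U u),
    coeFn_mulOp (IsMultiplier.indicator hQ) (extendZero U u), coeFn_extendZero hU u] with x h1 h2 h3
  rw [h1, h2, h3]
  by_cases hx : x ∈ U <;> by_cases hx' : x ∈ Q <;> simp [hx, hx']

/-- The range of an operator with values in the form domain is locally compact, near each point at
which the domain has an inner cone: averages over small shifted balls approximate it. -/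
theorem exists_isCompactOperator_indicator {U : Set E3} (hU : MeasurableSet U) (hcone : HasInnerCone U)
    {R : L2on U →L[ℂ] L2on U} {C : ℝ} (hC : 0 ≤ C)
    (hR : ∀ f, ∃ g, (R f, g) ∈ neumannForm b U ∧ ‖g‖ ≤ C * ‖f‖) (x₀ : E3) :
    ∃ Q ∈ 𝓝 x₀, MeasurableSet Q ∧
      IsCompactOperator (mulOp volume (Q.indicator fun _ => (1 : ℂ)) ∘L extendOp U R) := by
  obtain ⟨Q, hQ, e, θ, t₀, hθ, ht₀, hcone⟩ := hcone x₀
  set Q' := interior Q ∩ Metric.ball x₀ 1 with hQ'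
  have hQm : MeasurableSet Q' := isOpen_interior.measurableSet.inter Metric.isOpen_ball.measurableSet
  refine ⟨Q', inter_mem (interior_mem_nhds.2 hQ) (Metric.ball_mem_nhds _ one_pos), hQm, ?_⟩
  have hWm : MeasurableSet (Q' ∩ U) := hQm.inter hU
  -- the directions `-t (e + w)`, `‖w‖ < θ`, fill the ball of radius `t θ` around `-t e`
  have hβ : ∀ n : ℕ, ∃ β : ContDiffBump (-((t₀ / ((n : ℝ) + 1)) • e)),
      β.rOut = t₀ / ((n : ℝ) + 1) * θ := fun n =>
    ⟨⟨t₀ / ((n : ℝ) + 1) * θ / 2, t₀ / ((n : ℝ) + 1) * θ, by positivity,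
      half_lt_self (by positivity)⟩, rfl⟩
  choose β hβ using hβ
  have hbound : ∀ n f, ‖mulOp volume ((Q' ∩ U).indicator fun _ => (1 : ℂ))
      (extendOp U R f - bumpAverage b (β n) (extendOp U R f))‖ ≤
      t₀ / ((n : ℝ) + 1) * ((‖e‖ + θ) * (2 * C)) * ‖f‖ := by
    intro n f
    have hn : (0 : ℝ) < (n : ℝ) + 1 := by positivity
    set t := t₀ / ((n : ℝ) + 1) with ht
    have ht0 : 0 < t := by positivity
    have htt : t ≤ t₀ := div_le_self ht₀.le (by linarith [Nat.cast_nonneg (α := ℝ) n])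
    obtain ⟨g, hg, hgC⟩ := hR (restrictTo U f)
    refine norm_apply_sub_bumpAverage_le (β n) _ _ fun s hs => ?_
    obtain ⟨w, hw, rfl⟩ : ∃ w : E3, ‖w‖ < θ ∧ s = -(t • (e + w)) := by
      refine ⟨-(t⁻¹ • s) - e, ?_, ?_⟩
      · rw [hβ n, Metric.mem_ball, dist_eq_norm, sub_neg_eq_add] at hs
        have e1 : -(t⁻¹ • s) - e = -(t⁻¹ • (s + t • e)) := by
          rw [smul_add, smul_smul, inv_mul_cancel₀ ht0.ne', one_smul]; abel
        rw [e1, norm_neg, norm_smul, norm_inv, Real.norm_of_nonneg ht0.le]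
        rwa [inv_mul_lt_iff₀ ht0]
      · rw [add_sub_cancel, smul_neg, smul_smul, mul_inv_cancel₀ ht0.ne', one_smul, neg_neg]
    have hseg : ∀ y ∈ Q' ∩ U, ∀ t' : ℝ, 0 < t' → t' ≤ 1 → y + t' • (t • (e + w)) ∈ U := by
      intro y hy t' h0 h1
      rw [smul_smul]
      refine hcone y (interior_subset hy.1.1) hy.2 _ (by positivity) ?_ w hw
      nlinarith
    have h1 := norm_indicator_sub_magTrans_le hU hWm Set.inter_subset_right hseg hg
    rw [extendOp_apply]
    have h0 : 0 ≤ C * ‖restrictTo U f‖ := (norm_nonneg g).trans hgC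
    have h2 : ∑ j, ‖g j‖ ^ 2 ≤ (2 * (C * ‖restrictTo U f‖)) ^ 2 := by
      have h3 : ∀ j, ‖g j‖ ^ 2 ≤ (C * ‖restrictTo U f‖) ^ 2 := fun j =>
        pow_le_pow_left₀ (norm_nonneg _) ((norm_le_pi_norm g j).trans hgC) 2
      rw [Fin.sum_univ_three]
      nlinarith [h3 0, h3 1, h3 2, sq_nonneg (C * ‖restrictTo U f‖)]
    have h4 : ‖t • (e + w)‖ ≤ t * (‖e‖ + θ) := by
      rw [norm_smul, Real.norm_of_nonneg ht0.le]
      gcongr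
      exact (norm_add_le _ _).trans (by linarith)
    have h5 : C * ‖restrictTo U f‖ ≤ C * ‖f‖ := by
      gcongr
      exact norm_restrictTo_le f
    refine (pow_le_pow_iff_left₀ (norm_nonneg _) (by positivity) two_ne_zero).1 (h1.trans ?_)
    calc _ ≤ (t * (‖e‖ + θ)) ^ 2 * (2 * (C * ‖f‖)) ^ 2 := by gcongr; exact h2.trans (by gcongr)
      _ = _ := by ring
  have hX : mulOp volume (Q'.indicator fun _ => (1 : ℂ)) ∘L extendOp U R =
      mulOp volume ((Q' ∩ U).indicator fun _ => (1 : ℂ)) ∘L extendOp U R := by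
    ext1 f
    rw [ContinuousLinearMap.comp_apply, ContinuousLinearMap.comp_apply, extendOp_apply]
    exact (indicator_inter_extendZero hU hQm _).symm
  rw [hX]
  have hbdd : Bornology.IsBounded (Q' ∩ U) :=
    Metric.isBounded_ball.subset (Set.inter_subset_left.trans Set.inter_subset_right)
  refine isCompactOperator_of_tendsto (l := atTop)
    (F := fun n => (mulOp volume ((Q' ∩ U).indicator fun _ => (1 : ℂ)) ∘L bumpAverage b (β n)) ∘L
      extendOp U R) ?_ (Eventually.of_forall fun n =>
        (isCompactOperator_indicator_bumpAverage (β n) hWm hbdd).comp_clm _)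
  rw [tendsto_iff_norm_sub_tendsto_zero]
  refine squeeze_zero (g := fun n : ℕ => (t₀ * ((‖e‖ + θ) * (2 * C))) * (1 / ((n : ℝ) + 1)))
    (fun _ => norm_nonneg _) (fun n => ?_) ?_
  · rw [norm_sub_rev]
    refine ContinuousLinearMap.opNorm_le_bound _ (by positivity) fun f => ?_
    have h1 := hbound n f
    rw [map_sub] at h1
    refine h1.trans (le_of_eq ?_)
    ring
  · simpa using tendsto_one_div_add_atTop_nhds_zero_nat.const_mul (t₀ * ((‖e‖ + θ) * (2 * C)))

/-- The local compactness of the inclusion of the form domain into `L²`, in terms of an operator with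
values in the form domain. -/
theorem isCompactOperator_mulOp_extendOp {U : Set E3} (hU : MeasurableSet U)
    (hcone : HasInnerCone U) {R : L2on U →L[ℂ] L2on U} {C : ℝ} (hC : 0 ≤ C)
    (hR : ∀ f, ∃ g, (R f, g) ∈ neumannForm b U ∧ ‖g‖ ≤ C * ‖f‖) {χ : E3 → ℂ}
    (hχ : IsMultiplier χ) (hχc : HasCompactSupport χ) :
    IsCompactOperator (mulOp volume χ ∘L extendOp U R) := by
  obtain ⟨B, hB, hBm, hBX⟩ : ∃ B, tsupport χ ⊆ B ∧ MeasurableSet B ∧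
      IsCompactOperator (mulOp volume (B.indicator fun _ => (1 : ℂ)) ∘L extendOp U R) := by
    refine IsCompact.induction_on (p := fun s => ∃ B, s ⊆ B ∧ MeasurableSet B ∧
      IsCompactOperator (mulOp volume (B.indicator fun _ => (1 : ℂ)) ∘L extendOp U R)) hχc ?_ ?_ ?_ ?_
    · refine ⟨∅, subset_rfl, MeasurableSet.empty, ?_⟩
      have e : mulOp volume ((∅ : Set E3).indicator fun _ => (1 : ℂ)) = 0 := by
        ext1 f
        refine norm_le_zero_iff.1 ?_
        simpa using norm_mulOp_apply_le (IsMultiplier.indicator MeasurableSet.empty) (C := 0)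
          (by simp) f
      rw [e, ContinuousLinearMap.zero_comp]
      exact isCompactOperator_zero
    · rintro s t hst ⟨B, h1, h2⟩
      exact ⟨B, hst.trans h1, h2⟩
    · rintro s t ⟨B, h1, h2, h3⟩ ⟨B', h1', h2', h3'⟩
      refine ⟨B ∪ B', Set.union_subset_union h1 h1', h2.union h2', ?_⟩
      have e : mulOp volume ((B ∪ B').indicator fun _ => (1 : ℂ)) =
          mulOp volume (B.indicator fun _ => (1 : ℂ)) +
            mulOp volume (Bᶜ.indicator fun _ => (1 : ℂ)) ∘L
              mulOp volume (B'.indicator fun _ => (1 : ℂ)) := by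
        rw [mulOp_comp_mulOp (IsMultiplier.indicator h2.compl) (IsMultiplier.indicator h2'),
          ← mulOp_add (IsMultiplier.indicator h2)
            ((IsMultiplier.indicator h2.compl).mul (IsMultiplier.indicator h2'))]
        congr 1
        ext x
        by_cases hx : x ∈ B <;> by_cases hx' : x ∈ B' <;> simp [hx, hx']
      rw [e, ContinuousLinearMap.add_comp, ContinuousLinearMap.comp_assoc]
      exact h3.add (h3'.clm_comp _)
    · intro x _
      obtain ⟨Q, hQ, hQm, hQX⟩ := exists_isCompactOperator_indicator hU hcone hC hR x
      exact ⟨Q, mem_nhdsWithin_of_mem_nhds hQ, Q, subset_rfl, hQm, hQX⟩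
  have e : mulOp volume χ = mulOp volume χ ∘L mulOp volume (B.indicator fun _ => (1 : ℂ)) := by
    rw [mulOp_comp_mulOp hχ (IsMultiplier.indicator hBm)]
    congr 1
    ext x
    by_cases hx : x ∈ B
    · simp [hx]
    · rw [image_eq_zero_of_notMem_tsupport fun h => hx (hB h), zero_mul]
  rw [e, ContinuousLinearMap.comp_assoc]
  exact hBX.clm_comp _

/-- A neighbourhood contains the short segments that start near its centre. -/
theorem exists_segments {x₀ : E3} {N : Set E3} (hN : N ∈ 𝓝 x₀) (e : E3) :
    ∃ Q ∈ 𝓝 x₀, Q ⊆ N ∧ ∃ t₀ : ℝ, 0 < t₀ ∧ ∀ y ∈ Q, ∀ t, 0 < t → t ≤ t₀ → ∀ w : E3, ‖w‖ ≤ 1 →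
      y + t • (e + w) ∈ N := by
  obtain ⟨r, hr, hrN⟩ := Metric.mem_nhds_iff.1 hN
  refine ⟨Metric.ball x₀ (r / 2), Metric.ball_mem_nhds _ (by positivity),
    (Metric.ball_subset_ball (by linarith)).trans hrN, r / (2 * (‖e‖ + 1)), by positivity,
    fun y hy t ht htt w hw => hrN ?_⟩
  rw [Metric.mem_ball, dist_eq_norm] at hy ⊢
  have h1 : ‖t • (e + w)‖ ≤ r / 2 := by
    rw [norm_smul, Real.norm_of_nonneg ht.le]
    calc t * ‖e + w‖ ≤ r / (2 * (‖e‖ + 1)) * (‖e‖ + 1) := by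
          gcongr
          exact (norm_add_le _ _).trans (by gcongr)
      _ = r / 2 := by field_simp
  calc ‖y + t • (e + w) - x₀‖ = ‖(y - x₀) + t • (e + w)‖ := by congr 1; abel
    _ ≤ ‖y - x₀‖ + ‖t • (e + w)‖ := norm_add_le _ _
    _ < r := by linarith

/-- A smooth function decreases along a cone of directions, uniformly near a point at which its
derivative does not vanish. -/
theorem exists_decreasing_cone {ρ : E3 → ℝ} (hρ : ContDiff ℝ ∞ ρ) {x₀ : E3}
    (h0 : fderiv ℝ ρ x₀ ≠ 0) {N : Set E3} (hN : N ∈ 𝓝 x₀) :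
    ∃ Q ∈ 𝓝 x₀, Q ⊆ N ∧ ∃ (e : E3) (θ t₀ : ℝ), 0 < θ ∧ 0 < t₀ ∧ ∀ y ∈ Q,
      ∀ t, 0 < t → t ≤ t₀ → ∀ w : E3, ‖w‖ < θ →
        y + t • (e + w) ∈ N ∧ ρ (y + t • (e + w)) < ρ y := by
  set L := fderiv ℝ ρ x₀ with hL
  obtain ⟨v, hv⟩ : ∃ v, L v ≠ 0 := by
    by_contra! h
    exact h0 (ContinuousLinearMap.ext h)
  -- a direction in which `ρ` decreases at unit rate at `x₀`; the deviation `w` from it and the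
  -- error of linearization may each cost a quarter of that rate
  set e : E3 := (-(L v)⁻¹) • v with he
  have hLe : L e = -1 := by
    rw [he, map_smul, smul_eq_mul, neg_mul, inv_mul_cancel₀ hv]
  have hst : HasStrictFDerivAt ρ L x₀ := hρ.contDiffAt.hasStrictFDerivAt (by simp)
  have hη : (0 : ℝ) < 1 / (4 * (‖e‖ + 1)) := by positivity
  obtain ⟨s, hs, hsa⟩ := hst.approximates_deriv_on_nhds (c := ⟨1 / (4 * (‖e‖ + 1)), hη.le⟩)
    (Or.inr (by exact_mod_cast hη))
  obtain ⟨Q, hQ, hQN, t₀, ht₀, hseg⟩ := exists_segments (inter_mem hN hs) e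
  refine ⟨Q, hQ, hQN.trans Set.inter_subset_left, e, min 1 (1 / (4 * (‖L‖ + 1))), t₀, by positivity,
    ht₀, fun y hy t ht htt w hw => ?_⟩
  have hw1 : ‖w‖ ≤ 1 := hw.le.trans (min_le_left _ _)
  have h1 := hseg y hy t ht htt w hw1
  refine ⟨h1.1, ?_⟩
  have h2 := hsa _ h1.2 _ (hQN hy).2
  rw [add_sub_cancel_left, Real.norm_eq_abs] at h2
  have h3 := (abs_le.1 h2).2
  have h4 : ‖t • (e + w)‖ ≤ t * (‖e‖ + 1) := by
    rw [norm_smul, Real.norm_of_nonneg ht.le]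
    gcongr
    exact (norm_add_le _ _).trans (by gcongr)
  have h5 : (1 / (4 * (‖e‖ + 1))) * ‖t • (e + w)‖ ≤ t / 4 := by
    calc _ ≤ (1 / (4 * (‖e‖ + 1))) * (t * (‖e‖ + 1)) := by gcongr
      _ = t / 4 := by field_simp
  have h6 : L w ≤ 1 / 4 := by
    refine (le_abs_self _).trans ((L.le_opNorm w).trans ?_)
    calc ‖L‖ * ‖w‖ ≤ (‖L‖ + 1) * (1 / (4 * (‖L‖ + 1))) := by
          gcongr
          · linarith
          · exact hw.le.trans (min_le_right _ _)
      _ = 1 / 4 := by field_simp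
  have h7 : L (t • (e + w)) = t * (-1 + L w) := by rw [map_smul, map_add, hLe, smul_eq_mul]
  have h8 : ρ (y + t • (e + w)) - ρ y - t * (-1 + L w) ≤ t / 4 := by
    rw [← h7]
    exact h3.trans h5
  nlinarith

/-- At points of the interior, and off the closure, the inner cone property is automatic. -/
theorem hasInnerCone_of_frontier {U : Set E3} (h : ∀ x₀ ∈ frontier U, ∃ Q ∈ 𝓝 x₀,
    ∃ (e : E3) (θ t₀ : ℝ), 0 < θ ∧ 0 < t₀ ∧ ∀ y ∈ Q, y ∈ U →
      ∀ t, 0 < t → t ≤ t₀ → ∀ w : E3, ‖w‖ < θ → y + t • (e + w) ∈ U) : HasInnerCone U := by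
  intro x₀
  by_cases h1 : x₀ ∈ interior U
  · obtain ⟨Q, hQ, -, t₀, ht₀, hseg⟩ := exists_segments (mem_interior_iff_mem_nhds.1 h1) 0
    exact ⟨Q, hQ, 0, 1, t₀, one_pos, ht₀, fun y hy _ t ht htt w hw => hseg y hy t ht htt w hw.le⟩
  by_cases h2 : x₀ ∈ closure U
  · exact h x₀ ⟨h2, h1⟩
  · exact ⟨(closure U)ᶜ, isClosed_closure.isOpen_compl.mem_nhds h2, 0, 1, 1, one_pos, one_pos,
      fun y hy hyU => absurd (subset_closure hyU) hy⟩

theorem hasInnerCone_univ : HasInnerCone Set.univ :=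
  hasInnerCone_of_frontier fun x hx => by simp at hx

theorem IsSmoothCompactDomain.hasInnerCone {K : Set E3} (hK : IsSmoothCompactDomain K) :
    HasInnerCone K := by
  refine hasInnerCone_of_frontier fun x hx => ?_
  obtain ⟨N, hN, ρ, hρ, h0, hNρ⟩ := hK.2 x hx
  obtain ⟨Q, hQ, hQN, e, θ, t₀, hθ, ht₀, h⟩ := exists_decreasing_cone hρ h0 hN
  refine ⟨Q, hQ, e, θ, t₀, hθ, ht₀, fun y hy hyK t ht htt w hw => ?_⟩
  have h1 := h y hy t ht htt w hw
  exact (hNρ _ h1.1).2 (h1.2.le.trans ((hNρ y (hQN hy)).1 hyK))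

theorem IsSmoothCompactDomain.hasInnerCone_compl {K : Set E3} (hK : IsSmoothCompactDomain K) :
    HasInnerCone Kᶜ := by
  refine hasInnerCone_of_frontier fun x hx => ?_
  rw [frontier_compl] at hx
  obtain ⟨N, hN, ρ, hρ, h0, hNρ⟩ := hK.2 x hx
  obtain ⟨Q, hQ, hQN, e, θ, t₀, hθ, ht₀, h⟩ := exists_decreasing_cone (ρ := fun x => -ρ x) hρ.neg
    (by rwa [fderiv_fun_neg, neg_ne_zero]) hN
  refine ⟨Q, hQ, e, θ, t₀, hθ, ht₀, fun y hy hyK t ht htt w hw hmem => hyK ?_⟩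
  have h1 := h y hy t ht htt w hw
  have h2 := (hNρ _ h1.1).1 hmem
  exact (hNρ y (hQN hy)).2 (by linarith [h1.2])

end

section

variable {b : ℝ}

/-! ### The inverse of the obstacle realization -/

theorem eq_shiftedResolvent {A : Type*} [Ring A] [Algebra ℂ A] {R S : A} {z : ℂ}
    (hu : IsUnit (1 - z • R)) (h : S * (1 - z • R) = R) : S = shiftedResolvent R z := by
  calc S = S * (1 - z • R) * Ring.inverse (1 - z • R) := by
        rw [mul_assoc, Ring.mul_inverse_cancel _ hu, mul_one]
    _ = shiftedResolvent R z := by rw [h, shiftedResolvent]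

theorem shiftedResolvent_mul_cancel {A : Type*} [Ring A] [Algebra ℂ A] {R : A} {z : ℂ}
    (hu : IsUnit (1 - z • R)) : shiftedResolvent R z - z • (shiftedResolvent R z * R) = R := by
  have h : shiftedResolvent R z * (1 - z • R) = R := by
    rw [shiftedResolvent, mul_assoc, Ring.inverse_mul_cancel _ hu, mul_one]
  rwa [mul_sub, mul_one, mul_smul_comm] at h

theorem resolventAt_eq_shiftedResolvent {H : Type} [NormedAddCommGroup H] [InnerProductSpace ℂ H]
    [CompleteSpace H] {T : Set (H × H)} {c : ℝ} {R : H →L[ℂ] H}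
    (h : IsResolventAt T (-(c : ℂ)) R) (hR : IsSelfAdjoint R) {z : ℂ} (hz : z.im ≠ 0) :
    resolventAt T (z - c) = shiftedResolvent R z := by
  have h1 := h.translate (isUnit_one_sub_smul_selfAdjoint hR hz)
  rw [neg_add_eq_sub] at h1
  exact h1.eq_resolventAt

theorem extendOp_sub_smul {U : Set E3} (a : ℂ) (R S : L2on U →L[ℂ] L2on U) :
    extendOp U (R - a • S) = extendOp U R - a • extendOp U S := by
  ext1 f
  simp only [extendOp_apply, smul_apply, sub_apply, map_smul, map_sub]

theorem extendOp_shiftedResolvent {U : Set E3} (hU : MeasurableSet U) {R : L2on U →L[ℂ] L2on U}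
    (hR : IsSelfAdjoint R) {z : ℂ} (hz : z.im ≠ 0) :
    extendOp U (shiftedResolvent R z) - z • (extendOp U (shiftedResolvent R z) * extendOp U R) =
      extendOp U R := by
  rw [← extendOp_mul hU, ← extendOp_sub_smul,
    shiftedResolvent_mul_cancel (isUnit_one_sub_smul_selfAdjoint hR hz)]

theorem extendOp_apply_of_mem {U : Set E3} (hU : MeasurableSet U) {T : Set (L2on U × L2on U)} {c : ℝ}
    {R : L2on U →L[ℂ] L2on U} (hR : IsResolventAt T (-(c : ℂ)) R) {u w : L2}
    (hu : mulOp volume (U.indicator fun _ => (1 : ℂ)) u = u)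
    (h : (restrictTo U u, restrictTo U w) ∈ T) : extendOp U R (w + (c : ℂ) • u) = u := by
  have h1 := hR.2 _ h
  rw [neg_smul, sub_neg_eq_add, ← map_smul, ← map_add] at h1
  rw [extendOp_apply, h1, extendZero_restrictTo hU, hu]

theorem extendOp_apply_eq_zero {U U' : Set E3} (hU : MeasurableSet U) (hU' : MeasurableSet U')
    (hUU : Disjoint U U') (R : L2on U →L[ℂ] L2on U) {f : L2}
    (hf : mulOp volume (U'.indicator fun _ => (1 : ℂ)) f = f) : extendOp U R f = 0 := by
  have h1 : extendOp U' 1 f = f := by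
    rw [extendOp_apply, one_apply_eq_self, extendZero_restrictTo hU', hf]
  rw [← h1, ← mul_apply_eq_comp, extendOp_mul_of_disjoint hU hU' hUU, zero_apply]

/-- The properties of `R̃^l(0)` that the analysis of the obstacle relies on: it is self-adjoint,
locally compact, and inverts `H₀ + c` on functions that vanish near the obstacle. -/
structure IsObstacleInverse (b c : ℝ) (K : Set E3) (R : L2 →L[ℂ] L2) : Prop where
  isSelfAdjoint : IsSelfAdjoint R
  isCompactOperator : ∀ χ : E3 → ℂ, IsMultiplier χ → HasCompactSupport χ →
    IsCompactOperator (mulOp volume χ ∘L R)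
  apply_cutSource : ∀ ψ : E3 → ℂ, IsCutoff ψ → tsupport ψ ⊆ Kᶜ → ∀ (u w : L2) (G : Fin 3 → L2),
    (u, G) ∈ freeForm b → (∀ v h, (v, h) ∈ freeForm b → ∑ j, ⟪h j, G j⟫_ℂ = ⟪v, w⟫_ℂ) →
      R (cutSource ψ u G w + (c : ℂ) • mulOp volume ψ u) = mulOp volume ψ u

theorem isCompactOperator_mulOp_dirichlet {U : Set E3} (hU : MeasurableSet U) (hcone : HasInnerCone U)
    {ξ : ℂ} {R : L2on U →L[ℂ] L2on U} (hR : IsResolventAt (dirichletOp b U) ξ R) {χ : E3 → ℂ}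
    (hχ : IsMultiplier χ) (hχc : HasCompactSupport χ) :
    IsCompactOperator (mulOp volume χ ∘L extendOp U R) := by
  rw [dirichletOp_eq] at hR
  obtain ⟨C, hC, h⟩ := exists_gradient_bound (Submodule.isClosed_topologicalClosure _) hR
  refine isCompactOperator_mulOp_extendOp (b := b) hU hcone hC.le (fun f => ?_) hχ hχc
  obtain ⟨g, hg, hgC⟩ := h f
  exact ⟨g, dirichletForm_le_neumannForm b U hg, hgC⟩

theorem isCompactOperator_mulOp_robin {U : Set E3} (hU : MeasurableSet U) (hcone : HasInnerCone U)
    {γ : E3 → ℝ} {ξ : ℂ} {R : L2on U →L[ℂ] L2on U} (hR : IsResolventAt (robinOp b γ U) ξ R)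
    {χ : E3 → ℂ} (hχ : IsMultiplier χ) (hχc : HasCompactSupport χ) :
    IsCompactOperator (mulOp volume χ ∘L extendOp U R) := by
  rw [robinOp_eq] at hR
  obtain ⟨C, hC, h⟩ := exists_gradient_bound (Submodule.isClosed_topologicalClosure _) hR
  refine isCompactOperator_mulOp_extendOp (b := b) hU hcone hC.le (fun f => ?_) hχ hχc
  obtain ⟨g, hg, hgC⟩ := h f
  exact ⟨g.1, mem_neumannForm_of_mem_robinForm hg, (norm_fst_le g).trans hgC⟩

theorem indicator_cutSource_add {U : Set E3} (hU : MeasurableSet U) {ψ : E3 → ℂ} (hψ : IsCutoff ψ)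
    (hψU : tsupport ψ ⊆ U) (c : ℂ) (u w : L2) (G : Fin 3 → L2) :
    mulOp volume (U.indicator fun _ => (1 : ℂ)) (cutSource ψ u G w + c • mulOp volume ψ u) =
      cutSource ψ u G w + c • mulOp volume ψ u := by
  rw [map_add, map_smul, indicator_cutSource hU hψ hψU,
    indicator_mulOp hU hψ.multiplier fun x hx => image_eq_zero_of_notMem_tsupport fun h => hx (hψU h)]

/-- Both boundary conditions lead to an operator of this kind, whose shifts are the resolvents
`R̃^l(z)`. For the Robin condition the summand on `L²(K)` annihilates functions that vanish on the
obstacle. -/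
theorem exists_isObstacleInverse (hb : 0 < b) {c : ℝ} (hc : 0 ≤ c) {K : Set E3}
    (hK : IsSmoothCompactDomain K) {l : BoundaryCondition} (hl : IsAdmissibleShift b c K l) :
    ∃ R, IsObstacleInverse b c K R ∧ obstacleResolvent b c K l 0 = R ∧
      ∀ z : ℂ, z.im ≠ 0 → obstacleResolvent b c K l z = shiftedResolvent R z := by
  have hKm : MeasurableSet K := hK.1.measurableSet
  have hKK : Disjoint Kᶜ K := disjoint_compl_left
  have hψK : ∀ {ψ : E3 → ℂ}, tsupport ψ ⊆ Kᶜ → ∀ x ∉ Kᶜ, ψ x = 0 := fun h x hx =>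
    image_eq_zero_of_notMem_tsupport fun h' => hx (h h')
  have hcR : -(c : ℂ) = ((-c : ℝ) : ℂ) := by push_cast; rfl
  cases l with
  | dirichlet =>
    obtain ⟨R, hR⟩ := exists_resolvent_dirichletOp hb hc Kᶜ
    have hs : IsSelfAdjoint R := (hcR ▸ hR).isSelfAdjoint (dirichletOp_symm b _)
    refine ⟨extendOp Kᶜ R, ⟨isSelfAdjoint_extendOp hs, fun χ hχ hχc =>
      isCompactOperator_mulOp_dirichlet hKm.compl hK.hasInnerCone_compl hR hχ hχc,
      fun ψ hψ hψU u w G hu hw => ?_⟩, ?_, fun z hz => ?_⟩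
    · exact extendOp_apply_of_mem hKm.compl hR (indicator_mulOp hKm.compl hψ.multiplier (hψK hψU) _)
        (restrict_cutoff_mem_dirichletOp hKm.compl hψ hψU hu hw)
    · rw [obstacleResolvent, zero_sub, hR.eq_resolventAt]
    · rw [obstacleResolvent, resolventAt_eq_shiftedResolvent hR hs hz]
      refine eq_shiftedResolvent (isUnit_one_sub_smul_selfAdjoint (isSelfAdjoint_extendOp hs) hz) ?_
      rw [mul_sub, mul_one, mul_smul_comm, extendOp_shiftedResolvent hKm.compl hs hz]
  | robin γ hγ =>
    obtain ⟨⟨-, R, hR⟩, -, R', hR'⟩ := hl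
    have hs : IsSelfAdjoint R := (hcR ▸ hR).isSelfAdjoint (robinOp_symm b _ _)
    have hs' : IsSelfAdjoint R' := (hcR ▸ hR').isSelfAdjoint (robinOp_symm b _ _)
    have hsum := (isSelfAdjoint_extendOp hs).add (isSelfAdjoint_extendOp hs')
    refine ⟨extendOp Kᶜ R + extendOp K R', ⟨hsum, fun χ hχ hχc => ?_,
      fun ψ hψ hψU u w G hu hw => ?_⟩, ?_, fun z hz => ?_⟩
    · rw [ContinuousLinearMap.comp_add]
      exact (isCompactOperator_mulOp_robin hKm.compl hK.hasInnerCone_compl hR hχ hχc).add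
        (isCompactOperator_mulOp_robin hKm hK.hasInnerCone hR' hχ hχc)
    · rw [add_apply, extendOp_apply_eq_zero hKm hKm.compl hKK.symm R'
        (indicator_cutSource_add hKm.compl hψ hψU c u w G), add_zero]
      refine extendOp_apply_of_mem hKm.compl hR
        (indicator_mulOp hKm.compl hψ.multiplier (hψK hψU) _)
        (restrict_cutoff_mem_robinOp hKm.compl γ hψ hψU (fun x hx => ?_) hu hw)
      rw [frontier_compl] at hx
      exact hψK hψU x fun h => h (hK.1.isClosed.frontier_subset hx)
    · rw [obstacleResolvent, zero_sub, hR.eq_resolventAt, hR'.eq_resolventAt]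
    · rw [obstacleResolvent, resolventAt_eq_shiftedResolvent hR hs hz,
        resolventAt_eq_shiftedResolvent hR' hs' hz]
      refine eq_shiftedResolvent (isUnit_one_sub_smul_selfAdjoint hsum hz) ?_
      have h1 := extendOp_shiftedResolvent hKm.compl hs hz
      have h2 := extendOp_shiftedResolvent hKm hs' hz
      rw [mul_sub, mul_one, mul_smul_comm, mul_add, add_mul, add_mul,
        extendOp_mul_of_disjoint hKm.compl hKm hKK, extendOp_mul_of_disjoint hKm hKm.compl hKK.symm,
        add_zero, zero_add, smul_add]
      refine Eq.trans ?_ (congrArg₂ (· + ·) h1 h2)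
      abel

end

section

variable {b : ℝ}

/-! ### Decay and compactness of the perturbation -/

theorem exists_norm_mulOp_le_mulWeight {ε : ℝ} (hε : 0 ≤ ε) {m : E3 → ℂ} (hm : IsMultiplier m)
    (hc : HasCompactSupport m) : ∃ C, 0 ≤ C ∧ ∀ f : L2, ‖mulOp volume m f‖ ≤ C * ‖mulWeight ε f‖ := by
  obtain ⟨C, hC⟩ := hm.bounded
  have hC0 : 0 ≤ C := (norm_nonneg _).trans (hC 0)
  obtain ⟨D, hD⟩ := hc.isCompact.exists_bound_of_continuousOn (f := fun x => (weight ε x)⁻¹)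
    ((continuous_weight ε).inv₀ fun x => (weight_pos ε x).ne').continuousOn
  refine ⟨C * |D|, by positivity, fun f => ?_⟩
  rw [mulWeight_eq hε]
  refine norm_mulOp_apply_le_mul hm (isMultiplier_weight hε) (fun x => ?_) f
  have hw := weight_pos ε x
  rw [Complex.norm_real, Real.norm_of_nonneg hw.le]
  by_cases hx : x ∈ tsupport m
  · have h1 := (hD x hx).trans (le_abs_self D)
    rw [norm_inv, Real.norm_of_nonneg hw.le, inv_le_iff_one_le_mul₀ hw] at h1
    calc ‖m x‖ ≤ C * 1 := by rw [mul_one]; exact hC x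
      _ ≤ C * (|D| * weight ε x) := by gcongr
      _ = _ := by ring
  · rw [image_eq_zero_of_notMem_tsupport hx, norm_zero]
    positivity

theorem norm_mulWeight_le {ε : ℝ} (hε : 0 ≤ ε) (f : L2) : ‖mulWeight ε f‖ ≤ ‖f‖ := by
  rw [mulWeight_eq hε, ← one_mul ‖f‖]
  refine norm_mulOp_apply_le (isMultiplier_weight hε) (fun x => ?_) f
  rw [Complex.norm_real, Real.norm_of_nonneg (weight_pos ε x).le, weight, Real.exp_le_one_iff]
  have := Real.sqrt_nonneg (1 + x 2 ^ 2)
  nlinarith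

/-- The gradient of a solution is locally controlled by the weighted norms of the solution and of
the right-hand side. -/
theorem exists_norm_cutoff_grad_le {ε : ℝ} (hε : 0 ≤ ε) {ρ : E3 → ℂ} (hρ : IsCutoff ρ)
    (hc : HasCompactSupport ρ) : ∃ A, 0 ≤ A ∧ ∀ (u w : L2) (G : Fin 3 → L2), (u, G) ∈ freeForm b →
      (∀ v h, (v, h) ∈ freeForm b → ∑ j, ⟪h j, G j⟫_ℂ = ⟪v, w⟫_ℂ) → ∀ N : ℝ,
        ‖mulWeight ε u‖ ≤ N → ‖mulWeight ε w‖ ≤ N → ∀ j, ‖mulOp volume ρ (G j)‖ ≤ A * N := by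
  obtain ⟨C, hC0, hC⟩ := exists_norm_mulOp_le_mulWeight hε hρ.multiplier hc
  choose D hD0 hD using fun j => exists_norm_mulOp_le_mulWeight hε (hρ.multiplier_partialD j)
    (hasCompactSupport_partialD hc j)
  have hS : 0 ≤ ∑ j, D j := Finset.sum_nonneg fun j _ => hD0 j
  refine ⟨2 * (C + ∑ j, D j), by positivity, fun u w G hu hw N hN hN' j => ?_⟩
  have hN0 : 0 ≤ N := (norm_nonneg _).trans hN
  refine (pow_le_pow_iff_left₀ (norm_nonneg _) (by positivity) two_ne_zero).1 ?_
  have h1 : ‖mulOp volume ρ u‖ ≤ C * N := (hC u).trans (by gcongr)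
  have h2 : ‖mulOp volume ρ w‖ ≤ C * N := (hC w).trans (by gcongr)
  have h3 : ∀ i, ‖mulOp volume (partialD i ρ) u‖ ≤ D i * N := fun i =>
    (hD i u).trans (mul_le_mul_of_nonneg_left hN (hD0 i))
  have h4 : ∑ i, ‖mulOp volume (partialD i ρ) u‖ ^ 2 ≤ (∑ i, D i * N) ^ 2 :=
    (Finset.sum_le_sum fun i _ => pow_le_pow_left₀ (norm_nonneg _) (h3 i) 2).trans
      (by
        have h5 := fun i => mul_nonneg (hD0 i) hN0
        rw [Fin.sum_univ_three, Fin.sum_univ_three]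
        nlinarith [mul_nonneg (h5 0) (h5 1), mul_nonneg (h5 0) (h5 2), mul_nonneg (h5 1) (h5 2)])
  calc ‖mulOp volume ρ (G j)‖ ^ 2 ≤ ∑ j, ‖mulOp volume ρ (G j)‖ ^ 2 :=
        Finset.single_le_sum (f := fun j => ‖mulOp volume ρ (G j)‖ ^ 2)
          (fun i _ => by positivity) (Finset.mem_univ j)
    _ ≤ 2 * (‖mulOp volume ρ u‖ * ‖mulOp volume ρ w‖) +
          4 * ∑ i, ‖mulOp volume (partialD i ρ) u‖ ^ 2 := sum_norm_sq_cutoff_le hρ hu hw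
    _ ≤ 2 * ((C * N) * (C * N)) + 4 * (∑ i, D i * N) ^ 2 := by gcongr
    _ ≤ (2 * (C + ∑ j, D j) * N) ^ 2 := by
        rw [← Finset.sum_mul]
        nlinarith [mul_nonneg (mul_nonneg hC0 hS) (sq_nonneg N), mul_nonneg (mul_nonneg hC0 hC0) (sq_nonneg N)]

/-- A compactly supported cutoff that equals `1` near a compact set. -/
theorem exists_cutoff_eq_one {K : Set E3} (hK : IsCompact K) : ∃ χ : E3 → ℂ, IsCutoff χ ∧
    HasCompactSupport χ ∧ tsupport (fun x => 1 - χ x) ⊆ Kᶜ := by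
  obtain ⟨r, hr⟩ := hK.isBounded.subset_closedBall (0 : E3)
  -- absolute values, as the radius of a ball that contains `K` may be negative if `K` is empty
  let β : ContDiffBump (0 : E3) := ⟨|r| + 1, |r| + 2, by positivity, by linarith⟩
  have hcs : HasCompactSupport fun x => ((β x : ℝ) : ℂ) :=
    β.hasCompactSupport.comp_left Complex.ofReal_zero
  refine ⟨fun x => ((β x : ℝ) : ℂ), isCutoff_of_hasCompactSupport (contDiff_ofReal β.contDiff) hcs
    fun x => Complex.conj_ofReal _, hcs, ?_⟩
  have h1 : tsupport (fun x => 1 - ((β x : ℝ) : ℂ)) ⊆ (Metric.ball 0 (|r| + 1))ᶜ := by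
    refine closure_minimal (fun x hx hx' => hx ?_) Metric.isOpen_ball.isClosed_compl
    simp only
    rw [β.one_of_mem_closedBall (Metric.ball_subset_closedBall hx'), Complex.ofReal_one, sub_self]
  refine h1.trans (Set.compl_subset_compl.2 (hr.trans (Metric.closedBall_subset_ball ?_)))
  linarith [le_abs_self r]

theorem exists_norm_mulWeight_freeResolvent_le (hb : 0 < b) {c : ℝ} (hc : 0 ≤ c)
    {R₀ : L2 →L[ℂ] L2} (hR₀ : IsResolventAt (freeOp b) (-(c : ℂ)) R₀) {ε : ℝ} (hε : 0 ≤ ε)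
    (hεb : ε < √b) : ∃ C, 0 ≤ C ∧ ∀ f, ‖mulWeight ε (R₀ f)‖ ≤ C * ‖mulWeight ε f‖ := by
  have h0 : 0 < √b - ε := by linarith
  refine ⟨(√b)⁻¹ * (1 / (√b - ε)), by positivity, fun f =>
    norm_mulWeight_resolvent_le hb hR₀ hε hεb (fun j => ?_) f⟩
  obtain ⟨ζ, h1, h2, -⟩ := exists_landau_roots_of_nonneg hb hc j
  exact ⟨ζ, h1, h2⟩

theorem mulOp_neg {m : E3 → ℂ} (hm : IsMultiplier m) (f : L2) :
    mulOp volume (fun x => -m x) f = -mulOp volume m f := by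
  refine Lp.ext ?_
  filter_upwards [coeFn_mulOp (IsCutoff.neg_multiplier hm) f, coeFn_mulOp hm f,
    Lp.coeFn_neg (mulOp volume m f)] with x h1 h2 h3
  rw [h1, h3, Pi.neg_apply, h2, neg_mul]

theorem mulOp_one_sub {m : E3 → ℂ} (hm : IsMultiplier m) (f : L2) :
    mulOp volume (fun x => 1 - m x) f = f - mulOp volume m f := by
  simp only [sub_eq_add_neg]
  rw [mulOp_add (IsMultiplier.const 1) (IsCutoff.neg_multiplier hm), mulOp_one, add_apply,
    one_apply_eq_self, mulOp_neg hm]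

theorem cutSource_one_sub {χ : E3 → ℂ} (hχ : IsCutoff χ) (u w : L2) (G : Fin 3 → L2) :
    cutSource (fun x => 1 - χ x) u G w = w - cutSource χ u G w := by
  have h1 : ∀ j, mulOp volume (partialD j fun x => 1 - χ x) (G j) =
      -mulOp volume (partialD j χ) (G j) := fun j => by
    rw [partialD_one_sub, mulOp_neg (hχ.multiplier_partialD j)]
  have h2 : ∀ j, mulOp volume (partialD j (partialD j fun x => 1 - χ x)) u =
      -mulOp volume (partialD j (partialD j χ)) u := fun j => by
    have e : partialD j (partialD j fun x => 1 - χ x) = fun x => -partialD j (partialD j χ) x := by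
      ext x
      rw [partialD_one_sub, partialD, fderiv_fun_neg, neg_apply]
      rfl
    rw [e, mulOp_neg (hχ.multiplier_partialD_partialD j)]
  rw [cutSource, cutSource, mulOp_one_sub hχ.multiplier, Finset.sum_congr rfl fun j _ => h1 j,
    Finset.sum_congr rfl fun j _ => h2 j, Finset.sum_neg_distrib, Finset.sum_neg_distrib, smul_neg]
  abel

/-- The difference of the two inverses is localized near the obstacle: up to a localized free
solution it is the obstacle inverse applied to a source that is supported near the obstacle. -/
theorem exists_perturbation_decomposition (hb : 0 < b) {c : ℝ} (hc : 0 ≤ c) {K : Set E3}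
    (hK : IsCompact K) {R₀ R : L2 →L[ℂ] L2} (hR₀ : IsResolventAt (freeOp b) (-(c : ℂ)) R₀)
    (hR : IsObstacleInverse b c K R) {ε : ℝ} (hε : 0 ≤ ε) (hεb : ε < √b) :
    ∃ χ : E3 → ℂ, IsMultiplier χ ∧ HasCompactSupport χ ∧ ∃ C, 0 ≤ C ∧ ∀ f, ∃ F,
      (R₀ - R) f = mulOp volume χ (R₀ f) + R F ∧
        mulOp volume ((tsupport χ).indicator fun _ => (1 : ℂ)) F = F ∧
          ‖F‖ ≤ C * ‖mulWeight ε f‖ := by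
  obtain ⟨χ, hχ, hχc, hχK⟩ := exists_cutoff_eq_one hK
  obtain ⟨a, ha0, ha⟩ := exists_norm_mulWeight_freeResolvent_le hb hc hR₀ hε hεb
  obtain ⟨C, hC0, hC⟩ := exists_norm_mulOp_le_mulWeight hε hχ.multiplier hχc
  have hρc := fun j => hasCompactSupport_partialD hχc j
  have hρ : ∀ j, IsCutoff (partialD j χ) := fun j =>
    isCutoff_of_hasCompactSupport (contDiff_partialD hχ.contDiff j) (hρc j)
      (conj_partialD hχ.contDiff hχ.conj_eq j)
  choose A hA0 hA using fun j => exists_norm_cutoff_grad_le (b := b) hε (hρ j) (hρc j)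
  choose D hD0 hD using fun j => exists_norm_mulOp_le_mulWeight hε
    (hχ.multiplier_partialD_partialD j) (hasCompactSupport_partialD (hρc j) j)
  set a' := 1 + a + c * a with ha'
  have hBm : MeasurableSet (tsupport χ) := (isClosed_tsupport χ).measurableSet
  refine ⟨χ, hχ.multiplier, hχc, C + 2 * ∑ j, A j * a' + ∑ j, D j * a, ?_, fun f => ?_⟩
  · have h1 : 0 ≤ ∑ j, A j * a' := Finset.sum_nonneg fun j _ => mul_nonneg (hA0 j) (by positivity)
    have h2 : 0 ≤ ∑ j, D j * a := Finset.sum_nonneg fun j _ => mul_nonneg (hD0 j) ha0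
    positivity
  set u := R₀ f with hu
  obtain ⟨G, hG, hGw⟩ := hR₀.1 f
  rw [neg_smul, ← sub_eq_add_neg] at hGw
  set w := f - (c : ℂ) • u with hw
  -- apply the obstacle inverse to the equation of `(1 - χ) u`, where `u = R₀ f`
  have hsrc : cutSource (fun x => 1 - χ x) u G w + (c : ℂ) • mulOp volume (fun x => 1 - χ x) u =
      f - cutSource χ u G f := by
    have e : cutSource χ u G w = cutSource χ u G f - (c : ℂ) • mulOp volume χ u := by
      rw [cutSource, cutSource, hw, map_sub, map_smul]
      abel
    rw [cutSource_one_sub hχ, mulOp_one_sub hχ.multiplier, e, hw, smul_sub]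
    abel
  have h1 := hR.apply_cutSource _ hχ.one_sub hχK u w G hG hGw
  rw [hsrc, map_sub, mulOp_one_sub hχ.multiplier] at h1
  refine ⟨-cutSource χ u G f, ?_, ?_, ?_⟩
  · rw [sub_apply, map_neg, sub_eq_iff_eq_add.1 h1, ← hu]
    abel
  · rw [map_neg, indicator_cutSource hBm hχ subset_rfl]
  · have hN : ‖mulWeight ε u‖ ≤ a' * ‖mulWeight ε f‖ := (ha f).trans (by
      gcongr
      nlinarith [mul_nonneg hc ha0])
    have hN' : ‖mulWeight ε w‖ ≤ a' * ‖mulWeight ε f‖ := by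
      rw [hw, map_sub, map_smul]
      refine (norm_sub_le _ _).trans ?_
      rw [norm_smul, Complex.norm_real, Real.norm_of_nonneg hc]
      nlinarith [mul_le_mul_of_nonneg_left (ha f) hc, mul_nonneg ha0 (norm_nonneg (mulWeight ε f))]
    have e1 : ∀ j, ‖mulOp volume (partialD j χ) (G j)‖ ≤ A j * a' * ‖mulWeight ε f‖ := fun j => by
      have h := hA j u w G hG hGw (a' * ‖mulWeight ε f‖) hN hN' j
      linarith
    have e2 : ∀ j, ‖mulOp volume (partialD j (partialD j χ)) u‖ ≤ D j * a * ‖mulWeight ε f‖ :=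
      fun j => by
        have h := (hD j u).trans (mul_le_mul_of_nonneg_left (ha f) (hD0 j))
        linarith
    calc ‖-cutSource χ u G f‖ ≤ ‖mulOp volume χ f‖ + 2 * ‖∑ j, mulOp volume (partialD j χ) (G j)‖ +
          ‖∑ j, mulOp volume (partialD j (partialD j χ)) u‖ := by
          rw [norm_neg, cutSource]
          refine (norm_sub_le _ _).trans (add_le_add ((norm_sub_le _ _).trans ?_) le_rfl)
          rw [norm_smul, Complex.norm_two]
      _ ≤ C * ‖mulWeight ε f‖ + 2 * ∑ j, A j * a' * ‖mulWeight ε f‖ +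
          ∑ j, D j * a * ‖mulWeight ε f‖ := by
          gcongr
          · exact hC f
          · exact norm_sum_le_of_le _ fun j _ => e1 j
          · exact norm_sum_le_of_le _ fun j _ => e2 j
      _ = _ := by
          rw [add_mul, add_mul, Finset.sum_mul, mul_assoc 2, Finset.sum_mul]

theorem isCompactOperator_mulOp_freeResolvent {c : ℝ} {R₀ : L2 →L[ℂ] L2} (hb : 0 < b) (hc : 0 ≤ c)
    (hR₀ : IsResolventAt (freeOp b) (-(c : ℂ)) R₀) {χ : E3 → ℂ} (hχ : IsMultiplier χ)
    (hχc : HasCompactSupport χ) : IsCompactOperator (mulOp volume χ ∘L R₀) := by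
  obtain ⟨R, hR⟩ := exists_resolvent_dirichletOp hb hc Set.univ
  have h1 : freeResolvent b c 0 = R₀ := freeResolvent_eq (by rwa [zero_sub])
  have h2 : freeResolvent b c 0 = extendOp Set.univ R := by
    rw [freeResolvent, zero_sub, hR.eq_resolventAt]
  rw [← h1, h2]
  exact isCompactOperator_mulOp_dirichlet MeasurableSet.univ hasInnerCone_univ hR hχ hχc

theorem conj_indicator_one (B : Set E3) (x : E3) :
    starRingEnd ℂ (B.indicator (fun _ => (1 : ℂ)) x) = B.indicator (fun _ => (1 : ℂ)) x := by
  by_cases hx : x ∈ B <;> simp [hx]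

/-- The cutoff of `R₀` is compact. The rest is `f ↦ R F` with `F` supported near the obstacle, and
`‖R F‖² = ⟪R Z f, F⟫` only involves the localization of `R Z`, which is compact. -/
theorem isCompactOperator_perturbation (hb : 0 < b) {c : ℝ} (hc : 0 ≤ c) {K : Set E3}
    (hK : IsCompact K) {R₀ R : L2 →L[ℂ] L2} (hR₀ : IsResolventAt (freeOp b) (-(c : ℂ)) R₀)
    (hR : IsObstacleInverse b c K R) : IsCompactOperator (R₀ - R) := by
  obtain ⟨χ, hχ, hχc, C, hC0, hC⟩ := exists_perturbation_decomposition hb hc hK hR₀ hR le_rfl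
    (Real.sqrt_pos.2 hb)
  have hBm : MeasurableSet (tsupport χ) := (isClosed_tsupport χ).measurableSet
  have hB := IsMultiplier.indicator hBm
  have hBc : HasCompactSupport ((tsupport χ).indicator fun _ => (1 : ℂ)) :=
    HasCompactSupport.intro hχc fun x hx => Set.indicator_of_notMem hx _
  -- the part of the perturbation in the range of the obstacle inverse
  set Z := (R₀ - R) - mulOp volume χ ∘L R₀ with hZ
  have hZc : IsCompactOperator Z := by
    have hX : IsCompactOperator
        ((mulOp volume ((tsupport χ).indicator fun _ => (1 : ℂ)) ∘L R) ∘L Z) :=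
      (hR.isCompactOperator _ hB hBc).comp_clm Z
    refine isCompactOperator_of_sq_le hX (C := C) fun f => ?_
    obtain ⟨F, h1, h2, h3⟩ := hC f
    have h4 : Z f = R F := by
      rw [hZ, sub_apply, h1, ContinuousLinearMap.comp_apply, add_sub_cancel_left]
    have h5 : ⟪Z f, Z f⟫_ℂ = ⟪mulOp volume ((tsupport χ).indicator fun _ => (1 : ℂ)) (R (Z f)), F⟫_ℂ := by
      rw [inner_mulOp_left hB (conj_indicator_one _) (R (Z f)) F, h2]
      nth_rw 2 [h4]
      exact ((ContinuousLinearMap.isSelfAdjoint_iff_isSymmetric.1 hR.isSelfAdjoint) _ _).symm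
    have h6 : ‖Z f‖ ^ 2 = ‖⟪Z f, Z f⟫_ℂ‖ := by
      rw [inner_self_eq_norm_sq_to_K, norm_pow, RCLike.norm_ofReal, abs_norm]
    rw [h6, h5]
    refine (norm_inner_le_norm _ _).trans ?_
    rw [mul_comm C, mul_assoc]
    refine mul_le_mul_of_nonneg_left (h3.trans ?_) (norm_nonneg _)
    gcongr
    exact norm_mulWeight_le le_rfl f
  have h := hZc.add (isCompactOperator_mulOp_freeResolvent hb hc hR₀ hχ hχc)
  rw [← FunLike.coe_add, hZ, sub_add_cancel] at h
  exact h

/-- The quadratic form of the perturbation is controlled by exponentially decaying weights. -/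
theorem exists_norm_inner_perturbation_le (hb : 0 < b) {c : ℝ} (hc : 0 ≤ c) {K : Set E3}
    (hK : IsCompact K) {R₀ R : L2 →L[ℂ] L2} (hR₀ : IsResolventAt (freeOp b) (-(c : ℂ)) R₀)
    (hR : IsObstacleInverse b c K R) {ε : ℝ} (hε : 0 ≤ ε) (hεb : ε < √b) :
    ∃ C, 0 ≤ C ∧ ∀ f, ‖⟪f, (R₀ - R) f⟫_ℂ‖ ≤ C * ‖mulWeight ε f‖ ^ 2 := by
  obtain ⟨χ, hχ, hχc, C, hC0, hC⟩ := exists_perturbation_decomposition hb hc hK hR₀ hR hε hεb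
  obtain ⟨a, ha0, ha⟩ := exists_norm_mulWeight_freeResolvent_le hb hc hR₀ hε hεb
  have hBm : MeasurableSet (tsupport χ) := (isClosed_tsupport χ).measurableSet
  have hB := IsMultiplier.indicator hBm
  have hBc : HasCompactSupport ((tsupport χ).indicator fun _ => (1 : ℂ)) :=
    HasCompactSupport.intro hχc fun x hx => Set.indicator_of_notMem hx _
  set P := mulOp (volume : Measure E3) ((tsupport χ).indicator fun _ => (1 : ℂ)) with hP
  obtain ⟨D, hD0, hD⟩ := exists_norm_mulOp_le_mulWeight hε hB hBc
  obtain ⟨E, hE0, hE⟩ := exists_norm_mulOp_le_mulWeight hε hχ hχc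
  refine ⟨D * (E * a) + (D * a + (E * a + ‖R‖ * C)) * C, by positivity, fun f => ?_⟩
  obtain ⟨F, h1, h2, h3⟩ := hC f
  have hsym : ∀ g h : L2, ⟪P g, h⟫_ℂ = ⟪g, P h⟫_ℂ := fun g h =>
    inner_mulOp_left hB (conj_indicator_one _) g h
  have hχu : ‖mulOp volume χ (R₀ f)‖ ≤ E * a * ‖mulWeight ε f‖ := by
    rw [mul_assoc]
    exact (hE _).trans (by gcongr; exact ha f)
  have hPχ : P (mulOp volume χ (R₀ f)) = mulOp volume χ (R₀ f) :=
    indicator_mulOp hBm hχ (fun x hx => image_eq_zero_of_notMem_tsupport hx) _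
  have hRF : ‖R F‖ ≤ ‖R‖ * C * ‖mulWeight ε f‖ := by
    rw [mul_assoc]
    exact (R.le_opNorm F).trans (by gcongr)
  have hP1 : ∀ g, ‖P g‖ ≤ ‖g‖ := fun g => by
    have := norm_mulOp_apply_le (μ := volume) hB (C := 1) (fun x => by
      by_cases hx : x ∈ tsupport χ <;> simp [hx]) g
    rwa [one_mul] at this
  have hPR : ‖P (R f)‖ ≤ (D * a + (E * a + ‖R‖ * C)) * ‖mulWeight ε f‖ := by
    have e : R f = R₀ f - (mulOp volume χ (R₀ f) + R F) := by
      rw [← h1, sub_apply, sub_sub_cancel]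
    have e1 : ‖P (R₀ f)‖ ≤ D * a * ‖mulWeight ε f‖ := by
      rw [mul_assoc]
      exact (hD _).trans (by gcongr; exact ha f)
    rw [e, map_sub, add_mul, add_mul]
    refine (norm_sub_le _ _).trans (add_le_add e1 ((hP1 _).trans ?_))
    exact (norm_add_le _ _).trans (add_le_add hχu hRF)
  -- `⟪f, R F⟫ = ⟪R f, F⟫` only involves `R f` on the support of `F`, that is near the obstacle,
  -- and `R f` is the difference of `R₀ f` and the perturbation
  have h4 : ⟪f, (R₀ - R) f⟫_ℂ = ⟪P f, mulOp volume χ (R₀ f)⟫_ℂ + ⟪P (R f), F⟫_ℂ := by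
    rw [h1, inner_add_right, hsym, hsym, hPχ, h2]
    congr 1
    exact ((ContinuousLinearMap.isSelfAdjoint_iff_isSymmetric.1 hR.isSelfAdjoint) _ _).symm
  rw [h4]
  calc _ ≤ ‖P f‖ * ‖mulOp volume χ (R₀ f)‖ + ‖P (R f)‖ * ‖F‖ :=
        (norm_add_le _ _).trans (add_le_add (norm_inner_le_norm _ _) (norm_inner_le_norm _ _))
    _ ≤ (D * ‖mulWeight ε f‖) * (E * a * ‖mulWeight ε f‖) +
        ((D * a + (E * a + ‖R‖ * C)) * ‖mulWeight ε f‖) * (C * ‖mulWeight ε f‖) := by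
        gcongr
        exact hD f
    _ = _ := by ring

theorem norm_sq_factor {V M : L2 →L[ℂ] L2} {σ : ℂ} (hσ : ‖σ‖ = 1) (h : V = σ • (M.adjoint ∘L M))
    (f : L2) : ‖M f‖ ^ 2 = ‖⟪f, V f⟫_ℂ‖ := by
  rw [h, smul_apply, inner_smul_right, norm_mul, hσ, one_mul, ContinuousLinearMap.comp_apply,
    ContinuousLinearMap.adjoint_inner_right, inner_self_eq_norm_sq_to_K, norm_pow,
    RCLike.norm_ofReal, abs_norm]

/-- The factors of the perturbation are compact and decay exponentially. -/
theorem exists_factor_comp_mulWeight (hb : 0 < b) {c : ℝ} (hc : 0 ≤ c) {K : Set E3}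
    (hK : IsCompact K) {R₀ R : L2 →L[ℂ] L2} (hR₀ : IsResolventAt (freeOp b) (-(c : ℂ)) R₀)
    (hR : IsObstacleInverse b c K R) {σ : ℂ} (hσ : ‖σ‖ = 1) {M : L2 →L[ℂ] L2}
    (hM : R₀ - R = σ • (M.adjoint ∘L M)) {ε : ℝ} (hε : 0 ≤ ε) (hεb : ε < √b) :
    IsCompactOperator M ∧ ∃ N : L2 →L[ℂ] L2, N ∘L mulWeight ε = M := by
  constructor
  · refine isCompactOperator_of_sq_le (isCompactOperator_perturbation hb hc hK hR₀ hR) (C := 1)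
      fun f => ?_
    rw [norm_sq_factor hσ hM f, one_mul, mul_comm]
    exact norm_inner_le_norm _ _
  · obtain ⟨C, hC0, hC⟩ := exists_norm_inner_perturbation_le hb hc hK hR₀ hR hε hεb
    refine exists_comp_eq_of_norm_le _ _ (denseRange_mulWeight hε) (C := √C) fun f => ?_
    refine (pow_le_pow_iff_left₀ (norm_nonneg _) (by positivity) two_ne_zero).1 ?_
    rw [norm_sq_factor hσ hM f, mul_pow, Real.sq_sqrt hC0]
    exact hC f

end

section

variable {b : ℝ}

/-! ### The sandwiched resolvent near a threshold -/

/-- The operator function of the threshold is `-ikz M_l (1 - z R₀)⁻¹ M^l`: the singular part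
`p_q ⊗ r(ik)` of the free resolvent and the rest are put together again. -/
theorem charOp_eq (hb : 0 < b) {c : ℝ} (q : ℕ) {R₀ : L2 →L[ℂ] L2}
    (hR₀ : IsResolventAt (freeOp b) (-(c : ℂ)) R₀) (hs : IsSelfAdjoint R₀) (M : L2 →L[ℂ] L2)
    {k z : ℂ} (hkr : 0 < k.re) (hki : 0 < k.im) (hz : z = (landauLevel b c q : ℂ) + k ^ 2) :
    charOp b c q M k =
      (-(Complex.I * k * z)) • (M * Ring.inverse (1 - z • R₀) * M.adjoint) := by
  set κ := Complex.I * k with hκdef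
  have hκ : κ.re < 0 := by simp [hκdef]; exact hki
  have hκ0 : κ ≠ 0 := fun h => by rw [h] at hκ; simp at hκ
  have hzi : 0 < z.im := by
    rw [hz, Complex.add_im, Complex.ofReal_im, zero_add, sq, Complex.mul_im]
    nlinarith [mul_pos hkr hki]
  have hres := isResolventAt_shiftedResolvent hR₀ hs hzi.ne'
  have hfree : freeResolvent b c z = shiftedResolvent R₀ z :=
    freeResolvent_eq (by rw [sub_eq_neg_add]; exact hres)
  have hζ : κ ^ 2 = ((2 * q + 1) * b : ℝ) - (-(c : ℂ) + z) := by
    rw [hκdef, mul_pow, Complex.I_sq, hz, landauLevel]; push_cast; ring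
  have h1 := resolvent_mul_landauOp hb q hκ hζ hres
  have h2 : landauOp b q * vertOp b κ = (-κ) • (shiftedResolvent R₀ z * landauOp b q) := by
    rw [h1, smul_smul, neg_mul_neg, mul_inv_cancel₀ hκ0, one_smul, landauOp_mul_vertOp hb q hκ]
  have hc1 : charOp b c q M k = z ^ 2 • (M * landauTensor b q κ * M.adjoint) -
      κ • (M * (z • 1 + z ^ 2 • (freeResolvent b c z * (1 - landauProj b q))) * M.adjoint) := by
    rw [hz]; rfl
  rw [hc1, landauTensor_eq hb q hκ, h2, hfree, landauProj_eq hb,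
    ← one_add_smul_shiftedResolvent (isUnit_one_sub_smul_selfAdjoint hs hzi.ne')]
  simp only [mul_sub, mul_add, add_mul, sub_mul, smul_sub, mul_smul_comm, smul_mul_assoc, mul_one,
    smul_smul, mul_assoc]
  module

theorem smul_resolvent_mul_eq {A : Type*} [Ring A] [Algebra ℂ A] {S W B Q F : A} {z : ℂ}
    (hz : z ≠ 0) (h : S * W = W * B) : z⁻¹ • ((1 + z • S) * (W * Q) * F - W * Q) =
      W * (z⁻¹ • (Q * (F - 1)) + B * Q * F) := by
  have h1 : S * (W * (Q * F)) = W * (B * (Q * F)) := by rw [← mul_assoc, h, mul_assoc]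
  simp only [mul_sub, mul_add, add_mul, smul_sub, mul_smul_comm, smul_mul_assoc, mul_one,
    one_mul, smul_smul, mul_assoc, smul_add, inv_mul_cancel₀ hz, one_smul, h1]
  abel

set_option maxHeartbeats 1000000 in
/-- A weight splits off the obstacle resolvent, so that the threshold operator applies to it and
the free resolvent identity at the threshold can be used. -/
theorem sandwichedResolvent_eq (hb : 0 < b) {c : ℝ} (q : ℕ) {R₀ R : L2 →L[ℂ] L2}
    (hR₀ : IsResolventAt (freeOp b) (-(c : ℂ)) R₀) (hs₀ : IsSelfAdjoint R₀) (hs : IsSelfAdjoint R)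
    {σ : ℂ} (hσ : σ ^ 2 = 1) {M N : L2 →L[ℂ] L2} {ε : ℝ} (hε : 0 < ε) (hN : N * mulWeight ε = M)
    (hV : R₀ - R = σ • (M.adjoint * M)) {K : Set E3} {l : BoundaryCondition} {z : ℂ}
    (hRz : obstacleResolvent b c K l z = shiftedResolvent R z) (hzi : 0 < z.im) {κ : ℂ}
    (hκ : κ = Complex.I * (z - landauLevel b c q) ^ (1 / 2 : ℂ)) :
    ∃ F : L2 →L[ℂ] L2,
      (1 + (σ * z) • (M * Ring.inverse (1 - z • R₀) * M.adjoint)) * F = 1 ∧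
      F * (1 + (σ * z) • (M * Ring.inverse (1 - z • R₀) * M.adjoint)) = 1 ∧
      sandwichedResolvent b c ε q K l M z =
        (landauLevel b c q / (z * κ)) • (N * (landauOp b q * wVertOp b ε 0) * N.adjoint * F) -
          (κ / z) • (N * (landauOp b q * wVertOp b ε 0) * N.adjoint) +
            (σ / z ^ 2) • (1 - F) - z⁻¹ • (M * M.adjoint) := by
  have hz0 : z ≠ 0 := fun h => by rw [h] at hzi; simp at hzi
  have hσ0 : σ ≠ 0 := fun h => by rw [h] at hσ; simp at hσ
  have hσi : σ⁻¹ = σ := by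
    rw [inv_eq_iff_eq_inv, eq_comm, ← mul_eq_one_iff_inv_eq₀ hσ0, ← sq, hσ]
  have hw : 0 < (z - landauLevel b c q).im := by simpa using hzi
  obtain ⟨hkr, hki, hk2⟩ := sqrt_mem_quadrant hw
  have hκ2 : κ ^ 2 = landauLevel b c q - z := by
    rw [hκ, mul_pow, hk2, Complex.I_sq]; ring
  have hκ0 : κ ≠ 0 := by
    rw [hκ]
    refine mul_ne_zero Complex.I_ne_zero fun h => ?_
    rw [h] at hkr; simp at hkr
  have hu₀ := isUnit_one_sub_smul_selfAdjoint hs₀ hzi.ne'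
  have hu := isUnit_one_sub_smul_selfAdjoint hs hzi.ne'
  obtain ⟨h1, h2, h3⟩ := perturbation_inverse_identities hV (Ring.inverse_mul_cancel _ hu₀)
    (Ring.mul_inverse_cancel _ hu) (Ring.mul_inverse_cancel _ hu₀) (Ring.inverse_mul_cancel _ hu)
  set F := 1 - (σ * z) • (M * Ring.inverse (1 - z • R) * M.adjoint) with hF
  refine ⟨F, h1, h2, ?_⟩
  -- a weight `η ≤ ε` small enough for the free resolvent at `z`
  obtain ⟨δ, hδ, hroots⟩ := exists_landau_roots hb (ξ := -(c : ℂ) + starRingEnd ℂ z)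
    (by simpa using hzi.ne')
  set η := min ε (δ / 2) with hη
  have hη0 : 0 < η := lt_min hε (by positivity)
  have hηε : 0 ≤ ε - η := sub_nonneg.2 (min_le_left _ _)
  have hηδ : η < δ := (min_le_right _ _).trans_lt (by linarith)
  have hzc : (starRingEnd ℂ z).im ≠ 0 := by simpa using hzi.ne'
  obtain ⟨B', hB'⟩ := exists_resolvent_mul_mulWeight hb
    (isResolventAt_shiftedResolvent hR₀ hs₀ hzc) (adjoint_shiftedResolvent hs₀ _) hη0.le hηδ hroots
  rw [Complex.conj_conj] at hB'
  have hthr := threshold_mul_resolvent hb q hR₀ hs₀ hzi.ne' hη0 hB'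
  have hMa : M.adjoint = mulWeight η * (mulWeight (ε - η) * N.adjoint) := by
    rw [← mul_assoc, mulWeight_mul_mulWeight hη0.le hηε, add_sub_cancel, ← hN]
    exact (ContinuousLinearMap.adjoint_comp _ _).trans (by
      rw [(isSelfAdjoint_mulWeight hε.le).adjoint_eq]; rfl)
  set Q := mulWeight (ε - η) * N.adjoint with hQ
  have hAz : Ring.inverse (1 - z • R₀) = 1 + z • shiftedResolvent R₀ z := (one_add_smul_shiftedResolvent hu₀).symm
  have hBz : Ring.inverse (1 - z • R) = 1 + z • shiftedResolvent R z := (one_add_smul_shiftedResolvent hu).symm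
  have hRS : shiftedResolvent R z = z⁻¹ • (Ring.inverse (1 - z • R) - 1) := by
    rw [hBz, add_sub_cancel_left, smul_smul, inv_mul_cancel₀ hz0, one_smul]
  set X := z⁻¹ • (Q * (F - 1)) + B' * Q * F with hX
  -- the functions `R̃^l(z) M^l f` decay exponentially
  have hRX : shiftedResolvent R z * M.adjoint = mulWeight η * X := by
    rw [hRS, smul_mul_assoc, sub_mul, one_mul, h3, hAz, hMa]
    exact smul_resolvent_mul_eq hz0 hB'
  set P := landauOp b q * wVertOp b η 0 with hP
  have hop : (opOf fun f x => (weight ε x : ℂ) *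
      thresholdOp b q (obstacleResolvent b c K l z (M.adjoint f)) x) = mulWeight (ε - η) * (P * X) := by
    refine opOf_eq fun f => ?_
    have e1 : obstacleResolvent b c K l z (M.adjoint f) = mulWeight η (X f) := by
      rw [hRz]
      exact DFunLike.congr_fun hRX f
    filter_upwards [coeFn_mulWeight hηε (P (X f)), coeFn_landauOp_mul_wVertOp_zero hb q hη0 (X f)]
      with x h4 h5
    rw [mul_apply_eq_comp, mul_apply_eq_comp, h4, h5, e1, ← mul_assoc, ← Complex.ofReal_mul]
    congr 2
    rw [weight, weight, weight, ← Real.exp_add]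
    congr 1
    ring
  have hWP : mulWeight (ε - η) * P * mulWeight (ε - η) = landauOp b q * wVertOp b ε 0 := by
    have h4 := mulWeight_wVertOp_mulWeight b hη0.le hηε (ζ := 0) (by simpa using hη0)
    rw [sub_add_cancel] at h4
    rw [hP, ← mul_assoc, ← landauOp_mul_mulWeight hb q hηε, mul_assoc, mul_assoc, ← mul_assoc _ _
      (mulWeight (ε - η)), h4]
  have hext : weightedExtension ε M = N := by
    have hex : ∃ N : L2 →L[ℂ] L2, N ∘L mulWeight ε = M := ⟨N, hN⟩
    rw [weightedExtension, dif_pos hex]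
    exact comp_right_injective_of_denseRange (denseRange_mulWeight hε.le)
      (hex.choose_spec.trans hN.symm)
  have hY : sandwichedResolvent b c ε q K l M z = M * (shiftedResolvent R z * M.adjoint) +
      κ • (N * (mulWeight (ε - η) * (P * X))) := by
    rw [← hRz, ← hop, hκ, ← hext]
    rfl
  set L := landauOp b q * wVertOp b ε 0 with hL
  have hNP : N * (mulWeight (ε - η) * (P * X)) = z⁻¹ • (N * L * N.adjoint * (F - 1)) +
      (landauLevel b c q - z)⁻¹ • (N * L * N.adjoint * F) := by
    have e1 : P * X = z⁻¹ • (P * Q * (F - 1)) + (landauLevel b c q - z)⁻¹ • (P * Q * F) := by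
      rw [hX, mul_add, mul_smul_comm, ← mul_assoc P Q, ← mul_assoc P (B' * Q) F, ← mul_assoc P B' Q,
        hthr, smul_mul_assoc, smul_mul_assoc]
    have e2 : mulWeight (ε - η) * (P * Q) = L * N.adjoint := by
      rw [hQ, ← mul_assoc, ← mul_assoc, hWP]
    rw [e1, mul_add, mul_add, mul_smul_comm, mul_smul_comm, mul_smul_comm, mul_smul_comm,
      ← mul_assoc (mulWeight (ε - η)) (P * Q) (F - 1), ← mul_assoc (mulWeight (ε - η)) (P * Q) F, e2]
    simp only [mul_assoc]
  have hMBM : M * (shiftedResolvent R z * M.adjoint) =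
      z⁻¹ • ((σ * z)⁻¹ • (1 - F) - M * M.adjoint) := by
    rw [hF, sub_sub_cancel, smul_smul, inv_mul_cancel₀ (mul_ne_zero hσ0 hz0), one_smul, hRS]
    simp only [smul_mul_assoc, mul_smul_comm, sub_mul, mul_sub, one_mul, mul_assoc]
  have hc1 : κ * z⁻¹ + κ * (landauLevel b c q - z)⁻¹ = landauLevel b c q / (z * κ) := by
    rw [← hκ2]
    field_simp
    rw [hκ2]
    ring
  rw [hY, hNP, hMBM, ← hc1, mul_inv, hσi]
  simp only [mul_sub, mul_one]
  module

/-! ### Approach to the threshold -/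

theorem neBot_nhdsWithin_sector (Λ : ℝ) {δ : ℝ} : (𝓝[sector Λ δ] (Λ : ℂ)).NeBot := by
  refine mem_closure_iff_nhdsWithin_neBot.1 (mem_closure_of_tendsto (b := atTop)
    (f := fun n : ℕ => (Λ : ℂ) + ((1 / ((n : ℝ) + 1) : ℝ) : ℂ) * Complex.I) ?_ ?_)
  · have h1 := ((Complex.continuous_ofReal.tendsto 0).comp
      (tendsto_one_div_add_atTop_nhds_zero_nat (𝕜 := ℝ))).mul_const Complex.I
    simpa using h1.const_add (Λ : ℂ)
  · refine Eventually.of_forall fun n => ?_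
    have h1 : 0 < 1 / ((n : ℝ) + 1) := by positivity
    have h2 : ((Λ : ℂ) + ((1 / ((n : ℝ) + 1) : ℝ) : ℂ) * Complex.I).re = Λ := by simp
    have h3 : ((Λ : ℂ) + ((1 / ((n : ℝ) + 1) : ℝ) : ℂ) * Complex.I).im = 1 / ((n : ℝ) + 1) := by
      rw [Complex.add_im, Complex.ofReal_im, zero_add, Complex.im_ofReal_mul, Complex.I_im, mul_one]
    rw [sector, Set.mem_ofPred_eq, h2, h3, sub_self, abs_zero, mul_zero]
    exact h1

/-- In the sector, the square root of `z - Λ` stays away from the imaginary axis. -/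
theorem mul_norm_le_re_of_mem_sector {Λ δ : ℝ} (hδ : 0 < δ) {z k : ℂ} (hz : z ∈ sector Λ δ)
    (hkr : 0 < k.re) (hki : 0 < k.im) (hk : k ^ 2 = z - Λ) : δ / (2 * δ + 2) * ‖k‖ ≤ k.re := by
  have h1 : δ * |k.re ^ 2 - k.im ^ 2| < 2 * (k.re * k.im) := by
    have e1 : z.re - Λ = k.re ^ 2 - k.im ^ 2 := by
      have := congrArg Complex.re hk
      rw [sq, Complex.mul_re, Complex.sub_re, Complex.ofReal_re] at this
      linarith
    have e2 : z.im = 2 * (k.re * k.im) := by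
      have := congrArg Complex.im hk
      rw [sq, Complex.mul_im, Complex.sub_im, Complex.ofReal_im] at this
      linarith
    rw [← e1, ← e2]
    exact hz
  have h2 : δ * k.im ≤ (δ + 2) * k.re := by
    by_contra! h
    have h3 := neg_abs_le (k.re ^ 2 - k.im ^ 2)
    have h4 : k.re < k.im := by nlinarith
    nlinarith [mul_pos hkr hki, mul_lt_mul_of_pos_right h hki, mul_lt_mul_of_pos_left h4 hkr]
  have h3 : ‖k‖ ≤ k.re + k.im := by
    refine (Complex.norm_le_abs_re_add_abs_im k).trans (le_of_eq ?_)
    rw [abs_of_pos hkr, abs_of_pos hki]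
  rw [div_mul_eq_mul_div, div_le_iff₀ (by positivity)]
  nlinarith

theorem tendsto_sqrt_sub (Λ δ : ℝ) :
    Tendsto (fun z : ℂ => (z - Λ) ^ (1 / 2 : ℂ)) (𝓝[sector Λ δ] (Λ : ℂ)) (𝓝 0) := by
  refine tendsto_nhdsWithin_of_tendsto_nhds ?_
  have h1 : ContinuousAt (fun z : ℂ => z ^ (1 / 2 : ℂ)) 0 :=
    Complex.continuousAt_cpow_const_of_re_pos (Or.inl le_rfl) (by norm_num)
  have h2 : Tendsto (fun z : ℂ => z - Λ) (𝓝 (Λ : ℂ)) (𝓝 0) := by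
    have := (continuous_sub_right (Λ : ℂ)).tendsto (Λ : ℂ)
    rwa [sub_self] at this
  have h3 := h1.tendsto.comp h2
  rwa [Complex.zero_cpow (by norm_num)] at h3

/-- The derivative of a differentiable function with compact values along a filter is compact. -/
theorem isCompactOperator_of_hasDerivAt {A : ℂ → L2 →L[ℂ] L2} {A' : L2 →L[ℂ] L2}
    (hA : HasDerivAt A A' 0) {ι : Type*} {l : Filter ι} [l.NeBot] {κ : ι → ℂ}
    (hκ : Tendsto κ l (𝓝 0)) (h : ∀ᶠ i in l, κ i ≠ 0 ∧ IsCompactOperator (A (κ i))) :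
    IsCompactOperator A' := by
  have h0 : IsCompactOperator (A 0) :=
    isCompactOperator_of_tendsto (hA.continuousAt.tendsto.comp hκ) (h.mono fun i hi => hi.2)
  have h1 : Tendsto κ l (𝓝[≠] 0) := tendsto_nhdsWithin_iff.2 ⟨hκ, h.mono fun i hi => hi.1⟩
  refine isCompactOperator_of_tendsto ((hasDerivAt_iff_tendsto_slope.1 hA).comp h1)
    (h.mono fun i hi => ?_)
  have h2 : IsCompactOperator ((κ i - 0)⁻¹ • (A (κ i) - A 0)) := (hi.2.sub h0).smul (κ i - 0)⁻¹
  exact h2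

theorem charFun_zero (b c ε : ℝ) (q : ℕ) (R₀ N M : L2 →L[ℂ] L2) : charFun b c ε q R₀ N M 0 =
    ((landauLevel b c q : ℂ) ^ 2) • (N * (landauOp b q * wVertOp b ε 0) * N.adjoint) := by
  simp only [charFun, zero_smul, sub_zero, zero_pow two_ne_zero]

theorem isSelfAdjoint_charFun_zero (hb : 0 < b) (c : ℝ) {ε : ℝ} (hε : 0 < ε) (q : ℕ)
    (R₀ N M : L2 →L[ℂ] L2) : IsSelfAdjoint (charFun b c ε q R₀ N M 0) := by
  have h1 : IsSelfAdjoint (N * (landauOp b q * wVertOp b ε 0) * N.adjoint) :=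
    (isSelfAdjoint_landauOp_mul_wVertOp_zero hb q hε).conjugate N
  rw [charFun_zero, ← Complex.ofReal_pow]
  exact IsSelfAdjoint.smul (Complex.conj_ofReal _) h1

/-- `exists_tendsto_iff_isUnit` for `B = σ A`. By `sandwichedResolvent_eq` the sandwiched resolvent
is, up to convergent terms, a nonzero multiple of `κ⁻¹ σ A(0) F - (Λ / z) F`; the sector keeps `κ`
away from the real axis, and the derivative of `A` at `0` is compact because `M` is. -/
theorem isUnit_iff_noIsolatedResonance (hb : 0 < b) {c : ℝ} (hc : 0 ≤ c) (q : ℕ)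
    {R₀ R : L2 →L[ℂ] L2} (hR₀ : IsResolventAt (freeOp b) (-(c : ℂ)) R₀) (hs₀ : IsSelfAdjoint R₀)
    (hs : IsSelfAdjoint R) {σ : ℂ} (hσ : σ ^ 2 = 1) (hσr : starRingEnd ℂ σ = σ)
    {M N : L2 →L[ℂ] L2} (hMc : IsCompactOperator M) {ε : ℝ} (hε : 0 < ε)
    (hN : N * mulWeight ε = M) (hV : R₀ - R = σ • (M.adjoint * M)) {K : Set E3}
    {l : BoundaryCondition}
    (hRz : ∀ z : ℂ, z.im ≠ 0 → obstacleResolvent b c K l z = shiftedResolvent R z) {δ : ℝ}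
    (hδ : 0 < δ) {A : ℂ → L2 →L[ℂ] L2} (hA : IsCharFunction b c q M A) :
    IsUnit (1 - σ • (deriv A 0 * (A 0).ker.starProjection)) ↔
      NoIsolatedResonance b c ε δ q K l M := by
  have hσ0 : σ ≠ 0 := fun h => by rw [h] at hσ; simp at hσ
  set Λ := landauLevel b c q with hΛ
  have hΛ0 : (Λ : ℂ) ≠ 0 := by
    have : 0 < Λ := by rw [hΛ, landauLevel]; positivity
    exact_mod_cast this.ne'
  have hA0 := (hA.eventuallyEq (isCharFunction_charFun hb hc hε q hR₀ hs₀ hN)).self_of_nhds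
  set P := N * (landauOp b q * wVertOp b ε 0) * N.adjoint with hP
  have hAP : A 0 = (Λ : ℂ) ^ 2 • P := hA0.trans (charFun_zero b c ε q R₀ N M)
  have hAs : IsSelfAdjoint (A 0) := hA0 ▸ isSelfAdjoint_charFun_zero hb c hε q R₀ N M
  set l' := 𝓝[sector Λ δ] (Λ : ℂ) with hl'
  have : l'.NeBot := neBot_nhdsWithin_sector Λ
  set κ : ℂ → ℂ := fun z => Complex.I * (z - Λ) ^ (1 / 2 : ℂ) with hκ
  have hk0 := tendsto_sqrt_sub Λ δ
  have hκ0 : Tendsto κ l' (𝓝 0) := by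
    have h := hk0.const_mul Complex.I
    rwa [mul_zero] at h
  have hz : Tendsto (fun z : ℂ => z) l' (𝓝 (Λ : ℂ)) := tendsto_nhdsWithin_of_tendsto_nhds tendsto_id
  have hsec : ∀ᶠ z in l', z ∈ sector Λ δ := self_mem_nhdsWithin
  have him : ∀ z ∈ sector Λ δ, 0 < z.im := fun z h =>
    lt_of_le_of_lt (mul_nonneg hδ.le (abs_nonneg _)) h
  have hquad : ∀ z ∈ sector Λ δ, 0 < ((z - Λ) ^ (1 / 2 : ℂ)).re ∧ 0 < ((z - Λ) ^ (1 / 2 : ℂ)).im ∧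
      ((z - Λ) ^ (1 / 2 : ℂ)) ^ 2 = z - Λ := fun z h =>
    sqrt_mem_quadrant (by simpa using him z h)
  have hκz : ∀ᶠ z in l', κ z ≠ 0 ∧ δ / (2 * δ + 2) * ‖κ z‖ ≤ |(κ z).im| := by
    filter_upwards [hsec] with z h
    obtain ⟨h1, h2, h3⟩ := hquad z h
    have e : (κ z).im = ((z - Λ) ^ (1 / 2 : ℂ)).re := by simp [hκ]
    refine ⟨fun h0 => ?_, ?_⟩
    · rw [h0, Complex.zero_im] at e
      exact h1.ne e
    · rw [e, abs_of_pos h1, hκ, norm_mul, Complex.norm_I, one_mul]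
      exact mul_norm_le_re_of_mem_sector hδ h h1 h2 h3
  have hAκ : ∀ᶠ z in l', A (κ z) = (-(κ z * z)) • (M * Ring.inverse (1 - z • R₀) * M.adjoint) := by
    filter_upwards [hsec, hk0.eventually hA.2] with z h h'
    obtain ⟨h1, h2, h3⟩ := hquad z h
    rw [hκ, h' h1 h2]
    exact charOp_eq hb q hR₀ hs₀ M h1 h2 (by rw [h3]; ring)
  have hderiv : HasDerivAt A (deriv A 0) 0 := hA.1.differentiableAt.hasDerivAt
  have hderiv' : HasDerivAt (fun ζ => σ • A ζ) (σ • deriv A 0) 0 := hderiv.const_smul σ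
  have hcomp : IsCompactOperator (deriv A 0 : L2 →L[ℂ] L2) := by
    refine isCompactOperator_of_hasDerivAt hderiv hκ0 ?_
    filter_upwards [hκz, hAκ] with z h1 h2
    refine ⟨h1.1, ?_⟩
    rw [h2]
    have h3 : IsCompactOperator (M * Ring.inverse (1 - z • R₀) * M.adjoint) :=
      (hMc.comp_clm (Ring.inverse (1 - z • R₀))).comp_clm M.adjoint
    exact h3.smul (-(κ z * z))
  -- the inverse of `1 - σ A(κ) / κ` and the formula for the sandwiched resolvent
  have hF : ∀ z ∈ sector Λ δ, _ := fun z h =>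
    sandwichedResolvent_eq hb q hR₀ hs₀ hs hσ hε hN hV (K := K) (l := l)
      (hRz z (him z h).ne') (him z h) (κ := κ z) rfl
  choose! F hF1 hF2 hF3 using hF
  have hker : (σ • A 0).ker = (A 0).ker := by
    ext x
    simp [hσ0]
  have hmain := exists_tendsto_iff_isUnit (l := l') hκ0 (d := δ / (2 * δ + 2)) (by positivity) hκz
    hderiv' (IsSelfAdjoint.smul hσr hAs) (hcomp.smul σ) (F := F) (Y := sandwichedResolvent b c ε q K l M)
    (a := fun z => σ / (Λ * z)) (a₀ := σ / (Λ * Λ)) (b := fun z => Λ / z)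
    (E := fun z => (σ / z ^ 2) • (1 : L2 →L[ℂ] L2) - z⁻¹ • (M * M.adjoint) - (κ z / z) • P)
    (E₀ := (σ / (Λ : ℂ) ^ 2) • (1 : L2 →L[ℂ] L2) - (Λ : ℂ)⁻¹ • (M * M.adjoint) - ((0 : ℂ) / Λ) • P)
    ?_ ?_ ?_ ?_ ?_ ?_
  · rw [NoIsolatedResonance, hmain]
    simp only [hker, smul_mul_assoc]
  · filter_upwards [hsec, hAκ, hκz] with z h h1 h2
    have e : (1 : L2 →L[ℂ] L2) - (κ z)⁻¹ • (σ • A (κ z)) =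
        1 + (σ * z) • (M * Ring.inverse (1 - z • R₀) * M.adjoint) := by
      rw [h1, smul_smul, smul_smul, sub_eq_add_neg, ← neg_smul]
      congr 2
      field_simp [h2.1]
    simp only [e]
    exact ⟨hF1 z h, hF2 z h⟩
  · exact (tendsto_const_nhds.div (tendsto_const_nhds.mul hz) (mul_ne_zero hΛ0 hΛ0))
  · exact div_ne_zero hσ0 (mul_ne_zero hΛ0 hΛ0)
  · have := (tendsto_const_nhds (x := (Λ : ℂ))).div hz hΛ0
    rwa [div_self hΛ0] at this
  · exact (((tendsto_const_nhds.div (hz.pow 2) (pow_ne_zero 2 hΛ0)).smul_const _).sub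
      ((hz.inv₀ hΛ0).smul_const _)).sub ((hκ0.div hz hΛ0).smul_const _)
  · filter_upwards [hsec, hκz] with z h h2
    have hz0 : z ≠ 0 := fun h0 => by
      have := him z h
      rw [h0] at this; simp at this
    have hκ1 := h2.1
    have e1 : (Λ : ℂ) / (z * κ z) = σ / (Λ * z) * ((κ z)⁻¹ * (σ * Λ ^ 2)) := by
      field_simp
      rw [hσ]
    have e2 : σ / z ^ 2 = σ / (Λ * z) * (Λ / z) := by field_simp
    rw [hF3 z h, hAP, e1, ← hP]
    simp only [smul_sub, smul_smul, smul_mul_assoc]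
    rw [← e2]
    module

end

end MagneticObstacle

end

theorem mainTheorem8
    (b : ℝ) (hb : 0 < b)
    (K : Set MagneticObstacle.E3) (hK : MagneticObstacle.IsSmoothCompactDomain K)
    (l : MagneticObstacle.BoundaryCondition)
    (c : ℝ) (hc : 0 ≤ c) (hshift : MagneticObstacle.IsAdmissibleShift b c K l)
    (M : MagneticObstacle.L2 →L[ℂ] MagneticObstacle.L2)
    (hM : MagneticObstacle.IsFactorization b c K l M)
    (ε : ℝ) (hε : 0 < ε) (hεb : ε < Real.sqrt b)
    (q : ℕ) :
    (∃ A, MagneticObstacle.IsCharFunction b c q M A) ∧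
    ∀ A, MagneticObstacle.IsCharFunction b c q M A →
      ∀ δ : ℝ, 0 < δ →
        (IsUnit (1 - l.sign • (deriv A 0 * (A 0).ker.starProjection)) ↔
          MagneticObstacle.NoIsolatedResonance b c ε δ q K l M) := by
  obtain ⟨R₀, -, hR₀, -⟩ := MagneticObstacle.exists_resolvent_freeOp hb hc
  have hs₀ : IsSelfAdjoint R₀ := by
    have hcR : -(c : ℂ) = ((-c : ℝ) : ℂ) := by push_cast; rfl
    exact (hcR ▸ hR₀).isSelfAdjoint (MagneticObstacle.freeOp_symm b)
  obtain ⟨R, hR, hR0, hRz⟩ := MagneticObstacle.exists_isObstacleInverse hb hc hK hshift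
  have hσ : l.sign ^ 2 = 1 ∧ starRingEnd ℂ l.sign = l.sign ∧ ‖l.sign‖ = 1 := by
    cases l <;> simp [MagneticObstacle.BoundaryCondition.sign]
  have hV : R₀ - R = l.sign • (M.adjoint ∘L M) := by
    rw [← hM, MagneticObstacle.perturbation, hR0,
      MagneticObstacle.freeResolvent_eq (R := R₀) (by rwa [zero_sub])]
  obtain ⟨hMc, N, hN⟩ := MagneticObstacle.exists_factor_comp_mulWeight hb hc hK.1 hR₀ hR hσ.2.2 hV
    hε.le hεb
  refine ⟨⟨_, MagneticObstacle.isCharFunction_charFun hb hc hε q hR₀ hs₀ hN⟩, fun A hA δ hδ => ?_⟩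
  exact MagneticObstacle.isUnit_iff_noIsolatedResonance hb hc q hR₀ hs₀ hR.isSelfAdjoint hσ.1 hσ.2.1
    hMc hε hN hV hRz hδ hA
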